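/- Let $\mu>0$, $\lambda+2\mu>0$, $\sigma>0$, and let $P$ be smooth on $(0,\infty)$ with $P'>0$ and $P'(1)=1$. For every $\theta\in(0,1)$ there is a constant $C>0$, depending only on $\mu,\lambda,\sigma,P,\theta$, such that the following holds. Let $T>0$ and let $(a,\mathbf u,\mathbf B)\in C([0,T];H^3(\mathbb R^3))$, with $\rho=1+a$, solve the compressible MHD system with horizontal magnetic diffusion $$\begin{aligned} &\partial_t\rho+\operatorname{div}(\rho\mathbf u)=0,\\ &\rho\,\partial_t\mathbf u+\rho\,\mathbf u\cdot\nabla\mathbf u-\mu\Delta\mathbf u-(\lambda+\mu)\nabla\operatorname{div}\mathbf u+\nabla P(\rho)=(\nabla\times\mathbf B)\times\mathbf B,\\ &\partial_t\mathbf B-\sigma\Delta_h\mathbf B+\mathbf u\cdot\nabla\mathbf B+\mathbf B\operatorname{div}\mathbf u=\mathbf B\cdot\nabla\mathbf u,\qquad \operatorname{div}\mathbf B=0, \end{aligned}$$ on $[0,T]\times\mathbb R^3$, where $\Delta_h=\partial_1^2+\partial_2^2$ and $\nabla_h=(\partial_1,\partial_2)$, time derivatives are taken in $L^2(\mathbb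 R^3)$, and the equations hold almost everywhere in space at every time. Suppose that $|a|\le\frac12$. Then $\nabla\mathbf u,\nabla_h\mathbf B\in L^2(0,T;H^3)$, the function $t\mapsto\|(a,\mathbf u,\mathbf B)(t)\|_{H^3}^2$ is absolutely continuous on $[0,T]$, and for almost every $t\in[0,T]$ $$\begin{aligned} &\frac12\frac{d}{dt}\|(a,\mathbf u,\mathbf B)\|_{H^3}^2+\theta\Big(\mu\|\nabla\mathbf u\|_{H^3}^2+(\lambda+\mu)\|\operatorname{div}\mathbf u\|_{H^3}^2+\sigma\|\nabla_h\mathbf B\|_{H^3}^2\Big)\\ &\quad\le C\big(\|\mathbf u\|_{H^3}+\|(a,\mathbf u)\|_{H^3}^2+\|\mathbf B\|_{H^3}^4\big)\|\nabla a\|_{H^2}^2+C\big(\|a\|_{H^3}^2\|\mathbf B\|_{H^3}^2+\|(a,\mathbf u,\mathbf B)\|_{H^3}^2\big)\|\nabla\mathbf u\|_{H^3}^2 . \end{aligned}$$ Here $\|f\|_{H^k}^2=\sum_{j\le k}\|\nabla^jf\|_{L^2}^2$, and the square of the norm of a vector or a tuple is the sum of the squares of the norms of its components. -/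

import Mathlib

open MeasureTheory Filter Topology Set
open scoped ContDiff ENNReal

namespace MHD

noncomputable section

/-- Three-dimensional Euclidean space; the coordinate directions are `0`, `1`, `2`, and the
horizontal ones are `0` and `1`. -/
abbrev Space : Type := EuclideanSpace ℝ (Fin 3)

/-- `g` is the weak (distributional) partial derivative of `f` in the direction `i`. -/
def IsWeakDeriv (i : Fin 3) (f g : Space → ℝ) : Prop :=
  LocallyIntegrable f volume ∧ LocallyIntegrable g volume ∧
    ∀ φ : Space → ℝ, ContDiff ℝ ∞ φ → HasCompactSupport φ →
      ∫ x, f x * fderiv ℝ φ x (EuclideanSpace.single i (1 : ℝ)) = - ∫ x, g x * φ x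

open Classical in
/-- The weak partial derivative `∂ᵢ f` (unique up to a null set), and `0` if there is none. -/
def weakDeriv (i : Fin 3) (f : Space → ℝ) : Space → ℝ :=
  if h : ∃ g, IsWeakDeriv i f g then h.choose else 0

/-- `f` belongs to the Sobolev space `H^k(ℝ³)`. -/
def MemH : ℕ → (Space → ℝ) → Prop
  | 0, f => MemLp f 2 volume
  | k + 1, f => MemLp f 2 volume ∧
      ∀ i : Fin 3, (∃ g, IsWeakDeriv i f g) ∧ MemH k (weakDeriv i f)

/-- The squared Sobolev norm `‖f‖²_{H^k} = ∑_{j ≤ k} ‖∇^j f‖²_{L²}`, where `|∇^j f|²` is the sum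
of the squares of all `3^j` partial derivatives of order `j`; meaningful when `MemH k f`. -/
def normSqH : ℕ → (Space → ℝ) → ℝ
  | 0, f => ∫ x, f x ^ 2
  | k + 1, f => (∫ x, f x ^ 2) + ∑ i : Fin 3, normSqH k (weakDeriv i f)

/-- The squared `H^k` norm of a vector field. -/
def vnormSqH (k : ℕ) (v : Fin 3 → Space → ℝ) : ℝ := ∑ j : Fin 3, normSqH k (v j)

/-- `‖∇ v‖²_{H^k}` for a vector field `v`. -/
def gradNormSqH (k : ℕ) (v : Fin 3 → Space → ℝ) : ℝ :=
  ∑ i : Fin 3, ∑ j : Fin 3, normSqH k (weakDeriv i (v j))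

/-- `‖∇_h v‖²_{H^k}` with the horizontal gradient `∇_h = (∂₁, ∂₂)`. -/
def hgradNormSqH (k : ℕ) (v : Fin 3 → Space → ℝ) : ℝ :=
  ∑ j : Fin 3, (normSqH k (weakDeriv 0 (v j)) + normSqH k (weakDeriv 1 (v j)))

def divergence (v : Fin 3 → Space → ℝ) : Space → ℝ :=
  fun x => ∑ i : Fin 3, weakDeriv i (v i) x

def curl (v : Fin 3 → Space → ℝ) : Fin 3 → Space → ℝ :=
  ![fun x => weakDeriv 1 (v 2) x - weakDeriv 2 (v 1) x,
    fun x => weakDeriv 2 (v 0) x - weakDeriv 0 (v 2) x,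
    fun x => weakDeriv 0 (v 1) x - weakDeriv 1 (v 0) x]

/-- The Lorentz force `(∇ × B) × B`. -/
def lorentz (B : Fin 3 → Space → ℝ) (j : Fin 3) (x : Space) : ℝ :=
  crossProduct (fun i => curl B i x) (fun i => B i x) j

/-- The transport term `w · ∇ f`. -/
def advect (w : Fin 3 → Space → ℝ) (f : Space → ℝ) : Space → ℝ :=
  fun x => ∑ i : Fin 3, w i x * weakDeriv i f x

def laplacian (f : Space → ℝ) : Space → ℝ :=
  fun x => ∑ i : Fin 3, weakDeriv i (weakDeriv i f) x

/-- `Δ_h = ∂₁² + ∂₂²`. -/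
def hlaplacian (f : Space → ℝ) : Space → ℝ :=
  fun x => weakDeriv 0 (weakDeriv 0 f) x + weakDeriv 1 (weakDeriv 1 f) x

/-- `f ∈ C([0,T]; H^k(ℝ³))`. -/
def ContinuousInH (k : ℕ) (T : ℝ) (f : ℝ → Space → ℝ) : Prop :=
  ∀ t ∈ Icc 0 T, MemH k (f t) ∧
    Tendsto (fun s => normSqH k (fun x => f s x - f t x)) (𝓝[Icc 0 T] t) (𝓝 0)

/-- `f' t` is the time derivative of `f : [0,T] → L²(ℝ³)` for every `t ∈ [0,T]` (one-sided at the
end points), as a limit of difference quotients in `L²(ℝ³)`. -/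
def HasTimeDeriv (T : ℝ) (f f' : ℝ → Space → ℝ) : Prop :=
  ∀ t ∈ Icc 0 T, MemLp (f' t) 2 volume ∧ Tendsto
    (fun s => eLpNorm (fun x => (s - t)⁻¹ * (f s x - f t x) - f' t x) 2 volume)
    (𝓝[Icc 0 T \ {t}] t) (𝓝 0)

/-- `(a, u, B) ∈ C([0,T]; H³(ℝ³))` solves the compressible MHD system with horizontal magnetic
diffusion, where the density is `ρ = 1 + a`:
* `∂ₜρ + div (ρ u) = 0`,
* `ρ ∂ₜu + ρ u·∇u - μ Δu - (λ+μ) ∇ div u + ∇P(ρ) = (∇ × B) × B`,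
* `∂ₜB - σ Δ_h B + u·∇B + B div u = B·∇u`,
* `div B = 0`.
All the equations hold almost everywhere in space at every time. -/
structure IsSolution (μ lam σ : ℝ) (P : ℝ → ℝ) (T : ℝ)
    (a : ℝ → Space → ℝ) (u B : ℝ → Fin 3 → Space → ℝ) : Prop where
  continuous_a : ContinuousInH 3 T a
  continuous_u : ∀ j, ContinuousInH 3 T (fun t => u t j)
  continuous_B : ∀ j, ContinuousInH 3 T (fun t => B t j)
  mass : ∃ a' : ℝ → Space → ℝ, HasTimeDeriv T a a' ∧
    ∀ t ∈ Icc 0 T, ∀ᵐ x,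
      a' t x + divergence (fun i y => (1 + a t y) * u t i y) x = 0
  momentum : ∀ j, ∃ u' : ℝ → Space → ℝ, HasTimeDeriv T (fun t => u t j) u' ∧
    ∀ t ∈ Icc 0 T, ∀ᵐ x,
      (1 + a t x) * u' t x + (1 + a t x) * advect (u t) (u t j) x
        - μ * laplacian (u t j) x - (lam + μ) * weakDeriv j (divergence (u t)) x
        + weakDeriv j (fun y => P (1 + a t y)) x = lorentz (B t) j x
  induction : ∀ j, ∃ B' : ℝ → Space → ℝ, HasTimeDeriv T (fun t => B t j) B' ∧
    ∀ t ∈ Icc 0 T, ∀ᵐ x,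
      B' t x - σ * hlaplacian (B t j) x + advect (u t) (B t j) x
        + B t j x * divergence (u t) x = advect (B t) (u t j) x
  div_free : ∀ t ∈ Icc 0 T, ∀ᵐ x, divergence (B t) x = 0

/-- `‖(a, u, B)‖²_{H³}`. -/
def energy (a : Space → ℝ) (u B : Fin 3 → Space → ℝ) : ℝ :=
  normSqH 3 a + vnormSqH 3 u + vnormSqH 3 B

/-- `μ ‖∇u‖²_{H³} + (λ+μ) ‖div u‖²_{H³} + σ ‖∇_h B‖²_{H³}`. -/
def dissipation (μ lam σ : ℝ) (u B : Fin 3 → Space → ℝ) : ℝ :=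
  μ * gradNormSqH 3 u + (lam + μ) * normSqH 3 (divergence u) + σ * hgradNormSqH 3 B

end

end MHD

/-! The estimate is the H³ energy identity of the system, made rigorous by mollification. Dividing
the momentum equation by ρ and writing 1/ρ = 1 + h(a), P'(ρ)/ρ = 1 + k(a) splits the system into its
linearisation at (1, 0, 0) and terms of higher order. In the H³ pairing the linear couplings -div u
and -∇a cancel, while viscosity and σΔ_h produce the dissipation.

The delicate terms are the magnetic ones, because ∂₃B is not dissipated. The Lorentz force and the
stretching term exchange energy: since div B = 0, their top-order parts cancel (`couple_zero`), and
so does the top-order part of transport (`ip_transport_self`). What remains are trilinear integrals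
with two factors built from B and one from ∇u. The anisotropic inequality `lintegral_prod_le`, a
Loomis–Whitney argument, charges each factor with a derivative in its own direction. Giving the
horizontal directions to the two magnetic factors and the vertical one to ∇u yields ‖B‖ ‖∇_h B‖
‖∇u‖, which is `abs_magnetic_le`.

The other terms must keep enough gradients to fit the right-hand side. The homogeneous bounds
`sup_le_gn` and `nrm_mul_le`, and the composition bound `gn_one_comp_le`, which is linear in ∇a
because |a| ≤ 1/2, give `abs_pair_three_transport_le`, `abs_pair_three_mul_self_le`,
`nrm_two_force_le` and `abs_ip_force_le`. Young's inequality (`young_estimate`) then spends the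
fraction 1 - θ of the dissipation.

A solution is only H³ in space, so the identity is derived for the mollified fields S_n(a, u, B)
(`rate_add_diss`). Its commutators are bounded uniformly by Friedrichs' lemma
(`nrm_zero_commutator_le`) and vanish as n → ∞ (`small_rem`). All nonlinear algebra takes place in
the space `HInf` of smooth functions: the state itself is first approximated by mollifications with
a second index m. At fixed n the functionals involved are continuous bilinear forms on L² (`Quad`),
so the limit m → ∞ is harmless.

The limit n → ∞ requires ∇u, ∇_h B ∈ L²(0,T; H³), which is part of the conclusion. For u the viscous
term h(a)(μΔu + (λ+μ)∇div u) is of top order and its coefficient is not small, so it cannot simply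
be absorbed in the H³ identity. Instead `highForm_rhsU_le` differentiates the equation twice and
tests it with the viscous operator itself: 1 + h(a) ≥ 1/2 gives coercivity, a Friedrichs commutator
handles the variable coefficient, and the constants depend on H³ norms only. With ∇u under control,
the crude bound `abs_rateB_add_le` gives ∇_h B. Fatou's lemma and `memH_of_frequently` turn the
uniform bounds into regularity at almost every time. Finally `ae_deriv_le_of_tendsto` passes from
the mollified energies to the energy: an integrable bound uniform in n gives absolute continuity,
and the asymptotic upper bound gives the differential inequality. -/

namespace MHD

noncomputable section

/-! ### Smooth functions with all derivatives in L². -/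

/-- The classical partial derivative in the direction `i`. -/
def pd (i : Fin 3) (f : Space → ℝ) : Space → ℝ :=
  fun x => fderiv ℝ f x (EuclideanSpace.single i (1 : ℝ))

/-- Iterated classical partial derivatives. -/
def ipd : List (Fin 3) → (Space → ℝ) → Space → ℝ
  | [], f => f
  | i :: l, f => ipd l (pd i f)

theorem contDiff_pd {f : Space → ℝ} (hf : ContDiff ℝ ∞ f) (i : Fin 3) : ContDiff ℝ ∞ (pd i f) := by
  have : ContDiff ℝ ∞ (fderiv ℝ f) := hf.fderiv_right (by simp)
  exact this.clm_apply contDiff_const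

theorem contDiff_ipd {f : Space → ℝ} (hf : ContDiff ℝ ∞ f) (l : List (Fin 3)) :
    ContDiff ℝ ∞ (ipd l f) := by
  induction l generalizing f with
  | nil => exact hf
  | cons i l ih => exact ih (contDiff_pd hf i)

theorem ContDiff.diffAt {f : Space → ℝ} (hf : ContDiff ℝ ∞ f) (x : Space) :
    DifferentiableAt ℝ f x := hf.differentiable (by simp) x

theorem pd_add {f g : Space → ℝ} (hf : ContDiff ℝ ∞ f) (hg : ContDiff ℝ ∞ g) (i : Fin 3) :
    pd i (f + g) = pd i f + pd i g := by
  funext x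
  simp [pd, fderiv_add (ContDiff.diffAt hf x) (ContDiff.diffAt hg x)]

theorem pd_smul {f : Space → ℝ} (hf : ContDiff ℝ ∞ f) (c : ℝ) (i : Fin 3) :
    pd i (c • f) = c • pd i f := by
  funext x
  simp [pd, fderiv_const_smul (ContDiff.diffAt hf x)]

theorem pd_mul {f g : Space → ℝ} (hf : ContDiff ℝ ∞ f) (hg : ContDiff ℝ ∞ g) (i : Fin 3) :
    pd i (f * g) = pd i f * g + f * pd i g := by
  funext x
  simp [pd, fderiv_mul (ContDiff.diffAt hf x) (ContDiff.diffAt hg x)]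
  ring

theorem pd_zero (i : Fin 3) : pd i 0 = 0 := by
  funext x
  simp [pd]

theorem pd_comm {f : Space → ℝ} (hf : ContDiff ℝ ∞ f) (i j : Fin 3) :
    pd i (pd j f) = pd j (pd i f) := by
  have hd : ContDiff ℝ ∞ (fderiv ℝ f) := hf.fderiv_right (by simp)
  have key : ∀ (v w : Space) (x : Space),
      fderiv ℝ (fun y => fderiv ℝ f y v) x w = fderiv ℝ (fderiv ℝ f) x w v := by
    intro v w x
    rw [fderiv_clm_apply (hd.differentiable (by simp) x) (by fun_prop)]
    simp
  funext x
  have hs : IsSymmSndFDerivAt ℝ f x :=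
    hf.contDiffAt.isSymmSndFDerivAt (by simpa using ENat.LEInfty.out)
  change fderiv ℝ (fun y => fderiv ℝ f y _) x _ = fderiv ℝ (fun y => fderiv ℝ f y _) x _
  rw [key, key]
  exact hs.eq _ _

theorem ipd_add {f g : Space → ℝ} (hf : ContDiff ℝ ∞ f) (hg : ContDiff ℝ ∞ g) (l : List (Fin 3)) :
    ipd l (f + g) = ipd l f + ipd l g := by
  induction l generalizing f g with
  | nil => rfl
  | cons i l ih => simp only [ipd, pd_add hf hg]; exact ih (contDiff_pd hf i) (contDiff_pd hg i)

theorem ipd_smul {f : Space → ℝ} (hf : ContDiff ℝ ∞ f) (c : ℝ) (l : List (Fin 3)) :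
    ipd l (c • f) = c • ipd l f := by
  induction l generalizing f with
  | nil => rfl
  | cons i l ih => simp only [ipd, pd_smul hf]; exact ih (contDiff_pd hf i)

theorem ipd_zero (l : List (Fin 3)) : ipd l 0 = 0 := by
  induction l with
  | nil => rfl
  | cons i l ih => simp only [ipd, pd_zero, ih]

/-- Smooth functions all of whose derivatives are square integrable. -/
def hInf : Submodule ℝ (Space → ℝ) where
  carrier := {f | ContDiff ℝ ∞ f ∧ ∀ l, MemLp (ipd l f) 2 volume}
  zero_mem' := ⟨contDiff_const, fun l => by rw [ipd_zero]; exact MemLp.zero⟩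
  add_mem' := fun hf hg => ⟨hf.1.add hg.1, fun l => by
    rw [ipd_add hf.1 hg.1]; exact (hf.2 l).add (hg.2 l)⟩
  smul_mem' := fun c f hf => ⟨hf.1.const_smul c, fun l => by
    rw [ipd_smul hf.1]; exact (hf.2 l).const_smul c⟩

/-- The vector space `hInf` as a type. -/
abbrev HInf : Type := hInf

instance : CoeFun HInf (fun _ => Space → ℝ) := ⟨Subtype.val⟩

namespace HInf

theorem smooth (f : HInf) : ContDiff ℝ ∞ f.1 := f.2.1
theorem memLp (f : HInf) : MemLp f.1 2 volume := f.2.2 []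
theorem continuous (f : HInf) : Continuous f.1 := f.smooth.continuous
theorem differentiableAt (f : HInf) (x : Space) : DifferentiableAt ℝ f.1 x :=
  ContDiff.diffAt f.smooth x

@[ext] theorem ext {f g : HInf} (h : ∀ x, f x = g x) : f = g := Subtype.ext (funext h)

@[simp] theorem add_apply (f g : HInf) (x : Space) : (f + g) x = f x + g x := rfl
@[simp] theorem sub_apply (f g : HInf) (x : Space) : (f - g) x = f x - g x := rfl
@[simp] theorem neg_apply (f : HInf) (x : Space) : (-f) x = -f x := rfl
@[simp] theorem zero_apply (x : Space) : (0 : HInf) x = 0 := rfl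
@[simp] theorem smul_apply (c : ℝ) (f : HInf) (x : Space) : (c • f) x = c * f x := rfl
theorem sum_apply {ι : Type*} (s : Finset ι) (f : ι → HInf) (x : Space) :
    (∑ i ∈ s, f i) x = ∑ i ∈ s, f i x := by
  simp [Finset.sum_apply]

theorem integrable_mul (f g : HInf) : Integrable (fun x => f x * g x) volume :=
  f.memLp.integrable_mul g.memLp

/-- The partial derivative as an operator on `HInf`. -/
def D (i : Fin 3) : HInf →ₗ[ℝ] HInf where
  toFun f := ⟨pd i f, contDiff_pd f.smooth i, fun l => f.2.2 (i :: l)⟩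
  map_add' f g := Subtype.ext (pd_add f.smooth g.smooth i)
  map_smul' c f := Subtype.ext (pd_smul f.smooth c i)

theorem D_val (i : Fin 3) (f : HInf) : (D i f).1 = pd i f := rfl

theorem D_comm (i j : Fin 3) (f : HInf) : D i (D j f) = D j (D i f) :=
  Subtype.ext (pd_comm f.smooth i j)

/-! ### The L² and H^k inner products and norms. -/

/-- The `L²` inner product. -/
def ip : LinearMap.BilinForm ℝ HInf :=
  LinearMap.mk₂ ℝ (fun f g => ∫ x, f x * g x)
    (fun f g h => by
      rw [← integral_add (integrable_mul _ _) (integrable_mul _ _)]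
      congr 1; funext x; simp [add_mul])
    (fun c f h => by
      rw [smul_eq_mul, ← integral_const_mul]
      congr 1; funext x; simp [mul_assoc])
    (fun f g h => by
      rw [← integral_add (integrable_mul _ _) (integrable_mul _ _)]
      congr 1; funext x; simp [mul_add])
    (fun c f h => by
      rw [smul_eq_mul, ← integral_const_mul]
      congr 1; funext x; simp; ring)

theorem ip_def (f g : HInf) : ip f g = ∫ x, f x * g x := rfl

theorem ip_comm (f g : HInf) : ip f g = ip g f := by
  simp only [ip_def, mul_comm]

theorem ip_self_nonneg (f : HInf) : 0 ≤ ip f f :=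
  integral_nonneg fun _ => mul_self_nonneg _

/-- No decay has to be discussed: integration by parts holds as soon as the three products are
integrable, and they are products of L² functions. -/
theorem ip_D (i : Fin 3) (f g : HInf) : ip (D i f) g = -ip f (D i g) := by
  rw [ip_def, ip_def, ← neg_eq_iff_eq_neg]
  symm
  exact integral_mul_fderiv_eq_neg_fderiv_mul_of_integrable (integrable_mul (D i f) g)
    (integrable_mul f (D i g)) (integrable_mul f g)
    (fun x _ => f.differentiableAt x) (fun x _ => g.differentiableAt x)

/-- The `H^k` inner product. -/
def pair : ℕ → LinearMap.BilinForm ℝ HInf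
  | 0 => ip
  | k + 1 => ip + ∑ i : Fin 3, (pair k).compl₁₂ (D i) (D i)

@[simp] theorem pair_zero (f g : HInf) : pair 0 f g = ip f g := rfl

theorem pair_succ (k : ℕ) (f g : HInf) :
    pair (k + 1) f g = ip f g + ∑ i : Fin 3, pair k (D i f) (D i g) := by
  simp [pair, LinearMap.sum_apply]

theorem pair_comm (k : ℕ) (f g : HInf) : pair k f g = pair k g f := by
  induction k generalizing f g with
  | zero => exact ip_comm f g
  | succ k ih => simp only [pair_succ, ip_comm f g, ih (D _ f)]

theorem pair_self_nonneg (k : ℕ) (f : HInf) : 0 ≤ pair k f f := by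
  induction k generalizing f with
  | zero => exact ip_self_nonneg f
  | succ k ih =>
    rw [pair_succ]
    exact add_nonneg (ip_self_nonneg f) (Finset.sum_nonneg fun i _ => ih _)

theorem pair_D (k : ℕ) (i : Fin 3) (f g : HInf) : pair k (D i f) g = -pair k f (D i g) := by
  induction k generalizing f g with
  | zero => exact ip_D i f g
  | succ k ih =>
    simp only [pair_succ, ip_D i f g, D_comm _ i f, ih, D_comm _ i g, Finset.sum_neg_distrib]
    ring

/-- The `H^k` norm. -/
def nrm (k : ℕ) (f : HInf) : ℝ := √(pair k f f)

theorem nrm_nonneg (k : ℕ) (f : HInf) : 0 ≤ nrm k f := Real.sqrt_nonneg _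

theorem nrm_sq (k : ℕ) (f : HInf) : nrm k f ^ 2 = pair k f f := Real.sq_sqrt (pair_self_nonneg k f)

theorem abs_pair_le (k : ℕ) (f g : HInf) : |pair k f g| ≤ nrm k f * nrm k g := by
  rw [nrm, nrm, ← Real.sqrt_mul (pair_self_nonneg k f)]
  apply Real.abs_le_sqrt
  exact LinearMap.BilinForm.apply_sq_le_of_symm _ (pair_self_nonneg k) ⟨fun x y => pair_comm k x y⟩ f g

theorem pair_le (k : ℕ) (f g : HInf) : pair k f g ≤ nrm k f * nrm k g :=
  (le_abs_self _).trans (abs_pair_le k f g)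

theorem abs_ip_le (f g : HInf) : |ip f g| ≤ nrm 0 f * nrm 0 g := abs_pair_le 0 f g

theorem nrm_add (k : ℕ) (f g : HInf) : nrm k (f + g) ≤ nrm k f + nrm k g := by
  apply Real.sqrt_le_iff.2 ⟨add_nonneg (nrm_nonneg _ _) (nrm_nonneg _ _), ?_⟩
  have := pair_le k f g
  simp only [map_add, LinearMap.add_apply, pair_comm k g f]
  nlinarith [nrm_sq k f, nrm_sq k g]

theorem nrm_smul (k : ℕ) (c : ℝ) (f : HInf) : nrm k (c • f) = |c| * nrm k f := by
  simp only [nrm, map_smul, LinearMap.smul_apply, smul_eq_mul]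
  rw [← mul_assoc, Real.sqrt_mul (mul_self_nonneg c), Real.sqrt_mul_self_eq_abs]

theorem nrm_neg (k : ℕ) (f : HInf) : nrm k (-f) = nrm k f := by
  rw [← neg_one_smul ℝ f, nrm_smul]; simp

@[simp] theorem nrm_zero (k : ℕ) : nrm k (0 : HInf) = 0 := by simp [nrm]

theorem nrm_sub (k : ℕ) (f g : HInf) : nrm k (f - g) ≤ nrm k f + nrm k g := by
  rw [sub_eq_add_neg, ← nrm_neg k g]; exact nrm_add k f (-g)

theorem nrm_sum {ι : Type*} (k : ℕ) (s : Finset ι) (f : ι → HInf) :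
    nrm k (∑ i ∈ s, f i) ≤ ∑ i ∈ s, nrm k (f i) :=
  Finset.le_sum_of_subadditive _ (nrm_zero k).le (nrm_add k) s f

theorem nrm_sum_le {ι : Type*} [Fintype ι] (k : ℕ) (f : ι → HInf) {c : ℝ}
    (h : ∀ i, nrm k (f i) ≤ c) : nrm k (∑ i, f i) ≤ Fintype.card ι * c := by
  refine (nrm_sum k _ f).trans ((Finset.sum_le_sum fun i _ => h i).trans (le_of_eq ?_))
  rw [Finset.sum_const, nsmul_eq_mul, Finset.card_univ]

theorem nrm_succ_sq (k : ℕ) (f : HInf) :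
    nrm (k + 1) f ^ 2 = nrm 0 f ^ 2 + ∑ i : Fin 3, nrm k (D i f) ^ 2 := by
  simp only [nrm_sq, pair_succ, pair_zero]

theorem nrm_zero_le (k : ℕ) (f : HInf) : nrm 0 f ≤ nrm k f := by
  cases k with
  | zero => exact le_rfl
  | succ k =>
    apply Real.sqrt_le_sqrt
    rw [pair_succ]
    simpa using Finset.sum_nonneg fun i _ => pair_self_nonneg k (D i f)

theorem nrm_D_le (k : ℕ) (i : Fin 3) (f : HInf) : nrm k (D i f) ≤ nrm (k + 1) f := by
  apply Real.sqrt_le_sqrt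
  rw [pair_succ]
  have := Finset.single_le_sum (f := fun i => pair k (D i f) (D i f))
    (fun i _ => pair_self_nonneg k (D i f)) (Finset.mem_univ i)
  have h0 := ip_self_nonneg f
  linarith

theorem nrm_succ_le (k : ℕ) (f : HInf) : nrm k f ≤ nrm (k + 1) f := by
  induction k generalizing f with
  | zero => exact nrm_zero_le 1 f
  | succ k ih =>
    apply Real.sqrt_le_sqrt
    rw [pair_succ, pair_succ (k + 1)]
    gcongr with i
    have := ih (D i f)
    rwa [nrm, nrm, Real.sqrt_le_sqrt_iff (pair_self_nonneg _ _)] at this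

theorem nrm_mono {k m : ℕ} (h : k ≤ m) (f : HInf) : nrm k f ≤ nrm m f := by
  induction h with
  | refl => exact le_rfl
  | step _ ih => exact ih.trans (nrm_succ_le _ f)

/-- To bound the `H^{k+1}` norm it suffices to bound the `L²` norm and the `H^k` norms of the first
derivatives. -/
theorem nrm_succ_le_add (k : ℕ) (f : HInf) :
    nrm (k + 1) f ≤ nrm 0 f + ∑ i : Fin 3, nrm k (D i f) := by
  have h0 := nrm_nonneg 0 f
  have hn := fun i => nrm_nonneg k (D i f)
  apply Real.sqrt_le_iff.2 ⟨add_nonneg h0 (Finset.sum_nonneg fun i _ => hn i), ?_⟩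
  rw [← nrm_sq, nrm_succ_sq]
  simp only [Fin.sum_univ_three]
  nlinarith [mul_nonneg h0 (hn 0), mul_nonneg h0 (hn 1), mul_nonneg h0 (hn 2),
    mul_nonneg (hn 0) (hn 1), mul_nonneg (hn 0) (hn 2), mul_nonneg (hn 1) (hn 2)]

end HInf


/-! ### Cutoffs. -/

theorem integral_abs_mul_le {α : Type*} [MeasurableSpace α] {ν : Measure α} {f g : α → ℝ}
    (hf : MemLp f 2 ν) (hg : MemLp g 2 ν) :
    ∫ x, |f x * g x| ∂ν ≤ √(∫ x, f x ^ 2 ∂ν) * √(∫ x, g x ^ 2 ∂ν) := by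
  have h := integral_mul_le_Lp_mul_Lq_of_nonneg (μ := ν) (f := fun x => |f x|) (g := fun x => |g x|)
    Real.HolderConjugate.two_two (Eventually.of_forall fun x => abs_nonneg _)
    (Eventually.of_forall fun x => abs_nonneg _) (by rw [ENNReal.ofReal_ofNat]; exact hf.abs)
    (by rw [ENNReal.ofReal_ofNat]; exact hg.abs)
  simpa [abs_mul, Real.sqrt_eq_rpow] using h

theorem hasCompactSupport_pd {f : Space → ℝ} (hf : HasCompactSupport f) (i : Fin 3) :
    HasCompactSupport (pd i f) := hf.fderiv_apply (𝕜 := ℝ) _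

theorem mem_hInf_of_hasCompactSupport {f : Space → ℝ} (hf : ContDiff ℝ ∞ f)
    (hc : HasCompactSupport f) : f ∈ hInf := by
  refine ⟨hf, fun l => ?_⟩
  have : HasCompactSupport (ipd l f) := by
    clear hf
    induction l generalizing f with
    | nil => exact hc
    | cons i l ih => exact ih (hasCompactSupport_pd hc i)
  exact (contDiff_ipd hf l).continuous.memLp_of_hasCompactSupport this

theorem pd_comp_smul {f : Space → ℝ} (hf : ContDiff ℝ ∞ f) (c : ℝ) (i : Fin 3) :
    pd i (fun x => f (c • x)) = fun x => c * pd i f (c • x) := by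
  funext x
  have h1 : HasFDerivAt (fun x : Space => c • x) (c • ContinuousLinearMap.id ℝ Space) x :=
    (hasFDerivAt_id x).const_smul c
  have h2 := ((ContDiff.diffAt hf (c • x)).hasFDerivAt.comp x h1).fderiv
  simp only [pd]
  rw [show (fun x => f (c • x)) = f ∘ fun x => c • x from rfl, h2]
  simp

/-- Smooth cutoff functions at scale `R` with derivatives of size `1/R`. -/
theorem exists_cutoff : ∃ C : ℝ, 0 < C ∧ ∀ R : ℝ, 1 ≤ R → ∃ χ : Space → ℝ,
    ContDiff ℝ ∞ χ ∧ HasCompactSupport χ ∧ (∀ x, |χ x| ≤ 1) ∧ (∀ x, ‖x‖ ≤ R → χ x = 1) ∧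
    (∀ i x, |pd i χ x| ≤ C / R) ∧ ∀ i j x, |pd i (pd j χ) x| ≤ C / R := by
  let ψ : ContDiffBump (0 : Space) := ⟨1, 2, one_pos, one_lt_two⟩
  have hψ : ContDiff ℝ ∞ ψ := ψ.contDiff
  have bd : ∀ g : Space → ℝ, ContDiff ℝ ∞ g → HasCompactSupport g → ∃ C : ℝ, ∀ x, |g x| ≤ C :=
    fun g hg hc => hc.exists_bound_of_continuous hg.continuous
  choose C1 hC1 using fun i =>
    bd _ (contDiff_pd hψ i) (hasCompactSupport_pd ψ.hasCompactSupport i)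
  choose C2 hC2 using fun i j => bd _ (contDiff_pd (contDiff_pd hψ j) i)
    (hasCompactSupport_pd (hasCompactSupport_pd ψ.hasCompactSupport j) i)
  let C : ℝ := 1 + ∑ i, |C1 i| + ∑ i, ∑ j, |C2 i j|
  have hC : 0 < C := by positivity
  have h1 : ∀ i, C1 i ≤ C := fun i => by
    have a := Finset.single_le_sum (f := fun i => |C1 i|) (fun i _ => abs_nonneg _)
      (Finset.mem_univ i)
    have b : 0 ≤ ∑ i, ∑ j, |C2 i j| := by positivity
    have c := le_abs_self (C1 i)
    simp only [C] at *
    linarith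
  have h2 : ∀ i j, C2 i j ≤ C := fun i j => by
    have a := Finset.single_le_sum (f := fun i => ∑ j, |C2 i j|) (fun i _ => by positivity)
      (Finset.mem_univ i)
    have a' := Finset.single_le_sum (f := fun j => |C2 i j|) (fun i _ => abs_nonneg _)
      (Finset.mem_univ j)
    have b : 0 ≤ ∑ i, |C1 i| := by positivity
    have c := le_abs_self (C2 i j)
    simp only [C] at *
    linarith
  refine ⟨C, hC, fun R hR => ⟨fun x => ψ (R⁻¹ • x), ?_, ?_, ?_, ?_, ?_, ?_⟩⟩
  · exact hψ.comp (contDiff_const_smul _)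
  · exact ψ.hasCompactSupport.comp_smul (by positivity)
  · intro x
    rw [abs_of_nonneg ψ.nonneg]
    exact ψ.le_one
  · intro x hx
    apply ψ.one_of_mem_closedBall
    rw [mem_closedBall_zero_iff, norm_smul, norm_inv, Real.norm_of_nonneg (by positivity)]
    exact inv_mul_le_one_of_le₀ hx (by positivity)
  · intro i x
    rw [pd_comp_smul hψ, abs_mul, abs_of_nonneg (by positivity : 0 ≤ R⁻¹), div_eq_inv_mul]
    gcongr
    exact (hC1 i _).trans (h1 i)
  · intro i j x
    have hs : ContDiff ℝ ∞ (fun x => pd j ψ (R⁻¹ • x)) :=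
      (contDiff_pd hψ j).comp (contDiff_const_smul _)
    rw [pd_comp_smul hψ, show (fun x => R⁻¹ * pd j ψ (R⁻¹ • x)) =
      R⁻¹ • (fun x => pd j ψ (R⁻¹ • x)) from rfl,
      pd_smul hs, pd_comp_smul (contDiff_pd hψ j)]
    simp only [Pi.smul_apply, smul_eq_mul, abs_mul]
    rw [abs_of_nonneg (by positivity : 0 ≤ R⁻¹), div_eq_inv_mul]
    -- Two derivatives produce R⁻²; one factor is given away so that both orders share the bound C /
    -- R.
    have : R⁻¹ ≤ 1 := inv_le_one_of_one_le₀ hR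
    have h3 := (hC2 i j (R⁻¹ • x)).trans (h2 i j)
    gcongr
    calc R⁻¹ * |pd i (pd j ψ) (R⁻¹ • x)| ≤ 1 * C := by gcongr
      _ = C := one_mul C

namespace HInf

theorem nrm_zero_sq (f : HInf) : nrm 0 f ^ 2 = ∫ x, f x ^ 2 := by
  rw [nrm_sq, pair_zero, ip_def]
  simp only [sq]

theorem nrm_zero_eq (f : HInf) : nrm 0 f = √(∫ x, f x ^ 2) := by
  rw [← nrm_zero_sq, Real.sqrt_sq (nrm_nonneg _ _)]

theorem nrm_zero_le_of_abs_le {f g : HInf} {c : ℝ} (hc : 0 ≤ c) (h : ∀ x, |f x| ≤ c * |g x|) :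
    nrm 0 f ≤ c * nrm 0 g := by
  have h2 : (∫ x, f x ^ 2) ≤ ∫ x, c ^ 2 * g x ^ 2 := by
    apply integral_mono f.memLp.integrable_sq (g.memLp.integrable_sq.const_mul _)
    intro x
    have := pow_le_pow_left₀ (abs_nonneg _) (h x) 2
    simpa [mul_pow] using this
  rw [integral_const_mul, ← nrm_zero_sq, ← nrm_zero_sq, ← mul_pow] at h2
  exact (pow_le_pow_iff_left₀ (nrm_nonneg _ _) (mul_nonneg hc (nrm_nonneg _ _)) two_ne_zero).1 h2

/-- Multiplication by a smooth compactly supported function. -/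
def cut (χ : Space → ℝ) (hχ : ContDiff ℝ ∞ χ) (hc : HasCompactSupport χ) (f : HInf) : HInf :=
  ⟨χ * f.1, mem_hInf_of_hasCompactSupport (hχ.mul f.smooth) hc.mul_right⟩

theorem cut_apply (χ : Space → ℝ) (hχ : ContDiff ℝ ∞ χ) (hc : HasCompactSupport χ) (f : HInf)
    (x : Space) : cut χ hχ hc f x = χ x * f x := rfl

theorem D_cut (χ : Space → ℝ) (hχ : ContDiff ℝ ∞ χ) (hc : HasCompactSupport χ) (f : HInf)
    (i : Fin 3) : D i (cut χ hχ hc f) =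
      cut (pd i χ) (contDiff_pd hχ i) (hasCompactSupport_pd hc i) f + cut χ hχ hc (D i f) :=
  Subtype.ext (pd_mul hχ f.smooth i)

theorem nrm_zero_cut_le (χ : Space → ℝ) (hχ : ContDiff ℝ ∞ χ) (hc : HasCompactSupport χ) (f : HInf)
    {c : ℝ} (hb : ∀ x, |χ x| ≤ c) : nrm 0 (cut χ hχ hc f) ≤ c * nrm 0 f := by
  apply nrm_zero_le_of_abs_le ((abs_nonneg _).trans (hb 0))
  intro x
  rw [cut_apply, abs_mul]
  exact mul_le_mul_of_nonneg_right (hb x) (abs_nonneg _)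

end HInf

/-! ### The Sobolev embedding H² ⊂ L^∞ by the Fourier transform. -/

section Fourier

open scoped SchwartzMap FourierTransform
open LineDeriv

theorem fourier_D_D (g : 𝓢(Space, ℂ)) (i : Fin 3) (ξ : Space) :
    𝓕 (lineDerivOp (EuclideanSpace.single i (1 : ℝ))
      (lineDerivOp (EuclideanSpace.single i (1 : ℝ)) g)) ξ
      = -(4 * Real.pi ^ 2 * ξ i ^ 2 : ℝ) * 𝓕 g ξ := by
  have ht : (fun x : Space => inner ℝ x (EuclideanSpace.single i (1 : ℝ))).HasTemperateGrowth := by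
    fun_prop
  have h := fun g : 𝓢(Space, ℂ) => congrArg (fun F : 𝓢(Space, ℂ) => F ξ)
    (SchwartzMap.fourier_lineDerivOp_eq g (EuclideanSpace.single i (1 : ℝ)))
  simp only [smul_apply, SchwartzMap.smulLeftCLM_apply_apply ht] at h
  rw [h, h]
  simp only [EuclideanSpace.inner_single_right, conj_trivial, one_mul, smul_eq_mul,
    Complex.real_smul]
  push_cast
  ring_nf
  rw [Complex.I_sq]
  ring

/-- Fourier inversion bounds |g| by ∫ |ĝ|. With G = g - (4π²)⁻¹ Δg one has Ĝ = (1 + |ξ|²) ĝ, so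
Cauchy–Schwarz separates the weight (1 + |ξ|²)⁻¹, square integrable because 4 > 3, from Ĝ, whose
norm Plancherel converts back. -/
theorem schwartz_sup_le : ∃ K : ℝ, 0 < K ∧ ∀ (g : 𝓢(Space, ℂ)) (x : Space),
    ‖g x‖ ≤ K * √(∫ x, ‖g x - (4 * Real.pi ^ 2 : ℝ)⁻¹ • ∑ i : Fin 3,
      lineDerivOp (EuclideanSpace.single i (1 : ℝ))
        (lineDerivOp (EuclideanSpace.single i (1 : ℝ)) g) x‖ ^ 2) := by
  have hi : Integrable (fun x : Space => ((1 : ℝ) + ‖x‖ ^ 2) ^ (-(4 : ℝ) / 2)) volume :=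
    integrable_rpow_neg_one_add_norm_sq (by simp; norm_num)
  have hw : ∀ x : Space, ((1 : ℝ) + ‖x‖ ^ 2) ^ (-(4 : ℝ) / 2) = ((1 + ‖x‖ ^ 2)⁻¹) ^ 2 := by
    intro x
    rw [show -(4 : ℝ) / 2 = -2 by norm_num, Real.rpow_neg (by positivity), inv_pow]
    norm_cast
  simp only [hw] at hi
  refine ⟨√(∫ x : Space, ((1 + ‖x‖ ^ 2)⁻¹) ^ 2) + 1, by positivity, fun g x => ?_⟩
  let G : 𝓢(Space, ℂ) := g - (4 * Real.pi ^ 2 : ℝ)⁻¹ • ∑ i : Fin 3,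
      lineDerivOp (EuclideanSpace.single i (1 : ℝ))
        (lineDerivOp (EuclideanSpace.single i (1 : ℝ)) g)
  have hG : ∀ ξ, 𝓕 G ξ = (1 + ‖ξ‖ ^ 2 : ℝ) * 𝓕 g ξ := by
    intro ξ
    have e : 𝓕 G = 𝓕 g - (4 * Real.pi ^ 2 : ℝ)⁻¹ • ∑ i : Fin 3,
      𝓕 (lineDerivOp (EuclideanSpace.single i (1 : ℝ))
        (lineDerivOp (EuclideanSpace.single i (1 : ℝ)) g)) := by
      simp only [G, ← SchwartzMap.fourierTransformCLM_apply ℝ, map_sub, map_smul, map_sum]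
    rw [e]
    simp only [Fin.sum_univ_three, sub_apply, smul_apply, add_apply, fourier_D_D,
      EuclideanSpace.norm_sq_eq, Real.norm_eq_abs, sq_abs, Complex.real_smul]
    push_cast
    have : (Real.pi : ℂ) ≠ 0 := by exact_mod_cast Real.pi_ne_zero
    field_simp
    ring
  have h1 : ‖g x‖ ≤ ∫ ξ, ‖𝓕 g ξ‖ := by
    have e : g x = (𝓕⁻ (𝓕 g)) x := by rw [FourierTransform.fourierInv_fourier_eq]
    rw [e, SchwartzMap.fourierInv_coe, Real.fourierInv_eq]
    refine (norm_integral_le_integral_norm _).trans (le_of_eq ?_)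
    simp
  have h2 : ∫ ξ, ‖𝓕 g ξ‖ = ∫ ξ, |(1 + ‖ξ‖ ^ 2)⁻¹ * ‖𝓕 G ξ‖| := by
    congr 1; funext ξ
    rw [hG, norm_mul, Complex.norm_real, Real.norm_of_nonneg (by positivity), ← mul_assoc,
      inv_mul_cancel₀ (by positivity), one_mul, abs_of_nonneg (norm_nonneg _)]
  have h3 : MemLp (fun x : Space => (1 + ‖x‖ ^ 2)⁻¹) 2 volume := by
    refine (memLp_two_iff_integrable_sq ?_).2 hi
    exact Continuous.aestronglyMeasurable
      (Continuous.inv₀ (by fun_prop) (fun x => by positivity))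
  have h4 : MemLp (fun x : Space => ‖𝓕 G x‖) 2 volume := ((𝓕 G).memLp 2).norm
  have h5 := integral_abs_mul_le h3 h4
  rw [SchwartzMap.integral_norm_sq_fourier] at h5
  have h6 : ∀ x, G x = g x - (4 * Real.pi ^ 2 : ℝ)⁻¹ • ∑ i : Fin 3,
      lineDerivOp (EuclideanSpace.single i (1 : ℝ))
        (lineDerivOp (EuclideanSpace.single i (1 : ℝ)) g) x := by
    intro x
    simp [G, Fin.sum_univ_three]
  simp only [← h6]
  refine h1.trans (h2.le.trans (h5.trans ?_))
  gcongr
  linarith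

end Fourier


namespace HInf

theorem sup_le_of_hasCompactSupport : ∃ K : ℝ, 0 < K ∧ ∀ f : HInf, HasCompactSupport f.1 →
    ∀ x, |f x| ≤ K * nrm 2 f := by
  obtain ⟨K, hK, h⟩ := schwartz_sup_le
  -- The 4 counts f and its three pure second derivatives, whose coefficient (4π²)⁻¹ is at most 1.
  refine ⟨K * 4, by positivity, fun f hc x => ?_⟩
  let v : Fin 3 → Space := fun i => EuclideanSpace.single i (1 : ℝ)
  let g : SchwartzMap Space ℂ := (hc.comp_left (g := Complex.ofReal) rfl).toSchwartzMap
    (Complex.ofRealCLM.contDiff.comp f.smooth)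
  have hg : (g : Space → ℂ) = fun x => (f x : ℂ) := rfl
  have hd : ∀ (e : HInf) (i : Fin 3) (G : SchwartzMap Space ℂ), (G : Space → ℂ) = (fun x => (e x : ℂ)) →
      (LineDeriv.lineDerivOp (v i) G : Space → ℂ) = fun x => (D i e x : ℂ) := by
    intro e i G hG
    funext x
    have h1 : HasFDerivAt (fun x => (e x : ℂ)) (Complex.ofRealCLM.comp (fderiv ℝ e.1 x)) x :=
      Complex.ofRealCLM.hasFDerivAt.comp x (differentiableAt e x).hasFDerivAt
    rw [SchwartzMap.lineDerivOp_apply_eq_fderiv, hG, h1.fderiv]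
    rfl
  have hdd : ∀ i, (LineDeriv.lineDerivOp (v i) (LineDeriv.lineDerivOp (v i) g) : Space → ℂ)
      = fun x => (D i (D i f) x : ℂ) := fun i => hd _ i _ (hd f i g hg)
  let c : ℝ := (4 * Real.pi ^ 2)⁻¹
  have hc1 : |c| ≤ 1 := by
    have : 1 ≤ Real.pi ^ 2 := by nlinarith [Real.pi_gt_three]
    rw [abs_of_nonneg (by positivity)]
    exact inv_le_one_of_one_le₀ (by linarith)
  have key := h g x
  have e1 : ∀ y, ‖g y - c • ∑ i : Fin 3,
      LineDeriv.lineDerivOp (v i) (LineDeriv.lineDerivOp (v i) g) y‖ ^ 2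
      = (f - c • ∑ i, D i (D i f)) y ^ 2 := by
    intro y
    simp only [hdd, hg, sub_apply, smul_apply, sum_apply, Complex.real_smul]
    rw [← Complex.ofReal_sum, ← Complex.ofReal_mul, ← Complex.ofReal_sub, Complex.norm_real,
      Real.norm_eq_abs, sq_abs]
  simp only [v, c] at e1
  simp only [e1] at key
  rw [← nrm_zero_eq] at key
  have h2 : ∀ i, nrm 0 (D i (D i f)) ≤ nrm 2 f := fun i =>
    (nrm_D_le 0 i _).trans (nrm_D_le 1 i f)
  have h3 := nrm_sub 0 f (c • ∑ i, D i (D i f))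
  rw [nrm_smul] at h3
  have h4 := nrm_sum_le 0 (fun i => D i (D i f)) h2
  have h5 := nrm_zero_le 2 f
  have h6 : |c| * nrm 0 (∑ i, D i (D i f)) ≤ 1 * nrm 0 (∑ i, D i (D i f)) := by
    gcongr; exact nrm_nonneg _ _
  have e2 : |f x| = ‖g x‖ := by rw [hg]; simp
  rw [e2, mul_assoc]
  refine key.trans ?_
  gcongr
  simp only [Fintype.card_fin, Nat.cast_ofNat] at h4
  linarith

/-- Leibniz gives 1, 2 and 4 terms for derivatives of order 0, 1 and 2, hence the factor 1 + 3(2 +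
3·4) = 43 ≤ 50. -/
theorem nrm_two_cut_le (χ : Space → ℝ) (hχ : ContDiff ℝ ∞ χ) (hc : HasCompactSupport χ) (f : HInf)
    {c : ℝ} (h0 : ∀ x, |χ x| ≤ c) (h1 : ∀ i x, |pd i χ x| ≤ c)
    (h2 : ∀ i j x, |pd i (pd j χ) x| ≤ c) : nrm 2 (cut χ hχ hc f) ≤ 50 * c * nrm 2 f := by
  have hc0 : 0 ≤ c := (abs_nonneg _).trans (h0 0)
  set N := nrm 2 f
  have n0 : nrm 0 f ≤ N := nrm_zero_le _ _
  have n1 : ∀ i, nrm 0 (D i f) ≤ N := fun i => (nrm_D_le 0 i f).trans (nrm_mono (by norm_num) f)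
  have n2 : ∀ i j, nrm 0 (D i (D j f)) ≤ N := fun i j => (nrm_D_le 0 i _).trans (nrm_D_le 1 j f)
  have b : ∀ (η : Space → ℝ) (hη : ContDiff ℝ ∞ η) (hc : HasCompactSupport η) (g : HInf),
      (∀ x, |η x| ≤ c) → nrm 0 g ≤ N → nrm 0 (cut η hη hc g) ≤ c * N := fun η hη hc g h h' =>
    (nrm_zero_cut_le η hη hc g h).trans (mul_le_mul_of_nonneg_left h' hc0)
  have d1 : ∀ i, nrm 0 (D i (cut χ hχ hc f)) ≤ 2 * (c * N) := fun i => by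
    rw [D_cut]
    have := nrm_add 0 (cut (pd i χ) (contDiff_pd hχ i) (hasCompactSupport_pd hc i) f)
      (cut χ hχ hc (D i f))
    have a1 := b (pd i χ) (contDiff_pd hχ i) (hasCompactSupport_pd hc i) f (h1 i) n0
    have a2 := b χ hχ hc (D i f) h0 (n1 i)
    linarith
  have d2 : ∀ i j, nrm 0 (D i (D j (cut χ hχ hc f))) ≤ 4 * (c * N) := fun i j => by
    rw [D_cut, map_add, D_cut, D_cut]
    refine (nrm_add _ _ _).trans ((add_le_add (nrm_add _ _ _) (nrm_add _ _ _)).trans ?_)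
    have a1 := b _ (contDiff_pd (contDiff_pd hχ j) i)
      (hasCompactSupport_pd (hasCompactSupport_pd hc j) i) f (h2 i j) n0
    have a2 := b _ (contDiff_pd hχ j) (hasCompactSupport_pd hc j) (D i f) (h1 j) (n1 i)
    have a3 := b _ (contDiff_pd hχ i) (hasCompactSupport_pd hc i) (D j f) (h1 i) (n1 j)
    have a4 := b χ hχ hc (D i (D j f)) h0 (n2 i j)
    linarith
  have d3 : ∀ i, nrm 1 (D i (cut χ hχ hc f)) ≤ 14 * (c * N) := fun i => by
    refine (nrm_succ_le_add 0 _).trans ?_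
    have := Finset.sum_le_sum (fun j (_ : j ∈ Finset.univ) => d2 j i)
    simp only [Finset.sum_const, Finset.card_univ, Fintype.card_fin, nsmul_eq_mul,
      Nat.cast_ofNat] at this
    linarith [d1 i]
  refine (nrm_succ_le_add 1 _).trans ?_
  have := Finset.sum_le_sum (fun j (_ : j ∈ Finset.univ) => d3 j)
  simp only [Finset.sum_const, Finset.card_univ, Fintype.card_fin, nsmul_eq_mul,
    Nat.cast_ofNat] at this
  have := b χ hχ hc f h0 n0
  have : 0 ≤ c * N := mul_nonneg hc0 (nrm_nonneg _ _)
  linarith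

/-- The Sobolev embedding `H² ⊂ L^∞`. -/
theorem sup_le : ∃ K : ℝ, 0 < K ∧ ∀ (f : HInf) (x : Space), |f x| ≤ K * nrm 2 f := by
  obtain ⟨K, hK, h⟩ := sup_le_of_hasCompactSupport
  obtain ⟨C, hC, hcut⟩ := exists_cutoff
  refine ⟨K * (50 * (1 + C)), by positivity, fun f x => ?_⟩
  -- The radius depends on the point: the cutoff is 1 at x, and its derivative bounds stay uniform
  -- because the radius is at least 1.
  obtain ⟨χ, hχ, hc, b0, b1, b2, b3⟩ := hcut (max 1 ‖x‖) (le_max_left _ _)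
  have hR : C / max 1 ‖x‖ ≤ 1 + C := by
    have : C / max 1 ‖x‖ ≤ C := div_le_self hC.le (le_max_left _ _)
    linarith
  have h1 := h (cut χ hχ hc f) hc.mul_right x
  rw [cut_apply, b1 x (le_max_right _ _), one_mul] at h1
  refine h1.trans ?_
  rw [mul_assoc]
  gcongr
  exact nrm_two_cut_le χ hχ hc f (fun x => (b0 x).trans (by linarith))
    (fun i x => (b2 i x).trans hR) (fun i j x => (b3 i j x).trans hR)

/-- Leibniz distributes the derivatives over two factors that remain in the space; once none is
left, one factor is bounded and the other square integrable. This is what makes `HInf` a ring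
without unit. -/
theorem mul_mem_hInf (f g : HInf) : f.1 * g.1 ∈ hInf := by
  refine ⟨f.smooth.mul g.smooth, fun l => ?_⟩
  induction l generalizing f g with
  | nil =>
    obtain ⟨K, hK, h⟩ := sup_le
    exact g.memLp.of_le_mul (c := K * nrm 2 f)
      (f.continuous.mul g.continuous).aestronglyMeasurable
      (Eventually.of_forall fun x => by
        change |f x * g x| ≤ _ * |g x|
        rw [abs_mul]
        exact mul_le_mul_of_nonneg_right (h f x) (abs_nonneg _))
  | cons i l ih =>
    simp only [ipd]
    rw [pd_mul f.smooth g.smooth, ipd_add (f := pd i f.1 * g.1) (g := f.1 * pd i g.1)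
      ((contDiff_pd f.smooth i).mul g.smooth) (f.smooth.mul (contDiff_pd g.smooth i))]
    exact (ih (D i f) g).add (ih f (D i g))

instance : Mul HInf := ⟨fun f g => ⟨f.1 * g.1, mul_mem_hInf f g⟩⟩

@[simp] theorem mul_apply (f g : HInf) (x : Space) : (f * g) x = f x * g x := rfl

instance : NonUnitalCommRing HInf :=
  { (inferInstance : AddCommGroup HInf), (inferInstance : Mul HInf) with
    left_distrib := fun f g h => by ext x; simp [mul_add]
    right_distrib := fun f g h => by ext x; simp [add_mul]
    zero_mul := fun f => by ext x; simp
    mul_zero := fun f => by ext x; simp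
    mul_assoc := fun f g h => by ext x; simp [mul_assoc]
    mul_comm := fun f g => by ext x; simp [mul_comm] }

theorem D_mul (i : Fin 3) (f g : HInf) : D i (f * g) = D i f * g + f * D i g :=
  Subtype.ext (pd_mul f.smooth g.smooth i)

theorem ip_mul_left (f g h : HInf) : ip (f * g) h = ip f (g * h) := by
  simp [ip_def, mul_assoc]

/-! ### Gradient norms and the Sobolev inequality in L⁶. -/

/-- The sum of the `H^k` norms of the first derivatives. -/
def gn (k : ℕ) (f : HInf) : ℝ := ∑ i : Fin 3, nrm k (D i f)

theorem gn_nonneg (k : ℕ) (f : HInf) : 0 ≤ gn k f := Finset.sum_nonneg fun _ _ => nrm_nonneg _ _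

theorem nrm_D_le_gn (k : ℕ) (i : Fin 3) (f : HInf) : nrm k (D i f) ≤ gn k f :=
  Finset.single_le_sum (f := fun i => nrm k (D i f)) (fun _ _ => nrm_nonneg _ _)
    (Finset.mem_univ i)

theorem gn_le (k : ℕ) (f : HInf) : gn k f ≤ 3 * nrm (k + 1) f := by
  refine (Finset.sum_le_sum fun i _ => nrm_D_le k i f).trans ?_
  simp

theorem gn_mono {k m : ℕ} (h : k ≤ m) (f : HInf) : gn k f ≤ gn m f :=
  Finset.sum_le_sum fun _ _ => nrm_mono h _

theorem gn_D_le (k : ℕ) (i : Fin 3) (f : HInf) : gn k (D i f) ≤ 3 * gn (k + 1) f :=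
  (gn_le k _).trans (by gcongr; exact nrm_D_le_gn _ i f)

theorem eLpNorm_two (f : HInf) : eLpNorm f.1 2 volume = ENNReal.ofReal (nrm 0 f) := by
  rw [f.memLp.eLpNorm_eq_integral_rpow_norm two_ne_zero ENNReal.ofNat_ne_top, nrm_zero_eq,
    Real.sqrt_eq_rpow]
  simp

/-- This is the Gagliardo–Nirenberg–Sobolev inequality in dimension three with 1/6 = 1/2 - 1/3; the
operator norm of the differential is dominated by the sum of the partial derivatives. -/
theorem eLpNorm_six_of_hasCompactSupport : ∃ K : ℝ, 0 < K ∧ ∀ f : HInf, HasCompactSupport f.1 →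
    eLpNorm f.1 6 volume ≤ ENNReal.ofReal (K * gn 0 f) := by
  let K := SNormLESNormFDerivOfEqConst ℝ (volume : Measure Space) 2
  refine ⟨K + 1, by positivity, fun f hc => ?_⟩
  have h := eLpNorm_le_eLpNorm_fderiv_of_eq (F := ℝ) (volume : Measure Space) (u := f.1)
    (f.smooth.of_le (by simp)) hc (p := 2) (p' := 6) (by norm_num) (by simp)
    (by simp; norm_num)
  have h2 : eLpNorm (fderiv ℝ f.1) 2 volume ≤ ENNReal.ofReal (gn 0 f) := by
    have e : ∀ x, ‖fderiv ℝ f.1 x‖ ≤ ∑ i, ‖D i f x‖ := by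
      intro x
      refine ContinuousLinearMap.opNorm_le_bound _ (by positivity) fun v => ?_
      have hv : v = ∑ i, v i • EuclideanSpace.single i (1 : ℝ) := by
        ext j
        simp [Finset.sum_apply, Pi.single_apply]
      conv_lhs => rw [hv]
      rw [map_sum, Finset.sum_mul]
      refine (norm_sum_le _ _).trans (Finset.sum_le_sum fun i _ => ?_)
      rw [map_smul, norm_smul, mul_comm]
      exact mul_le_mul_of_nonneg_left (PiLp.norm_apply_le v i) (norm_nonneg _)
    calc eLpNorm (fderiv ℝ f.1) 2 volume
        ≤ eLpNorm (fun x => ∑ i, ‖D i f x‖) 2 volume :=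
          eLpNorm_mono_real e
      _ = eLpNorm (∑ i, fun x => ‖D i f x‖) 2 volume := by
          congr 1
      _ ≤ ∑ i, eLpNorm (fun x => ‖D i f x‖) 2 volume :=
          eLpNorm_sum_le (fun i _ => (D i f).continuous.norm.aestronglyMeasurable) (by norm_num)
      _ = ENNReal.ofReal (gn 0 f) := by
          rw [gn, ENNReal.ofReal_sum_of_nonneg fun _ _ => nrm_nonneg _ _]
          exact Finset.sum_congr rfl fun i _ => by rw [eLpNorm_norm]; exact eLpNorm_two _
  refine h.trans ?_
  rw [ENNReal.ofReal_mul (by positivity)]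
  gcongr
  · rw [ENNReal.ofReal_add (by positivity) (by norm_num), ENNReal.ofReal_coe_nnreal]
    exact le_self_add
  · exact_mod_cast h2

theorem tendsto_cutoff_const (C N g : ℝ) :
    Tendsto (fun n : ℕ => g + C / (n + 1 : ℝ) * N) atTop (𝓝 g) := by
  have : Tendsto (fun n : ℕ => g + C * (1 / (n + 1 : ℝ)) * N) atTop (𝓝 (g + C * 0 * N)) :=
    ((tendsto_one_div_add_atTop_nhds_zero_nat.const_mul C).mul_const N).const_add g
  simpa [div_eq_mul_inv] using this

/-- A sequence of cutoffs exhausting the space. -/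
theorem exists_cutoff_seq : ∃ C : ℝ, 0 < C ∧ ∃ χ : ℕ → Space → ℝ,
    ∃ (hχ : ∀ n, ContDiff ℝ ∞ (χ n)) (hc : ∀ n, HasCompactSupport (χ n)),
    (∀ n x, |χ n x| ≤ 1) ∧ (∀ x, ∀ᶠ n in atTop, χ n x = 1) ∧
    ∀ (n : ℕ) (i : Fin 3) (f : HInf),
      nrm 0 (D i (cut (χ n) (hχ n) (hc n) f)) ≤ nrm 0 (D i f) + C / (n + 1 : ℝ) * nrm 0 f := by
  obtain ⟨C, hC, hcut⟩ := exists_cutoff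
  choose χ hχ hc b0 b1 b2 _ using fun n : ℕ =>
    hcut (n + 1) (le_add_of_nonneg_left (Nat.cast_nonneg n))
  refine ⟨C, hC, χ, hχ, hc, b0, fun x => ?_, fun n i f => ?_⟩
  · obtain ⟨N, hN⟩ := exists_nat_ge ‖x‖
    filter_upwards [eventually_ge_atTop N] with n hn
    apply b1
    have : (N : ℝ) ≤ n := by exact_mod_cast hn
    linarith
  · rw [D_cut]
    refine (nrm_add _ _ _).trans ?_
    have h1 := nrm_zero_cut_le _ (contDiff_pd (hχ n) i) (hasCompactSupport_pd (hc n) i) f (b2 n i)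
    have h2 := nrm_zero_cut_le _ (hχ n) (hc n) (D i f) (b0 n)
    linarith

/-- The Sobolev inequality `‖f‖_{L⁶} ≤ C ‖∇f‖_{L²}`. -/
theorem eLpNorm_six_le : ∃ K : ℝ, 0 < K ∧ ∀ f : HInf,
    eLpNorm f.1 6 volume ≤ ENNReal.ofReal (K * gn 0 f) := by
  obtain ⟨K, hK, h⟩ := eLpNorm_six_of_hasCompactSupport
  obtain ⟨C, hC, χ, hχ, hc, b0, b1, b2⟩ := exists_cutoff_seq
  refine ⟨K, hK, fun f => ?_⟩
  -- The L⁶ norm is lower semicontinuous along the cutoffs. Differentiating a cutoff costs only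
  -- C/(n+1) times the L² norm, so in the limit the gradient alone survives.
  refine (Lp.eLpNorm_lim_le_liminf_eLpNorm (f := fun n => (cut (χ n) (hχ n) (hc n) f).1)
    (fun n => (cut (χ n) (hχ n) (hc n) f).continuous.aestronglyMeasurable) f.1
    (Eventually.of_forall fun x => ?_)).trans ?_
  · apply tendsto_const_nhds.congr'
    filter_upwards [b1 x] with n hn
    rw [cut_apply, hn, one_mul]
  · have ht : Tendsto (fun n : ℕ => ENNReal.ofReal
        (K * (gn 0 f + (3 * C) / (n + 1 : ℝ) * nrm 0 f))) atTop
        (𝓝 (ENNReal.ofReal (K * gn 0 f))) :=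
      (ENNReal.continuous_ofReal.tendsto _).comp ((tendsto_cutoff_const _ _ _).const_mul K)
    rw [← ht.liminf_eq]
    refine liminf_le_liminf (Eventually.of_forall fun n => ?_)
    refine (h _ (hc n).mul_right).trans ?_
    gcongr
    refine (Finset.sum_le_sum fun i _ => b2 n i f).trans (le_of_eq ?_)
    rw [Finset.sum_add_distrib, gn]
    simp
    ring

instance : ENNReal.HolderTriple 6 6 3 :=
  ENNReal.HolderTriple.of_toReal ⟨by norm_num, by norm_num, by norm_num⟩

instance : ENNReal.HolderTriple 3 6 2 :=
  ENNReal.HolderTriple.of_toReal ⟨by norm_num, by norm_num, by norm_num⟩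

/-- Hölder with 1/2 = 1/6 + 1/6 + 1/6, then the Sobolev inequality on each factor. -/
theorem nrm_zero_mul_mul_le : ∃ K : ℝ, 0 < K ∧ ∀ f g h : HInf,
    nrm 0 (f * g * h) ≤ K * (gn 0 f * gn 0 g * gn 0 h) := by
  obtain ⟨K, hK, hk⟩ := eLpNorm_six_le
  refine ⟨K ^ 3, by positivity, fun f g h => ?_⟩
  have h1 := eLpNorm_smul_le_mul_eLpNorm (p := 6) (q := 6) (r := 3) (μ := volume) (f := g.1)
    (φ := f.1) g.continuous.aestronglyMeasurable f.continuous.aestronglyMeasurable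
  have h2 := eLpNorm_smul_le_mul_eLpNorm (p := 3) (q := 6) (r := 2) (μ := volume) (f := h.1)
    (φ := f.1 • g.1) h.continuous.aestronglyMeasurable
    (f.continuous.mul g.continuous).aestronglyMeasurable
  have h3 : eLpNorm (f * g * h).1 2 volume ≤ ENNReal.ofReal (K * gn 0 f) *
      ENNReal.ofReal (K * gn 0 g) * ENNReal.ofReal (K * gn 0 h) := by
    refine h2.trans ?_
    gcongr
    · exact h1.trans (by gcongr <;> exact hk _)
    · exact hk _
  have p := fun f => mul_nonneg hK.le (gn_nonneg 0 f)
  rw [eLpNorm_two, ← ENNReal.ofReal_mul (p f), ← ENNReal.ofReal_mul (mul_nonneg (p f) (p g)),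
    ENNReal.ofReal_le_ofReal_iff (mul_nonneg (mul_nonneg (p f) (p g)) (p h))] at h3
  linarith

/-- `‖f g‖_{L²} ≤ C ‖∇f‖_{L²} ‖g‖_{H¹}`. -/
theorem nrm_zero_mul_le : ∃ K : ℝ, 0 < K ∧ ∀ f g : HInf,
    nrm 0 (f * g) ≤ K * (gn 0 f * nrm 1 g) := by
  obtain ⟨K, hK, hk⟩ := nrm_zero_mul_mul_le
  refine ⟨3 * K + 1, by positivity, fun f g => ?_⟩
  -- Writing ‖fg‖² = ⟨f²g, g⟩ allows the triple product bound, which leaves ∇f twice and ∇g once.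
  have h1 : nrm 0 (f * g) ^ 2 ≤ nrm 0 (f * f * g) * nrm 0 g := by
    rw [nrm_sq, show pair 0 (f * g) (f * g) = pair 0 (f * f * g) g by
      simp only [pair_zero, ip_def, mul_apply]; congr 1; funext x; ring]
    exact pair_le 0 _ _
  have h2 := hk f f g
  have h3 := gn_le 0 g
  have h4 := nrm_zero_le 1 g
  have p1 := nrm_nonneg 0 g
  have p2 := gn_nonneg 0 f
  have p3 := gn_nonneg 0 g
  have p4 := nrm_nonneg 1 g
  refine le_of_sq_le_sq ?_ (by positivity)
  calc nrm 0 (f * g) ^ 2 ≤ (K * (gn 0 f * gn 0 f * gn 0 g)) * nrm 0 g :=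
        h1.trans (mul_le_mul_of_nonneg_right h2 p1)
    _ ≤ (K * (gn 0 f * gn 0 f * (3 * nrm 1 g))) * nrm 1 g := by gcongr
    _ = 3 * K * (gn 0 f * nrm 1 g) ^ 2 := by ring
    _ ≤ (3 * K + 1) ^ 2 * (gn 0 f * nrm 1 g) ^ 2 := by
        gcongr
        nlinarith
    _ = _ := by ring

end HInf


/-! ### Homogeneous supremum bound and product estimates. -/

theorem le_mul_mul_of_le {x K a b a' b' : ℝ} (h : x ≤ K * (a * b)) (hK : 0 ≤ K) (ha : a ≤ a')
    (hb : b ≤ b') (b0 : 0 ≤ b) (a0 : 0 ≤ a') : x ≤ K * (a' * b') :=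
  h.trans (mul_le_mul_of_nonneg_left (mul_le_mul ha hb b0 a0) hK)

namespace HInf

theorem nrm_zero_mul_le_of_abs_le {f g : HInf} {c : ℝ} (h : ∀ x, |f x| ≤ c) :
    nrm 0 (f * g) ≤ c * nrm 0 g := by
  apply nrm_zero_le_of_abs_le ((abs_nonneg _).trans (h 0))
  intro x
  rw [mul_apply, abs_mul]
  exact mul_le_mul_of_nonneg_right (h x) (abs_nonneg _)

/-- The exact supremum is needed because `sup_le_gn` first bounds it by an expression containing the
supremum itself. -/
theorem exists_least_bound (f : HInf) : ∃ S : ℝ, 0 ≤ S ∧ (∀ x, |f x| ≤ S) ∧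
    ∀ r, (∀ x, |f x| ≤ r) → S ≤ r := by
  obtain ⟨K, hK, h⟩ := sup_le
  have hb : BddAbove (Set.range fun x => |f x|) := ⟨K * nrm 2 f, by rintro _ ⟨x, rfl⟩; exact h f x⟩
  exact ⟨⨆ x, |f x|, Real.iSup_nonneg fun x => abs_nonneg _, fun x => le_ciSup hb x,
    fun r hr => ciSup_le hr⟩

theorem D_cube (i : Fin 3) (f : HInf) : D i (f * f * f) = (3 : ℝ) • (f * f * D i f) := by
  rw [D_mul, D_mul]; ext x; simp; ring

theorem D_D_cube (i j : Fin 3) (f : HInf) : D j (D i (f * f * f)) =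
    (3 : ℝ) • (f * f * D j (D i f)) + (6 : ℝ) • (f * (D j f * D i f)) := by
  rw [D_cube, map_smul, D_mul, D_mul]; ext x; simp; ring

/-- The homogeneous embedding `‖f‖_{L^∞} ≤ C ‖∇f‖_{H¹}`. -/
theorem sup_le_gn : ∃ K : ℝ, 0 < K ∧ ∀ (f : HInf) (x : Space), |f x| ≤ K * gn 1 f := by
  obtain ⟨K₁, hK₁, h₁⟩ := sup_le
  obtain ⟨K₂, hK₂, h₂⟩ := nrm_zero_mul_mul_le
  obtain ⟨K₃, hK₃, h₃⟩ := nrm_zero_mul_le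
  set C := K₁ * (K₂ + 36 + 200 * K₃ + 1) with hC
  have hCpos : 0 < C := by positivity
  refine ⟨3 * C + 1, by positivity, fun f => ?_⟩
  -- The H² embedding is applied to f³ rather than f, since ‖f³‖_{L²} is controlled by the gradient
  -- alone. With N = `gn 1 f`, every contribution to ‖f³‖_{H²} is of type N³, S²N or SN², so S³ ≤
  -- C(N³ + S²N + SN²), which forces S ≤ C'N.
  obtain ⟨S, hS0, hS, hSl⟩ := exists_least_bound f
  set N := gn 1 f
  have hN : 0 ≤ N := gn_nonneg _ _
  have g0 : gn 0 f ≤ N := gn_mono (by norm_num) f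
  have g1 : ∀ i, nrm 1 (D i f) ≤ N := fun i => nrm_D_le_gn 1 i f
  have hff : ∀ g : HInf, nrm 0 (f * f * g) ≤ S * (S * nrm 0 g) := fun g => by
    rw [mul_assoc]
    refine (nrm_zero_mul_le_of_abs_le hS).trans ?_
    gcongr
    exact nrm_zero_mul_le_of_abs_le hS
  have e0 : nrm 0 (f * f * f) ≤ K₂ * N ^ 3 := by
    refine (h₂ f f f).trans ?_
    have := gn_nonneg 0 f
    calc K₂ * (gn 0 f * gn 0 f * gn 0 f) ≤ K₂ * (N * N * N) := by gcongr
      _ = K₂ * N ^ 3 := by ring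
  have e1 : ∀ i, nrm 0 (D i (f * f * f)) ≤ 3 * (S ^ 2 * N) := fun i => by
    rw [D_cube, nrm_smul, abs_of_pos three_pos]
    have := le_mul_mul_of_le (hff (D i f)) hS0 le_rfl ((nrm_zero_le 1 _).trans (g1 i))
      (nrm_nonneg _ _) hS0
    linarith
  have e2 : ∀ i j, nrm 0 (D j (D i (f * f * f))) ≤ 3 * (S ^ 2 * N) + 18 * K₃ * (S * N ^ 2) :=
      fun i j => by
    rw [D_D_cube]
    refine (nrm_add _ _ _).trans ?_
    rw [nrm_smul, nrm_smul, abs_of_pos three_pos, abs_of_pos (by norm_num : (0 : ℝ) < 6)]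
    have a1 := le_mul_mul_of_le (hff (D j (D i f))) hS0 le_rfl ((nrm_D_le 0 j _).trans (g1 i))
      (nrm_nonneg _ _) hS0
    have a2 : nrm 0 (f * (D j f * D i f)) ≤ S * (K₃ * (3 * N * N)) := by
      refine (nrm_zero_mul_le_of_abs_le hS).trans ?_
      gcongr
      refine le_mul_mul_of_le (h₃ _ _) hK₃.le ((gn_le 0 _).trans ?_) (g1 i) (nrm_nonneg _ _)
        (by positivity)
      linarith [g1 j]
    nlinarith
  have e3 : ∀ i, nrm 1 (D i (f * f * f)) ≤ 12 * (S ^ 2 * N) + 54 * K₃ * (S * N ^ 2) := fun i => by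
    refine (nrm_succ_le_add 0 _).trans ?_
    have := Finset.sum_le_sum (fun j (_ : j ∈ Finset.univ) => e2 i j)
    simp only [Finset.sum_const, Finset.card_univ, Fintype.card_fin, nsmul_eq_mul,
      Nat.cast_ofNat] at this
    linarith [e1 i]
  have e4 : nrm 2 (f * f * f) ≤ K₂ * N ^ 3 + 36 * (S ^ 2 * N) + 162 * K₃ * (S * N ^ 2) := by
    refine (nrm_succ_le_add 1 _).trans ?_
    have := Finset.sum_le_sum (fun j (_ : j ∈ Finset.univ) => e3 j)
    simp only [Finset.sum_const, Finset.card_univ, Fintype.card_fin, nsmul_eq_mul,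
      Nat.cast_ofNat] at this
    linarith
  have e5 : nrm 2 (f * f * f) ≤ (K₂ + 36 + 200 * K₃ + 1) * (N ^ 3 + S ^ 2 * N + S * N ^ 2) := by
    refine e4.trans ?_
    have p1 : 0 ≤ N ^ 3 := by positivity
    have p2 : 0 ≤ S ^ 2 * N := by positivity
    have p3 : 0 ≤ S * N ^ 2 := by positivity
    nlinarith [mul_nonneg hK₂.le p2, mul_nonneg hK₂.le p3, mul_nonneg hK₃.le p1,
      mul_nonneg hK₃.le p2, mul_nonneg hK₃.le p3]
  set R := C * (N ^ 3 + S ^ 2 * N + S * N ^ 2) with hR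
  have hR0 : 0 ≤ R := by positivity
  have e6 : S ^ 3 ≤ R := by
    -- Minimality of S is tested against the cube root of R, because the pointwise bound is on |f|³.
    have hr : (R ^ ((3 : ℕ) : ℝ)⁻¹) ^ 3 = R := Real.rpow_inv_natCast_pow hR0 (by norm_num)
    rw [← hr]
    gcongr
    apply hSl
    intro x
    apply le_of_pow_le_pow_left₀ (three_ne_zero) (by positivity)
    rw [hr]
    have := h₁ (f * f * f) x
    simp only [mul_apply, abs_mul] at this
    calc |f x| ^ 3 = |f x| * |f x| * |f x| := by ring
      _ ≤ K₁ * nrm 2 (f * f * f) := this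
      _ ≤ K₁ * ((K₂ + 36 + 200 * K₃ + 1) * (N ^ 3 + S ^ 2 * N + S * N ^ 2)) := by gcongr
      _ = R := by rw [hR, hC]; ring
  have e7 : S ≤ (3 * C + 1) * N := by
    -- Otherwise N ≤ S, all three terms of R are at most S²N, and S³ ≤ 3C S²N < S³.
    by_contra hcon
    push Not at hcon
    have hNS : N ≤ S := by nlinarith
    have hSp : 0 < S := lt_of_le_of_lt (by positivity) hcon
    have a1 : N ^ 3 ≤ S ^ 2 * N := by nlinarith [mul_nonneg hN (sub_nonneg.2 hNS), mul_nonneg hN hN]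
    have a2 : S * N ^ 2 ≤ S ^ 2 * N := by nlinarith [mul_nonneg (mul_nonneg hS0 hN) (sub_nonneg.2 hNS)]
    have a3 : S ^ 3 ≤ S ^ 2 * (3 * C * N) := by
      refine e6.trans ?_
      rw [hR]
      calc _ ≤ C * (S ^ 2 * N + S ^ 2 * N + S ^ 2 * N) := by gcongr
        _ = _ := by ring
    have a4 : S ^ 2 * (3 * C * N) < S ^ 2 * S := by gcongr; linarith
    linarith [a3, a4, (by ring : S ^ 2 * S = S ^ 3)]
  exact fun x => (hS x).trans e7

/-- `‖f g‖_{H^m} ≤ C ‖∇f‖_{H¹} ‖g‖_{H^m}` for `m ≤ 2`. -/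
theorem nrm_mul_le : ∃ K : ℝ, 0 < K ∧ ∀ m ≤ 2, ∀ f g : HInf,
    nrm m (f * g) ≤ K * (gn 1 f * nrm m g) := by
  obtain ⟨K₁, hK₁, h₁⟩ := sup_le_gn
  obtain ⟨K₂, hK₂, h₂⟩ := sup_le
  obtain ⟨K₃, hK₃, h₃⟩ := nrm_zero_mul_le
  have a0 : ∀ f g : HInf, nrm 0 (f * g) ≤ K₁ * (gn 1 f * nrm 0 g) := fun f g => by
    rw [← mul_assoc]
    exact nrm_zero_mul_le_of_abs_le (h₁ f)
  have b0 : ∀ (i : Fin 3) (f g : HInf), nrm 0 (D i f * g) ≤ 3 * K₃ * (gn 1 f * nrm 1 g) :=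
      fun i f g => by
    refine (h₃ _ _).trans ?_
    have := gn_D_le 0 i f
    have h' := nrm_nonneg 1 g
    calc K₃ * (gn 0 (D i f) * nrm 1 g) ≤ K₃ * (3 * gn 1 f * nrm 1 g) := by gcongr
      _ = _ := by ring
  have a1 : ∀ f g : HInf, nrm 1 (f * g) ≤ (4 * K₁ + 9 * K₃) * (gn 1 f * nrm 1 g) := fun f g => by
    refine (nrm_succ_le_add 0 _).trans ?_
    have p := gn_nonneg 1 f
    have c : ∀ i, nrm 0 (D i (f * g)) ≤ (3 * K₃ + K₁) * (gn 1 f * nrm 1 g) := fun i => by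
      rw [D_mul]
      refine (nrm_add _ _ _).trans ?_
      have u := b0 i f g
      have v := le_mul_mul_of_le (a0 f (D i g)) hK₁.le le_rfl (nrm_D_le 0 i g) (nrm_nonneg _ _) p
      linarith
    have := Finset.sum_le_sum (fun j (_ : j ∈ Finset.univ) => c j)
    simp only [Finset.sum_const, Finset.card_univ, Fintype.card_fin, nsmul_eq_mul,
      Nat.cast_ofNat] at this
    have w := le_mul_mul_of_le (a0 f g) hK₁.le le_rfl (nrm_zero_le 1 g) (nrm_nonneg _ _) p
    linarith
  have b1 : ∀ (i : Fin 3) (f g : HInf), nrm 1 (D i f * g) ≤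
      (12 * K₃ + 3 * K₂ + 9 * K₃) * (gn 1 f * nrm 2 g) := fun i f g => by
    refine (nrm_succ_le_add 0 _).trans ?_
    have p := gn_nonneg 1 f
    have p' := nrm_nonneg 2 g
    have c : ∀ j, nrm 0 (D j (D i f * g)) ≤ (K₂ + 3 * K₃) * (gn 1 f * nrm 2 g) := fun j => by
      rw [D_mul]
      refine (nrm_add _ _ _).trans ?_
      -- With two derivatives f is only in L², so here g has to be taken in L^∞; this term exists
      -- only at order m = 2, where `nrm 2 g` is available.
      have u : nrm 0 (D j (D i f) * g) ≤ K₂ * (gn 1 f * nrm 2 g) := by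
        rw [mul_comm]
        refine (nrm_zero_mul_le_of_abs_le (h₂ g)).trans ?_
        have := (nrm_D_le 0 j (D i f)).trans (nrm_D_le_gn 1 i f)
        calc K₂ * nrm 2 g * nrm 0 (D j (D i f)) ≤ K₂ * nrm 2 g * gn 1 f := by gcongr
          _ = _ := by ring
      have v := le_mul_mul_of_le (b0 i f (D j g)) (by positivity) le_rfl (nrm_D_le 1 j g)
        (nrm_nonneg _ _) p
      linarith
    have := Finset.sum_le_sum (fun j (_ : j ∈ Finset.univ) => c j)
    simp only [Finset.sum_const, Finset.card_univ, Fintype.card_fin, nsmul_eq_mul,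
      Nat.cast_ofNat] at this
    have w := le_mul_mul_of_le (b0 i f g) (by positivity) le_rfl
      (nrm_mono (by norm_num : 1 ≤ 2) g) (nrm_nonneg _ _) p
    nlinarith [mul_nonneg hK₃.le (mul_nonneg p p')]
  have a2 : ∀ f g : HInf, nrm 2 (f * g) ≤
      (K₁ + 3 * (12 * K₃ + 3 * K₂ + 9 * K₃ + (4 * K₁ + 9 * K₃))) * (gn 1 f * nrm 2 g) :=
      fun f g => by
    refine (nrm_succ_le_add 1 _).trans ?_
    have p := gn_nonneg 1 f
    have c : ∀ i, nrm 1 (D i (f * g)) ≤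
        (12 * K₃ + 3 * K₂ + 9 * K₃ + (4 * K₁ + 9 * K₃)) * (gn 1 f * nrm 2 g) := fun i => by
      rw [D_mul]
      refine (nrm_add _ _ _).trans ?_
      have u := b1 i f g
      have v := le_mul_mul_of_le (a1 f (D i g)) (by positivity) le_rfl (nrm_D_le 1 i g)
        (nrm_nonneg _ _) p
      linarith
    have := Finset.sum_le_sum (fun j (_ : j ∈ Finset.univ) => c j)
    simp only [Finset.sum_const, Finset.card_univ, Fintype.card_fin, nsmul_eq_mul,
      Nat.cast_ofNat] at this
    have w := le_mul_mul_of_le (a0 f g) hK₁.le le_rfl (nrm_zero_le 2 g) (nrm_nonneg _ _) p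
    linarith
  refine ⟨K₁ + 3 * (12 * K₃ + 3 * K₂ + 9 * K₃ + (4 * K₁ + 9 * K₃)), by positivity, ?_⟩
  intro m hm f g
  have p := mul_nonneg (gn_nonneg 1 f) (nrm_nonneg m g)
  have q := mul_nonneg hK₁.le p
  have q2 := mul_nonneg hK₂.le p
  have q3 := mul_nonneg hK₃.le p
  interval_cases m
  · refine (a0 f g).trans ?_
    nlinarith
  · refine (a1 f g).trans ?_
    nlinarith
  · exact a2 f g

theorem nrm_mul_le_nrm : ∃ K : ℝ, 0 < K ∧ ∀ m ≤ 2, ∀ f g : HInf,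
    nrm m (f * g) ≤ K * (nrm 2 f * nrm m g) := by
  obtain ⟨K, hK, h⟩ := nrm_mul_le
  refine ⟨3 * K, by positivity, fun m hm f g => (h m hm f g).trans ?_⟩
  have := gn_le 1 f
  have := nrm_nonneg m g
  calc K * (gn 1 f * nrm m g) ≤ K * (3 * nrm 2 f * nrm m g) := by gcongr
    _ = _ := by ring

/-- `H³` is an algebra. -/
theorem nrm_three_mul_le : ∃ K : ℝ, 0 < K ∧ ∀ f g : HInf,
    nrm 3 (f * g) ≤ K * (nrm 3 f * nrm 3 g) := by
  obtain ⟨K, hK, h⟩ := nrm_mul_le_nrm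
  refine ⟨7 * K, by positivity, fun f g => ?_⟩
  have p := nrm_nonneg 3 f
  have q := nrm_nonneg 3 g
  have h2 : ∀ f g : HInf, nrm 2 (f * g) ≤ K * (nrm 2 f * nrm 2 g) := h 2 le_rfl
  have c : ∀ i, nrm 2 (D i (f * g)) ≤ 2 * K * (nrm 3 f * nrm 3 g) := fun i => by
    rw [D_mul]
    refine (nrm_add _ _ _).trans ?_
    have u := le_mul_mul_of_le (h2 (D i f) g) hK.le (nrm_D_le 2 i f) (nrm_succ_le 2 g)
      (nrm_nonneg _ _) p
    have v := le_mul_mul_of_le (h2 f (D i g)) hK.le (nrm_succ_le 2 f) (nrm_D_le 2 i g)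
      (nrm_nonneg _ _) p
    linarith
  refine (nrm_succ_le_add 2 _).trans ?_
  have := Finset.sum_le_sum (fun j (_ : j ∈ Finset.univ) => c j)
  simp only [Finset.sum_const, Finset.card_univ, Fintype.card_fin, nsmul_eq_mul,
    Nat.cast_ofNat] at this
  have w := le_mul_mul_of_le ((nrm_zero_le 2 _).trans (h2 f g)) hK.le (nrm_succ_le 2 f)
    (nrm_succ_le 2 g) (nrm_nonneg _ _) p
  linarith

end HInf


/-! ### The anisotropic trilinear estimate. -/

namespace HInf

/-- The fundamental theorem of calculus for f² along the line through y in direction i: the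
derivative is 2 f ∂ᵢf, and compact support removes the value at -∞. -/
theorem enorm_sq_le_lintegral_line (f : HInf) (hc : HasCompactSupport f.1) (i : Fin 3)
    (y : Fin 3 → ℝ) : ‖f (WithLp.toLp 2 y) ^ 2‖ₑ ≤
      ∫⁻ t, ‖2 * (f * D i f) (WithLp.toLp 2 (Function.update y i t))‖ₑ := by
  let L : (Fin 3 → ℝ) ≃L[ℝ] Space := (EuclideanSpace.equiv (Fin 3) ℝ).symm
  let c : ℝ → Space := fun t => L (Function.update y i t)
  have hcd : ∀ t, HasDerivAt c (EuclideanSpace.single i (1 : ℝ)) t := fun t => by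
    have h1 := hasDerivAt_update y i t
    have h2 := L.toContinuousLinearMap.hasFDerivAt.comp_hasDerivAt t h1
    have e : L (Pi.single i (1 : ℝ)) = EuclideanSpace.single i (1 : ℝ) := by
      ext j; simp [L]
    rw [← e]
    exact h2
  let u : ℝ → ℝ := fun t => f (c t) ^ 2
  have hu : ∀ t, HasDerivAt u (2 * (f * D i f) (c t)) t := fun t => by
    have h1 : HasDerivAt (fun t => f (c t)) (D i f (c t)) t :=
      (f.differentiableAt (c t)).hasFDerivAt.comp_hasDerivAt t (hcd t)
    have h2 := h1.pow 2
    have e : 2 * (f * D i f) (c t) = ((2 : ℕ) : ℝ) * f (c t) ^ (2 - 1) * D i f (c t) := by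
      simp [mul_assoc]
    rw [e]
    exact h2
  have hcc : ContDiff ℝ 1 c := L.contDiff.comp (by convert! contDiff_update 1 y i)
  have hu1 : ContDiff ℝ 1 u := ((f.smooth.of_le (by simp)).comp hcc).pow 2
  have hemb : IsClosedEmbedding c :=
    L.toHomeomorph.isClosedEmbedding.comp (isClosedEmbedding_update y i)
  have huc : HasCompactSupport u := by
    have := hc.comp_isClosedEmbedding hemb
    exact this.comp_left (g := fun r : ℝ => r ^ 2) (by simp)
  have hc' : c (y i) = WithLp.toLp 2 y := by simp [c, L]
  calc ‖f (WithLp.toLp 2 y) ^ 2‖ₑ = ‖u (y i)‖ₑ := by simp only [u, hc']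
    _ ≤ ∫⁻ t in Iic (y i), ‖deriv u t‖ₑ := HasCompactSupport.enorm_le_lintegral_Ici_deriv hu1 huc _
    _ ≤ ∫⁻ t, ‖deriv u t‖ₑ := lintegral_mono' Measure.restrict_le_self le_rfl
    _ = _ := by
        congr 1; funext t
        rw [(hu t).deriv]
        rfl

/-- A Loomis–Whitney argument. Each |fᵢ|² is at most the integral of 2|fᵢ ∂ᵢfᵢ| along direction i,
so the product is dominated by square roots of three line integrals in different directions; the
grid-lines inequality, whose exponent is 1/(3 - 1) = 1/2, integrates such a product. -/
theorem lintegral_prod_le_of_hasCompactSupport (f : Fin 3 → HInf)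
    (hc : ∀ i, HasCompactSupport (f i).1) (A : Fin 3 → ℝ) (hA : ∀ i, 0 < A i)
    (h : ∀ i, 2 * (nrm 0 (f i) * nrm 0 (D i (f i))) ≤ A i) :
    ∫⁻ x, ‖f 0 x * f 1 x * f 2 x‖ₑ ≤ ENNReal.ofReal (9 * √(A 0 * A 1 * A 2)) := by
  let F : Fin 3 → (Fin 3 → ℝ) → ℝ≥0∞ := fun i y => ‖2 * (f i * D i (f i)) (WithLp.toLp 2 y)‖ₑ
  let a : Fin 3 → ℝ≥0∞ := fun i => ENNReal.ofReal (A i)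
  have ha0 : ∀ i, a i ≠ 0 := fun i => (ENNReal.ofReal_pos.2 (hA i)).ne'
  have hat : ∀ i, a i ≠ ⊤ := fun i => ENNReal.ofReal_ne_top
  -- The grid-lines inequality takes one function for all directions. Dividing by A i normalises the
  -- three integrands to integral at most 1, so their sum dominates each of them and has integral at
  -- most 3.
  let Φ : (Fin 3 → ℝ) → ℝ≥0∞ := fun y => ∑ i, (a i)⁻¹ * F i y
  have hmp := PiLp.volume_preserving_toLp (Fin 3)
  have hFm : ∀ i, Measurable (F i) := fun i =>
    (((f i * D i (f i)).continuous.measurable.comp hmp.measurable).const_mul 2).enorm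
  have hΦm : Measurable Φ := Finset.measurable_sum _ fun i _ => (hFm i).const_mul _
  have hF : ∀ i y, F i y ≤ a i * Φ y := fun i y => by
    calc F i y = a i * ((a i)⁻¹ * F i y) := by
          rw [← mul_assoc, ENNReal.mul_inv_cancel (ha0 i) (hat i), one_mul]
      _ ≤ a i * Φ y := by
          gcongr
          exact Finset.single_le_sum (f := fun i => (a i)⁻¹ * F i y) (fun _ _ => zero_le)
            (Finset.mem_univ i)
  have hFi : ∀ i, ∫⁻ y, F i y ≤ a i := fun i => by
    have e : ∫⁻ y, F i y = ∫⁻ x, ‖2 * (f i * D i (f i)) x‖ₑ :=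
      hmp.lintegral_comp (((f i * D i (f i)).continuous.measurable).const_mul 2).enorm
    have hint : Integrable fun x => 2 * (f i * D i (f i)) x :=
      (integrable_mul (f i) (D i (f i))).const_mul 2
    rw [e, ← ofReal_integral_norm_eq_lintegral_enorm hint]
    refine ENNReal.ofReal_le_ofReal ((le_of_eq ?_).trans ((mul_le_mul_of_nonneg_left
      (integral_abs_mul_le (f i).memLp (D i (f i)).memLp) zero_le_two).trans ?_))
    · rw [← integral_const_mul]
      congr 1; funext x; simp
    · rw [← nrm_zero_eq, ← nrm_zero_eq]
      exact h i
  have hΦi : ∫⁻ y, Φ y ≤ 3 := by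
    rw [lintegral_finsetSum _ fun i _ => (hFm i).const_mul _]
    calc ∑ i, ∫⁻ y, (a i)⁻¹ * F i y ≤ ∑ i : Fin 3, 1 := by
          gcongr with i
          rw [lintegral_const_mul _ (hFm i)]
          calc (a i)⁻¹ * ∫⁻ y, F i y ≤ (a i)⁻¹ * a i := by gcongr; exact hFi i
            _ = 1 := ENNReal.inv_mul_cancel (ha0 i) (hat i)
      _ = 3 := by simp
  have hp : Real.HolderConjugate (Fintype.card (Fin 3)) (3 / 2) := by
    rw [Real.holderConjugate_iff]; norm_num
  have grid := lintegral_prod_lintegral_pow_le (fun _ : Fin 3 => (volume : Measure ℝ)) hp hΦm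
  have hexp : (1 : ℝ) / ((Fintype.card (Fin 3) : ℝ) - 1) = 1 / 2 := by norm_num
  rw [hexp] at grid
  have hpt : ∀ i y, ‖f i (WithLp.toLp 2 y)‖ₑ ≤
      a i ^ (1 / 2 : ℝ) * (∫⁻ t, Φ (Function.update y i t)) ^ (1 / 2 : ℝ) := fun i y => by
    have h1 : ‖f i (WithLp.toLp 2 y)‖ₑ = ‖f i (WithLp.toLp 2 y) ^ 2‖ₑ ^ (1 / 2 : ℝ) := by
      rw [enorm_pow, ← ENNReal.rpow_natCast, ← ENNReal.rpow_mul]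
      norm_num
    rw [h1, ← ENNReal.mul_rpow_of_nonneg _ _ (by norm_num)]
    gcongr
    refine (enorm_sq_le_lintegral_line (f i) (hc i) i y).trans ?_
    rw [← lintegral_const_mul' _ _ (hat i)]
    exact lintegral_mono fun t => hF i _
  have e1 : ∫⁻ x, ‖f 0 x * f 1 x * f 2 x‖ₑ =
      ∫⁻ y : Fin 3 → ℝ, ‖f 0 (WithLp.toLp 2 y) * f 1 (WithLp.toLp 2 y) * f 2 (WithLp.toLp 2 y)‖ₑ :=
    (hmp.lintegral_comp (((f 0).continuous.mul (f 1).continuous).mul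
      (f 2).continuous).measurable.enorm).symm
  rw [e1]
  have hfin : (a 0 ^ (1 / 2 : ℝ) * a 1 ^ (1 / 2 : ℝ) * a 2 ^ (1 / 2 : ℝ)) ≠ ⊤ := by
    refine ENNReal.mul_ne_top (ENNReal.mul_ne_top ?_ ?_) ?_ <;>
      exact ENNReal.rpow_ne_top_of_nonneg (by norm_num) (hat _)
  calc ∫⁻ y : Fin 3 → ℝ, ‖f 0 (WithLp.toLp 2 y) * f 1 (WithLp.toLp 2 y) * f 2 (WithLp.toLp 2 y)‖ₑ
      ≤ ∫⁻ y : Fin 3 → ℝ, (a 0 ^ (1 / 2 : ℝ) * a 1 ^ (1 / 2 : ℝ) * a 2 ^ (1 / 2 : ℝ)) *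
        ∏ i, (∫⁻ t, Φ (Function.update y i t)) ^ (1 / 2 : ℝ) := by
        refine lintegral_mono fun y => ?_
        simp only [Fin.prod_univ_three, enorm_mul]
        calc _ ≤ (a 0 ^ (1 / 2 : ℝ) * (∫⁻ t, Φ (Function.update y 0 t)) ^ (1 / 2 : ℝ)) *
              (a 1 ^ (1 / 2 : ℝ) * (∫⁻ t, Φ (Function.update y 1 t)) ^ (1 / 2 : ℝ)) *
              (a 2 ^ (1 / 2 : ℝ) * (∫⁻ t, Φ (Function.update y 2 t)) ^ (1 / 2 : ℝ)) := by
              gcongr <;> exact hpt _ y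
          _ = _ := by ring
    _ = (a 0 ^ (1 / 2 : ℝ) * a 1 ^ (1 / 2 : ℝ) * a 2 ^ (1 / 2 : ℝ)) *
        ∫⁻ y : Fin 3 → ℝ, ∏ i, (∫⁻ t, Φ (Function.update y i t)) ^ (1 / 2 : ℝ) :=
        lintegral_const_mul' _ _ hfin
    _ ≤ (a 0 ^ (1 / 2 : ℝ) * a 1 ^ (1 / 2 : ℝ) * a 2 ^ (1 / 2 : ℝ)) * 9 := by
        gcongr
        refine grid.trans ?_
        -- The constant 9 comes from rounding 3^{3/2} up to 3².
        calc (∫⁻ y, Φ y) ^ (3 / 2 : ℝ) ≤ (3 : ℝ≥0∞) ^ (3 / 2 : ℝ) := by gcongr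
          _ ≤ (3 : ℝ≥0∞) ^ (2 : ℝ) := ENNReal.rpow_le_rpow_of_exponent_le (by norm_num) (by norm_num)
          _ = 9 := by
            rw [show (2 : ℝ) = ((2 : ℕ) : ℝ) by norm_num, ENNReal.rpow_natCast]; norm_num
    _ = ENNReal.ofReal (9 * √(A 0 * A 1 * A 2)) := by
        rw [← ENNReal.mul_rpow_of_nonneg _ _ (by norm_num),
          ← ENNReal.mul_rpow_of_nonneg _ _ (by norm_num), ← ENNReal.ofReal_mul (hA 0).le,
          ← ENNReal.ofReal_mul (mul_pos (hA 0) (hA 1)).le,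
          ENNReal.ofReal_rpow_of_nonneg (mul_pos (mul_pos (hA 0) (hA 1)) (hA 2)).le (by norm_num),
          ← Real.sqrt_eq_rpow, mul_comm, ENNReal.ofReal_mul (by norm_num), ENNReal.ofReal_ofNat]

/-- The anisotropic trilinear estimate. -/
theorem lintegral_prod_le (f : Fin 3 → HInf) (A : Fin 3 → ℝ)
    (h : ∀ i, 2 * (nrm 0 (f i) * nrm 0 (D i (f i))) ≤ A i) :
    ∫⁻ x, ‖f 0 x * f 1 x * f 2 x‖ₑ ≤ ENNReal.ofReal (9 * √(A 0 * A 1 * A 2)) := by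
  obtain ⟨C, hC, χ, hχ, hc, b0, b1, b2⟩ := exists_cutoff_seq
  let g : ℕ → Fin 3 → HInf := fun n i => cut (χ n) (hχ n) (hc n) (f i)
  -- The middle term pays for differentiating the cutoff. The last one keeps A' strictly positive,
  -- as the compactly supported case demands even when A i = 0.
  let A' : ℕ → Fin 3 → ℝ := fun n i =>
    A i + (2 * C) / (n + 1 : ℝ) * nrm 0 (f i) ^ 2 + 1 / (n + 1 : ℝ) * 1
  have hA : ∀ i, 0 ≤ A i := fun i =>
    (mul_nonneg zero_le_two (mul_nonneg (nrm_nonneg _ _) (nrm_nonneg _ _))).trans (h i)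
  have hA' : ∀ n i, 0 < A' n i := fun n i => by
    have := hA i
    positivity
  have hg : ∀ n i, 2 * (nrm 0 (g n i) * nrm 0 (D i (g n i))) ≤ A' n i := fun n i => by
    have h1 := nrm_zero_cut_le _ (hχ n) (hc n) (f i) (b0 n)
    rw [one_mul] at h1
    have h2 := b2 n i (f i)
    have p := nrm_nonneg 0 (f i)
    have p' := nrm_nonneg 0 (D i (g n i))
    have := mul_le_mul h1 h2 p' p
    have h3 := h i
    have h4 : 0 ≤ 1 / (n + 1 : ℝ) * 1 := by positivity
    have e : (2 * C) / (n + 1 : ℝ) * nrm 0 (f i) ^ 2 =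
      2 * (nrm 0 (f i) * (C / (n + 1 : ℝ) * nrm 0 (f i))) := by ring
    simp only [A', e]
    simp only [g] at *
    linarith
  have hlim : Tendsto (fun n => ENNReal.ofReal (9 * √(A' n 0 * A' n 1 * A' n 2))) atTop
      (𝓝 (ENNReal.ofReal (9 * √(A 0 * A 1 * A 2)))) := by
    have t : ∀ i, Tendsto (fun n => A' n i) atTop (𝓝 (A i)) := fun i => by
      have t1 := tendsto_cutoff_const (2 * C) (nrm 0 (f i) ^ 2) (A i)
      have t2 := tendsto_cutoff_const 1 1 0
      simpa only [A', zero_add, add_zero] using t1.add t2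
    exact (ENNReal.continuous_ofReal.tendsto _).comp
      (((((t 0).mul (t 1)).mul (t 2)).sqrt).const_mul 9)
  have hm : ∀ u v w : HInf, Measurable fun x => ‖u x * v x * w x‖ₑ := fun u v w =>
    ((u.continuous.mul v.continuous).mul w.continuous).measurable.enorm
  calc ∫⁻ x, ‖f 0 x * f 1 x * f 2 x‖ₑ
      = ∫⁻ x, liminf (fun n => ‖g n 0 x * g n 1 x * g n 2 x‖ₑ) atTop := by
        refine lintegral_congr fun x => (Tendsto.liminf_eq ?_).symm
        apply tendsto_const_nhds.congr'
        filter_upwards [b1 x] with n hn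
        simp only [g, cut_apply, hn, one_mul]
    _ ≤ liminf (fun n => ∫⁻ x, ‖g n 0 x * g n 1 x * g n 2 x‖ₑ) atTop :=
        lintegral_liminf_le fun n => hm _ _ _
    _ ≤ liminf (fun n => ENNReal.ofReal (9 * √(A' n 0 * A' n 1 * A' n 2))) atTop := by
        refine liminf_le_liminf (Eventually.of_forall fun n => ?_)
        exact lintegral_prod_le_of_hasCompactSupport (g n) (fun i => (hc n).mul_right) (A' n)
          (hA' n) (hg n)
    _ = _ := hlim.liminf_eq

/-- The directions are shared out: f and g pay with one horizontal derivative each, and only h pays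
with the vertical one. The root of (2bd)(2bd)(2e²) is at most 3bde, whence 9·3 = 27 ≤ 30. -/
theorem abs_ip_mul_le {f g h : HInf} {b d e : ℝ} (hf : nrm 0 f ≤ b) (hf' : nrm 0 (D 0 f) ≤ d)
    (hg : nrm 0 g ≤ b) (hg' : nrm 0 (D 1 g) ≤ d) (hh : nrm 0 h ≤ e) (hh' : nrm 0 (D 2 h) ≤ e) :
    |ip (f * g) h| ≤ 30 * (b * d * e) := by
  have pb : 0 ≤ b := (nrm_nonneg _ _).trans hf
  have pd : 0 ≤ d := (nrm_nonneg _ _).trans hf'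
  have pe : 0 ≤ e := (nrm_nonneg _ _).trans hh
  have key := lintegral_prod_le ![f, g, h] ![2 * (b * d), 2 * (b * d), 2 * (e * e)] (by
    intro i
    fin_cases i
    · simpa using mul_le_mul hf hf' (nrm_nonneg _ _) pb
    · simpa using mul_le_mul hg hg' (nrm_nonneg _ _) pb
    · simpa using mul_le_mul hh hh' (nrm_nonneg _ _) pe)
  simp only [Matrix.cons_val] at key
  have h1 : ENNReal.ofReal |ip (f * g) h| ≤ ∫⁻ x, ‖f x * g x * h x‖ₑ := by
    rw [← Real.enorm_eq_ofReal_abs]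
    exact enorm_integral_le_lintegral_enorm _
  have h2 := (ENNReal.ofReal_le_ofReal_iff (by positivity)).1 (h1.trans key)
  refine h2.trans ?_
  have h3 : √(2 * (b * d) * (2 * (b * d)) * (2 * (e * e))) ≤ 3 * (b * d * e) := by
    rw [Real.sqrt_le_left (by positivity)]
    nlinarith [sq_nonneg (b * d * e)]
  have : 0 ≤ b * d * e := by positivity
  linarith

end HInf


/-! ### Energy estimates for transport terms. -/

theorem abs_sum_le_three {f : Fin 3 → ℝ} {c : ℝ} (h : ∀ i, |f i| ≤ c) : |∑ i, f i| ≤ 3 * c := by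
  refine (Finset.abs_sum_le_sum_abs _ _).trans ((Finset.sum_le_sum fun i _ => h i).trans ?_)
  simp

theorem abs_add_sum_le {x a c : ℝ} {f : Fin 3 → ℝ} (hx : |x| ≤ a) (h : ∀ i, |f i| ≤ c) :
    |x + ∑ i, f i| ≤ a + 3 * c :=
  (abs_add_le _ _).trans (add_le_add hx (abs_sum_le_three h))

theorem abs_add_le_of {x y a b : ℝ} (hx : |x| ≤ a) (hy : |y| ≤ b) : |x + y| ≤ a + b :=
  (abs_add_le _ _).trans (add_le_add hx hy)

theorem abs_sub_le_of {x y a b : ℝ} (hx : |x| ≤ a) (hy : |y| ≤ b) : |x - y| ≤ a + b :=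
  (abs_sub _ _).trans (add_le_add hx hy)

namespace HInf

/-- The transport term `v · ∇ c`. -/
def transport (v : Fin 3 → HInf) (c : HInf) : HInf := ∑ i, v i * D i c

theorem D_transport (j : Fin 3) (v : Fin 3 → HInf) (c : HInf) : D j (transport v c) =
    transport (fun i => D j (v i)) c + transport v (D j c) := by
  simp only [transport, map_sum, D_mul, Finset.sum_add_distrib, D_comm j _ c]

theorem pair_transport (k : ℕ) (v : Fin 3 → HInf) (c g : HInf) :
    pair k (transport v c) g = ∑ i, pair k (v i * D i c) g := by
  simp only [transport, map_sum, LinearMap.sum_apply]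

/-- Moving the derivative off c reproduces the same pairing with the opposite sign, so twice the
pairing equals -∫ (div v) c². -/
theorem ip_transport_self (v : Fin 3 → HInf) (c : HInf) :
    ip (transport v c) c = ∑ i, -(1 / 2) * ip (D i (v i) * c) c := by
  rw [← pair_zero, pair_transport]
  refine Finset.sum_congr rfl fun i _ => ?_
  have h : ip (v i * D i c) c = -ip (D i (v i) * c) c - ip (v i * D i c) c := by
    conv_lhs => rw [mul_comm, ip_mul_left, ip_D, D_mul, map_add, ip_comm c, ip_comm c]
    ring
  rw [pair_zero]
  linarith

theorem pair_succ_transport (k : ℕ) (v : Fin 3 → HInf) (c : HInf) :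
    pair (k + 1) (transport v c) c = ip (transport v c) c +
      ∑ j, (pair k (transport (fun i => D j (v i)) c) (D j c) +
        pair k (transport v (D j c)) (D j c)) := by
  simp only [pair_succ, D_transport, map_add, LinearMap.add_apply]

theorem abs_pair_mul_le_nrm : ∃ K : ℝ, 0 < K ∧ ∀ m ≤ 2, ∀ f g h : HInf,
    |pair m (f * g) h| ≤ K * (nrm 2 f * nrm m g * nrm m h) := by
  obtain ⟨K, hK, h⟩ := nrm_mul_le_nrm
  refine ⟨K, hK, fun m hm f g r => (abs_pair_le _ _ _).trans ?_⟩
  rw [← mul_assoc]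
  exact mul_le_mul_of_nonneg_right (h m hm f g) (nrm_nonneg _ _)

/-- When a derivative falls on c, the result is again a transport pairing of D j c with itself, to
which the induction hypothesis applies; no derivative of c is lost. When it falls on v, the product
estimate suffices. -/
theorem abs_pair_transport_le (k : ℕ) (hk : k ≤ 2) : ∃ K : ℝ, 0 < K ∧
    ∀ (v : Fin 3 → HInf) (c : HInf) (M : ℝ), (∀ i, nrm 3 (v i) ≤ M) →
      |pair k (transport v c) c| ≤ K * (M * nrm k c ^ 2) := by
  obtain ⟨K₁, hK₁, h₁⟩ := abs_pair_mul_le_nrm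
  have base : ∀ (v : Fin 3 → HInf) (c : HInf) (M : ℝ), (∀ i, nrm 3 (v i) ≤ M) →
      |ip (transport v c) c| ≤ 3 * (K₁ * (M * nrm 0 c ^ 2)) := by
    intro v c M hM
    rw [ip_transport_self]
    refine abs_sum_le_three fun i => ?_
    have h := h₁ 0 (by norm_num) (D i (v i)) c c
    have h2 : nrm 2 (D i (v i)) ≤ M := (nrm_D_le 2 i _).trans (hM i)
    have h3 : nrm 2 (D i (v i)) * nrm 0 c * nrm 0 c ≤ M * nrm 0 c ^ 2 := by
      rw [mul_assoc, ← sq]; gcongr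
    rw [abs_mul, pair_zero] at *
    have : |-(1 / 2 : ℝ)| = 1 / 2 := by rw [abs_neg]; norm_num
    rw [this]
    have h4 := mul_le_mul_of_nonneg_left h3 hK₁.le
    have := abs_nonneg (ip (D i (v i) * c) c)
    linarith
  induction k with
  | zero => exact ⟨3 * K₁, by positivity, fun v c M hM => by
      rw [pair_zero, mul_assoc]; exact base v c M hM⟩
  | succ k ih =>
    obtain ⟨K₂, hK₂, h₂⟩ := ih (by omega)
    refine ⟨3 * K₁ + 3 * (3 * K₁ + K₂), by positivity, fun v c M hM => ?_⟩
    have hM0 : 0 ≤ M := (nrm_nonneg _ _).trans (hM 0)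
    rw [pair_succ_transport]
    set N := M * nrm (k + 1) c ^ 2 with hN
    have e : (3 * K₁ + 3 * (3 * K₁ + K₂)) * N = 3 * (K₁ * N) + 3 * (3 * (K₁ * N) + K₂ * N) := by
      ring
    rw [e]
    refine abs_add_sum_le ((base v c M hM).trans ?_) fun j => abs_add_le_of ?_ ?_
    · rw [hN]
      have := nrm_nonneg 0 c
      gcongr
      exact nrm_zero_le _ _
    · rw [pair_transport]
      refine abs_sum_le_three fun i => (h₁ k (by omega) _ _ _).trans ?_
      rw [hN]
      have a1 : nrm 2 (D j (v i)) ≤ M := (nrm_D_le 2 j _).trans (hM i)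
      have a2 := nrm_nonneg k (D i c)
      have a3 := nrm_nonneg k (D j c)
      have a4 := nrm_nonneg (k + 1) c
      rw [show M * nrm (k + 1) c ^ 2 = M * nrm (k + 1) c * nrm (k + 1) c by ring]
      gcongr
      · exact nrm_D_le _ _ _
      · exact nrm_D_le _ _ _
    · refine (h₂ v (D j c) M hM).trans ?_
      rw [hN]
      have a3 := nrm_nonneg k (D j c)
      gcongr
      exact nrm_D_le _ _ _

/-- For the density, c itself may not appear on the right, only its gradient, and twice. The L² part
is grouped as ⟨∂c, c v⟩ with ‖c v‖ ≤ C‖∇c‖‖v‖_{H¹}; the derivative part is `abs_pair_transport_le`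
at order 2 applied to D j c. -/
theorem abs_pair_three_transport_le : ∃ K : ℝ, 0 < K ∧
    ∀ (v : Fin 3 → HInf) (c : HInf) (M : ℝ), (∀ i, nrm 3 (v i) ≤ M) →
      |pair 3 (transport v c) c| ≤ K * (M * gn 2 c ^ 2) := by
  obtain ⟨K₁, hK₁, h₁⟩ := abs_pair_mul_le_nrm
  obtain ⟨K₂, hK₂, h₂⟩ := abs_pair_transport_le 2 le_rfl
  obtain ⟨K₃, hK₃, h₃⟩ := nrm_zero_mul_le
  refine ⟨3 * K₃ + 3 * (3 * K₁ + K₂), by positivity, fun v c M hM => ?_⟩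
  have hM0 : 0 ≤ M := (nrm_nonneg _ _).trans (hM 0)
  have p := gn_nonneg 2 c
  have q : ∀ j, nrm 2 (D j c) ≤ gn 2 c := fun j => nrm_D_le_gn 2 j c
  have q0 : ∀ j, 0 ≤ nrm 2 (D j c) := fun j => nrm_nonneg _ _
  rw [pair_succ_transport]
  set N := M * gn 2 c ^ 2 with hN
  have e : (3 * K₃ + 3 * (3 * K₁ + K₂)) * N = 3 * (K₃ * N) + 3 * (3 * (K₁ * N) + K₂ * N) := by
    ring
  rw [e]
  refine abs_add_sum_le ?_ fun j => abs_add_le_of ?_ ?_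
  · rw [← pair_zero, pair_transport]
    refine abs_sum_le_three fun i => ?_
    rw [pair_zero, mul_comm (v i), ip_mul_left, mul_comm (v i)]
    refine (abs_ip_le _ _).trans ?_
    calc nrm 0 (D i c) * nrm 0 (c * v i) ≤ gn 2 c * (K₃ * (gn 2 c * M)) := by
          refine mul_le_mul ((nrm_mono (by norm_num) _).trans (q i)) ((h₃ c (v i)).trans ?_)
            (nrm_nonneg _ _) p
          have := nrm_nonneg 1 (v i)
          gcongr
          · exact gn_mono (by norm_num) c
          · exact (nrm_mono (by norm_num) _).trans (hM i)
      _ = K₃ * N := by rw [hN]; ring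
  · rw [pair_transport]
    refine abs_sum_le_three fun i => (h₁ 2 le_rfl _ _ _).trans ?_
    have a1 : nrm 2 (D j (v i)) ≤ M := (nrm_D_le 2 j _).trans (hM i)
    have a2 := q i
    have a3 := q j
    have a4 := q0 i
    have a5 := q0 j
    rw [show N = M * gn 2 c * gn 2 c by rw [hN]; ring]
    gcongr
  · refine (h₂ v (D j c) M hM).trans ?_
    have a3 := q j
    have a5 := q0 j
    rw [hN]
    gcongr

/-- At order zero the product a·a supplies the required ∇a through `nrm_zero_mul_le`; at higher
order the differentiated second argument does. -/
theorem abs_pair_three_mul_self_le : ∃ K : ℝ, 0 < K ∧ ∀ (a w : HInf),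
    |pair 3 (a * w) a| ≤ K * (nrm 3 a * gn 2 a * nrm 3 w) := by
  obtain ⟨K₁, hK₁, h₁⟩ := abs_pair_mul_le_nrm
  obtain ⟨K₃, hK₃, h₃⟩ := nrm_zero_mul_le
  refine ⟨K₃ + 3 * (K₁ + K₁), by positivity, fun a w => ?_⟩
  have p := gn_nonneg 2 a
  have pa := nrm_nonneg 3 a
  have pw := nrm_nonneg 3 w
  set N := nrm 3 a * gn 2 a * nrm 3 w with hN
  have e : (K₃ + 3 * (K₁ + K₁)) * N = K₃ * N + 3 * (K₁ * N + K₁ * N) := by ring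
  rw [e, pair_succ]
  refine abs_add_sum_le ?_ fun i => ?_
  · rw [mul_comm a w, ip_mul_left]
    refine (abs_ip_le _ _).trans ?_
    calc nrm 0 w * nrm 0 (a * a) ≤ nrm 3 w * (K₃ * (gn 2 a * nrm 3 a)) := by
          refine mul_le_mul (nrm_zero_le _ _) ((h₃ a a).trans ?_) (nrm_nonneg _ _) pw
          have := nrm_nonneg 1 a
          gcongr
          · exact gn_mono (by norm_num) _
          · exact nrm_mono (by norm_num) _
      _ = K₃ * N := by rw [hN]; ring
  · have q : nrm 2 (D i a) ≤ gn 2 a := nrm_D_le_gn 2 i a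
    have q0 := nrm_nonneg 2 (D i a)
    have q1 := nrm_nonneg 2 w
    have q2 := nrm_nonneg 2 a
    have q3 := nrm_nonneg 2 (D i w)
    rw [D_mul, map_add, LinearMap.add_apply, mul_comm (D i a) w]
    refine abs_add_le_of ((h₁ 2 le_rfl _ _ _).trans ?_) ((h₁ 2 le_rfl _ _ _).trans ?_)
    · calc K₁ * (nrm 2 w * nrm 2 (D i a) * nrm 2 (D i a)) ≤ K₁ * (nrm 3 w * nrm 3 a * gn 2 a) := by
            gcongr
            · exact nrm_mono (by norm_num) _
            · exact nrm_D_le _ _ _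
        _ = K₁ * N := by rw [hN]; ring
    · calc K₁ * (nrm 2 a * nrm 2 (D i w) * nrm 2 (D i a)) ≤ K₁ * (nrm 3 a * nrm 3 w * gn 2 a) := by
            gcongr
            · exact nrm_mono (by norm_num) _
            · exact nrm_D_le _ _ _
        _ = K₁ * N := by rw [hN]; ring

/-! ### Anisotropic product and transport estimates in H^k. -/

/-- Bounds on `p` and on its horizontal derivatives. -/
structure HBound (k : ℕ) (b d : ℝ) (p : HInf) : Prop where
  val : nrm k p ≤ b
  d0 : nrm k (D 0 p) ≤ d
  d1 : nrm k (D 1 p) ≤ d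

/-- Bounds on `r` and on its vertical derivative. -/
structure VBound (k : ℕ) (e : ℝ) (r : HInf) : Prop where
  val : nrm k r ≤ e
  d2 : nrm k (D 2 r) ≤ e

theorem HBound.mono {k m : ℕ} {b d : ℝ} {p : HInf} (h : HBound m b d p) (hk : k ≤ m) :
    HBound k b d p :=
  ⟨(nrm_mono hk _).trans h.val, (nrm_mono hk _).trans h.d0, (nrm_mono hk _).trans h.d1⟩

theorem HBound.deriv {k : ℕ} {b d : ℝ} {p : HInf} (h : HBound (k + 1) b d p) (i : Fin 3) :
    HBound k b d (D i p) :=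
  ⟨(nrm_D_le k i p).trans h.val, by rw [D_comm]; exact (nrm_D_le k i _).trans h.d0,
    by rw [D_comm]; exact (nrm_D_le k i _).trans h.d1⟩

theorem VBound.mono {k m : ℕ} {e : ℝ} {p : HInf} (h : VBound m e p) (hk : k ≤ m) :
    VBound k e p :=
  ⟨(nrm_mono hk _).trans h.val, (nrm_mono hk _).trans h.d2⟩

theorem VBound.deriv {k : ℕ} {e : ℝ} {p : HInf} (h : VBound (k + 1) e p) (i : Fin 3) :
    VBound k e (D i p) :=
  ⟨(nrm_D_le k i p).trans h.val, by rw [D_comm]; exact (nrm_D_le k i _).trans h.d2⟩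

/-- The trilinear estimate with only horizontal derivatives falling on two of the factors. -/
theorem abs_pair_mul_le_aniso (k : ℕ) : ∃ K : ℝ, 0 < K ∧ ∀ (p q r : HInf) (b d e : ℝ),
    HBound k b d p → HBound k b d q → VBound k e r →
      |pair k (p * q) r| ≤ K * (b * d * e) ∧ |pair k (p * r) q| ≤ K * (b * d * e) := by
  have base : ∀ (p q r : HInf) (b d e : ℝ), HBound 0 b d p → HBound 0 b d q → VBound 0 e r →
      |ip (p * q) r| ≤ 30 * (b * d * e) ∧ |ip (p * r) q| ≤ 30 * (b * d * e) := by
    intro p q r b d e hp hq hr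
    have h := abs_ip_mul_le hp.val hp.d0 hq.val hq.d1 hr.val hr.d2
    -- The L² integral is symmetric in its three factors. The H^k pairing is not, which is why the
    -- position of r is recorded by two separate bounds.
    refine ⟨h, ?_⟩
    rwa [ip_mul_left, mul_comm r q, ← ip_mul_left]
  induction k with
  | zero => exact ⟨30, by norm_num, base⟩
  | succ k ih =>
    obtain ⟨K, hK, h⟩ := ih
    refine ⟨30 + 3 * (K + K), by positivity, fun p q r b d e hp hq hr => ?_⟩
    have e1 : (30 + 3 * (K + K)) * (b * d * e) = 30 * (b * d * e) + 3 * (K * (b * d * e) +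
      K * (b * d * e)) := by ring
    have hb := base p q r b d e (hp.mono (by omega)) (hq.mono (by omega)) (hr.mono (by omega))
    have hp' := hp.mono (Nat.le_succ k)
    have hq' := hq.mono (Nat.le_succ k)
    have hr' := hr.mono (Nat.le_succ k)
    rw [e1]
    constructor
    · rw [pair_succ]
      refine abs_add_sum_le hb.1 fun i => ?_
      rw [D_mul, map_add, LinearMap.add_apply]
      exact abs_add_le_of (h _ _ _ b d e (hp.deriv i) hq' (hr.deriv i)).1
        (h _ _ _ b d e hp' (hq.deriv i) (hr.deriv i)).1
    · rw [pair_succ]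
      refine abs_add_sum_le hb.2 fun i => ?_
      rw [D_mul, map_add, LinearMap.add_apply]
      exact abs_add_le_of (h _ _ _ b d e (hp.deriv i) (hq.deriv i) hr').2
        (h _ _ _ b d e hp' (hq.deriv i) (hr.deriv i)).2

/-- The induction of `abs_pair_transport_le`, now with v entering through its gradient only. At
order k at least one derivative lands on v, so k - 1 further ones suffice; the truncated value 0 at
k = 0 is what the term (div v) c² needs. -/
theorem abs_pair_transport_le_aniso (k : ℕ) : ∃ K : ℝ, 0 < K ∧
    ∀ (v : Fin 3 → HInf) (c : HInf) (b d e : ℝ), (∀ i j, VBound (k - 1) e (D i (v j))) →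
      HBound k b d c → |pair k (transport v c) c| ≤ K * (b * d * e) := by
  obtain ⟨K₀, hK₀, h₀⟩ := abs_pair_mul_le_aniso 0
  have base : ∀ (v : Fin 3 → HInf) (c : HInf) (b d e : ℝ), (∀ i j, VBound 0 e (D i (v j))) →
      HBound 0 b d c → |ip (transport v c) c| ≤ 3 * (K₀ * (b * d * e)) := by
    intro v c b d e hv hc
    rw [ip_transport_self]
    refine abs_sum_le_three fun i => ?_
    have h := (h₀ c c (D i (v i)) b d e hc hc (hv i i)).2
    rw [mul_comm, pair_zero] at h
    have : |-(1 / 2 : ℝ)| = 1 / 2 := by rw [abs_neg]; norm_num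
    rw [abs_mul, this]
    have := abs_nonneg (ip (D i (v i) * c) c)
    linarith
  induction k with
  | zero => exact ⟨3 * K₀, by positivity, fun v c b d e hv hc => by
      rw [mul_assoc]; exact base v c b d e hv hc⟩
  | succ k ih =>
    obtain ⟨K₁, hK₁, h₁⟩ := abs_pair_mul_le_aniso k
    obtain ⟨K, hK, h⟩ := ih
    refine ⟨3 * K₀ + 3 * (3 * K₁ + K), by positivity, fun v c b d e hv hc => ?_⟩
    have e1 : (3 * K₀ + 3 * (3 * K₁ + K)) * (b * d * e) = 3 * (K₀ * (b * d * e)) +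
      3 * (3 * (K₁ * (b * d * e)) + K * (b * d * e)) := by ring
    rw [e1, pair_succ_transport]
    refine abs_add_sum_le (base v c b d e (fun i j => (hv i j).mono (by omega))
      (hc.mono (by omega))) fun j => abs_add_le_of ?_ ?_
    · rw [pair_transport]
      refine abs_sum_le_three fun i => ?_
      rw [mul_comm]
      exact (h₁ _ _ _ b d e (hc.deriv i) (hc.deriv j) (hv j i)).2
    · exact h v (D j c) b d e (fun i j => (hv i j).mono (by omega)) (hc.deriv j)

/-! ### Cancellation between Lorentz force and magnetic stretching. -/

/-- The bilinear form of the Lorentz force `(∇ × Y) × X`. -/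
def lor (X Y : Fin 3 → HInf) (j : Fin 3) : HInf := ∑ i, X i * (D i (Y j) - D j (Y i))

/-- The stretching terms `X · ∇ v - X div v` of the induction equation. -/
def stretch (X v : Fin 3 → HInf) (j : Fin 3) : HInf := ∑ i, (X i * D i (v j) - X j * D i (v i))

/-- The work of the Lorentz force plus the energy gained by stretching. The first field is kept
apart from the second because, when the equation is differentiated, the top-order part leaves X
untouched and replaces Y and v by their derivatives. -/
def couple (k : ℕ) (X Y v : Fin 3 → HInf) : ℝ :=
  ∑ j, (pair k (lor X Y j) (v j) + pair k (stretch X v j) (Y j))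

theorem D_lor (l : Fin 3) (X Y : Fin 3 → HInf) (j : Fin 3) : D l (lor X Y j) =
    lor (fun i => D l (X i)) Y j + lor X (fun i => D l (Y i)) j := by
  simp only [lor, map_sum, D_mul, Finset.sum_add_distrib, map_sub, D_comm l]

theorem D_stretch (l : Fin 3) (X v : Fin 3 → HInf) (j : Fin 3) : D l (stretch X v j) =
    stretch (fun i => D l (X i)) v j + stretch X (fun i => D l (v i)) j := by
  simp only [stretch, map_sum, D_mul, ← Finset.sum_add_distrib, map_sub, D_comm l]
  refine Finset.sum_congr rfl fun i _ => ?_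
  abel

/-- As div X = 0, the integral of X · ∇(Y · v) vanishes, which cancels X · ∇Y in the force against X
· ∇v in the stretching. Integrating X div v by parts produces a term cancelling the rest of the
force, and only X remains differentiated. -/
theorem couple_zero (X Y v : Fin 3 → HInf) (hX : ∑ i, D i (X i) = 0) :
    couple 0 X Y v = ∑ i, ∑ j, ip (v i * D i (X j)) (Y j) := by
  have h1 : ∀ j, ∑ i, (ip (X i * D i (Y j)) (v j) + ip (X i * D i (v j)) (Y j)) = 0 := fun j => by
    have h : ip (∑ i, D i (X i)) (Y j * v j) = 0 := by rw [hX]; simp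
    rw [map_sum, LinearMap.sum_apply] at h
    rw [← neg_eq_zero, ← h, ← Finset.sum_neg_distrib]
    refine Finset.sum_congr rfl fun i _ => ?_
    rw [ip_D, D_mul, map_add, ip_mul_left, ip_mul_left, mul_comm (Y j)]
  have h2 : ∀ i j, ip (X j * D i (v i)) (Y j) =
      -ip (v i * D i (X j)) (Y j) - ip (X j * D i (Y j)) (v i) := fun i j => by
    rw [mul_comm, ip_mul_left, ip_D, D_mul, map_add, ip_mul_left, ip_comm (X j * _)]
    ring
  have e : ∀ j, ip (lor X Y j) (v j) + ip (stretch X v j) (Y j) =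
      ∑ i, (ip (X i * D i (Y j)) (v j) + ip (X i * D i (v j)) (Y j)) +
        (∑ i, ip (v i * D i (X j)) (Y j) + ∑ i, (ip (X j * D i (Y j)) (v i) -
          ip (X i * D j (Y i)) (v j))) := fun j => by
    simp only [lor, stretch, map_sum, map_sub, mul_sub, LinearMap.sum_apply, LinearMap.sub_apply,
      h2, ← Finset.sum_add_distrib]
    refine Finset.sum_congr rfl fun i _ => ?_
    ring
  simp only [couple, pair_zero, e, h1, zero_add, Finset.sum_add_distrib, Finset.sum_sub_distrib]
  rw [Finset.sum_comm (f := fun j i => ip (X j * D i (Y j)) (v i)), sub_self, add_zero,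
    Finset.sum_comm]

/-- Derivatives on Y and v reproduce the coupling with the same X, so the divergence constraint
survives the induction; those on X go into a remainder that needs no cancellation. -/
theorem couple_succ (k : ℕ) (X Y v : Fin 3 → HInf) : couple (k + 1) X Y v = couple 0 X Y v +
    ∑ l, (couple k X (fun i => D l (Y i)) (fun i => D l (v i)) +
      ∑ j, (pair k (lor (fun i => D l (X i)) Y j) (D l (v j)) +
        pair k (stretch (fun i => D l (X i)) v j) (D l (Y j)))) := by
  simp only [couple, pair_succ, pair_zero, D_lor, D_stretch, map_add, LinearMap.add_apply,
    Finset.sum_add_distrib]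
  rw [Finset.sum_comm (f := fun j i => pair k (lor (fun i_1 => D i (X i_1)) Y j) (D i (v j))),
    Finset.sum_comm (f := fun j i => pair k (lor X (fun i_1 => D i (Y i_1)) j) (D i (v j))),
    Finset.sum_comm (f := fun j i => pair k (stretch (fun i_1 => D i (X i_1)) v j) (D i (Y j))),
    Finset.sum_comm (f := fun j i => pair k (stretch X (fun i_1 => D i (v i_1)) j) (D i (Y j)))]
  ring

/-- Every term has one factor from X, one from Y and one from v, each already differentiated, so the
trilinear estimate applies term by term. -/
theorem abs_couple_rem_le (k : ℕ) : ∃ K : ℝ, 0 < K ∧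
    ∀ (X Y v : Fin 3 → HInf) (b d e : ℝ), (∀ i j, HBound k b d (D i (X j))) →
      (∀ i j, HBound k b d (D i (Y j))) → (∀ i j, VBound k e (D i (v j))) →
      ∀ l, |∑ j, (pair k (lor (fun i => D l (X i)) Y j) (D l (v j)) +
        pair k (stretch (fun i => D l (X i)) v j) (D l (Y j)))| ≤ K * (b * d * e) := by
  obtain ⟨K, hK, h⟩ := abs_pair_mul_le_aniso k
  refine ⟨3 * (3 * (K + K) + 3 * (K + K)), by positivity, fun X Y v b d e hX hY hv l => ?_⟩
  have e1 : 3 * (3 * (K + K) + 3 * (K + K)) * (b * d * e) = 3 * (3 * (K * (b * d * e) +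
    K * (b * d * e)) + 3 * (K * (b * d * e) + K * (b * d * e))) := by ring
  rw [e1]
  refine abs_sum_le_three fun j => ?_
  simp only [lor, stretch, map_sum, mul_sub, map_sub, LinearMap.sum_apply, LinearMap.sub_apply]
  refine abs_add_le_of (abs_sum_le_three fun i => abs_sub_le_of ?_ ?_)
    (abs_sum_le_three fun i => abs_sub_le_of ?_ ?_)
  · exact (h _ _ _ b d e (hX l i) (hY i j) (hv l j)).1
  · exact (h _ _ _ b d e (hX l i) (hY j i) (hv l j)).1
  · exact (h _ _ _ b d e (hX l i) (hY l j) (hv i j)).2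
  · exact (h _ _ _ b d e (hX l j) (hY l j) (hv i i)).2

theorem abs_couple_le (k : ℕ) : ∃ K : ℝ, 0 < K ∧
    ∀ (X Y v : Fin 3 → HInf) (b d e : ℝ), ∑ i, D i (X i) = 0 → (∀ i j, HBound k b d (D i (X j))) →
      (∀ j, HBound k b d (Y j)) → (∀ j, VBound k e (v j)) →
      |couple k X Y v| ≤ K * (b * d * e) := by
  obtain ⟨K₀, hK₀, h₀⟩ := abs_pair_mul_le_aniso 0
  have base : ∀ (X Y v : Fin 3 → HInf) (b d e : ℝ), ∑ i, D i (X i) = 0 →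
      (∀ i j, HBound 0 b d (D i (X j))) → (∀ j, HBound 0 b d (Y j)) → (∀ j, VBound 0 e (v j)) →
      |couple 0 X Y v| ≤ 3 * (3 * (K₀ * (b * d * e))) := by
    intro X Y v b d e h1 hX hY hv
    rw [couple_zero X Y v h1]
    refine abs_sum_le_three fun i => abs_sum_le_three fun j => ?_
    rw [mul_comm]
    exact (h₀ _ _ _ b d e (hX i j) (hY j) (hv i)).2
  induction k with
  | zero => exact ⟨9 * K₀, by positivity, fun X Y v b d e h1 hX hY hv =>
      (base X Y v b d e h1 hX hY hv).trans (le_of_eq (by ring))⟩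
  | succ k ih =>
    obtain ⟨K₁, hK₁, h₁⟩ := abs_couple_rem_le k
    obtain ⟨K, hK, h⟩ := ih
    refine ⟨9 * K₀ + 3 * (K + K₁), by positivity, fun X Y v b d e h0 hX hY hv => ?_⟩
    have e1 : (9 * K₀ + 3 * (K + K₁)) * (b * d * e) = 3 * (3 * (K₀ * (b * d * e))) +
      3 * (K * (b * d * e) + K₁ * (b * d * e)) := by ring
    rw [e1, couple_succ]
    refine abs_add_sum_le (base X Y v b d e h0 (fun i j => (hX i j).mono (by omega))
      (fun j => (hY j).mono (by omega)) (fun j => (hv j).mono (by omega))) fun l =>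
      abs_add_le_of ?_ ?_
    · exact h _ _ _ b d e h0 (fun i j => (hX i j).mono (by omega)) (fun j => (hY j).deriv l)
        (fun j => (hv j).deriv l)
    · exact h₁ X Y v b d e (fun i j => (hX i j).mono (by omega)) (fun i j => (hY j).deriv i)
        (fun i j => (hv j).deriv i) l

/-- The magnetic terms of the energy estimate. -/
theorem abs_magnetic_le : ∃ K : ℝ, 0 < K ∧
    ∀ (B u : Fin 3 → HInf) (b d e : ℝ), ∑ i, D i (B i) = 0 → (∀ j, HBound 3 b d (B j)) →
      (∀ i j, VBound 2 e (D i (u j))) →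
      |couple 3 B B u - ∑ j, pair 3 (transport u (B j)) (B j)| ≤ K * (b * d * e) := by
  obtain ⟨K₀, hK₀, h₀⟩ := abs_pair_transport_le_aniso 0
  obtain ⟨K₁, hK₁, h₁⟩ := abs_couple_rem_le 2
  obtain ⟨K₂, hK₂, h₂⟩ := abs_couple_le 2
  obtain ⟨K₃, hK₃, h₃⟩ := abs_pair_transport_le_aniso 3
  refine ⟨3 * K₀ + 3 * (K₂ + K₁) + 3 * K₃, by positivity, fun B u b d e h0 hB hu => ?_⟩
  have e1 : (3 * K₀ + 3 * (K₂ + K₁) + 3 * K₃) * (b * d * e) = 3 * (K₀ * (b * d * e)) +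
      3 * (K₂ * (b * d * e) + K₁ * (b * d * e)) + 3 * (K₃ * (b * d * e)) := by ring
  -- For X = Y = B the order-zero coupling is ∑ ⟨u · ∇Bⱼ, Bⱼ⟩, which depends on u only through div
  -- u. At higher order u appears already differentiated, so no bound on u itself is used.
  rw [e1, couple_succ, couple_zero _ _ _ h0, Finset.sum_comm]
  refine abs_sub_le_of (abs_add_sum_le (abs_sum_le_three fun j => ?_) fun l =>
    abs_add_le_of ?_ ?_) (abs_sum_le_three fun j => ?_)
  · have := h₀ u (B j) b d e (fun i j => (hu i j).mono (by omega)) ((hB j).mono (by omega))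
    rwa [pair_transport] at this
  · exact h₂ _ _ _ b d e h0 (fun i j => (hB j).deriv i) (fun j => (hB j).deriv l)
      (fun j => hu l j)
  · exact h₁ _ _ _ b d e (fun i j => (hB j).deriv i) (fun i j => (hB j).deriv i) hu l
  · exact h₃ u (B j) b d e hu (hB j)

end HInf


/-! ### Composition with smooth functions. -/

theorem pd_comp {G : ℝ → ℝ} (hG : ContDiff ℝ ∞ G) {f : Space → ℝ} (hf : ContDiff ℝ ∞ f)
    (i : Fin 3) : pd i (fun x => G (f x)) = fun x => deriv G (f x) * pd i f x := by
  funext x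
  have h1 : HasDerivAt G (deriv G (f x)) (f x) :=
    ((hG.differentiable (by simp)) (f x)).hasDerivAt
  have h2 := h1.comp_hasFDerivAt x (ContDiff.diffAt hf x).hasFDerivAt
  rw [pd]
  erw [h2.fderiv]
  simp [pd]

theorem contDiff_deriv_infty {G : ℝ → ℝ} (hG : ContDiff ℝ ∞ G) : ContDiff ℝ ∞ (deriv G) :=
  (contDiff_infty_iff_deriv.1 hG).2

theorem exists_abs_le_of_continuous {G : ℝ → ℝ} (hG : Continuous G) (S : ℝ) :
    ∃ c : ℝ, 0 < c ∧ ∀ r, |r| ≤ S → |G r| ≤ c := by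
  obtain ⟨c, hc⟩ := (isCompact_Icc (a := -S) (b := S)).exists_bound_of_continuousOn hG.continuousOn
  exact ⟨max c 1, by positivity, fun r hr => (hc r (abs_le.1 hr)).trans (le_max_left _ _)⟩

/-- Smooth functions vanishing at the origin. -/
def Nonlin : Type := {G : ℝ → ℝ // ContDiff ℝ ∞ G ∧ G 0 = 0}

theorem Nonlin.exists_abs_le (G : Nonlin) (S : ℝ) :
    ∃ c : ℝ, 0 < c ∧ ∀ r, |r| ≤ S → |G.1 r| ≤ c * |r| := by
  obtain ⟨c, hc, h⟩ := exists_abs_le_of_continuous (contDiff_deriv_infty G.2.1).continuous S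
  refine ⟨c, hc, fun r hr => ?_⟩
  have := Convex.norm_image_sub_le_of_norm_deriv_le (f := G.1) (s := Icc (-S) S) (C := c)
    (fun x _ => (G.2.1.differentiable (by simp)) x) (fun x hx => h x (abs_le.2 hx))
    (convex_Icc _ _) (x := 0) (y := r)
    (abs_le.1 (by rw [abs_zero]; exact (abs_nonneg _).trans hr)) (abs_le.1 hr)
  simpa [G.2.2] using this

namespace HInf

theorem exists_abs_le (f : HInf) : ∃ S, ∀ x, |f x| ≤ S := by
  obtain ⟨K, -, h⟩ := sup_le
  exact ⟨_, h f⟩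

/-- The class of products (G ∘ a) g is closed under differentiation when G and g vary together: the
two resulting terms are (G' ∘ a)(∂a g) and (G ∘ a) ∂g. The factor g provides integrability, so G
need not vanish at 0. -/
theorem comp_mul_mem {G : ℝ → ℝ} (hG : ContDiff ℝ ∞ G) (a g : HInf) :
    (fun x => G (a x) * g x) ∈ hInf := by
  refine ⟨(hG.comp a.smooth).mul g.smooth, fun l => ?_⟩
  induction l generalizing G g with
  | nil =>
    obtain ⟨S, hS⟩ := a.exists_abs_le
    obtain ⟨c, hc, h⟩ := exists_abs_le_of_continuous hG.continuous S
    exact g.memLp.of_le_mul (c := c)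
      (((hG.continuous.comp a.continuous).mul g.continuous).aestronglyMeasurable)
      (Eventually.of_forall fun x => by
        change ‖G (a x) * g x‖ ≤ _
        rw [norm_mul]; gcongr; exact h _ (hS x))
  | cons i l ih =>
    have e : pd i (fun x => G (a x) * g x) = (fun x => deriv G (a x) * (D i a * g) x) +
        fun x => G (a x) * D i g x := by
      have := pd_mul (hG.comp a.smooth) g.smooth i
      refine this.trans ?_
      have h2 := pd_comp hG a.smooth i
      funext x
      simp only [Pi.add_apply, Pi.mul_apply, mul_apply, D_val]
      have := congrFun h2 x
      simp only [Function.comp_def] at *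
      rw [this]
      ring
    have h1 : ContDiff ℝ ∞ fun x => deriv G (a x) * (D i a * g) x :=
      ((contDiff_deriv_infty hG).comp a.smooth).mul (D i a * g).smooth
    have h2 : ContDiff ℝ ∞ fun x => G (a x) * D i g x := (hG.comp a.smooth).mul (D i g).smooth
    rw [ipd, e, ipd_add h1 h2]
    exact (ih (contDiff_deriv_infty hG) (D i a * g)).add (ih hG (D i g))

/-- The product of `G ∘ a` and `g`. -/
def compMul {G : ℝ → ℝ} (hG : ContDiff ℝ ∞ G) (a g : HInf) : HInf := ⟨_, comp_mul_mem hG a g⟩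

theorem compMul_apply {G : ℝ → ℝ} (hG : ContDiff ℝ ∞ G) (a g : HInf) (x : Space) :
    compMul hG a g x = G (a x) * g x := rfl

/-- The composition of an element of `HInf` with a smooth function vanishing at the origin. -/
def comp (G : Nonlin) (a : HInf) : HInf := ⟨fun x => G.1 (a x), G.2.1.comp a.smooth, fun l => by
  cases l with
  | nil =>
    obtain ⟨S, hS⟩ := a.exists_abs_le
    obtain ⟨c, hc, h⟩ := G.exists_abs_le S
    exact a.memLp.of_le_mul (c := c) (G.2.1.continuous.comp a.continuous).aestronglyMeasurable
      (Eventually.of_forall fun x => h _ (hS x))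
  | cons i l =>
    rw [ipd, pd_comp G.2.1 a.smooth]
    exact (comp_mul_mem (contDiff_deriv_infty G.2.1) a (D i a)).2 l⟩

@[simp] theorem comp_apply (G : Nonlin) (a : HInf) (x : Space) : comp G a x = G.1 (a x) := rfl

theorem D_comp (i : Fin 3) (G : Nonlin) (a : HInf) :
    D i (comp G a) = compMul (contDiff_deriv_infty G.2.1) a (D i a) :=
  Subtype.ext (pd_comp G.2.1 a.smooth i)

theorem D_compMul (i : Fin 3) {G : ℝ → ℝ} (hG : ContDiff ℝ ∞ G) (a g : HInf) :
    D i (compMul hG a g) =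
      compMul (contDiff_deriv_infty hG) a (D i a * g) + compMul hG a (D i g) := by
  apply Subtype.ext
  have := pd_mul (hG.comp a.smooth) g.smooth i
  refine this.trans ?_
  have h2 := pd_comp hG a.smooth i
  funext x
  have h3 := congrFun h2 x
  have e : ((compMul (contDiff_deriv_infty hG) a (D i a * g) + compMul hG a (D i g) : HInf) : HInf)
    x = deriv G (a x) * (pd i a.1 x * g x) + G (a x) * pd i g.1 x := rfl
  simp only [Function.comp_def, Pi.add_apply, Pi.mul_apply] at *
  rw [e, h3]
  ring

theorem nrm_zero_compMul_le {G : ℝ → ℝ} (hG : ContDiff ℝ ∞ G) {a g : HInf} {c : ℝ}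
    (h : ∀ x, |G (a x)| ≤ c) : nrm 0 (compMul hG a g) ≤ c * nrm 0 g := by
  apply nrm_zero_le_of_abs_le ((abs_nonneg _).trans (h 0))
  intro x
  rw [compMul_apply, abs_mul]
  gcongr
  exact h x

theorem nrm_zero_comp_le {G : Nonlin} {a : HInf} {c : ℝ} (hc : 0 ≤ c)
    (h : ∀ x, |G.1 (a x)| ≤ c * |a x|) : nrm 0 (comp G a) ≤ c * nrm 0 a :=
  nrm_zero_le_of_abs_le hc h

/-- A Gagliardo–Nirenberg inequality: one integration by parts turns ∫ (∂a)⁴ into -3 ∫ a (∂a)² ∂²a,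
and |a| ≤ 1/2 leaves 3/2. The squared gradient is thus bounded linearly by second derivatives. -/
theorem nrm_zero_D_mul_self_le {a : HInf} (ha : ∀ x, |a x| ≤ 1 / 2) (i : Fin 3) :
    nrm 0 (D i a * D i a) ≤ 3 / 2 * nrm 0 (D i (D i a)) := by
  set f := D i a with hf
  have h1 : ip (f * f) (f * f) = -3 * ip (a * (f * f)) (D i f) := by
    have e1 : ip (f * f) (f * f) = ip (D i a) (f * f * f) := by
      rw [ip_mul_left]; simp only [mul_assoc, hf]
    have e2 : ip (a * (f * f)) (D i f) = ip a (f * f * D i f) := ip_mul_left _ _ _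
    rw [e1, ip_D, D_cube, e2, map_smul, smul_eq_mul]; ring
  have h2 : nrm 0 (a * (f * f)) ≤ 1 / 2 * nrm 0 (f * f) := nrm_zero_mul_le_of_abs_le ha
  have h3 := abs_ip_le (a * (f * f)) (D i f)
  have h4 : nrm 0 (f * f) ^ 2 = ip (f * f) (f * f) := nrm_sq 0 _
  have p := nrm_nonneg 0 (f * f)
  have q := nrm_nonneg 0 (D i f)
  have h5 : |ip (a * (f * f)) (D i f)| ≤ 1 / 2 * nrm 0 (f * f) * nrm 0 (D i f) :=
    h3.trans (mul_le_mul_of_nonneg_right h2 q)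
  have h6 : nrm 0 (f * f) ^ 2 ≤ 3 / 2 * nrm 0 (D i f) * nrm 0 (f * f) := by
    rw [h4, h1]; have := (abs_le.1 h5).1; linarith
  rcases p.eq_or_lt with h | h
  · rw [← h]; exact mul_nonneg (by norm_num) q
  · nlinarith

theorem nrm_zero_D_mul_D_le {a : HInf} (ha : ∀ x, |a x| ≤ 1 / 2) (i j : Fin 3) :
    nrm 0 (D i a * D j a) ≤ 3 * gn 1 a := by
  have h1 : nrm 0 (D i a * D j a) ≤ 1 * nrm 0 (D i a * D i a + D j a * D j a) := by
    apply nrm_zero_le_of_abs_le zero_le_one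
    intro x
    have : 0 ≤ D i a x * D i a x + D j a x * D j a x :=
      add_nonneg (mul_self_nonneg _) (mul_self_nonneg _)
    simp only [mul_apply, add_apply, one_mul]
    rw [abs_of_nonneg this, abs_le]
    constructor <;> nlinarith [sq_nonneg (D i a x - D j a x), sq_nonneg (D i a x + D j a x)]
  have h2 := nrm_add 0 (D i a * D i a) (D j a * D j a)
  have h3 := fun i => nrm_zero_D_mul_self_le ha i
  have h4 : ∀ i, nrm 0 (D i (D i a)) ≤ gn 1 a := fun i =>
    (nrm_D_le 0 i _).trans (nrm_D_le_gn 1 i a)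
  have := h3 i
  have := h3 j
  have := h4 i
  have := h4 j
  linarith

/-- Second derivatives of G ∘ a contain the quadratic term G''(a) ∂a ∂a; since |a| ≤ 1/2 it obeys a
linear bound. Hence the coefficients h(a) and k(a) cost exactly one power of ∇a. -/
theorem gn_one_comp_le (G : Nonlin) : ∃ K : ℝ, 0 < K ∧ ∀ a : HInf, (∀ x, |a x| ≤ 1 / 2) →
    gn 1 (comp G a) ≤ K * gn 1 a := by
  obtain ⟨c₁, hc₁, h₁⟩ := exists_abs_le_of_continuous (contDiff_deriv_infty G.2.1).continuous (1 / 2)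
  obtain ⟨c₂, hc₂, h₂⟩ := exists_abs_le_of_continuous
    (contDiff_deriv_infty (contDiff_deriv_infty G.2.1)).continuous (1 / 2)
  refine ⟨3 * (c₁ + 3 * (c₂ * 3 + c₁)), by positivity, fun a ha => ?_⟩
  have p := gn_nonneg 1 a
  have q : ∀ i, nrm 0 (D i a) ≤ gn 1 a := fun i =>
    (nrm_zero_le 1 _).trans (nrm_D_le_gn 1 i a)
  have q' : ∀ i j, nrm 0 (D i (D j a)) ≤ gn 1 a := fun i j =>
    (nrm_D_le 0 i _).trans (nrm_D_le_gn 1 j a)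
  have key : ∀ i, nrm 1 (D i (comp G a)) ≤ (c₁ + 3 * (c₂ * 3 + c₁)) * gn 1 a := fun i => by
    rw [D_comp]
    refine (nrm_succ_le_add 0 _).trans ?_
    have k1 : nrm 0 (compMul (contDiff_deriv_infty G.2.1) a (D i a)) ≤ c₁ * gn 1 a :=
      (nrm_zero_compMul_le _ fun x => h₁ _ (ha x)).trans (by gcongr; exact q i)
    have k2 : ∀ j, nrm 0 (D j (compMul (contDiff_deriv_infty G.2.1) a (D i a))) ≤
        (c₂ * 3 + c₁) * gn 1 a := fun j => by
      rw [D_compMul]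
      refine (nrm_add _ _ _).trans ?_
      have k3 := (nrm_zero_compMul_le (contDiff_deriv_infty (contDiff_deriv_infty G.2.1))
        (g := D j a * D i a) fun x => h₂ _ (ha x)).trans
        (mul_le_mul_of_nonneg_left (nrm_zero_D_mul_D_le ha j i) hc₂.le)
      have k4 := (nrm_zero_compMul_le (contDiff_deriv_infty G.2.1)
        (g := D j (D i a)) fun x => h₁ _ (ha x)).trans
        (mul_le_mul_of_nonneg_left (q' j i) hc₁.le)
      linarith
    have k5 := Finset.sum_le_sum fun j (_ : j ∈ Finset.univ) => k2 j
    simp only [Finset.sum_const, Finset.card_univ, Fintype.card_fin, nsmul_eq_mul,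
      Nat.cast_ofNat] at k5
    linarith
  have k5 := Finset.sum_le_sum fun j (_ : j ∈ Finset.univ) => key j
  simp only [Finset.sum_const, Finset.card_univ, Fintype.card_fin, nsmul_eq_mul,
    Nat.cast_ofNat] at k5
  rw [gn]
  linarith

/-- Subtracting G'(0) from the derivative gives a function vanishing at 0, so ∂(G ∘ a) = G'(0) ∂a +
(G'(a) - G'(0)) ∂a with a product estimable in H². The bound is no longer linear; it serves only
where constants may depend on the H³ norms. -/
theorem nrm_three_comp_le (G : Nonlin) : ∃ K : ℝ, 0 < K ∧ ∀ a : HInf, (∀ x, |a x| ≤ 1 / 2) →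
    nrm 3 (comp G a) ≤ K * ((1 + nrm 3 a) * nrm 3 a) := by
  let G' : Nonlin := ⟨fun r => deriv G.1 r - deriv G.1 0,
    (contDiff_deriv_infty G.2.1).sub contDiff_const, sub_self _⟩
  obtain ⟨c, hc, h⟩ := G.exists_abs_le (1 / 2)
  obtain ⟨K₁, hK₁, h₁⟩ := gn_one_comp_le G'
  obtain ⟨K₂, hK₂, h₂⟩ := nrm_mul_le
  refine ⟨c + 3 * (|deriv G.1 0| + 3 * K₂ * K₁), by positivity, fun a ha => ?_⟩
  have p := nrm_nonneg 3 a
  have key : ∀ i, nrm 2 (D i (comp G a)) ≤ (|deriv G.1 0| + 3 * K₂ * K₁) * ((1 + nrm 3 a) * nrm 3 a) :=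
    fun i => by
    have e : D i (comp G a) = deriv G.1 0 • D i a + comp G' a * D i a := by
      rw [D_comp]; ext x
      have e1 : comp G' a x = deriv G.1 (a x) - deriv G.1 0 := rfl
      simp only [compMul_apply, add_apply, smul_apply, mul_apply, e1]; ring
    have q := nrm_D_le 2 i a
    have q0 := nrm_nonneg 2 (D i a)
    have q1 : gn 1 a ≤ 3 * nrm 3 a := (gn_le 1 a).trans (by gcongr; exact nrm_succ_le _ _)
    rw [e]
    refine (nrm_add _ _ _).trans ?_
    rw [nrm_smul]
    have t1 : |deriv G.1 0| * nrm 2 (D i a) ≤ |deriv G.1 0| * ((1 + nrm 3 a) * nrm 3 a) := by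
      gcongr
      nlinarith
    have t2 : nrm 2 (comp G' a * D i a) ≤ K₂ * ((K₁ * (3 * nrm 3 a)) * nrm 3 a) :=
      le_mul_mul_of_le (h₂ 2 le_rfl _ _) hK₂.le ((h₁ a ha).trans (by gcongr)) q q0 (by positivity)
    have t3 : K₂ * ((K₁ * (3 * nrm 3 a)) * nrm 3 a) ≤ 3 * K₂ * K₁ * ((1 + nrm 3 a) * nrm 3 a) := by
      have : 0 ≤ 3 * K₂ * K₁ * nrm 3 a := by positivity
      linarith
    linarith
  have k5 := Finset.sum_le_sum fun j (_ : j ∈ Finset.univ) => key j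
  simp only [Finset.sum_const, Finset.card_univ, Fintype.card_fin, nsmul_eq_mul,
    Nat.cast_ofNat] at k5
  have k6 := nrm_succ_le_add 2 (comp G a)
  have k7 := nrm_zero_comp_le hc.le fun x => h _ (ha x)
  have k8 : c * nrm 0 a ≤ c * ((1 + nrm 3 a) * nrm 3 a) := by
    have := nrm_zero_le 3 a
    gcongr
    nlinarith
  linarith

/-! ### The nonlinear force in the momentum equation. -/

/-- The divergence. -/
def dv (u : Fin 3 → HInf) : HInf := ∑ i, D i (u i)

/-- The viscous operator `μ Δ + (λ + μ) ∇ div`. -/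
def visc (μ lam : ℝ) (u : Fin 3 → HInf) (j : Fin 3) : HInf :=
  μ • ∑ i, D i (D i (u j)) + (lam + μ) • D j (dv u)

/-- The quadratic and higher order part of the acceleration, apart from the Lorentz force. -/
def force (h k : Nonlin) (μ lam : ℝ) (a : HInf) (u B : Fin 3 → HInf) (j : Fin 3) : HInf :=
  comp h a * (visc μ lam u j + lor B B j) - comp k a * D j a - transport u (u j)

theorem nrm_visc_le (μ lam : ℝ) (k : ℕ) {u : Fin 3 → HInf} {e : ℝ}
    (he : ∀ i j, nrm (k + 1) (D i (u j)) ≤ e) (j : Fin 3) :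
    nrm k (visc μ lam u j) ≤ (3 * |μ| + 3 * |lam + μ|) * e := by
  refine (nrm_add _ _ _).trans ?_
  rw [nrm_smul, nrm_smul, dv, map_sum]
  have h1 := nrm_sum_le k (fun i => D i (D i (u j))) (c := e)
    fun i => (nrm_D_le k i _).trans (he i j)
  have h2 := nrm_sum_le k (fun i => D j (D i (u i))) (c := e)
    fun i => (nrm_D_le k j _).trans (he i i)
  simp only [Fintype.card_fin, Nat.cast_ofNat] at h1 h2
  have h3 := mul_le_mul_of_nonneg_left h1 (abs_nonneg μ)
  have h4 := mul_le_mul_of_nonneg_left h2 (abs_nonneg (lam + μ))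
  linarith

theorem nrm_lor_le : ∃ K : ℝ, 0 < K ∧ ∀ m ≤ 2, ∀ (X Y : Fin 3 → HInf) (b c : ℝ),
    (∀ j, nrm 2 (X j) ≤ b) → (∀ i j, nrm m (D i (Y j)) ≤ c) → ∀ j, nrm m (lor X Y j) ≤ K * (b * c) := by
  obtain ⟨K, hK, h⟩ := nrm_mul_le_nrm
  refine ⟨6 * K, by positivity, fun m hm X Y b c hX hY j => ?_⟩
  have hb := (nrm_nonneg _ _).trans (hX 0)
  have := nrm_sum_le m (fun i => X i * (D i (Y j) - D j (Y i))) (c := K * (b * (c + c))) fun i =>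
    le_mul_mul_of_le (h m hm _ _) hK.le (hX i) ((nrm_sub _ _ _).trans (add_le_add (hY i j) (hY j i)))
      (nrm_nonneg _ _) hb
  simp only [Fintype.card_fin, Nat.cast_ofNat] at this
  rw [lor]
  linarith

theorem nrm_transport_le : ∃ K : ℝ, 0 < K ∧ ∀ m ≤ 2, ∀ (v : Fin 3 → HInf) (c : HInf) (b d : ℝ),
    (∀ j, nrm 2 (v j) ≤ b) → (∀ i, nrm m (D i c) ≤ d) → nrm m (transport v c) ≤ K * (b * d) := by
  obtain ⟨K, hK, h⟩ := nrm_mul_le_nrm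
  refine ⟨3 * K, by positivity, fun m hm v c b d hv hc => ?_⟩
  have hb := (nrm_nonneg _ _).trans (hv 0)
  have := nrm_sum_le m (fun i => v i * D i c) (c := K * (b * d)) fun i =>
    le_mul_mul_of_le (h m hm _ _) hK.le (hv i) (hc i) (nrm_nonneg _ _) hb
  simp only [Fintype.card_fin, Nat.cast_ofNat] at this
  rw [transport]
  linarith

/-- H² is enough, because at positive order one derivative can be moved onto the velocity. The
coefficients enter through the gradient norm of h(a) or k(a), which may be charged either to α or to
A. -/
theorem nrm_two_force_le (h k : Nonlin) (μ lam : ℝ) : ∃ K : ℝ, 0 < K ∧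
    ∀ (a : HInf) (u B : Fin 3 → HInf) (α U b A e : ℝ), (∀ x, |a x| ≤ 1 / 2) → nrm 3 a ≤ α →
      (∀ j, nrm 3 (u j) ≤ U) → (∀ j, nrm 3 (B j) ≤ b) → gn 2 a ≤ A →
      (∀ i j, nrm 3 (D i (u j)) ≤ e) → ∀ j, nrm 2 (force h k μ lam a u B j) ≤
        K * (U * e + α * e + A * b ^ 2 + α * A) := by
  obtain ⟨K, hK, hm⟩ := nrm_mul_le
  obtain ⟨Kl, hKl, hl⟩ := nrm_lor_le
  obtain ⟨Kt, hKt, ht⟩ := nrm_transport_le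
  obtain ⟨Kh, hKh, hh⟩ := gn_one_comp_le h
  obtain ⟨Kk, hKk, hk⟩ := gn_one_comp_le k
  set V := 3 * |μ| + 3 * |lam + μ| with hV
  have hV0 : 0 ≤ V := by positivity
  refine ⟨K * (Kh * 3) * V + K * Kh * Kl + K * (Kk * 3) + Kt, by positivity,
    fun a u B α U b A e ha hα hU hb hA he j => ?_⟩
  have α0 := (nrm_nonneg _ _).trans hα
  have U0 := (nrm_nonneg _ _).trans (hU 0)
  have b0 := (nrm_nonneg _ _).trans (hb 0)
  have A0 := (gn_nonneg _ _).trans hA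
  have e0 := (nrm_nonneg _ _).trans (he 0 0)
  have q1 : gn 1 a ≤ 3 * α :=
    (gn_le 1 a).trans (by gcongr; exact (nrm_succ_le _ _).trans hα)
  have q2 : gn 1 a ≤ A := (gn_mono (by norm_num) _).trans hA
  have t1 : nrm 2 (comp h a * visc μ lam u j) ≤ K * ((Kh * (3 * α)) * (V * e)) :=
    le_mul_mul_of_le (hm 2 le_rfl _ _) hK.le ((hh a ha).trans (by gcongr))
      (nrm_visc_le μ lam 2 he j) (nrm_nonneg _ _) (by positivity)
  have t2 : nrm 2 (comp h a * lor B B j) ≤ K * ((Kh * A) * (Kl * (b * b))) :=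
    le_mul_mul_of_le (hm 2 le_rfl _ _) hK.le ((hh a ha).trans (by gcongr))
      (hl 2 le_rfl B B b b (fun j => (nrm_succ_le _ _).trans (hb j))
        (fun i j => (nrm_D_le 2 i _).trans (hb j)) j) (nrm_nonneg _ _) (by positivity)
  have t3 : nrm 2 (comp k a * D j a) ≤ K * ((Kk * (3 * α)) * A) :=
    le_mul_mul_of_le (hm 2 le_rfl _ _) hK.le ((hk a ha).trans (by gcongr))
      ((nrm_D_le_gn 2 j a).trans hA) (nrm_nonneg _ _) (by positivity)
  have t4 : nrm 2 (transport u (u j)) ≤ Kt * (U * e) :=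
    ht 2 le_rfl u (u j) U e (fun j => (nrm_succ_le _ _).trans (hU j))
      fun i => (nrm_succ_le _ _).trans (he i j)
  have s1 := nrm_sub 2 (comp h a * (visc μ lam u j + lor B B j) - comp k a * D j a) (transport u (u j))
  have s2 := nrm_sub 2 (comp h a * (visc μ lam u j + lor B B j)) (comp k a * D j a)
  have s3 := nrm_add 2 (comp h a * visc μ lam u j) (comp h a * lor B B j)
  rw [← mul_add] at s3
  rw [force]
  have r1 : 0 ≤ U * e := by positivity
  have r2 : 0 ≤ α * e := by positivity
  have r3 : 0 ≤ A * b ^ 2 := by positivity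
  have r4 : 0 ≤ α * A := by positivity
  set X := U * e + α * e + A * b ^ 2 + α * A with hX
  have z1 : K * (Kh * 3) * V * (α * e) ≤ K * (Kh * 3) * V * X := by gcongr; linarith
  have z2 : K * Kh * Kl * (A * b ^ 2) ≤ K * Kh * Kl * X := by gcongr; linarith
  have z3 : K * (Kk * 3) * (α * A) ≤ K * (Kk * 3) * X := by gcongr; linarith
  have z4 : Kt * (U * e) ≤ Kt * X := by gcongr; linarith
  linarith

/-- At order zero no derivative can be moved onto u. Each product is therefore regrouped so that two
of its factors come with a gradient, using the L⁶ bounds for products of two or three functions. -/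
theorem abs_ip_force_le (h k : Nonlin) (μ lam : ℝ) : ∃ K : ℝ, 0 < K ∧
    ∀ (a : HInf) (u B : Fin 3 → HInf) (U b A e : ℝ), (∀ x, |a x| ≤ 1 / 2) →
      (∀ j, nrm 3 (u j) ≤ U) → (∀ j, nrm 3 (B j) ≤ b) → gn 2 a ≤ A →
      (∀ i j, nrm 3 (D i (u j)) ≤ e) → ∀ j, |ip (force h k μ lam a u B j) (u j)| ≤
        K * (U * e ^ 2 + e * A * U + A * e * b ^ 2 + U * A ^ 2) := by
  obtain ⟨K, hK, hm⟩ := nrm_zero_mul_le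
  obtain ⟨K₃, hK₃, hm₃⟩ := nrm_zero_mul_mul_le
  obtain ⟨Kh, hKh, hh⟩ := gn_one_comp_le h
  obtain ⟨Kk, hKk, hk⟩ := gn_one_comp_le k
  set V := 3 * |μ| + 3 * |lam + μ| with hV
  have hV0 : 0 ≤ V := by positivity
  refine ⟨K * Kh * V + 54 * K₃ * Kh + K * Kk + 9 * K, by positivity,
    fun a u B U b A e ha hU hb hA he j => ?_⟩
  have U0 := (nrm_nonneg _ _).trans (hU 0)
  have b0 := (nrm_nonneg _ _).trans (hb 0)
  have A0 := (gn_nonneg _ _).trans hA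
  have e0 := (nrm_nonneg _ _).trans (he 0 0)
  have q2 : gn 1 a ≤ A := (gn_mono (by norm_num) _).trans hA
  have qh : gn 0 (comp h a) ≤ Kh * A := (gn_mono (by norm_num) _).trans ((hh a ha).trans (by gcongr))
  have qk : gn 0 (comp k a) ≤ Kk * A := (gn_mono (by norm_num) _).trans ((hk a ha).trans (by gcongr))
  have qu : ∀ j, gn 0 (u j) ≤ 3 * e := fun j => by
    have := Finset.sum_le_sum fun i (_ : i ∈ Finset.univ) => (nrm_zero_le 3 _).trans (he i j)
    simpa [gn] using this
  have u1 : ∀ j, nrm 1 (u j) ≤ U := fun j => (nrm_mono (by norm_num) _).trans (hU j)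
  have b2 : ∀ j, gn 0 (B j) ≤ 3 * b := fun j =>
    (gn_le 0 _).trans (by gcongr; exact (nrm_mono (by norm_num) _).trans (hb j))
  have t1 : |ip (comp h a * visc μ lam u j) (u j)| ≤ V * e * (K * ((Kh * A) * U)) := by
    rw [mul_comm, ip_mul_left]
    refine (abs_ip_le _ _).trans (mul_le_mul ?_ ?_ (nrm_nonneg _ _) (by positivity))
    · exact nrm_visc_le μ lam 0 (fun i j => (nrm_mono (by norm_num) _).trans (he i j)) j
    · exact le_mul_mul_of_le (hm _ _) hK.le qh (u1 j) (nrm_nonneg _ _) (by positivity)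
  have t2 : |ip (comp h a * lor B B j) (u j)| ≤ 3 * ((b + b) * (K₃ * ((Kh * A) * (3 * b) * (3 * e)))) := by
    -- The grouping creates the triple product h(a) Bᵢ uⱼ, where each factor contributes its
    -- gradient, of size A, b and e; the differentiated magnetic factor stays in L².
    have : comp h a * lor B B j = ∑ i, (D i (B j) - D j (B i)) * (comp h a * B i) := by
      rw [lor, Finset.mul_sum]
      refine Finset.sum_congr rfl fun i _ => ?_
      rw [← mul_assoc, mul_comm]
    rw [this, map_sum, LinearMap.sum_apply]
    refine abs_sum_le_three fun i => ?_
    rw [ip_mul_left]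
    refine (abs_ip_le _ _).trans (mul_le_mul ?_ ((hm₃ _ _ _).trans ?_) (nrm_nonneg _ _) (by positivity))
    · exact (nrm_sub _ _ _).trans (add_le_add
        (((nrm_D_le 0 i _).trans (nrm_mono (by norm_num) _)).trans (hb j))
        (((nrm_D_le 0 j _).trans (nrm_mono (by norm_num) _)).trans (hb i)))
    · have g1 := gn_nonneg 0 (comp h a)
      have g2 := gn_nonneg 0 (B i)
      have g3 := gn_nonneg 0 (u j)
      have h1 := b2 i
      have h2 := qu j
      gcongr
  have t3 : |ip (comp k a * D j a) (u j)| ≤ A * (K * ((Kk * A) * U)) := by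
    rw [mul_comm, ip_mul_left]
    refine (abs_ip_le _ _).trans (mul_le_mul ?_ ?_ (nrm_nonneg _ _) (by positivity))
    · exact (nrm_zero_le 2 _).trans ((nrm_D_le_gn 2 j a).trans hA)
    · exact le_mul_mul_of_le (hm _ _) hK.le qk (u1 j) (nrm_nonneg _ _) (by positivity)
  have t4 : |ip (transport u (u j)) (u j)| ≤ 3 * (e * (K * ((3 * e) * U))) := by
    rw [← pair_zero, pair_transport]
    refine abs_sum_le_three fun i => ?_
    rw [pair_zero, mul_comm, ip_mul_left]
    refine (abs_ip_le _ _).trans (mul_le_mul ?_ ?_ (nrm_nonneg _ _) (by positivity))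
    · exact (nrm_zero_le 3 _).trans (he i j)
    · exact le_mul_mul_of_le (hm _ _) hK.le (qu i) (u1 j) (nrm_nonneg _ _) (by positivity)
  rw [force, mul_add]
  simp only [map_sub, map_add, LinearMap.sub_apply, LinearMap.add_apply]
  refine (abs_sub_le_of (abs_sub_le_of (abs_add_le_of t1 t2) t3) t4).trans ?_
  have r1 : 0 ≤ U * e ^ 2 := by positivity
  have r2 : 0 ≤ e * A * U := by positivity
  have r3 : 0 ≤ A * e * b ^ 2 := by positivity
  have r4 : 0 ≤ U * A ^ 2 := by positivity
  set X := U * e ^ 2 + e * A * U + A * e * b ^ 2 + U * A ^ 2 with hX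
  have z1 : K * Kh * V * (e * A * U) ≤ K * Kh * V * X := by gcongr; linarith
  have z2 : 54 * K₃ * Kh * (A * e * b ^ 2) ≤ 54 * K₃ * Kh * X := by gcongr; linarith
  have z3 : K * Kk * (U * A ^ 2) ≤ K * Kk * X := by gcongr; linarith
  have z4 : 9 * K * (U * e ^ 2) ≤ 9 * K * X := by gcongr; linarith
  linarith

end HInf


/-! ### Convolution on L². -/

abbrev L2 : Type := Lp ℝ 2 (volume : Measure Space)

/-- Young's inequality in the form of the Schur test. -/
theorem eLpNorm_le_of_le_convolution {F f : Space → ℝ} {κ : Space → ℝ≥0∞} (hκ : Measurable κ)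
    (hf : Measurable f) (h : ∀ x, ‖F x‖ₑ ≤ ∫⁻ t, ‖f t‖ₑ * κ (x - t)) :
    eLpNorm F 2 volume ≤ (∫⁻ y, κ y) * eLpNorm f 2 volume := by
  have hκ' : ∀ x, Measurable fun t => κ (x - t) := fun x => hκ.comp (measurable_const.sub measurable_id)
  have h1 : ∀ x, ‖F x‖ₑ ^ (2 : ℝ) ≤ (∫⁻ y, κ y) * ∫⁻ t, ‖f t‖ₑ ^ (2 : ℝ) * κ (x - t) := fun x => by
    -- Cauchy–Schwarz with the kernel split as κ^{1/2} κ^{1/2}; one half stays with f, the other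
    -- integrates to the mass of κ.
    have hc := ENNReal.lintegral_mul_le_Lp_mul_Lq (volume : Measure Space)
      (Real.holderConjugate_iff.2 ⟨one_lt_two, by norm_num⟩ : Real.HolderConjugate 2 2)
      (f := fun t => κ (x - t) ^ (1 / 2 : ℝ)) (g := fun t => ‖f t‖ₑ * κ (x - t) ^ (1 / 2 : ℝ))
      ((hκ' x).pow_const _).aemeasurable (hf.enorm.mul ((hκ' x).pow_const _)).aemeasurable
    have e1 : ∀ t, ((fun t => κ (x - t) ^ (1 / 2 : ℝ)) *
        fun t => ‖f t‖ₑ * κ (x - t) ^ (1 / 2 : ℝ)) t = ‖f t‖ₑ * κ (x - t) := fun t => by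
      have : κ (x - t) ^ (1 / 2 : ℝ) * κ (x - t) ^ (1 / 2 : ℝ) = κ (x - t) := by
        rw [← ENNReal.rpow_add_of_nonneg _ _ (by norm_num) (by norm_num)]; norm_num
      rw [Pi.mul_apply, mul_left_comm, this]
    have e2 : ∀ t, (κ (x - t) ^ (1 / 2 : ℝ)) ^ (2 : ℝ) = κ (x - t) := fun t => by
      rw [← ENNReal.rpow_mul]; norm_num
    simp only [e1, ENNReal.mul_rpow_of_nonneg _ _ zero_le_two, e2] at hc
    rw [lintegral_sub_left_eq_self κ x] at hc
    calc ‖F x‖ₑ ^ (2 : ℝ) ≤ ((∫⁻ y, κ y) ^ (1 / 2 : ℝ) *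
          (∫⁻ t, ‖f t‖ₑ ^ (2 : ℝ) * κ (x - t)) ^ (1 / 2 : ℝ)) ^ (2 : ℝ) := by
          gcongr; exact (h x).trans hc
      _ = _ := by
          rw [ENNReal.mul_rpow_of_nonneg _ _ zero_le_two, ← ENNReal.rpow_mul, ← ENNReal.rpow_mul]
          norm_num
  have h2 : ∫⁻ x, ‖F x‖ₑ ^ (2 : ℝ) ≤ (∫⁻ y, κ y) ^ (2 : ℝ) * ∫⁻ t, ‖f t‖ₑ ^ (2 : ℝ) := by
    have hm : Measurable (Function.uncurry fun x t : Space => ‖f t‖ₑ ^ (2 : ℝ) * κ (x - t)) :=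
      ((hf.enorm.pow_const _).comp measurable_snd).mul (hκ.comp (measurable_fst.sub measurable_snd))
    calc ∫⁻ x, ‖F x‖ₑ ^ (2 : ℝ)
        ≤ ∫⁻ x, (∫⁻ y, κ y) * ∫⁻ t, ‖f t‖ₑ ^ (2 : ℝ) * κ (x - t) := lintegral_mono h1
      _ = (∫⁻ y, κ y) * ∫⁻ x, ∫⁻ t, ‖f t‖ₑ ^ (2 : ℝ) * κ (x - t) :=
          lintegral_const_mul _ hm.lintegral_prod_right
      _ = (∫⁻ y, κ y) * ∫⁻ t, ∫⁻ x, ‖f t‖ₑ ^ (2 : ℝ) * κ (x - t) := by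
          rw [lintegral_lintegral_swap hm.aemeasurable]
      _ = (∫⁻ y, κ y) * ∫⁻ t, ‖f t‖ₑ ^ (2 : ℝ) * ∫⁻ y, κ y := by
          congr 2; funext t
          have hm2 : Measurable fun x => κ (x - t) := hκ.comp (measurable_id.sub measurable_const)
          rw [lintegral_const_mul _ hm2,
            lintegral_sub_right_eq_self κ t]
      _ = _ := by
          rw [lintegral_mul_const _ (hf.enorm.pow_const _)]
          rw [show (2 : ℝ) = ((2 : ℕ) : ℝ) by norm_num, ENNReal.rpow_natCast, sq]
          ring
  rw [eLpNorm_eq_lintegral_rpow_enorm_toReal two_ne_zero ENNReal.ofNat_ne_top,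
    eLpNorm_eq_lintegral_rpow_enorm_toReal two_ne_zero ENNReal.ofNat_ne_top]
  simp only [ENNReal.toReal_ofNat]
  calc (∫⁻ x, ‖F x‖ₑ ^ (2 : ℝ)) ^ (1 / 2 : ℝ)
      ≤ ((∫⁻ y, κ y) ^ (2 : ℝ) * ∫⁻ t, ‖f t‖ₑ ^ (2 : ℝ)) ^ (1 / 2 : ℝ) := by gcongr
    _ = _ := by
      rw [ENNReal.mul_rpow_of_nonneg _ _ (by norm_num), ← ENNReal.rpow_mul]; norm_num

/-- Convolution kernels. -/
def Ker : Type := {k : Space → ℝ // ContDiff ℝ ∞ k ∧ HasCompactSupport k}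

/-- The partial derivative of a kernel. -/
def Ker.d (i : Fin 3) (k : Ker) : Ker :=
  ⟨pd i k.1, contDiff_pd k.2.1 i, hasCompactSupport_pd k.2.2 i⟩

/-- The `L¹` norm of a kernel. -/
def Ker.size (k : Ker) : ℝ := ∫ y, |k.1 y|

theorem Ker.size_nonneg (k : Ker) : 0 ≤ k.size := integral_nonneg fun _ => abs_nonneg _

theorem Ker.continuous (k : Ker) : Continuous k.1 := k.2.1.continuous

theorem Ker.integrable (k : Ker) : Integrable k.1 volume :=
  k.continuous.integrable_of_hasCompactSupport k.2.2

theorem Ker.lintegral (k : Ker) : ∫⁻ y, ‖k.1 y‖ₑ = ENNReal.ofReal k.size :=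
  (ofReal_integral_norm_eq_lintegral_enorm k.integrable).symm

/-- The convolution of a function with a kernel. -/
def conv (k : Ker) (f : Space → ℝ) : Space → ℝ :=
  convolution f k.1 (ContinuousLinearMap.lsmul ℝ ℝ) volume

theorem conv_apply (k : Ker) (f : Space → ℝ) (x : Space) : conv k f x = ∫ t, f t * k.1 (x - t) := rfl

theorem conv_congr (k : Ker) {f g : Space → ℝ} (h : f =ᵐ[volume] g) : conv k f = conv k g := by
  funext x
  rw [conv_apply, conv_apply]
  apply integral_congr_ae
  filter_upwards [h] with t ht
  rw [ht]

theorem integrable_conv (k : Ker) {f : Space → ℝ} (hf : LocallyIntegrable f) (x : Space) :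
    Integrable (fun t => f t * k.1 (x - t)) volume :=
  k.2.2.convolutionExists_right (ContinuousLinearMap.lsmul ℝ ℝ) hf k.continuous x

theorem contDiff_conv (k : Ker) {f : Space → ℝ} (hf : LocallyIntegrable f) :
    ContDiff ℝ ∞ (conv k f) := k.2.2.contDiff_convolution_right _ hf k.2.1

theorem pd_conv (k : Ker) {f : Space → ℝ} (hf : LocallyIntegrable f) (i : Fin 3) :
    pd i (conv k f) = conv (k.d i) f := by
  funext x
  have h := k.2.2.hasFDerivAt_convolution_right (ContinuousLinearMap.lsmul ℝ ℝ) hf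
    (k.2.1.of_le (by simp)) x
  rw [pd, conv, h.fderiv]
  exact convolution_precompR_apply (ContinuousLinearMap.lsmul ℝ ℝ) hf (k.2.2.fderiv ℝ)
    (k.2.1.continuous_fderiv (by simp)) x _

theorem eLpNorm_conv_le (k : Ker) {f : Space → ℝ} (hf : Measurable f) :
    eLpNorm (conv k f) 2 volume ≤ ENNReal.ofReal k.size * eLpNorm f 2 volume := by
  rw [← k.lintegral]
  refine eLpNorm_le_of_le_convolution (κ := fun y => ‖k.1 y‖ₑ) k.continuous.measurable.enorm hf
    fun x => ?_
  rw [conv_apply]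
  refine (enorm_integral_le_lintegral_enorm _).trans (le_of_eq ?_)
  simp only [enorm_mul]

theorem locallyIntegrable_L2 (F : L2) : LocallyIntegrable (F : Space → ℝ) volume :=
  (Lp.memLp F).locallyIntegrable (by norm_num)

theorem measurable_L2 (F : L2) : Measurable (F : Space → ℝ) := (Lp.stronglyMeasurable F).measurable

theorem memLp_conv (k : Ker) (F : L2) : MemLp (conv k F) 2 volume :=
  ⟨(contDiff_conv k (locallyIntegrable_L2 F)).continuous.aestronglyMeasurable,
    (eLpNorm_conv_le k (measurable_L2 F)).trans_lt
      (ENNReal.mul_lt_top ENNReal.ofReal_lt_top (Lp.memLp F).2)⟩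

theorem conv_mem_hInf (k : Ker) (F : L2) : conv k F ∈ hInf := by
  refine ⟨contDiff_conv k (locallyIntegrable_L2 F), fun l => ?_⟩
  induction l generalizing k with
  | nil => exact memLp_conv k F
  | cons i l ih => rw [ipd, pd_conv k (locallyIntegrable_L2 F)]; exact ih _

/-- Mollification with a kernel. -/
def moll (k : Ker) : L2 →ₗ[ℝ] HInf where
  toFun F := ⟨conv k F, conv_mem_hInf k F⟩
  map_add' F G := by
    ext x
    change conv k (F + G : L2) x = conv k F x + conv k G x
    rw [conv_congr k (Lp.coeFn_add F G), conv_apply, conv_apply, conv_apply, ← integral_add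
      (integrable_conv k (locallyIntegrable_L2 F) x) (integrable_conv k (locallyIntegrable_L2 G) x)]
    simp only [Pi.add_apply, add_mul]
  map_smul' c F := by
    ext x
    change conv k (c • F : L2) x = c * conv k F x
    rw [conv_congr k (Lp.coeFn_smul c F), conv_apply, conv_apply, ← integral_const_mul]
    simp only [Pi.smul_apply, smul_eq_mul, mul_assoc]

theorem moll_val (k : Ker) (F : L2) : (moll k F).1 = conv k F := rfl

theorem moll_apply (k : Ker) (F : L2) (x : Space) : moll k F x = ∫ t, F t * k.1 (x - t) := rfl

namespace HInf

/-- The embedding into `L²`. -/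
def toL : HInf →ₗ[ℝ] L2 where
  toFun f := f.memLp.toLp f.1
  map_add' _ _ := rfl
  map_smul' _ _ := rfl

theorem coeFn_toL (f : HInf) : (toL f : Space → ℝ) =ᵐ[volume] f.1 := f.memLp.coeFn_toLp

theorem norm_toL (f : HInf) : ‖toL f‖ = nrm 0 f := by
  have : ‖toL f‖ = (eLpNorm f.1 2 volume).toReal := Lp.norm_toLp f.1 f.memLp
  rw [this, eLpNorm_two, ENNReal.toReal_ofReal (nrm_nonneg _ _)]

theorem eLpNorm_L2 (F : L2) : eLpNorm (F : Space → ℝ) 2 volume = ENNReal.ofReal ‖F‖ := by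
  rw [Lp.norm_def, ENNReal.ofReal_toReal (Lp.eLpNorm_ne_top F)]

theorem nrm_zero_moll_le (k : Ker) (F : L2) : nrm 0 (moll k F) ≤ k.size * ‖F‖ := by
  have h := eLpNorm_conv_le k (measurable_L2 F)
  rw [← moll_val, eLpNorm_two, eLpNorm_L2, ← ENNReal.ofReal_mul k.size_nonneg] at h
  exact (ENNReal.ofReal_le_ofReal_iff (mul_nonneg k.size_nonneg (norm_nonneg _))).1 h

theorem D_moll (k : Ker) (i : Fin 3) (F : L2) : D i (moll k F) = moll (k.d i) F :=
  Subtype.ext (pd_conv k (locallyIntegrable_L2 F) i)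

theorem exists_nrm_moll_le (m : ℕ) (k : Ker) : ∃ C : ℝ, 0 ≤ C ∧ ∀ F, nrm m (moll k F) ≤ C * ‖F‖ := by
  induction m generalizing k with
  | zero => exact ⟨k.size, k.size_nonneg, nrm_zero_moll_le k⟩
  | succ m ih =>
    choose C hC h using fun i => ih (k.d i)
    refine ⟨k.size + ∑ i, C i, add_nonneg k.size_nonneg (Finset.sum_nonneg fun i _ => hC i),
      fun F => (nrm_succ_le_add _ _).trans ?_⟩
    rw [add_mul, Finset.sum_mul]
    refine add_le_add (nrm_zero_moll_le k F) (Finset.sum_le_sum fun i _ => ?_)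
    rw [D_moll]
    exact h i F

/-- Mollification of elements of `HInf`. -/
def mol (k : Ker) : HInf →ₗ[ℝ] HInf := moll k ∘ₗ toL

theorem mol_eq (k : Ker) (f : HInf) : mol k f = moll k (toL f) := rfl

theorem mol_apply (k : Ker) (f : HInf) (x : Space) : mol k f x = ∫ t, f t * k.1 (x - t) :=
  congrFun (conv_congr k (coeFn_toL f)) x

theorem locallyIntegrable (f : HInf) : LocallyIntegrable f.1 volume :=
  f.continuous.locallyIntegrable

end HInf

/-- The function t ↦ k(x - t) is an admissible test function with derivative -∂k(x - t), and this
sign cancels the one in the definition of the weak derivative. -/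
theorem moll_d_eq {i : Fin 3} {f g : Space → ℝ} (h : IsWeakDeriv i f g) (k : Ker) :
    conv (k.d i) f = conv k g := by
  funext x
  have hφ : ContDiff ℝ ∞ fun t => k.1 (x - t) := k.2.1.comp (contDiff_const.sub contDiff_id)
  have hc : HasCompactSupport fun t => k.1 (x - t) :=
    k.2.2.comp_homeomorph (Homeomorph.subLeft x)
  have h1 := h.2.2 _ hφ hc
  have e : ∀ t, fderiv ℝ (fun t => k.1 (x - t)) t (EuclideanSpace.single i (1 : ℝ)) =
      -pd i k.1 (x - t) := fun t => by
    have h1 : HasFDerivAt (fun t : Space => x - t) (-ContinuousLinearMap.id ℝ Space) t :=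
      (hasFDerivAt_id t).const_sub x
    have h2 := ((ContDiff.diffAt k.2.1 (x - t)).hasFDerivAt).comp t h1
    have h3 : fderiv ℝ (fun t => k.1 (x - t)) t = _ := h2.fderiv
    rw [h3]
    simp [pd]
  simp only [e, mul_neg, integral_neg, neg_inj] at h1
  exact h1

namespace HInf

theorem isWeakDeriv (i : Fin 3) (f : HInf) : IsWeakDeriv i f.1 (D i f).1 := by
  refine ⟨f.locallyIntegrable, (D i f).locallyIntegrable, fun φ hφ hc => ?_⟩
  let ψ : HInf := ⟨φ, mem_hInf_of_hasCompactSupport hφ hc⟩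
  have := ip_D i f ψ
  rw [ip_def, ip_def] at this
  rw [eq_comm, neg_eq_iff_eq_neg]
  exact this

theorem D_mol (k : Ker) (i : Fin 3) (f : HInf) : D i (mol k f) = mol k (D i f) := by
  rw [mol_eq, D_moll, mol_eq]
  apply Subtype.ext
  change conv (k.d i) (toL f) = conv k (toL (D i f))
  rw [conv_congr _ (coeFn_toL f), conv_congr _ (coeFn_toL (D i f))]
  exact moll_d_eq (isWeakDeriv i f) k

theorem nrm_mol_le (k : Ker) (m : ℕ) (f : HInf) : nrm m (mol k f) ≤ k.size * nrm m f := by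
  induction m generalizing f with
  | zero => rw [mol_eq, ← norm_toL f]; exact nrm_zero_moll_le k _
  | succ m ih =>
    have h0 : nrm 0 (mol k f) ≤ k.size * nrm 0 f := by
      rw [mol_eq, ← norm_toL f]; exact nrm_zero_moll_le k _
    refine abs_le_of_sq_le_sq' ?_ (mul_nonneg k.size_nonneg (nrm_nonneg _ _)) |>.2
    rw [mul_pow, nrm_succ_sq, nrm_succ_sq, mul_add, Finset.mul_sum]
    refine add_le_add ?_ (Finset.sum_le_sum fun i _ => ?_)
    · rw [← mul_pow]; gcongr; exact nrm_nonneg _ _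
    · rw [← mul_pow, D_mol]; gcongr; exacts [nrm_nonneg _ _, ih _]

theorem abs_mol_le (k : Ker) (F : L2) {c : ℝ} (h : ∀ᵐ x, |F x| ≤ c) (x : Space) :
    |moll k F x| ≤ c * k.size := by
  rw [moll_apply, ← Real.norm_eq_abs, Ker.size, ← integral_sub_left_eq_self (fun y => |k.1 y|) volume x,
    ← integral_const_mul]
  refine norm_integral_le_of_norm_le ((k.integrable.abs.comp_sub_left x).const_mul c) ?_
  filter_upwards [h] with t ht
  rw [norm_mul, Real.norm_eq_abs, Real.norm_eq_abs]
  gcongr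

end HInf

/-! ### The mollifying kernels and convergence of mollifications. -/

/-- A fixed bump function with integral one. -/
def bump : Space → ℝ := (⟨1, 2, one_pos, one_lt_two⟩ : ContDiffBump (0 : Space)).normed volume

theorem contDiff_bump : ContDiff ℝ ∞ bump := ContDiffBump.contDiff_normed _

theorem hasCompactSupport_bump : HasCompactSupport bump := ContDiffBump.hasCompactSupport_normed _

theorem bump_nonneg (x : Space) : 0 ≤ bump x := ContDiffBump.nonneg_normed _ _

theorem integral_bump : ∫ x, bump x = 1 := ContDiffBump.integral_normed _

theorem integral_dilation (g : Space → ℝ) {s : ℝ} (hs : 0 < s) :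
    ∫ x, s ^ 3 * g (s • x) = ∫ x, g x := by
  rw [integral_const_mul, Measure.integral_comp_smul_of_nonneg volume g s (hR := hs.le)]
  simp only [finrank_euclideanSpace, Fintype.card_fin, smul_eq_mul]
  field_simp

/-- The mollifying kernels. -/
def ker (n : ℕ) : Ker := ⟨fun x => (n + 1 : ℝ) ^ 3 * bump ((n + 1 : ℝ) • x),
  contDiff_const.mul (contDiff_bump.comp (contDiff_const_smul _)),
  (hasCompactSupport_bump.comp_smul (by positivity)).mul_left⟩

theorem ker_apply (n : ℕ) (x : Space) : (ker n).1 x = (n + 1 : ℝ) ^ 3 * bump ((n + 1 : ℝ) • x) := rfl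

theorem ker_nonneg (n : ℕ) (x : Space) : 0 ≤ (ker n).1 x :=
  mul_nonneg (by positivity) (bump_nonneg _)

theorem integral_ker (n : ℕ) : ∫ x, (ker n).1 x = 1 := by
  simp only [ker_apply]
  rw [integral_dilation bump (by positivity), integral_bump]

theorem size_ker (n : ℕ) : (ker n).size = 1 := by
  rw [Ker.size, ← integral_ker n]
  simp only [abs_of_nonneg (ker_nonneg n _)]

theorem ker_d_apply (n : ℕ) (i : Fin 3) (x : Space) : ((ker n).d i).1 x =
    (n + 1 : ℝ) ^ 3 * ((n + 1 : ℝ) * pd i bump ((n + 1 : ℝ) • x)) := by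
  have h := pd_smul (f := fun x => bump ((n + 1 : ℝ) • x))
    (contDiff_bump.comp (contDiff_const_smul _)) ((n + 1 : ℝ) ^ 3) i
  have h2 := pd_comp_smul contDiff_bump (n + 1 : ℝ) i
  rw [h2] at h
  exact congrFun h x

theorem exists_size_ker_d : ∃ C : ℝ, 0 < C ∧ ∀ n i, ((ker n).d i).size ≤ C * (n + 1 : ℝ) := by
  refine ⟨∑ i, (∫ y, |pd i bump y|) + 1, add_pos_of_nonneg_of_pos (Finset.sum_nonneg fun i _ =>
    integral_nonneg fun _ => abs_nonneg _) one_pos, fun n i => ?_⟩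
  have e : ((ker n).d i).size = (n + 1 : ℝ) * ∫ y, |pd i bump y| := by
    rw [Ker.size, ← integral_dilation (fun y => |pd i bump y|) (s := (n + 1 : ℝ)) (by positivity),
      ← integral_const_mul]
    congr 1; funext x
    rw [ker_d_apply, abs_mul, abs_mul, abs_of_nonneg (by positivity : (0 : ℝ) ≤ (n + 1 : ℝ) ^ 3),
      abs_of_nonneg (by positivity : (0 : ℝ) ≤ (n + 1 : ℝ))]
    ring
  rw [e, mul_comm]
  gcongr
  have := Finset.single_le_sum (f := fun i => ∫ y, |pd i bump y|)
    (fun i _ => integral_nonneg fun _ => abs_nonneg _) (Finset.mem_univ i)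
  linarith

theorem exists_moment_ker : ∃ C : ℝ, 0 < C ∧ ∀ n, ∫ y, ‖y‖ * (ker n).1 y ≤ C / (n + 1 : ℝ) := by
  refine ⟨(∫ y, ‖y‖ * bump y) + 1, add_pos_of_nonneg_of_pos (integral_nonneg fun _ =>
    mul_nonneg (norm_nonneg _) (bump_nonneg _)) one_pos, fun n => ?_⟩
  have e : ∫ y, ‖y‖ * (ker n).1 y = (∫ y, ‖y‖ * bump y) / (n + 1 : ℝ) := by
    rw [← integral_dilation (fun y => ‖y‖ * bump y) (s := (n + 1 : ℝ)) (by positivity),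
      ← integral_div]
    congr 1; funext x
    rw [ker_apply, norm_smul, Real.norm_of_nonneg (by positivity : (0 : ℝ) ≤ (n + 1 : ℝ))]
    field_simp
  rw [e]
  gcongr
  linarith

/-- The weight ‖y‖ gains exactly the factor n + 1 that a derivative of the kernel loses. This
balance is what makes Friedrichs' commutator bounded uniformly in n. -/
theorem exists_moment_ker_d : ∃ C : ℝ, 0 < C ∧ ∀ n i,
    ∫⁻ y, ENNReal.ofReal (‖y‖ * |((ker n).d i).1 y|) ≤ ENNReal.ofReal C := by
  have hi : ∀ i, Integrable (fun y => ‖y‖ * |pd i bump y|) (volume : Measure Space) := fun i =>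
    (continuous_norm.mul (contDiff_pd contDiff_bump i).continuous.abs).integrable_of_hasCompactSupport
      ((hasCompactSupport_pd hasCompactSupport_bump i).abs.mul_left)
  refine ⟨∑ i, (∫ y, ‖y‖ * |pd i bump y|) + 1, add_pos_of_nonneg_of_pos (Finset.sum_nonneg fun i _ =>
    integral_nonneg fun _ => by positivity) one_pos, fun n i => ?_⟩
  have e : ∀ y, ‖y‖ * |((ker n).d i).1 y| =
      (n + 1 : ℝ) ^ 3 * (‖(n + 1 : ℝ) • y‖ * |pd i bump ((n + 1 : ℝ) • y)|) := fun y => by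
    rw [ker_d_apply, abs_mul, abs_mul, abs_of_nonneg (by positivity : (0 : ℝ) ≤ (n + 1 : ℝ) ^ 3),
      abs_of_nonneg (by positivity : (0 : ℝ) ≤ (n + 1 : ℝ)), norm_smul,
      Real.norm_of_nonneg (by positivity : (0 : ℝ) ≤ (n + 1 : ℝ))]
    ring
  simp only [e]
  rw [← ofReal_integral_eq_lintegral_ofReal (((hi i).comp_smul (by positivity)).const_mul _)
    (Eventually.of_forall fun y => by positivity),
    integral_dilation (fun y => ‖y‖ * |pd i bump y|) (by positivity)]
  apply ENNReal.ofReal_le_ofReal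
  have := Finset.single_le_sum (f := fun i => ∫ y, ‖y‖ * |pd i bump y|)
    (fun i _ => integral_nonneg fun _ => by positivity) (Finset.mem_univ i)
  linarith


theorem bump_eq_zero {x : Space} (h : 2 ≤ ‖x‖) : bump x = 0 := by
  by_contra h0
  have : x ∈ Function.support bump := h0
  rw [bump, ContDiffBump.support_normed_eq] at this
  simp at this
  linarith

theorem ker_eq_zero {n : ℕ} {x : Space} (h : 2 ≤ (n + 1 : ℝ) * ‖x‖) : (ker n).1 x = 0 := by
  rw [ker_apply, bump_eq_zero, mul_zero]
  rwa [norm_smul, Real.norm_of_nonneg (by positivity)]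

theorem conv_ker_sub (n : ℕ) {g : Space → ℝ} (hg : LocallyIntegrable g) (x : Space) (c : ℝ) :
    conv (ker n) g x - c = ∫ t, (g t - c) * (ker n).1 (x - t) := by
  have h1 : ∫ t, c * (ker n).1 (x - t) = c := by
    rw [integral_const_mul, integral_sub_left_eq_self (fun y => (ker n).1 y) volume x, integral_ker,
      mul_one]
  have h2 : Integrable (fun t => c * (ker n).1 (x - t)) volume :=
    ((ker n).integrable.comp_sub_left x).const_mul c
  simp only [sub_mul]
  rw [integral_sub (integrable_conv _ hg x) h2, h1, conv_apply]

theorem tendsto_conv_ker {g : Space → ℝ} (hg : Continuous g) (x : Space) :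
    Tendsto (fun n => conv (ker n) g x) atTop (𝓝 (g x)) := by
  rw [Metric.tendsto_atTop]
  intro ε hε
  obtain ⟨δ, hδ, h⟩ := Metric.continuous_iff.1 hg x (ε / 2) (by positivity)
  obtain ⟨N, hN⟩ := exists_nat_gt (2 / δ)
  refine ⟨N, fun n hn => ?_⟩
  rw [Real.dist_eq, conv_ker_sub n hg.locallyIntegrable, ← Real.norm_eq_abs]
  have hb : ‖∫ t, (g t - g x) * (ker n).1 (x - t)‖ ≤ ∫ t, ε / 2 * (ker n).1 (x - t) := by
    refine norm_integral_le_of_norm_le (((ker n).integrable.comp_sub_left x).const_mul _)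
      (Eventually.of_forall fun t => ?_)
    rw [norm_mul, Real.norm_of_nonneg (ker_nonneg n _)]
    by_cases ht : dist t x < δ
    · have := h t ht
      rw [dist_eq_norm] at this
      exact mul_le_mul_of_nonneg_right this.le (ker_nonneg n _)
    · rw [ker_eq_zero, mul_zero, mul_zero]
      rw [not_lt, dist_comm, dist_eq_norm] at ht
      have h3 : (N : ℝ) ≤ n := by exact_mod_cast hn
      rw [div_lt_iff₀ hδ] at hN
      nlinarith
  rw [integral_const_mul, integral_sub_left_eq_self (fun y => (ker n).1 y) volume x, integral_ker,
    mul_one] at hb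
  linarith

theorem abs_conv_ker_le (n : ℕ) {g : Space → ℝ} {M : ℝ} (hM : ∀ x, |g x| ≤ M)
    (x : Space) : |conv (ker n) g x| ≤ M := by
  rw [conv_apply, ← Real.norm_eq_abs]
  have hb : ‖∫ t, g t * (ker n).1 (x - t)‖ ≤ ∫ t, M * (ker n).1 (x - t) := by
    refine norm_integral_le_of_norm_le (((ker n).integrable.comp_sub_left x).const_mul _)
      (Eventually.of_forall fun t => ?_)
    rw [norm_mul, Real.norm_of_nonneg (ker_nonneg n _)]
    exact mul_le_mul_of_nonneg_right (hM t) (ker_nonneg n _)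
  rwa [integral_const_mul, integral_sub_left_eq_self (fun y => (ker n).1 y) volume x, integral_ker,
    mul_one] at hb

/-- Dominated convergence: the kernels live in balls of radius 2/(n+1) ≤ 2, so all mollifications
vanish outside one compact neighbourhood of the support of g. -/
theorem tendsto_integral_conv_ker_sub {g : Space → ℝ} (hg : Continuous g) (hc : HasCompactSupport g) :
    Tendsto (fun n => ∫ x, (conv (ker n) g x - g x) ^ 2) atTop (𝓝 0) := by
  obtain ⟨M, hM⟩ := hc.exists_bound_of_continuous hg
  have hM' : ∀ x, |g x| ≤ M := hM
  let K := Metric.cthickening 2 (tsupport g)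
  have hK : IsCompact K := IsCompact.cthickening hc
  have h0 : ∀ n x, x ∉ K → conv (ker n) g x = 0 ∧ g x = 0 := fun n x hx => by
    have hx0 : ∀ t ∈ tsupport g, 2 < dist x t := fun t ht => by
      by_contra hle
      exact hx (Metric.mem_cthickening_of_dist_le x t 2 _ ht (not_lt.1 hle))
    constructor
    · rw [conv_apply]
      apply integral_eq_zero_of_ae (Eventually.of_forall fun t => ?_)
      by_cases ht : t ∈ tsupport g
      · have := hx0 t ht
        rw [dist_eq_norm] at this
        have h5 : (0 : ℝ) ≤ n := Nat.cast_nonneg n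
        simp only [Pi.zero_apply]
        rw [ker_eq_zero, mul_zero]
        nlinarith
      · simp [image_eq_zero_of_notMem_tsupport ht]
    · apply image_eq_zero_of_notMem_tsupport
      intro ht
      have := hx0 x ht
      simp at this
      linarith
  have hlim : ∀ x, Tendsto (fun n => (conv (ker n) g x - g x) ^ 2) atTop (𝓝 0) := fun x => by
    have := ((tendsto_conv_ker hg x).sub_const (g x)).pow 2
    simpa using this
  have key := tendsto_integral_of_dominated_convergence
    (F := fun (n : ℕ) (x : Space) => (conv (ker n) g x - g x) ^ 2) (f := fun _ => (0 : ℝ))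
    (K.indicator fun _ => (2 * M) ^ 2) (μ := volume)
    (fun n => (((contDiff_conv (ker n) hg.locallyIntegrable).continuous.sub hg).pow
      2).aestronglyMeasurable)
    ((integrable_indicator_iff hK.measurableSet).2 (integrableOn_const hK.measure_lt_top.ne))
    (fun n => Eventually.of_forall fun x => ?_) (Eventually.of_forall hlim)
  · simpa using key
  · by_cases hx : x ∈ K
    · rw [indicator_of_mem hx, Real.norm_of_nonneg (sq_nonneg _), sq_le_sq]
      have hM0 : 0 ≤ M := (abs_nonneg _).trans (hM' x)
      rw [abs_of_nonneg (by positivity : 0 ≤ 2 * M)]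
      have := abs_sub (conv (ker n) g x) (g x)
      have := abs_conv_ker_le n hM' x
      have := hM' x
      linarith
    · rw [indicator_of_notMem hx, (h0 n x hx).1, (h0 n x hx).2]
      simp

namespace HInf

/-- The mollifier on `L²`. -/
def SL (n : ℕ) : L2 →ₗ[ℝ] HInf := moll (ker n)

/-- The mollifier on `HInf`. -/
def S (n : ℕ) : HInf →ₗ[ℝ] HInf := mol (ker n)

theorem S_eq (n : ℕ) (f : HInf) : S n f = SL n (toL f) := rfl

theorem D_S (n : ℕ) (i : Fin 3) (f : HInf) : D i (S n f) = S n (D i f) := D_mol _ _ _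

theorem nrm_S_le (n m : ℕ) (f : HInf) : nrm m (S n f) ≤ nrm m f := by
  have := nrm_mol_le (ker n) m f
  rwa [size_ker, one_mul] at this

theorem nrm_zero_SL_le (n : ℕ) (F : L2) : nrm 0 (SL n F) ≤ ‖F‖ := by
  have := nrm_zero_moll_le (ker n) F
  rwa [size_ker, one_mul] at this

/-- Mollification contracts L², so the convergence need only be known on the dense set of continuous
functions with compact support. -/
theorem tendsto_SL (F : L2) : Tendsto (fun n => toL (SL n F)) atTop (𝓝 F) := by
  rw [Metric.tendsto_atTop]
  intro ε hε
  obtain ⟨g, hgc, hg1, hg, hgm⟩ := (Lp.memLp F).exists_hasCompactSupport_eLpNorm_sub_le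
    ENNReal.ofNat_ne_top (ε := ENNReal.ofReal (ε / 4)) (by simpa using hε)
  set G : L2 := hgm.toLp g with hG
  have hFG : ‖F - G‖ ≤ ε / 4 := by
    rw [Lp.norm_def]
    apply ENNReal.toReal_le_of_le_ofReal (by positivity)
    refine le_trans (le_of_eq (eLpNorm_congr_ae ?_)) hg1
    filter_upwards [Lp.coeFn_sub F G, hgm.coeFn_toLp] with x h1 h2
    rw [h1, Pi.sub_apply, Pi.sub_apply, hG, h2]
  have hlim : Tendsto (fun n => ‖toL (SL n G) - G‖ ^ 2) atTop (𝓝 0) := by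
    refine (tendsto_integral_conv_ker_sub hg hgc).congr fun n => ?_
    rw [← real_inner_self_eq_norm_sq, MeasureTheory.L2.inner_def]
    apply integral_congr_ae
    filter_upwards [Lp.coeFn_sub (toL (SL n G)) G, hgm.coeFn_toLp, coeFn_toL (SL n G)] with x h1 h2 h3
    have e : SL n G x = conv (ker n) g x := congrFun (conv_congr (ker n) hgm.coeFn_toLp) x
    rw [h1, Pi.sub_apply, h3, hG, h2, ← hG, e]
    simp [sq]
  obtain ⟨N, hN⟩ := Metric.tendsto_atTop.1 hlim ((ε / 4) ^ 2) (by positivity)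
  refine ⟨N, fun n hn => ?_⟩
  have h1 := hN n hn
  rw [Real.dist_eq, sub_zero, abs_of_nonneg (sq_nonneg _)] at h1
  have h2 := lt_of_pow_lt_pow_left₀ 2 (by positivity) h1
  have h3 : ‖toL (SL n (F - G))‖ ≤ ε / 4 := by
    rw [norm_toL]; exact (nrm_zero_SL_le n _).trans hFG
  have e : toL (SL n F) - F = toL (SL n (F - G)) + (toL (SL n G) - G) - (F - G) := by
    simp only [map_sub]; abel
  rw [dist_eq_norm, e]
  calc _ ≤ ‖toL (SL n (F - G))‖ + ‖toL (SL n G) - G‖ + ‖F - G‖ :=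
        (norm_sub_le _ _).trans (add_le_add_left (norm_add_le _ _) _)
    _ < ε := by linarith

theorem tendsto_nrm_S_sub (k : ℕ) (f : HInf) : Tendsto (fun n => nrm k (S n f - f)) atTop (𝓝 0) := by
  induction k generalizing f with
  | zero =>
    have := (tendsto_SL (toL f)).sub_const (toL f)
    rw [sub_self] at this
    have h := this.norm
    rw [norm_zero] at h
    refine h.congr fun n => ?_
    rw [← norm_toL, S_eq, map_sub]
  | succ k ih =>
    have h0 : Tendsto (fun n => nrm 0 (S n f - f)) atTop (𝓝 0) := by
      have := (tendsto_SL (toL f)).sub_const (toL f)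
      rw [sub_self] at this
      have h := this.norm
      rw [norm_zero] at h
      refine h.congr fun n => ?_
      rw [← norm_toL, S_eq, map_sub]
    have h1 : Tendsto (fun n => nrm 0 (S n f - f) + ∑ i, nrm k (S n (D i f) - D i f)) atTop
        (𝓝 (0 + ∑ i : Fin 3, 0)) := h0.add (tendsto_finsetSum _ fun i _ => ih (D i f))
    rw [Finset.sum_const_zero, add_zero] at h1
    refine squeeze_zero (fun n => nrm_nonneg _ _) (fun n => ?_) h1
    have := nrm_succ_le_add k (S n f - f)
    simpa only [map_sub, D_S] using this

/-! ### Friedrichs' commutators. -/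

theorem lipschitz {f : HInf} {L : ℝ} (h : ∀ i x, |D i f x| ≤ L) (x y : Space) :
    |f y - f x| ≤ 3 * L * ‖y - x‖ := by
  have hf : ∀ z, ‖fderiv ℝ f.1 z‖ ≤ 3 * L := fun z => by
    refine ContinuousLinearMap.opNorm_le_bound _ ?_ fun v => ?_
    · have := (abs_nonneg _).trans (h 0 0); positivity
    · have e : v = ∑ i, v i • EuclideanSpace.single i (1 : ℝ) := by
        ext j; simp [Finset.sum_apply, Pi.single_apply]
      have e2 : fderiv ℝ f.1 z v = ∑ i, v i * D i f z := by
        conv_lhs => rw [e]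
        rw [map_sum]
        refine Finset.sum_congr rfl fun i _ => ?_
        rw [map_smul, smul_eq_mul]; rfl
      rw [e2, Real.norm_eq_abs, mul_assoc]
      refine abs_sum_le_three fun i => ?_
      rw [abs_mul, mul_comm]
      exact mul_le_mul (h i z) (PiLp.norm_apply_le v i) (abs_nonneg _) ((abs_nonneg _).trans (h i z))
  exact Convex.norm_image_sub_le_of_norm_fderiv_le (𝕜 := ℝ) (fun z _ => f.differentiableAt z)
    (fun z _ => hf z) convex_univ (mem_univ x) (mem_univ y)

theorem abs_S_sub_le : ∃ K : ℝ, 0 < K ∧ ∀ (n : ℕ) (f : HInf) (L : ℝ), (∀ i x, |D i f x| ≤ L) →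
    ∀ x, |S n f x - f x| ≤ K * L / (n + 1 : ℝ) := by
  obtain ⟨C, hC, h⟩ := exists_moment_ker
  refine ⟨3 * C, by positivity, fun n f L hL x => ?_⟩
  have L0 : 0 ≤ L := (abs_nonneg _).trans (hL 0 0)
  have e : S n f x - f x = ∫ t, (f t - f x) * (ker n).1 (x - t) := by
    rw [← conv_ker_sub n f.locallyIntegrable]
    congr 1
    exact mol_apply (ker n) f x
  have hi : Integrable (fun y => ‖y‖ * (ker n).1 y) (volume : Measure Space) :=
    (continuous_norm.mul (ker n).continuous).integrable_of_hasCompactSupport (ker n).2.2.mul_left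
  have hb : ‖∫ t, (f t - f x) * (ker n).1 (x - t)‖ ≤
      ∫ t, 3 * L * (‖x - t‖ * (ker n).1 (x - t)) := by
    refine norm_integral_le_of_norm_le ((hi.comp_sub_left x).const_mul _)
      (Eventually.of_forall fun t => ?_)
    rw [norm_mul, Real.norm_of_nonneg (ker_nonneg n _), ← mul_assoc, norm_sub_rev x t]
    exact mul_le_mul_of_nonneg_right (lipschitz hL x t) (ker_nonneg n _)
  rw [integral_const_mul, integral_sub_left_eq_self (fun y => ‖y‖ * (ker n).1 y) volume x] at hb
  rw [e, ← Real.norm_eq_abs]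
  refine hb.trans ((mul_le_mul_of_nonneg_left (h n) (by positivity)).trans (le_of_eq ?_))
  ring

theorem nrm_zero_D_S_le : ∃ K : ℝ, 0 < K ∧ ∀ (n : ℕ) (i : Fin 3) (f : HInf),
    nrm 0 (D i (S n f)) ≤ K * (n + 1 : ℝ) * nrm 0 f := by
  obtain ⟨C, hC, h⟩ := exists_size_ker_d
  refine ⟨C, hC, fun n i f => ?_⟩
  rw [S_eq, SL, D_moll, ← norm_toL f]
  exact (nrm_zero_moll_le _ _).trans (mul_le_mul_of_nonneg_right (h n i) (norm_nonneg _))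

theorem D_S_apply (n : ℕ) (i : Fin 3) (f : HInf) (x : Space) :
    D i (S n f) x = ∫ t, f t * ((ker n).d i).1 (x - t) := by
  rw [S_eq, SL, D_moll]
  exact congrFun (conv_congr _ (coeFn_toL f)) x

/-- Friedrichs' commutator lemma. -/
theorem nrm_zero_commutator_le : ∃ K : ℝ, 0 < K ∧ ∀ (n : ℕ) (i : Fin 3) (g v : HInf) (L : ℝ),
    (∀ i x, |D i g x| ≤ L) →
      nrm 0 (D i (S n (g * v)) - g * D i (S n v)) ≤ K * (L * nrm 0 v) := by
  obtain ⟨C, hC, h⟩ := exists_moment_ker_d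
  refine ⟨3 * C, by positivity, fun n i g v L hL => ?_⟩
  have L0 : 0 ≤ L := (abs_nonneg _).trans (hL 0 0)
  set k := (ker n).d i with hk
  set κ : Space → ℝ≥0∞ := fun y => ENNReal.ofReal (3 * L) * ENNReal.ofReal (‖y‖ * |k.1 y|) with hκ
  have hm : Measurable fun y => ENNReal.ofReal (‖y‖ * |k.1 y|) :=
    (continuous_norm.mul k.continuous.abs).measurable.ennreal_ofReal
  have hκm : Measurable κ := hm.const_mul _
  have hv := v.continuous.measurable
  have key := eLpNorm_le_of_le_convolution (F := (D i (S n (g * v)) - g * D i (S n v) : HInf).1)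
    (f := v.1) hκm hv fun x => by
      -- The commutator has kernel (g(t) - g(x)) ∂k(x - t); the Lipschitz bound on g supplies the
      -- weight ‖x - t‖ that compensates the derivative.
      have e : (D i (S n (g * v)) - g * D i (S n v)) x = ∫ t, (g t - g x) * v t * k.1 (x - t) := by
        rw [sub_apply, mul_apply, D_S_apply, D_S_apply, ← integral_const_mul, ← integral_sub]
        · congr 1; funext t; rw [mul_apply]; ring
        · exact integrable_conv k (g * v).locallyIntegrable x
        · exact (integrable_conv k v.locallyIntegrable x).const_mul _
      rw [e]
      refine (enorm_integral_le_lintegral_enorm _).trans (lintegral_mono fun t => ?_)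
      rw [enorm_mul, enorm_mul, hκ]
      have h1 : ‖g t - g x‖ₑ ≤ ENNReal.ofReal (3 * L * ‖x - t‖) := by
        rw [Real.enorm_eq_ofReal_abs, norm_sub_rev]
        exact ENNReal.ofReal_le_ofReal (lipschitz hL x t)
      calc _ ≤ ENNReal.ofReal (3 * L * ‖x - t‖) * ‖v t‖ₑ * ‖k.1 (x - t)‖ₑ := by gcongr
        _ = ‖v t‖ₑ * (ENNReal.ofReal (3 * L) * ENNReal.ofReal (‖x - t‖ * |k.1 (x - t)|)) := by
          rw [Real.enorm_eq_ofReal_abs (k.1 _), ENNReal.ofReal_mul (by positivity),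
            ENNReal.ofReal_mul (norm_nonneg _)]
          ring
  rw [eLpNorm_two, eLpNorm_two] at key
  have h2 : ∫⁻ y, κ y ≤ ENNReal.ofReal (3 * L * C) := by
    rw [hκ, lintegral_const_mul _ hm, ENNReal.ofReal_mul (p := 3 * L) (by positivity)]
    exact mul_le_mul' le_rfl (h n i)
  have h3 : ENNReal.ofReal (nrm 0 (D i (S n (g * v)) - g * D i (S n v))) ≤
      ENNReal.ofReal (3 * L * C * nrm 0 v) := by
    rw [ENNReal.ofReal_mul (by positivity)]
    exact key.trans (by gcongr)
  have h4 := (ENNReal.ofReal_le_ofReal_iff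
    (mul_nonneg (by positivity) (nrm_nonneg _ _))).1 h3
  refine h4.trans (le_of_eq (by ring))

/-- The commutator of mollification and transport. -/
def tc (n : ℕ) (i : Fin 3) (v c : HInf) : HInf := S n (v * D i c) - S n v * D i (S n c)

/-- The commutator of mollification and multiplication. -/
def pc (n : ℕ) (f g : HInf) : HInf := S n (f * g) - S n f * S n g

theorem D_tc (n : ℕ) (i j : Fin 3) (v c : HInf) :
    D j (tc n i v c) = tc n i (D j v) c + tc n i v (D j c) := by
  simp only [tc, map_sub, D_S, D_mul, map_add, D_comm j i]
  abel

theorem nrm_pc_le : ∃ K : ℝ, 0 < K ∧ ∀ m ≤ 2, ∀ (n : ℕ) (f g : HInf),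
    nrm m (pc n f g) ≤ K * (nrm 2 f * nrm m g) := by
  obtain ⟨K, hK, h⟩ := nrm_mul_le_nrm
  refine ⟨2 * K, by positivity, fun m hm n f g => (nrm_sub _ _ _).trans ?_⟩
  have h1 := (nrm_S_le n m (f * g)).trans (h m hm f g)
  have h2 := le_mul_mul_of_le (h m hm (S n f) (S n g)) hK.le (nrm_S_le n 2 f) (nrm_S_le n m g)
    (nrm_nonneg _ _) (nrm_nonneg _ _)
  linarith

theorem nrm_three_pc_le : ∃ K : ℝ, 0 < K ∧ ∀ (n : ℕ) (f g : HInf),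
    nrm 3 (pc n f g) ≤ K * (nrm 3 f * nrm 3 g) := by
  obtain ⟨K, hK, h⟩ := nrm_three_mul_le
  refine ⟨2 * K, by positivity, fun n f g => (nrm_sub _ _ _).trans ?_⟩
  have h1 := (nrm_S_le n 3 (f * g)).trans (h f g)
  have h2 := le_mul_mul_of_le (h (S n f) (S n g)) hK.le (nrm_S_le n 3 f) (nrm_S_le n 3 g)
    (nrm_nonneg _ _) (nrm_nonneg _ _)
  linarith

theorem abs_D_le : ∃ K : ℝ, 0 < K ∧ ∀ (f : HInf) (i : Fin 3) (x : Space), |D i f x| ≤ K * nrm 3 f := by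
  obtain ⟨K, hK, h⟩ := sup_le
  exact ⟨K, hK, fun f i x => (h _ x).trans (by gcongr; exact nrm_D_le 2 i f)⟩

/-- Writing v ∂c = ∂(vc) - (∂v) c reduces to Friedrichs' commutator. Replacing v by S n v then gains
1/(n+1) from the difference and loses n + 1 from ∂(S n c), so no derivative of c is needed. -/
theorem nrm_zero_tc_le : ∃ K : ℝ, 0 < K ∧ ∀ (n : ℕ) (i : Fin 3) (v c : HInf),
    nrm 0 (tc n i v c) ≤ K * (nrm 3 v * nrm 0 c) := by
  obtain ⟨K₁, hK₁, h₁⟩ := nrm_zero_commutator_le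
  obtain ⟨K₂, hK₂, h₂⟩ := abs_S_sub_le
  obtain ⟨K₃, hK₃, h₃⟩ := nrm_zero_D_S_le
  obtain ⟨K₄, hK₄, h₄⟩ := abs_D_le
  refine ⟨K₁ * K₄ + K₂ * K₄ * K₃ + K₄, by positivity, fun n i v c => ?_⟩
  have e : tc n i v c = (D i (S n (v * c)) - v * D i (S n c)) - (S n v - v) * D i (S n c) -
      S n (D i v * c) := by
    rw [tc, D_S n i (v * c), D_mul, map_add, sub_mul]
    abel
  have hv := h₄ v
  have p := nrm_nonneg 3 v
  have q := nrm_nonneg 0 c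
  have t1 := h₁ n i v c _ hv
  have t2 : nrm 0 ((S n v - v) * D i (S n c)) ≤
      (K₂ * (K₄ * nrm 3 v) / (n + 1 : ℝ)) * (K₃ * (n + 1 : ℝ) * nrm 0 c) :=
    (nrm_zero_mul_le_of_abs_le (fun x => h₂ n v _ hv x)).trans (by gcongr; exact h₃ n i c)
  have t3 : nrm 0 (S n (D i v * c)) ≤ K₄ * nrm 3 v * nrm 0 c :=
    (nrm_S_le n 0 _).trans (nrm_zero_mul_le_of_abs_le (hv i))
  have e2 : (K₂ * (K₄ * nrm 3 v) / (n + 1 : ℝ)) * (K₃ * (n + 1 : ℝ) * nrm 0 c) =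
      K₂ * K₄ * K₃ * (nrm 3 v * nrm 0 c) := by
    field_simp
  rw [e2] at t2
  rw [e]
  have s1 := nrm_sub 0 (D i (S n (v * c)) - v * D i (S n c) - (S n v - v) * D i (S n c))
    (S n (D i v * c))
  have s2 := nrm_sub 0 (D i (S n (v * c)) - v * D i (S n c)) ((S n v - v) * D i (S n c))
  linarith

/-- A derivative on c reproduces the commutator at lower order. A derivative on v leaves a
difference of two products that are each bounded separately. -/
theorem nrm_tc_le (k : ℕ) (hk : k ≤ 3) : ∃ K : ℝ, 0 < K ∧ ∀ (n : ℕ) (i : Fin 3) (v c : HInf),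
    nrm k (tc n i v c) ≤ K * (nrm 3 v * nrm k c) := by
  obtain ⟨K₀, hK₀, h₀⟩ := nrm_zero_tc_le
  induction k with
  | zero => exact ⟨K₀, hK₀, h₀⟩
  | succ k ih =>
    obtain ⟨K, hK, h⟩ := ih (by omega)
    obtain ⟨K₁, hK₁, h₁⟩ := nrm_mul_le_nrm
    refine ⟨K₀ + 3 * (2 * K₁ + K), by positivity, fun n i v c => ?_⟩
    have p := nrm_nonneg 3 v
    have p1 := nrm_nonneg (k + 1) c
    have key : ∀ j, nrm k (D j (tc n i v c)) ≤ (2 * K₁ + K) * (nrm 3 v * nrm (k + 1) c) := fun j => by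
      rw [D_tc]
      have t1 := le_mul_mul_of_le (h₁ k (by omega) (D j v) (D i c)) hK₁.le (nrm_D_le 2 j v)
        (nrm_D_le k i c) (nrm_nonneg _ _) p
      have t2 := le_mul_mul_of_le (h₁ k (by omega) (S n (D j v)) (D i (S n c))) hK₁.le
        ((nrm_S_le n 2 _).trans (nrm_D_le 2 j v))
        (((nrm_D_le k i _)).trans (nrm_S_le n _ _)) (nrm_nonneg _ _) p
      have t3 := nrm_sub k (S n (D j v * D i c)) (S n (D j v) * D i (S n c))
      have t4 := nrm_S_le n k (D j v * D i c)
      have t5 := le_mul_mul_of_le (h n i v (D j c)) hK.le (le_refl (nrm 3 v)) (nrm_D_le k j c)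
        (nrm_nonneg _ _) p
      have t6 := nrm_add k (tc n i (D j v) c) (tc n i v (D j c))
      rw [← tc] at t3
      linarith
    have s := nrm_succ_le_add k (tc n i v c)
    have s1 := Finset.sum_le_sum fun j (_ : j ∈ Finset.univ) => key j
    simp only [Finset.sum_const, Finset.card_univ, Fintype.card_fin, nsmul_eq_mul,
      Nat.cast_ofNat] at s1
    have s2 := le_mul_mul_of_le (h₀ n i v c) hK₀.le (le_refl (nrm 3 v)) (nrm_zero_le (k + 1) c)
        (nrm_nonneg _ _) p
    linarith

end HInf


/-! ### The mollified energy identity and its estimate. -/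

namespace HInf

theorem sum_pair_visc (μ lam : ℝ) (k : ℕ) (u v : Fin 3 → HInf) :
    ∑ j, pair k (visc μ lam u j) (v j) =
      -(μ * ∑ i, ∑ j, pair k (D i (u j)) (D i (v j)) + (lam + μ) * pair k (dv u) (dv v)) := by
  have h : pair k (dv u) (dv v) = ∑ j, pair k (dv u) (D j (v j)) := by rw [dv.eq_1 v, map_sum]
  have h1 : ∀ i (f g : HInf), pair k (D i (D i f)) g = -pair k (D i f) (D i g) :=
    fun i f g => pair_D k i (D i f) g
  have h2 : ∀ i (g : HInf), pair k (D i (dv u)) g = -pair k (dv u) (D i g) := fun i g => pair_D k i _ g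
  simp only [visc, map_add, map_smul, LinearMap.add_apply, LinearMap.smul_apply, smul_eq_mul, h, h2,
    Finset.sum_add_distrib, ← Finset.mul_sum]
  simp only [map_sum, LinearMap.sum_apply, h1, Finset.sum_neg_distrib]
  rw [Finset.sum_comm (f := fun j i => pair k (D i (u j)) (D i (v j)))]
  ring

/-- Integrating by parts twice exchanges indices, ⟨∂ᵢuᵢ, ∂ⱼuⱼ⟩ = ⟨∂ⱼuᵢ, ∂ᵢuⱼ⟩, without a factor. The
constant 1 is what allows λ + μ < 0 as long as λ + 2μ > 0. -/
theorem nrm_dv_sq_le (k : ℕ) (u : Fin 3 → HInf) :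
    nrm k (dv u) ^ 2 ≤ ∑ i, ∑ j, nrm k (D i (u j)) ^ 2 := by
  have h : nrm k (dv u) ^ 2 = ∑ i, ∑ j, pair k (D j (u i)) (D i (u j)) := by
    rw [nrm_sq, dv]
    simp only [map_sum, LinearMap.sum_apply]
    rw [Finset.sum_comm]
    refine Finset.sum_congr rfl fun i _ => Finset.sum_congr rfl fun j _ => ?_
    rw [pair_D, pair_D, D_comm]
  have h2 : ∑ i, ∑ j, pair k (D j (u i)) (D i (u j)) ≤
      ∑ i, ∑ j, (nrm k (D j (u i)) ^ 2 / 2 + nrm k (D i (u j)) ^ 2 / 2) := by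
    refine Finset.sum_le_sum fun i _ => Finset.sum_le_sum fun j _ => ?_
    have := pair_le k (D j (u i)) (D i (u j))
    nlinarith [sq_nonneg (nrm k (D j (u i)) - nrm k (D i (u j)))]
  rw [h]
  refine h2.trans (le_of_eq ?_)
  simp only [Finset.sum_add_distrib]
  rw [Finset.sum_comm (f := fun i j => nrm k (D j (u i)) ^ 2 / 2), ← Finset.sum_add_distrib]
  refine Finset.sum_congr rfl fun i _ => ?_
  rw [← Finset.sum_add_distrib]
  refine Finset.sum_congr rfl fun j _ => ?_
  ring

/-- Right-hand side of the continuity equation. -/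
def rhsA (a : HInf) (u : Fin 3 → HInf) : HInf := -dv u - transport u a - a * dv u

/-- Right-hand side of the momentum equation divided by the density. -/
def rhsU (h k : Nonlin) (μ lam : ℝ) (a : HInf) (u B : Fin 3 → HInf) (j : Fin 3) : HInf :=
  visc μ lam u j - D j a + lor B B j + force h k μ lam a u B j

/-- Right-hand side of the induction equation. -/
def rhsB (σ : ℝ) (u B : Fin 3 → HInf) (j : Fin 3) : HInf :=
  σ • (D 0 (D 0 (B j)) + D 1 (D 1 (B j))) - transport u (B j) + stretch B u j

/-- Mollification of vector fields. -/
def Sv (n : ℕ) (u : Fin 3 → HInf) (j : Fin 3) : HInf := S n (u j)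

theorem Sv_apply (n : ℕ) (u : Fin 3 → HInf) (j : Fin 3) : Sv n u j = S n (u j) := rfl

theorem S_dv (n : ℕ) (u : Fin 3 → HInf) : S n (dv u) = dv (Sv n u) := by
  simp only [dv, map_sum, Sv, D_S]

theorem S_visc (μ lam : ℝ) (n : ℕ) (u : Fin 3 → HInf) (j : Fin 3) :
    S n (visc μ lam u j) = visc μ lam (Sv n u) j := by
  simp only [visc, map_add, map_smul, map_sum, ← D_S, S_dv, Sv]

theorem S_transport (n : ℕ) (u : Fin 3 → HInf) (c : HInf) :
    S n (transport u c) = transport (Sv n u) (S n c) + ∑ i, tc n i (u i) c := by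
  simp only [transport, map_sum, tc, Sv, Finset.sum_sub_distrib]
  abel

theorem S_mul_dv (n : ℕ) (a : HInf) (u : Fin 3 → HInf) :
    S n (a * dv u) = S n a * dv (Sv n u) + ∑ i, pc n a (D i (u i)) := by
  simp only [dv, Finset.mul_sum, map_sum, pc, Sv, Finset.sum_sub_distrib, D_S]
  abel

theorem S_lor (n : ℕ) (B : Fin 3 → HInf) (j : Fin 3) : S n (lor B B j) =
    lor (Sv n B) (Sv n B) j + ∑ i, (pc n (B i) (D i (B j)) - pc n (B i) (D j (B i))) := by
  simp only [lor, map_sum, pc, Sv, Finset.sum_sub_distrib, D_S, mul_sub, map_sub]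
  abel

theorem S_stretch (n : ℕ) (B u : Fin 3 → HInf) (j : Fin 3) : S n (stretch B u j) =
    stretch (Sv n B) (Sv n u) j + ∑ i, (pc n (B i) (D i (u j)) - pc n (B j) (D i (u i))) := by
  simp only [stretch, map_sum, pc, Sv, Finset.sum_sub_distrib, D_S, map_sub]
  abel

/-- Half of the time derivative of the squared `H³` norm of the mollified solution. -/
def rate (h k : Nonlin) (μ lam σ : ℝ) (n : ℕ) (a : HInf) (u B : Fin 3 → HInf) : ℝ :=
  pair 3 (S n a) (S n (rhsA a u)) + ∑ j, pair 3 (S n (u j)) (S n (rhsU h k μ lam a u B j)) +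
    ∑ j, pair 3 (S n (B j)) (S n (rhsB σ u B j))

/-- The dissipation functional. -/
def diss (μ lam σ : ℝ) (u B : Fin 3 → HInf) : ℝ :=
  μ * ∑ i, ∑ j, nrm 3 (D i (u j)) ^ 2 + (lam + μ) * nrm 3 (dv u) ^ 2 +
    σ * ∑ j, (nrm 3 (D 0 (B j)) ^ 2 + nrm 3 (D 1 (B j)) ^ 2)

/-- The commutator terms. -/
def rem (h k : Nonlin) (μ lam : ℝ) (n : ℕ) (a : HInf) (u B : Fin 3 → HInf) : ℝ :=
  ∑ i, nrm 3 (tc n i (u i) a) + ∑ i, nrm 3 (pc n a (D i (u i))) +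
    ∑ j, (∑ i, (nrm 2 (pc n (B i) (D i (B j))) + nrm 2 (pc n (B i) (D j (B i)))) +
      ∑ i, (nrm 3 (pc n (B i) (D i (u j))) + nrm 3 (pc n (B j) (D i (u i)))) +
      ∑ i, nrm 3 (tc n i (u i) (B j)) +
      |ip (S n (u j)) (S n (force h k μ lam a u B j)) - ip (u j) (force h k μ lam a u B j)|)

/-- Beyond the L² part every term carries a derivative, and one of them is moved from g to f. So g
is needed only in H², at the price of ∇f in H³. -/
theorem abs_pair_three_sub_ip_le {f : HInf} {e : ℝ} (h : ∀ i, nrm 3 (D i f) ≤ e) (g : HInf) :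
    |pair 3 f g - ip f g| ≤ 3 * (e * nrm 2 g) := by
  rw [pair_succ, add_sub_cancel_left]
  refine abs_sum_le_three fun i => ?_
  have e1 : pair 2 (D i f) (D i g) = -pair 2 (D i (D i f)) g := by
    rw [pair_D 2 i (D i f) g, neg_neg]
  rw [e1, abs_neg]
  refine (abs_pair_le _ _ _).trans ?_
  gcongr
  · exact nrm_nonneg _ _
  · exact (nrm_D_le 2 i _).trans (h i)

theorem abs_pair_three_le_nrm_two {f : HInf} {e U : ℝ} (h : ∀ i, nrm 3 (D i f) ≤ e)
    (hU : nrm 3 f ≤ U) (g : HInf) : |pair 3 f g| ≤ (U + 3 * e) * nrm 2 g := by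
  have h1 := abs_pair_three_sub_ip_le h g
  have h2 : |ip f g| ≤ U * nrm 2 g := (abs_ip_le f g).trans
    (mul_le_mul ((nrm_zero_le _ _).trans hU) (nrm_zero_le _ _) (nrm_nonneg _ _)
      ((nrm_nonneg _ _).trans hU))
  have := abs_add_le_of h1 h2
  rw [sub_add_cancel] at this
  linarith

/-- Bounds on a state of the system. -/
structure Bounds (a : HInf) (u B : Fin 3 → HInf) (α U b A d e : ℝ) : Prop where
  range : ∀ x, |a x| ≤ 1 / 2
  na : nrm 3 a ≤ α
  nu : ∀ j, nrm 3 (u j) ≤ U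
  nB : ∀ j, nrm 3 (B j) ≤ b
  grad_a : gn 2 a ≤ A
  grad_B : ∀ j, nrm 3 (D 0 (B j)) ≤ d ∧ nrm 3 (D 1 (B j)) ≤ d
  grad_u : ∀ i j, nrm 3 (D i (u j)) ≤ e
  div_B : dv B = 0

theorem gn_S_le (n k : ℕ) (f : HInf) : gn k (S n f) ≤ gn k f :=
  Finset.sum_le_sum fun i _ => by rw [D_S]; exact nrm_S_le n k _

theorem Bounds.nonneg {a : HInf} {u B : Fin 3 → HInf} {α U b A d e : ℝ}
    (h : Bounds a u B α U b A d e) : 0 ≤ α ∧ 0 ≤ U ∧ 0 ≤ b ∧ 0 ≤ A ∧ 0 ≤ d ∧ 0 ≤ e :=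
  ⟨(nrm_nonneg _ _).trans h.na, (nrm_nonneg _ _).trans (h.nu 0), (nrm_nonneg _ _).trans (h.nB 0),
    (gn_nonneg _ _).trans h.grad_a, (nrm_nonneg _ _).trans (h.grad_B 0).1,
    (nrm_nonneg _ _).trans (h.grad_u 0 0)⟩

theorem abs_S_le (n : ℕ) {f : HInf} {c : ℝ} (h : ∀ x, |f x| ≤ c) (x : Space) : |S n f x| ≤ c := by
  have := abs_mol_le (ker n) (toL f) (c := c) (by
    filter_upwards [coeFn_toL f] with x hx
    rw [hx]; exact h x) x
  rwa [size_ker, mul_one] at this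

theorem Bounds.mollify {a : HInf} {u B : Fin 3 → HInf} {α U b A d e : ℝ}
    (h : Bounds a u B α U b A d e) (n : ℕ) : Bounds (S n a) (Sv n u) (Sv n B) α U b A d e where
  range := abs_S_le n h.range
  na := (nrm_S_le n 3 _).trans h.na
  nu j := (nrm_S_le n 3 _).trans (h.nu j)
  nB j := (nrm_S_le n 3 _).trans (h.nB j)
  grad_a := (gn_S_le n 2 a).trans h.grad_a
  grad_B j := by
    rw [Sv_apply, D_S, D_S]
    exact ⟨(nrm_S_le n 3 _).trans (h.grad_B j).1, (nrm_S_le n 3 _).trans (h.grad_B j).2⟩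
  grad_u i j := by rw [Sv_apply, D_S]; exact (nrm_S_le n 3 _).trans (h.grad_u i j)
  div_B := by rw [← S_dv, h.div_B, map_zero]

/-- Each nonlinear term except the force is written as the same term in the mollified fields plus a
commutator. The viscous and horizontal Laplacians cancel the dissipation exactly, the linear
couplings cancel each other, and the commutators are collected in the last bracket. -/
theorem rate_add_diss (h k : Nonlin) (μ lam σ : ℝ) (n : ℕ) (a : HInf) (u B : Fin 3 → HInf) :
    rate h k μ lam σ n a u B + diss μ lam σ (Sv n u) (Sv n B) =
      (-pair 3 (transport (Sv n u) (S n a)) (S n a) - pair 3 (S n a * dv (Sv n u)) (S n a)) +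
      (couple 3 (Sv n B) (Sv n B) (Sv n u) -
        ∑ j, pair 3 (transport (Sv n u) (Sv n B j)) (Sv n B j)) +
      ∑ j, pair 3 (Sv n u j) (S n (force h k μ lam a u B j)) +
      (-pair 3 (S n a) (∑ i, tc n i (u i) a) - pair 3 (S n a) (∑ i, pc n a (D i (u i))) +
        ∑ j, pair 3 (Sv n u j) (∑ i, (pc n (B i) (D i (B j)) - pc n (B i) (D j (B i)))) +
        ∑ j, (pair 3 (Sv n B j) (∑ i, (pc n (B i) (D i (u j)) - pc n (B j) (D i (u i)))) -
          pair 3 (Sv n B j) (∑ i, tc n i (u i) (B j)))) := by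
  have hv := sum_pair_visc μ lam 3 (Sv n u) (Sv n u)
  -- Skew symmetry of the acoustic coupling: both linear terms occur with coefficient 1.
  have hc : pair 3 (S n a) (dv (Sv n u)) + ∑ j, pair 3 (Sv n u j) (D j (S n a)) = 0 := by
    rw [dv, map_sum, ← Finset.sum_add_distrib]
    refine Finset.sum_eq_zero fun j _ => ?_
    rw [pair_comm 3 (Sv n u j), pair_D, add_neg_cancel]
  have hB : ∀ j, pair 3 (Sv n B j) (S n (rhsB σ u B j)) =
      -σ * (nrm 3 (D 0 (Sv n B j)) ^ 2 + nrm 3 (D 1 (Sv n B j)) ^ 2) -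
        pair 3 (transport (Sv n u) (Sv n B j)) (Sv n B j) -
        pair 3 (Sv n B j) (∑ i, tc n i (u i) (B j)) +
        pair 3 (stretch (Sv n B) (Sv n u) j) (Sv n B j) +
        pair 3 (Sv n B j) (∑ i, (pc n (B i) (D i (u j)) - pc n (B j) (D i (u i)))) := fun j => by
    simp only [rhsB, map_add, map_sub, map_smul, S_transport, S_stretch, ← D_S, nrm_sq, smul_eq_mul]
    simp only [← Sv_apply]
    have hD : ∀ i (f : HInf), pair 3 f (D i (D i f)) = -pair 3 (D i f) (D i f) := fun i f => by
      rw [pair_D 3 i f (D i f), neg_neg]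
    rw [hD, hD, pair_comm 3 _ (transport _ _), pair_comm 3 _ (stretch _ _ _)]
    ring
  have hU : ∀ j, pair 3 (Sv n u j) (S n (rhsU h k μ lam a u B j)) =
      pair 3 (visc μ lam (Sv n u) j) (Sv n u j) - pair 3 (Sv n u j) (D j (S n a)) +
      pair 3 (lor (Sv n B) (Sv n B) j) (Sv n u j) +
      pair 3 (Sv n u j) (∑ i, (pc n (B i) (D i (B j)) - pc n (B i) (D j (B i)))) +
      pair 3 (Sv n u j) (S n (force h k μ lam a u B j)) := fun j => by
    simp only [rhsU, map_add, map_sub, S_visc, S_lor, ← D_S]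
    rw [pair_comm 3 _ (visc _ _ _ _), pair_comm 3 _ (lor _ _ _)]
    ring
  have hA : pair 3 (S n a) (S n (rhsA a u)) = -pair 3 (S n a) (dv (Sv n u)) -
      pair 3 (transport (Sv n u) (S n a)) (S n a) - pair 3 (S n a) (∑ i, tc n i (u i) a) -
      pair 3 (S n a * dv (Sv n u)) (S n a) - pair 3 (S n a) (∑ i, pc n a (D i (u i))) := by
    simp only [rhsA, map_add, map_sub, map_neg, S_dv, S_transport, S_mul_dv]
    rw [pair_comm 3 _ (transport _ _), pair_comm 3 _ (S n a * _)]
    ring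
  simp only [← nrm_sq] at hv
  simp only [rate, diss]
  rw [hA]
  change _ + ∑ j, pair 3 (Sv n u j) _ + ∑ j, pair 3 (Sv n B j) _ + _ = _
  simp only [hB, hU, couple, Finset.sum_add_distrib, Finset.sum_sub_distrib, ← Finset.mul_sum] at *
  linarith

/-- Mollification preserves `Bounds`, so the product estimates apply to the mollified fields. The
force is not decomposed: its positive-order part uses only its H² norm, while its L² part is
compared with the unmollified pairing, where the product structure is intact, and the difference is
put into `rem`. -/
theorem rate_add_diss_le (h k : Nonlin) (μ lam σ : ℝ) : ∃ K : ℝ, 0 < K ∧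
    ∀ (n : ℕ) (a : HInf) (u B : Fin 3 → HInf) (α U b A d e : ℝ), Bounds a u B α U b A d e →
      |rate h k μ lam σ n a u B + diss μ lam σ (Sv n u) (Sv n B)| ≤
        K * (U * A ^ 2 + α * A * e + b * d * e + (U * e ^ 2 + e * A * U + A * e * b ^ 2 + U * A ^ 2) +
          e * (U * e + α * e + A * b ^ 2 + α * A)) +
        (1 + α + U + 3 * e + b) * rem h k μ lam n a u B := by
  obtain ⟨K₁, hK₁, h₁⟩ := abs_pair_three_transport_le
  obtain ⟨K₂, hK₂, h₂⟩ := abs_pair_three_mul_self_le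
  obtain ⟨K₃, hK₃, h₃⟩ := abs_magnetic_le
  obtain ⟨K₄, hK₄, h₄⟩ := nrm_two_force_le h k μ lam
  obtain ⟨K₅, hK₅, h₅⟩ := abs_ip_force_le h k μ lam
  refine ⟨K₁ + 3 * K₂ + K₃ + 9 * K₄ + 3 * K₅, by positivity, fun n a u B α U b A d e hb => ?_⟩
  obtain ⟨α0, U0, b0, A0, d0, e0⟩ := hb.nonneg
  have hm := hb.mollify n
  have t1 : |pair 3 (transport (Sv n u) (S n a)) (S n a)| ≤ K₁ * (U * A ^ 2) :=
    (h₁ _ _ U hm.nu).trans (by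
      have := hm.grad_a
      have := gn_nonneg 2 (S n a)
      gcongr)
  have t2 : |pair 3 (S n a * dv (Sv n u)) (S n a)| ≤ 3 * K₂ * (α * A * e) := by
    have hdv : nrm 3 (dv (Sv n u)) ≤ 3 * e := by
      have := nrm_sum_le 3 (fun i => D i (Sv n u i)) fun i => hm.grad_u i i
      simpa [dv] using this
    refine (h₂ _ _).trans ?_
    have q1 := hm.grad_a
    have q2 := hm.na
    have q3 := gn_nonneg 2 (S n a)
    have q4 := nrm_nonneg 3 (dv (Sv n u))
    calc _ ≤ K₂ * (α * A * (3 * e)) := by gcongr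
      _ = _ := by ring
  have t3 : |couple 3 (Sv n B) (Sv n B) (Sv n u) -
      ∑ j, pair 3 (transport (Sv n u) (Sv n B j)) (Sv n B j)| ≤ K₃ * (b * d * e) :=
    h₃ _ _ b d e hm.div_B (fun j => ⟨hm.nB j, (hm.grad_B j).1, (hm.grad_B j).2⟩)
      fun i j => ⟨(nrm_succ_le _ _).trans (hm.grad_u i j), (nrm_D_le 2 2 _).trans (hm.grad_u i j)⟩
  set X₁ := U * e ^ 2 + e * A * U + A * e * b ^ 2 + U * A ^ 2 with hX₁
  set X₂ := U * e + α * e + A * b ^ 2 + α * A with hX₂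
  set F := force h k μ lam a u B with hF
  have hFb : ∀ j, nrm 2 (F j) ≤ K₄ * X₂ := h₄ a u B α U b A e hb.range hb.na hb.nu hb.nB hb.grad_a hb.grad_u
  have t4 : |∑ j, pair 3 (Sv n u j) (S n (F j))| ≤ 9 * K₄ * (e * X₂) + 3 * K₅ * X₁ +
      ∑ j, |ip (S n (u j)) (S n (F j)) - ip (u j) (F j)| := by
    have key : ∀ j, |pair 3 (Sv n u j) (S n (F j))| ≤ 3 * (e * (K₄ * X₂)) + K₅ * X₁ +
        |ip (S n (u j)) (S n (F j)) - ip (u j) (F j)| := fun j => by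
      have s1 := (abs_pair_three_sub_ip_le (fun i => hm.grad_u i j) (S n (F j)))
      have s2 : e * nrm 2 (S n (F j)) ≤ e * (K₄ * X₂) :=
        mul_le_mul_of_nonneg_left ((nrm_S_le n 2 _).trans (hFb j)) e0
      have s3 := h₅ a u B U b A e hb.range hb.nu hb.nB hb.grad_a hb.grad_u j
      rw [← hF, ip_comm] at s3
      have s4 := abs_add_le_of s1 (abs_add_le_of s3 le_rfl : |ip (u j) (F j) +
        (ip (S n (u j)) (S n (F j)) - ip (u j) (F j))| ≤ _)
      rw [add_sub_cancel, Sv_apply, sub_add_cancel] at s4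
      rw [Sv_apply]
      linarith
    refine (Finset.abs_sum_le_sum_abs _ _).trans ((Finset.sum_le_sum fun j _ => key j).trans
      (le_of_eq ?_))
    simp only [Finset.sum_add_distrib, Finset.sum_const, Finset.card_univ, Fintype.card_fin,
      nsmul_eq_mul, Nat.cast_ofNat]
    ring
  have t5 : |pair 3 (S n a) (∑ i, tc n i (u i) a)| ≤ α * ∑ i, nrm 3 (tc n i (u i) a) :=
    (abs_pair_le _ _ _).trans (mul_le_mul hm.na (nrm_sum _ _ _) (nrm_nonneg _ _) α0)
  have t6 : |pair 3 (S n a) (∑ i, pc n a (D i (u i)))| ≤ α * ∑ i, nrm 3 (pc n a (D i (u i))) :=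
    (abs_pair_le _ _ _).trans (mul_le_mul hm.na (nrm_sum _ _ _) (nrm_nonneg _ _) α0)
  have t7 : |∑ j, pair 3 (Sv n u j) (∑ i, (pc n (B i) (D i (B j)) - pc n (B i) (D j (B i))))| ≤
      ∑ j, (U + 3 * e) * ∑ i, (nrm 2 (pc n (B i) (D i (B j))) + nrm 2 (pc n (B i) (D j (B i)))) := by
    refine (Finset.abs_sum_le_sum_abs _ _).trans (Finset.sum_le_sum fun j _ => ?_)
    refine (abs_pair_three_le_nrm_two (fun i => hm.grad_u i j) (hm.nu j) _).trans ?_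
    gcongr
    exact (nrm_sum _ _ _).trans (Finset.sum_le_sum fun i _ => nrm_sub _ _ _)
  have t8 : |∑ j, (pair 3 (Sv n B j) (∑ i, (pc n (B i) (D i (u j)) - pc n (B j) (D i (u i)))) -
      pair 3 (Sv n B j) (∑ i, tc n i (u i) (B j)))| ≤
      ∑ j, (b * ∑ i, (nrm 3 (pc n (B i) (D i (u j))) + nrm 3 (pc n (B j) (D i (u i)))) +
        b * ∑ i, nrm 3 (tc n i (u i) (B j))) := by
    refine (Finset.abs_sum_le_sum_abs _ _).trans (Finset.sum_le_sum fun j _ => abs_sub_le_of ?_ ?_)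
    · exact (abs_pair_le _ _ _).trans (mul_le_mul (hm.nB j) ((nrm_sum _ _ _).trans
        (Finset.sum_le_sum fun i _ => nrm_sub _ _ _)) (nrm_nonneg _ _) b0)
    · exact (abs_pair_le _ _ _).trans (mul_le_mul (hm.nB j) (nrm_sum _ _ _) (nrm_nonneg _ _) b0)
  rw [rate_add_diss]
  have hneg : |-pair 3 (transport (Sv n u) (S n a)) (S n a)| ≤ K₁ * (U * A ^ 2) := by rwa [abs_neg]
  have hneg2 : |-pair 3 (S n a) (∑ i, tc n i (u i) a)| ≤ α * ∑ i, nrm 3 (tc n i (u i) a) := by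
    rwa [abs_neg]
  refine (abs_add_le_of (abs_add_le_of (abs_add_le_of (abs_sub_le_of hneg t2) t3) t4)
    (abs_add_le_of (abs_add_le_of (abs_sub_le_of hneg2 t6) t7) t8)).trans ?_
  simp only [rem, ← hF, Finset.sum_add_distrib, ← Finset.mul_sum]
  set r1 := ∑ i, nrm 3 (tc n i (u i) a)
  set r2 := ∑ i, nrm 3 (pc n a (D i (u i)))
  set r3 := ∑ j, ∑ i, nrm 2 (pc n (B i) (D i (B j)))
  set r4 := ∑ j, ∑ i, nrm 2 (pc n (B i) (D j (B i)))
  set r5 := ∑ j, ∑ i, nrm 3 (pc n (B i) (D i (u j)))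
  set r6 := ∑ j, ∑ i, nrm 3 (pc n (B j) (D i (u i)))
  set r7 := ∑ j, ∑ i, nrm 3 (tc n i (u i) (B j))
  set r8 := ∑ j, |ip (S n (u j)) (S n (F j)) - ip (u j) (F j)|
  have p1 : 0 ≤ r1 := Finset.sum_nonneg fun _ _ => nrm_nonneg _ _
  have p2 : 0 ≤ r2 := Finset.sum_nonneg fun _ _ => nrm_nonneg _ _
  have p3 : 0 ≤ r3 := Finset.sum_nonneg fun _ _ => Finset.sum_nonneg fun _ _ => nrm_nonneg _ _
  have p4 : 0 ≤ r4 := Finset.sum_nonneg fun _ _ => Finset.sum_nonneg fun _ _ => nrm_nonneg _ _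
  have p5 : 0 ≤ r5 := Finset.sum_nonneg fun _ _ => Finset.sum_nonneg fun _ _ => nrm_nonneg _ _
  have p6 : 0 ≤ r6 := Finset.sum_nonneg fun _ _ => Finset.sum_nonneg fun _ _ => nrm_nonneg _ _
  have p7 : 0 ≤ r7 := Finset.sum_nonneg fun _ _ => Finset.sum_nonneg fun _ _ => nrm_nonneg _ _
  have p8 : 0 ≤ r8 := Finset.sum_nonneg fun _ _ => abs_nonneg _
  set P := 1 + α + U + 3 * e + b with hP
  have z1 : α * r1 ≤ P * r1 := mul_le_mul_of_nonneg_right (by linarith) p1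
  have z2 : α * r2 ≤ P * r2 := mul_le_mul_of_nonneg_right (by linarith) p2
  have z3 : (U + 3 * e) * (r3 + r4) ≤ P * (r3 + r4) :=
    mul_le_mul_of_nonneg_right (by linarith) (by linarith)
  have z5 : b * (r5 + r6) ≤ P * (r5 + r6) :=
    mul_le_mul_of_nonneg_right (by linarith) (by linarith)
  have z7 : b * r7 ≤ P * r7 := mul_le_mul_of_nonneg_right (by linarith) p7
  have z8 : 1 * r8 ≤ P * r8 := mul_le_mul_of_nonneg_right (by linarith) p8
  have q1 : 0 ≤ U * A ^ 2 := by positivity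
  have q2 : 0 ≤ α * A * e := by positivity
  have q3 : 0 ≤ b * d * e := by positivity
  have q4 : 0 ≤ X₁ := by positivity
  have q5 : 0 ≤ e * X₂ := by positivity
  set Y := U * A ^ 2 + α * A * e + b * d * e + X₁ + e * X₂ with hY
  have y1 : K₁ * (U * A ^ 2) ≤ K₁ * Y := by gcongr; linarith
  have y2 : 3 * K₂ * (α * A * e) ≤ 3 * K₂ * Y := by gcongr; linarith
  have y3 : K₃ * (b * d * e) ≤ K₃ * Y := by gcongr; linarith
  have y4 : 9 * K₄ * (e * X₂) ≤ 9 * K₄ * Y := by gcongr; linarith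
  have y5 : 3 * K₅ * X₁ ≤ 3 * K₅ * Y := by gcongr; linarith
  linarith

end HInf


/-! ### Bounds that yield the gain of regularity. -/

namespace HInf

/-- Half of the time derivative of the squared `H³` norm of the mollified magnetic field. -/
def rateB (σ : ℝ) (n : ℕ) (u B : Fin 3 → HInf) : ℝ :=
  ∑ j, pair 3 (S n (B j)) (S n (rhsB σ u B j))

/-- An isotropic bound, too weak for the final inequality but free of ∇_h B on the right. It makes
∇_h B square integrable in time, after which the anisotropic estimate becomes meaningful. -/
theorem abs_rateB_add_le (σ : ℝ) : ∃ K : ℝ, 0 < K ∧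
    ∀ (n : ℕ) (u B : Fin 3 → HInf) (U b e : ℝ), (∀ j, nrm 3 (u j) ≤ U) → (∀ j, nrm 3 (B j) ≤ b) →
      (∀ i j, nrm 3 (D i (u j)) ≤ e) →
      |rateB σ n u B + σ * ∑ j, (nrm 3 (D 0 (Sv n B j)) ^ 2 + nrm 3 (D 1 (Sv n B j)) ^ 2)| ≤
        K * (b ^ 2 * (U + e)) := by
  obtain ⟨K₁, hK₁, h₁⟩ := abs_pair_three_transport_le
  obtain ⟨K₂, hK₂, h₂⟩ := nrm_tc_le 3 le_rfl
  obtain ⟨K₃, hK₃, h₃⟩ := nrm_three_mul_le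
  refine ⟨3 * (9 * K₁ + 3 * K₂ + 6 * K₃), by positivity, fun n u B U b e hU hb he => ?_⟩
  have U0 := (nrm_nonneg _ _).trans (hU 0)
  have b0 := (nrm_nonneg _ _).trans (hb 0)
  have e0 := (nrm_nonneg _ _).trans (he 0 0)
  have e1 : rateB σ n u B + σ * ∑ j, (nrm 3 (D 0 (Sv n B j)) ^ 2 + nrm 3 (D 1 (Sv n B j)) ^ 2) =
      ∑ j, (-pair 3 (transport (Sv n u) (Sv n B j)) (Sv n B j) -
        pair 3 (Sv n B j) (∑ i, tc n i (u i) (B j)) + pair 3 (Sv n B j) (S n (stretch B u j))) := by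
    rw [rateB, Finset.mul_sum, ← Finset.sum_add_distrib]
    refine Finset.sum_congr rfl fun j _ => ?_
    have hD : ∀ i (f : HInf), pair 3 f (D i (D i f)) = -pair 3 (D i f) (D i f) := fun i f => by
      rw [pair_D 3 i f (D i f), neg_neg]
    simp only [rhsB, map_add, map_sub, map_smul, S_transport, ← D_S, nrm_sq, smul_eq_mul]
    simp only [← Sv_apply]
    rw [hD, hD, pair_comm 3 _ (transport _ _)]
    ring
  rw [e1, mul_assoc]
  refine abs_sum_le_three fun j => ?_
  have q1 : nrm 3 (Sv n B j) ≤ b := (nrm_S_le n 3 _).trans (hb j)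
  have t1 : |-pair 3 (transport (Sv n u) (Sv n B j)) (Sv n B j)| ≤ 9 * K₁ * (b ^ 2 * U) := by
    rw [abs_neg]
    refine (h₁ _ _ U fun i => (nrm_S_le n 3 _).trans (hU i)).trans ?_
    have q2 : gn 2 (Sv n B j) ≤ 3 * b := (gn_le 2 _).trans (by gcongr)
    have q3 := gn_nonneg 2 (Sv n B j)
    calc _ ≤ K₁ * (U * (3 * b) ^ 2) := by gcongr
      _ = _ := by ring
  have t2 : |pair 3 (Sv n B j) (∑ i, tc n i (u i) (B j))| ≤ b * (3 * (K₂ * (U * b))) := by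
    refine (abs_pair_le _ _ _).trans (mul_le_mul q1 ?_ (nrm_nonneg _ _) b0)
    have := nrm_sum_le 3 (fun i => tc n i (u i) (B j)) (c := K₂ * (U * b)) fun i =>
      le_mul_mul_of_le (h₂ n i (u i) (B j)) hK₂.le (hU i) (hb j) (nrm_nonneg _ _) U0
    simpa using this
  have t3 : |pair 3 (Sv n B j) (S n (stretch B u j))| ≤ b * (3 * (K₃ * (b * e) + K₃ * (b * e))) := by
    refine (abs_pair_le _ _ _).trans (mul_le_mul q1 ((nrm_S_le n 3 _).trans ?_) (nrm_nonneg _ _) b0)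
    have := nrm_sum_le 3 (fun i => B i * D i (u j) - B j * D i (u i))
      (c := K₃ * (b * e) + K₃ * (b * e)) fun i => (nrm_sub _ _ _).trans (add_le_add
      (le_mul_mul_of_le (h₃ (B i) (D i (u j))) hK₃.le (hb i) (he i j) (nrm_nonneg _ _) b0)
      (le_mul_mul_of_le (h₃ (B j) (D i (u i))) hK₃.le (hb j) (he i i) (nrm_nonneg _ _) b0))
    simpa [stretch] using this
  refine (abs_add_le_of (abs_sub_le_of t1 t2) t3).trans ?_
  have y1 : 0 ≤ b ^ 2 * U := by positivity
  have y2 : 0 ≤ b ^ 2 * e := by positivity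
  set Y := b ^ 2 * (U + e) with hY
  have z1 : 9 * K₁ * (b ^ 2 * U) ≤ 9 * K₁ * Y := by gcongr; linarith
  have z2 : 3 * K₂ * (b ^ 2 * U) ≤ 3 * K₂ * Y := by gcongr; linarith
  have z3 : 6 * K₃ * (b ^ 2 * e) ≤ 6 * K₃ * Y := by gcongr; linarith
  linarith

/-- The second derivatives of a mollified vector field. -/
def DDS (n : ℕ) (i k : Fin 3) (u : Fin 3 → HInf) (j : Fin 3) : HInf := D i (D k (S n (u j)))

/-- The bilinear form of the higher order energy of the velocity. -/
def highForm (μ lam : ℝ) (n : ℕ) (u v : Fin 3 → HInf) : ℝ :=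
  ∑ i, ∑ k, ∑ j, -pair 0 (visc μ lam (DDS n i k u) j) (DDS n i k v j)

theorem highForm_eq (μ lam : ℝ) (n : ℕ) (u v : Fin 3 → HInf) : highForm μ lam n u v =
    ∑ i, ∑ k, (μ * ∑ l, ∑ j, pair 0 (D l (DDS n i k u j)) (D l (DDS n i k v j)) +
      (lam + μ) * pair 0 (dv (DDS n i k u)) (dv (DDS n i k v))) := by
  simp only [highForm, Finset.sum_neg_distrib, sum_pair_visc, neg_neg]

/-- For λ + μ ≥ 0 the second term is dropped; otherwise Y is replaced by X and the coefficients add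
up to λ + 2μ. -/
theorem visc_form_lower {μ lam X Y : ℝ} (hXY : Y ≤ X) (hY : 0 ≤ Y) :
    min μ (lam + 2 * μ) * X ≤ μ * X + (lam + μ) * Y := by
  rcases le_total 0 (lam + μ) with h | h
  · have := min_le_left μ (lam + 2 * μ)
    nlinarith
  · have := min_le_right μ (lam + 2 * μ)
    nlinarith

theorem highForm_self_nonneg {μ lam : ℝ} (hμ : 0 < μ) (hν : 0 < lam + 2 * μ) (n : ℕ)
    (u : Fin 3 → HInf) : 0 ≤ highForm μ lam n u u := by
  rw [highForm_eq]
  refine Finset.sum_nonneg fun i _ => Finset.sum_nonneg fun k _ => ?_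
  have h := nrm_dv_sq_le 0 (DDS n i k u)
  simp only [← nrm_sq]
  have h0 : 0 ≤ nrm 0 (dv (DDS n i k u)) ^ 2 := sq_nonneg _
  have h1 := visc_form_lower (μ := μ) (lam := lam) h h0
  have h2 : 0 < min μ (lam + 2 * μ) := lt_min hμ hν
  exact (mul_nonneg h2.le (h0.trans h)).trans h1

theorem highForm_self_le {μ lam : ℝ} (n : ℕ) {u : Fin 3 → HInf} {M : ℝ} (hM : ∀ j, nrm 3 (u j) ≤ M) :
    highForm μ lam n u u ≤ 81 * (|μ| + |lam + μ|) * M ^ 2 := by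
  have M0 := (nrm_nonneg _ _).trans (hM 0)
  have h1 : ∀ i k l j, nrm 0 (D l (DDS n i k u j)) ≤ M := fun i k l j =>
    (nrm_D_le 0 _ _).trans ((nrm_D_le 1 _ _).trans ((nrm_D_le 2 _ _).trans
      ((nrm_S_le n 3 _).trans (hM j))))
  have h2 : ∀ i k, ∑ l, ∑ j, nrm 0 (D l (DDS n i k u j)) ^ 2 ≤ 9 * M ^ 2 := fun i k => by
    have : ∑ l : Fin 3, ∑ j : Fin 3, nrm 0 (D l (DDS n i k u j)) ^ 2 ≤ ∑ l : Fin 3, ∑ j : Fin 3, M ^ 2 := by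
      gcongr
      · exact nrm_nonneg _ _
      · exact h1 _ _ _ _
    refine this.trans (le_of_eq ?_)
    simp; ring
  rw [highForm_eq]
  have h3 : ∀ i k, (μ * ∑ l, ∑ j, pair 0 (D l (DDS n i k u j)) (D l (DDS n i k u j)) +
      (lam + μ) * pair 0 (dv (DDS n i k u)) (dv (DDS n i k u))) ≤ (|μ| + |lam + μ|) * (9 * M ^ 2) :=
    fun i k => by
    simp only [← nrm_sq]
    have a0 := h2 i k
    have a1 := (nrm_dv_sq_le 0 (DDS n i k u)).trans a0
    have a2 : 0 ≤ ∑ l, ∑ j, nrm 0 (D l (DDS n i k u j)) ^ 2 := by positivity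
    have e : (|μ| + |lam + μ|) * (9 * M ^ 2) = |μ| * (9 * M ^ 2) + |lam + μ| * (9 * M ^ 2) := by ring
    rw [e]
    exact add_le_add (mul_le_mul (le_abs_self _) a0 a2 (abs_nonneg _))
      (mul_le_mul (le_abs_self _) a1 (sq_nonneg _) (abs_nonneg _))
  refine (Finset.sum_le_sum fun i _ => Finset.sum_le_sum fun k _ => h3 i k).trans (le_of_eq ?_)
  simp; ring

/-- Ellipticity of the viscous operator. -/
theorem sum_nrm_visc_ge {μ lam : ℝ} (hμ : 0 < μ) (hν : 0 < lam + 2 * μ) (w : Fin 3 → HInf) :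
    min μ (lam + 2 * μ) ^ 2 * ∑ j, ∑ a, ∑ b, nrm 0 (D b (D a (w j))) ^ 2 ≤
      ∑ j, nrm 0 (visc μ lam w j) ^ 2 := by
  set Δ : Fin 3 → HInf := fun j => ∑ i, D i (D i (w j)) with hΔ
  set G : Fin 3 → HInf := fun j => D j (dv w) with hG
  have e1 : ∀ j, ip (Δ j) (Δ j) = ∑ a, ∑ b, nrm 0 (D b (D a (w j))) ^ 2 := fun j => by
    simp only [hΔ, map_sum, LinearMap.sum_apply, nrm_sq, pair_zero]
    refine Finset.sum_congr rfl fun a _ => Finset.sum_congr rfl fun b _ => ?_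
    rw [ip_D b (D b (w j)), D_comm b a (D a (w j)), D_comm b a (w j),
      ip_D a (D b (w j)) (D a (D b (w j)))]
  -- The Laplacian commutes with the divergence, so against a gradient field only the gradient part
  -- of Δw is seen.
  have e2 : ∑ j, ip (Δ j) (G j) = ∑ j, ip (G j) (G j) := by
    have l1 : ∑ j, ip (Δ j) (G j) = -ip (dv Δ) (dv w) := by
      rw [dv.eq_1 Δ]
      simp only [map_sum, LinearMap.sum_apply, hG, ip_D, neg_neg, ← Finset.sum_neg_distrib]
    have l2 : dv Δ = ∑ i, D i (D i (dv w)) := by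
      simp only [dv, hΔ, map_sum]
      rw [Finset.sum_comm]
      refine Finset.sum_congr rfl fun i _ => Finset.sum_congr rfl fun j _ => ?_
      rw [D_comm j i, D_comm j i]
    rw [l1, l2]
    simp only [map_sum, LinearMap.sum_apply, hG]
    rw [← Finset.sum_neg_distrib]
    refine Finset.sum_congr rfl fun i _ => ?_
    rw [ip_D i (D i (dv w)), neg_neg]
  -- Here 2μ(λ+μ) + (λ+μ)² = (λ+2μ)² - μ²: the operator acts as μ on the solenoidal part and as λ +
  -- 2μ on the gradient part.
  have e3 : ∑ j, nrm 0 (visc μ lam w j) ^ 2 = μ ^ 2 * ∑ j, ip (Δ j) (Δ j) +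
      ((lam + 2 * μ) ^ 2 - μ ^ 2) * ∑ j, ip (G j) (G j) := by
    have : ∀ j, nrm 0 (visc μ lam w j) ^ 2 = μ ^ 2 * ip (Δ j) (Δ j) +
        2 * μ * (lam + μ) * ip (Δ j) (G j) + (lam + μ) ^ 2 * ip (G j) (G j) := fun j => by
      rw [nrm_sq, pair_zero]
      change ip (μ • Δ j + (lam + μ) • G j) (μ • Δ j + (lam + μ) • G j) = _
      simp only [map_add, map_smul, LinearMap.add_apply, LinearMap.smul_apply, smul_eq_mul,
        ip_comm (G j) (Δ j)]
      ring
    simp only [this, Finset.sum_add_distrib, ← Finset.mul_sum, e2]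
    ring
  have e4 : ∑ j, ip (G j) (G j) ≤ ∑ j, ip (Δ j) (Δ j) := by
    have h : 0 ≤ ∑ j, ip (Δ j - G j) (Δ j - G j) := Finset.sum_nonneg fun j _ => ip_self_nonneg _
    simp only [map_sub, LinearMap.sub_apply, Finset.sum_sub_distrib, ip_comm (G _) (Δ _), e2] at h
    linarith
  have e5 : 0 ≤ ∑ j, ip (G j) (G j) := Finset.sum_nonneg fun j _ => ip_self_nonneg _
  simp only [← e1]
  rw [e3]
  rcases le_total μ (lam + 2 * μ) with hle | hle
  · rw [min_eq_left hle]
    have : 0 ≤ (lam + 2 * μ) ^ 2 - μ ^ 2 := by nlinarith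
    nlinarith
  · rw [min_eq_right hle]
    have : 0 ≤ μ ^ 2 - (lam + 2 * μ) ^ 2 := by nlinarith
    nlinarith

/-- The 13 = 1 + 3 + 9 counts the derivatives of D i f of order at most two; only those of order
three are not controlled by f in H³. -/
theorem nrm_three_D_sq_le (f : HInf) (i : Fin 3) : nrm 3 (D i f) ^ 2 ≤ 13 * nrm 3 f ^ 2 +
    ∑ j, ∑ l, ∑ m, nrm 0 (D m (D l (D j (D i f)))) ^ 2 := by
  have h0 : nrm 0 (D i f) ^ 2 ≤ nrm 3 f ^ 2 := by
    gcongr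
    · exact nrm_nonneg _ _
    · exact (nrm_D_le 0 i f).trans (nrm_mono (by norm_num) f)
  have h1 : ∀ j, nrm 0 (D j (D i f)) ^ 2 ≤ nrm 3 f ^ 2 := fun j => by
    gcongr
    · exact nrm_nonneg _ _
    · exact (nrm_D_le 0 _ _).trans ((nrm_D_le 1 _ _).trans (nrm_mono (by norm_num) f))
  have h2 : ∀ j l, nrm 0 (D l (D j (D i f))) ^ 2 ≤ nrm 3 f ^ 2 := fun j l => by
    gcongr
    · exact nrm_nonneg _ _
    · exact (nrm_D_le 0 _ _).trans ((nrm_D_le 1 _ _).trans (nrm_D_le 2 _ _))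
  have s1 := Finset.sum_le_sum fun j (_ : j ∈ Finset.univ) => h1 j
  have s2 := Finset.sum_le_sum fun j (_ : j ∈ Finset.univ) => Finset.sum_le_sum
    fun l (_ : l ∈ Finset.univ) => h2 j l
  simp only [Finset.sum_const, Finset.card_univ, Fintype.card_fin, nsmul_eq_mul,
    Nat.cast_ofNat] at s1 s2
  simp only [nrm_succ_sq, Finset.sum_add_distrib] at *
  linarith

theorem D_dv (i : Fin 3) (u : Fin 3 → HInf) : D i (dv u) = dv (fun j => D i (u j)) := by
  simp only [dv, map_sum]
  exact Finset.sum_congr rfl fun j _ => D_comm _ _ _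

theorem D_visc (μ lam : ℝ) (i : Fin 3) (u : Fin 3 → HInf) (j : Fin 3) :
    D i (visc μ lam u j) = visc μ lam (fun j => D i (u j)) j := by
  have h : ∀ l, D i (D l (D l (u j))) = D l (D l (D i (u j))) := fun l => by
    rw [D_comm i l, D_comm i l]
  simp only [visc, map_add, map_smul, map_sum, h]
  rw [D_comm i j, D_dv]

/-- Since 1 + H ≥ 1/2, the first two terms give -½‖Z‖², and Young's inequality spends half of that
on E. -/
theorem neg_ip_add_mul_add_le {Z H E : HInf} {c : ℝ} (hH : ∀ x, -(1 / 2) ≤ H x) (hE : nrm 0 E ≤ c) :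
    -ip Z (Z + H * Z + E) ≤ -(1 / 4) * nrm 0 Z ^ 2 + c ^ 2 := by
  have hpos : 1 / 2 * nrm 0 Z ^ 2 ≤ ip Z (Z + H * Z) := by
    rw [nrm_zero_sq, ip_def, ← integral_const_mul]
    refine integral_mono (Z.memLp.integrable_sq.const_mul _) (integrable_mul _ _) fun x => ?_
    have := hH x
    simp only [add_apply, mul_apply]
    nlinarith [sq_nonneg (Z x)]
  have hcs2 : -ip Z E ≤ nrm 0 Z * c := by
    have := (abs_le.1 (abs_ip_le Z E)).1
    have := mul_le_mul_of_nonneg_left hE (nrm_nonneg 0 Z)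
    linarith
  rw [map_add]
  nlinarith [sq_nonneg (nrm 0 Z / 2 - c), nrm_nonneg 0 Z]

set_option maxHeartbeats 1000000 in
/-- Smoothing estimate for the velocity, valid without control of fourth derivatives. -/
theorem highForm_rhsU_le (h k : Nonlin) (hh : ∀ r, |r| ≤ 1 / 2 → -(1 / 2) ≤ h.1 r) {μ lam : ℝ}
    (hμ : 0 < μ) (hν : 0 < lam + 2 * μ) (M : ℝ) : ∃ K : ℝ, 0 < K ∧
    ∀ (n : ℕ) (a : HInf) (u B : Fin 3 → HInf), (∀ x, |a x| ≤ 1 / 2) → nrm 3 a ≤ M →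
      (∀ j, nrm 3 (u j) ≤ M) → (∀ j, nrm 3 (B j) ≤ M) →
      highForm μ lam n u (rhsU h k μ lam a u B) ≤ K -
        min μ (lam + 2 * μ) ^ 2 / 4 * ∑ i, ∑ j, nrm 3 (D i (S n (u j))) ^ 2 := by
  obtain ⟨K₁, hK₁, h₁⟩ := nrm_zero_commutator_le
  obtain ⟨K₂, hK₂, h₂⟩ := abs_D_le
  obtain ⟨K₃, hK₃, h₃⟩ := nrm_three_comp_le h
  obtain ⟨K₄, hK₄, h₄⟩ := nrm_mul_le_nrm
  obtain ⟨K₅, hK₅, h₅⟩ := nrm_lor_le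
  obtain ⟨K₆, hK₆, h₆⟩ := nrm_transport_le
  obtain ⟨K₇, hK₇, h₇⟩ := nrm_three_comp_le k
  set N := max M 0 with hN
  set V := 3 * |μ| + 3 * |lam + μ| with hV
  set H₀ := K₃ * ((1 + N) * N) with hH₀
  set k₀ := K₇ * ((1 + N) * N) with hk₀
  set G₀ := N + K₅ * (N * N) + K₄ * (H₀ * (K₅ * (N * N))) + K₄ * (k₀ * N) + K₆ * (N * N) with hG₀
  set E₀ := K₄ * (H₀ * (V * N)) + K₁ * (K₂ * H₀ * (V * N)) + G₀ with hE₀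
  set ν := min μ (lam + 2 * μ) with hν'
  have hN0 : 0 ≤ N := le_max_right _ _
  have hV0 : 0 ≤ V := by positivity
  have hE0 : 0 ≤ E₀ := by positivity
  -- The 27 counts two derivatives and one component; the second term returns the derivatives of
  -- order at most three that ellipticity does not see.
  refine ⟨27 * E₀ ^ 2 + ν ^ 2 / 4 * (9 * (13 * N ^ 2)) + 1, by positivity,
    fun n a u B ha haM huM hBM => ?_⟩
  have haN : nrm 3 a ≤ N := haM.trans (le_max_left _ _)
  have huN : ∀ j, nrm 3 (u j) ≤ N := fun j => (huM j).trans (le_max_left _ _)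
  have hBN : ∀ j, nrm 3 (B j) ≤ N := fun j => (hBM j).trans (le_max_left _ _)
  have a0 := nrm_nonneg 3 a
  have hH : nrm 3 (comp h a) ≤ H₀ := (h₃ a ha).trans (by rw [hH₀]; gcongr)
  have hk3 : nrm 3 (comp k a) ≤ k₀ := (h₇ a ha).trans (by rw [hk₀]; gcongr)
  have hvis : ∀ j, nrm 1 (visc μ lam u j) ≤ V * N := fun j =>
    nrm_visc_le μ lam 1 (fun i j => (nrm_D_le 2 i _).trans (huN j)) j
  set g : Fin 3 → HInf := fun j => lor B B j - D j a + comp h a * lor B B j - comp k a * D j a -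
    transport u (u j) with hg
  have hrhs : ∀ j, rhsU h k μ lam a u B j = visc μ lam u j + comp h a * visc μ lam u j + g j :=
    fun j => by
      simp only [rhsU, force, hg, mul_add]; abel
  have hlor : ∀ j, nrm 2 (lor B B j) ≤ K₅ * (N * N) := fun j =>
    h₅ 2 le_rfl B B N N (fun j => (nrm_succ_le _ _).trans (hBN j))
      (fun i j => (nrm_D_le 2 i _).trans (hBN j)) j
  have hDa : ∀ j, nrm 2 (D j a) ≤ N := fun j => (nrm_D_le 2 j a).trans haN
  have hgb : ∀ j, nrm 2 (g j) ≤ G₀ := fun j => by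
    have s1 : nrm 2 (comp h a * lor B B j) ≤ K₄ * (H₀ * (K₅ * (N * N))) :=
      le_mul_mul_of_le (h₄ 2 le_rfl _ _) hK₄.le ((nrm_succ_le _ _).trans hH) (hlor j)
        (nrm_nonneg _ _) (by positivity)
    have s2 : nrm 2 (comp k a * D j a) ≤ K₄ * (k₀ * N) :=
      le_mul_mul_of_le (h₄ 2 le_rfl _ _) hK₄.le ((nrm_succ_le _ _).trans hk3) (hDa j)
        (nrm_nonneg _ _) (by positivity)
    have s3 : nrm 2 (transport u (u j)) ≤ K₆ * (N * N) :=
      h₆ 2 le_rfl u (u j) N N (fun j => (nrm_succ_le _ _).trans (huN j))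
        fun i => (nrm_D_le 2 i _).trans (huN j)
    have r1 := nrm_sub 2 (lor B B j - D j a + comp h a * lor B B j - comp k a * D j a)
      (transport u (u j))
    have r2 := nrm_sub 2 (lor B B j - D j a + comp h a * lor B B j) (comp k a * D j a)
    have r3 := nrm_add 2 (lor B B j - D j a) (comp h a * lor B B j)
    have r4 := nrm_sub 2 (lor B B j) (D j a)
    have r5 := hlor j
    have r6 := hDa j
    linarith
  have hDH : ∀ i x, |D i (comp h a) x| ≤ K₂ * H₀ := fun i x => (h₂ _ i x).trans (by gcongr)
  -- Let Z be the viscous operator applied to ∂ᵢ∂ₗ S_n u, a quantity of fourth order. The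
  -- differentiated right-hand side equals Z + h(a) Z + E, where E collects a derivative falling on
  -- h(a), the Friedrichs commutator of h(a) with ∂ᵢ S_n, and the terms already in H². All are
  -- bounded by H³ norms uniformly in n.
  have key : ∀ i l j, -pair 0 (visc μ lam (DDS n i l u) j) (DDS n i l (rhsU h k μ lam a u B) j) ≤
      -(1 / 4) * nrm 0 (visc μ lam (DDS n i l u) j) ^ 2 + E₀ ^ 2 := fun i l j => by
    set Z := visc μ lam (DDS n i l u) j with hZ
    have hZ' : Z = D i (S n (D l (visc μ lam u j))) := by
      rw [← D_S, S_visc, D_visc, D_visc, hZ]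
      rfl
    set c := D i (S n (comp h a * D l (visc μ lam u j))) -
      comp h a * D i (S n (D l (visc μ lam u j))) with hc
    set E := D i (S n (D l (comp h a) * visc μ lam u j)) + c + D i (D l (S n (g j))) with hE
    have hexp : DDS n i l (rhsU h k μ lam a u B) j = Z + comp h a * Z + E := by
      rw [DDS, hrhs, map_add, map_add, map_add, map_add, map_add, map_add, hE, hc, ← hZ']
      have x1 : D i (D l (S n (visc μ lam u j))) = Z := by rw [D_S n l, hZ']
      have x2 : D i (D l (S n (comp h a * visc μ lam u j))) =
          D i (S n (D l (comp h a) * visc μ lam u j)) +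
            D i (S n (comp h a * D l (visc μ lam u j))) := by
        rw [D_S n l, D_mul, map_add, map_add]
      rw [x1, x2]
      abel
    have hEb : nrm 0 E ≤ E₀ := by
      have s1 : nrm 0 (D i (S n (D l (comp h a) * visc μ lam u j))) ≤ K₄ * (H₀ * (V * N)) :=
        (nrm_D_le 0 i _).trans ((nrm_S_le n 1 _).trans (le_mul_mul_of_le (h₄ 1 (by norm_num) _ _)
          hK₄.le ((nrm_D_le 2 l _).trans hH) (hvis j) (nrm_nonneg _ _) (by positivity)))
      have s2 : nrm 0 c ≤ K₁ * (K₂ * H₀ * (V * N)) :=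
        le_mul_mul_of_le (h₁ n i (comp h a) (D l (visc μ lam u j)) (K₂ * H₀) hDH) hK₁.le le_rfl
          ((nrm_D_le 0 l _).trans (hvis j)) (nrm_nonneg _ _) (by positivity)
      have s3 : nrm 0 (D i (D l (S n (g j)))) ≤ G₀ :=
        (nrm_D_le 0 i _).trans ((nrm_D_le 1 l _).trans ((nrm_S_le n 2 _).trans (hgb j)))
      have r1 := nrm_add 0 (D i (S n (D l (comp h a) * visc μ lam u j)) + c) (D i (D l (S n (g j))))
      have r2 := nrm_add 0 (D i (S n (D l (comp h a) * visc μ lam u j))) c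
      linarith
    rw [hexp, pair_zero]
    exact neg_ip_add_mul_add_le (fun x => by rw [comp_apply]; exact hh _ (ha x)) hEb
  have hsum : highForm μ lam n u (rhsU h k μ lam a u B) ≤
      ∑ i, ∑ l, ∑ j, (-(1 / 4) * nrm 0 (visc μ lam (DDS n i l u) j) ^ 2 + E₀ ^ 2) :=
    Finset.sum_le_sum fun i _ => Finset.sum_le_sum fun l _ => Finset.sum_le_sum fun j _ => key i l j
  have hsum2 : ∑ i : Fin 3, ∑ l : Fin 3, ∑ j : Fin 3,
      (-(1 / 4) * nrm 0 (visc μ lam (DDS n i l u) j) ^ 2 + E₀ ^ 2) =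
      27 * E₀ ^ 2 - 1 / 4 * ∑ i, ∑ l, ∑ j, nrm 0 (visc μ lam (DDS n i l u) j) ^ 2 := by
    simp only [Finset.sum_add_distrib, ← Finset.mul_sum, Finset.sum_const, Finset.card_univ,
      Fintype.card_fin, nsmul_eq_mul, Nat.cast_ofNat]
    ring
  have hell : ν ^ 2 * ∑ i : Fin 3, ∑ l : Fin 3, ∑ j, ∑ p, ∑ q, nrm 0 (D q (D p (DDS n i l u j))) ^ 2 ≤
      ∑ i, ∑ l, ∑ j, nrm 0 (visc μ lam (DDS n i l u) j) ^ 2 := by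
    rw [Finset.mul_sum]
    refine Finset.sum_le_sum fun i _ => ?_
    rw [Finset.mul_sum]
    exact Finset.sum_le_sum fun l _ => sum_nrm_visc_ge hμ hν (DDS n i l u)
  have hfin : ∑ i, ∑ j, nrm 3 (D i (S n (u j))) ^ 2 ≤ 9 * (13 * N ^ 2) +
      ∑ i : Fin 3, ∑ l : Fin 3, ∑ j, ∑ p, ∑ q, nrm 0 (D q (D p (DDS n i l u j))) ^ 2 := by
    have s1 : ∑ i, ∑ j, nrm 3 (D i (S n (u j))) ^ 2 ≤ ∑ i : Fin 3, ∑ j : Fin 3, (13 * N ^ 2 +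
        ∑ p, ∑ l, ∑ q, nrm 0 (D q (D l (D p (D i (S n (u j)))))) ^ 2) := by
      refine Finset.sum_le_sum fun i _ => Finset.sum_le_sum fun j _ =>
        (nrm_three_D_sq_le _ _).trans ?_
      have := (nrm_S_le n 3 (u j)).trans (huN j)
      have := nrm_nonneg 3 (S n (u j))
      gcongr
    refine s1.trans (le_of_eq ?_)
    simp only [Finset.sum_add_distrib, Finset.sum_const, Finset.card_univ, Fintype.card_fin,
      nsmul_eq_mul, Nat.cast_ofNat]
    congr 1
    · ring
    · refine Finset.sum_congr rfl fun i _ => ?_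
      rw [Finset.sum_comm]
      refine Finset.sum_congr rfl fun p _ => Finset.sum_congr rfl fun j _ =>
        Finset.sum_congr rfl fun l _ => Finset.sum_congr rfl fun q _ => ?_
      rw [DDS, D_comm p i]
  have hν2 : 0 ≤ ν ^ 2 / 4 := by positivity
  have := mul_le_mul_of_nonneg_left hfin hν2
  rw [hsum2] at hsum
  linarith

end HInf


/-- Every term except U A² contains e or d, which is split off by xy ≤ ηx² + y²/η and later
absorbed. The exception is kept, and is the origin of the first power of ‖u‖ in the final bound. -/
theorem young_estimate {η : ℝ} (hη : 0 < η) {α U b A d e : ℝ} (hU : 0 ≤ U) :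
    U * A ^ 2 + α * A * e + b * d * e + (U * e ^ 2 + e * A * U + A * e * b ^ 2 + U * A ^ 2) +
      e * (U * e + α * e + A * b ^ 2 + α * A) ≤ 8 * η * (e ^ 2 + d ^ 2) +
      (2 / η + 2) * ((U + (α ^ 2 + U ^ 2) + b ^ 4) * A ^ 2 + (α ^ 2 + U ^ 2 + b ^ 2) * e ^ 2) := by
  have key : ∀ x y : ℝ, x * y ≤ η * x ^ 2 + 1 / η * y ^ 2 := fun x y => by
    have h : 0 ≤ 1 / η * ((η * x - y) ^ 2 + η * x * η * x + y * y) := by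
      have : 0 ≤ η * x * η * x := by nlinarith [mul_self_nonneg (η * x)]
      have := mul_self_nonneg y
      positivity
    have e : 1 / η * ((η * x - y) ^ 2 + η * x * η * x + y * y) =
        2 * (η * x ^ 2 + 1 / η * y ^ 2 - x * y) := by
      field_simp; ring
    linarith
  have hw : 0 < 1 / η := by positivity
  have k1 := key e (α * A)
  have k2 := key d (b * e)
  have k3 := key e (U * e)
  have k4 := key e (α * e)
  have k5 := key e (A * U)
  have k6 := key e (A * b ^ 2)
  have e1 : 2 / η = 2 * (1 / η) := by ring
  rw [e1]
  set w := 1 / η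
  have p1 : 0 ≤ w * (U * A ^ 2) := by positivity
  have p2 : 0 ≤ w * (U ^ 2 * A ^ 2) := by positivity
  have p3 : 0 ≤ w * (α ^ 2 * e ^ 2) := by positivity
  have p4 : 0 ≤ w * (b ^ 2 * e ^ 2) := by positivity
  have p5 : 0 ≤ η * d ^ 2 := by positivity
  have p6 : 0 ≤ (α ^ 2 + U ^ 2 + b ^ 4) * A ^ 2 + (α ^ 2 + U ^ 2 + b ^ 2) * e ^ 2 := by positivity
  have p7 : 0 ≤ U * A ^ 2 := by positivity
  nlinarith

/-! ### Vanishing and uniform control of the commutator terms. -/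

/-- A double sequence that is eventually small for large first index. -/
def Small (r : ℕ → ℕ → ℝ) : Prop := ∀ ε > 0, ∀ᶠ n in atTop, ∀ᶠ m in atTop, r n m ≤ ε

theorem Small.add {r s : ℕ → ℕ → ℝ} (hr : Small r) (hs : Small s) :
    Small fun n m => r n m + s n m := fun ε hε => by
  filter_upwards [hr (ε / 2) (by positivity), hs (ε / 2) (by positivity)] with n h1 h2
  filter_upwards [h1, h2] with m h1 h2
  linarith

theorem Small.sum {r : Fin 3 → ℕ → ℕ → ℝ} (hr : ∀ i, Small (r i)) :
    Small fun n m => ∑ i, r i n m := by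
  have := ((hr 0).add (hr 1)).add (hr 2)
  simpa only [Fin.sum_univ_three] using this

namespace HInf

/-- Cauchy sequences with respect to the `H^k` norm. -/
def CauchyNrm (k : ℕ) (x : ℕ → HInf) : Prop :=
  ∀ ε > 0, ∃ N, ∀ m ≥ N, ∀ p ≥ N, nrm k (x m - x p) ≤ ε

theorem CauchyNrm.deriv {k : ℕ} {x : ℕ → HInf} (h : CauchyNrm (k + 1) x) (i : Fin 3) :
    CauchyNrm k fun m => D i (x m) := fun ε hε => by
  obtain ⟨N, hN⟩ := h ε hε
  refine ⟨N, fun m hm p hp => ?_⟩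
  rw [← map_sub]
  exact (nrm_D_le k i _).trans (hN m hm p hp)

theorem CauchyNrm.mono {j k : ℕ} (hjk : j ≤ k) {x : ℕ → HInf} (h : CauchyNrm k x) :
    CauchyNrm j x := fun ε hε => by
  obtain ⟨N, hN⟩ := h ε hε
  exact ⟨N, fun m hm p hp => (nrm_mono hjk _).trans (hN m hm p hp)⟩

theorem CauchyNrm.exists_bound {k : ℕ} {x : ℕ → HInf} (h : CauchyNrm k x) :
    ∃ P, 0 ≤ P ∧ ∀ᶠ m in atTop, nrm k (x m) ≤ P := by
  obtain ⟨N, hN⟩ := h 1 one_pos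
  refine ⟨nrm k (x N) + 1, by have := nrm_nonneg k (x N); positivity, ?_⟩
  filter_upwards [eventually_ge_atTop N] with m hm
  have := nrm_add k (x N) (x m - x N)
  rw [add_sub_cancel] at this
  linarith [hN m hm N le_rfl]

/-- Uniformly bounded bilinear remainders that vanish on fixed arguments vanish on Cauchy
sequences. -/
theorem small_of_bilinear {T : ℕ → HInf → HInf → ℝ} {p q : ℕ} {C : ℝ} (hC : 0 ≤ C)
    (hT : ∀ n x x' y y', T n x y ≤ T n x' y' +
      C * (nrm p (x - x') * nrm q y + nrm p x' * nrm q (y - y')))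
    (hlim : ∀ x y, Tendsto (fun n => T n x y) atTop (𝓝 0)) {x y : ℕ → HInf}
    (hx : CauchyNrm p x) (hy : CauchyNrm q y) : Small fun n m => T n (x m) (y m) := fun ε hε => by
  obtain ⟨P, hP, hxP⟩ := hx.exists_bound
  obtain ⟨Q, hQ, hyQ⟩ := hy.exists_bound
  obtain ⟨N₁, hN₁⟩ := eventually_atTop.1 (hxP.and hyQ)
  set δ := ε / (2 * (C + 1) * (P + Q + 1)) with hδ
  have hδ0 : 0 < δ := by positivity
  obtain ⟨N₂, hN₂⟩ := hx δ hδ0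
  obtain ⟨N₃, hN₃⟩ := hy δ hδ0
  -- Both arguments are frozen at the index M. The error of freezing is small uniformly in n and in
  -- m ≥ M, and the frozen remainder tends to 0 as n → ∞.
  set M := max N₁ (max N₂ N₃) with hM
  have m1 : N₁ ≤ M := le_max_left _ _
  have m2 : N₂ ≤ M := (le_max_left _ _).trans (le_max_right _ _)
  have m3 : N₃ ≤ M := (le_max_right _ _).trans (le_max_right _ _)
  filter_upwards [(hlim (x M) (y M)).eventually (ge_mem_nhds (half_pos hε))] with n hn
  filter_upwards [eventually_ge_atTop M] with m hm
  have a1 := hN₂ m (m2.trans hm) M m2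
  have a2 := hN₃ m (m3.trans hm) M m3
  have a3 := (hN₁ m (m1.trans hm)).2
  have a4 := (hN₁ M m1).1
  have b1 : nrm p (x m - x M) * nrm q (y m) ≤ δ * Q :=
    mul_le_mul a1 a3 (nrm_nonneg _ _) hδ0.le
  have b2 : nrm p (x M) * nrm q (y m - y M) ≤ P * δ := mul_le_mul a4 a2 (nrm_nonneg _ _) hP
  have b3 : C * (δ * Q + P * δ) ≤ ε / 2 := by
    have : (C + 1) * (P + Q + 1) * δ = ε / 2 := by rw [hδ]; field_simp
    nlinarith [mul_nonneg hC hδ0.le, mul_nonneg hP hδ0.le, mul_nonneg hQ hδ0.le]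
  have b4 := mul_le_mul_of_nonneg_left (add_le_add b1 b2) hC
  have := hT n (x m) (x M) (y m) (y M)
  linarith

theorem tc_eq_pc (n : ℕ) (i : Fin 3) (v c : HInf) : tc n i v c = pc n v (D i c) := by
  rw [tc, pc, D_S]

theorem pc_sub (n : ℕ) (f f' g g' : HInf) :
    pc n f g = pc n f' g' + (pc n (f - f') g + pc n f' (g - g')) := by
  simp only [pc, map_sub, sub_mul, mul_sub]
  abel

theorem tendsto_nrm_pc {k : ℕ} {K : ℝ} (hK : 0 ≤ K)
    (h : ∀ f g : HInf, nrm k (f * g) ≤ K * (nrm k f * nrm k g)) (f g : HInf) :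
    Tendsto (fun n => nrm k (pc n f g)) atTop (𝓝 0) := by
  have e : ∀ n, pc n f g = (S n (f * g) - f * g) - (S n f - f) * S n g - f * (S n g - g) := fun n => by
    simp only [pc, sub_mul, mul_sub]; abel
  have hb : ∀ n, nrm k (pc n f g) ≤ nrm k (S n (f * g) - f * g) +
      K * (nrm k (S n f - f) * nrm k g) + K * (nrm k f * nrm k (S n g - g)) := fun n => by
    rw [e]
    refine (nrm_sub _ _ _).trans (add_le_add ((nrm_sub _ _ _).trans (add_le_add le_rfl ?_)) (h _ _))
    exact le_mul_mul_of_le (h _ _) hK le_rfl (nrm_S_le n k g) (nrm_nonneg _ _) (nrm_nonneg _ _)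
  have hl := ((tendsto_nrm_S_sub k (f * g)).add
    (((tendsto_nrm_S_sub k f).mul_const (nrm k g)).const_mul K)).add
    (((tendsto_nrm_S_sub k g).const_mul (nrm k f)).const_mul K)
  simp only [zero_mul, mul_zero, add_zero] at hl
  exact squeeze_zero (fun n => nrm_nonneg _ _) hb hl

/-- The uniform bound `nrm_tc_le` needs y only in H³. The limit for fixed smooth arguments may use
one derivative more, through `tc_eq_pc`. -/
theorem small_tc (i : Fin 3) {x y : ℕ → HInf} (hx : CauchyNrm 3 x) (hy : CauchyNrm 3 y) :
    Small fun n m => nrm 3 (tc n i (x m) (y m)) := by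
  obtain ⟨K, hK, h⟩ := nrm_tc_le 3 le_rfl
  obtain ⟨K', hK', h'⟩ := nrm_three_mul_le
  refine small_of_bilinear (T := fun n x y => nrm 3 (tc n i x y)) (p := 3) (q := 3) hK.le
    (fun n x x' y y' => ?_) (fun x y => ?_) hx hy
  · have e : tc n i x y = tc n i x' y' + (tc n i (x - x') y + tc n i x' (y - y')) := by
      simp only [tc_eq_pc, map_sub]; exact pc_sub n _ _ _ _
    rw [e, mul_add]
    exact (nrm_add _ _ _).trans (add_le_add le_rfl ((nrm_add _ _ _).trans (add_le_add (h _ _ _ _)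
      (h _ _ _ _))))
  · simp only [tc_eq_pc]
    exact tendsto_nrm_pc hK'.le h' _ _

theorem small_pc_three {x y : ℕ → HInf} (hx : CauchyNrm 3 x) (hy : CauchyNrm 3 y) :
    Small fun n m => nrm 3 (pc n (x m) (y m)) := by
  obtain ⟨K, hK, h⟩ := nrm_three_pc_le
  obtain ⟨K', hK', h'⟩ := nrm_three_mul_le
  refine small_of_bilinear (T := fun n x y => nrm 3 (pc n x y)) (p := 3) (q := 3) hK.le (fun n x x' y y' => ?_)
    (fun x y => tendsto_nrm_pc hK'.le h' x y) hx hy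
  rw [pc_sub n x x' y y', mul_add]
  exact (nrm_add _ _ _).trans (add_le_add le_rfl ((nrm_add _ _ _).trans (add_le_add (h _ _ _)
    (h _ _ _))))

theorem small_pc_two {x y : ℕ → HInf} (hx : CauchyNrm 2 x) (hy : CauchyNrm 2 y) :
    Small fun n m => nrm 2 (pc n (x m) (y m)) := by
  obtain ⟨K, hK, h⟩ := nrm_pc_le
  obtain ⟨K', hK', h'⟩ := nrm_mul_le_nrm
  refine small_of_bilinear (T := fun n x y => nrm 2 (pc n x y)) (p := 2) (q := 2) hK.le (fun n x x' y y' => ?_)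
    (fun x y => tendsto_nrm_pc hK'.le (h' 2 le_rfl) x y) hx hy
  rw [pc_sub n x x' y y', mul_add]
  exact (nrm_add _ _ _).trans (add_le_add le_rfl ((nrm_add _ _ _).trans (add_le_add
    (h 2 le_rfl _ _ _) (h 2 le_rfl _ _ _))))

theorem abs_ip_S_sub_le (n : ℕ) (x y : HInf) :
    |ip (S n x) (S n y) - ip x y| ≤ 2 * (nrm 0 x * nrm 0 y) := by
  have h1 : |ip (S n x) (S n y)| ≤ nrm 0 x * nrm 0 y := (abs_ip_le _ _).trans
    (mul_le_mul (nrm_S_le n 0 x) (nrm_S_le n 0 y) (nrm_nonneg _ _) (nrm_nonneg _ _))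
  have := abs_sub_le_of h1 (abs_ip_le x y)
  linarith

theorem small_ip {x y : ℕ → HInf} (hx : CauchyNrm 0 x) (hy : CauchyNrm 0 y) :
    Small fun n m => |ip (S n (x m)) (S n (y m)) - ip (x m) (y m)| := by
  refine small_of_bilinear (T := fun n x y => |ip (S n x) (S n y) - ip x y|) (p := 0) (q := 0)
    zero_le_two (fun n x x' y y' => ?_) (fun x y => ?_) hx hy
  · have e : ip (S n x) (S n y) - ip x y = (ip (S n x') (S n y') - ip x' y') +
        ((ip (S n (x - x')) (S n y) - ip (x - x') y) +
          (ip (S n x') (S n (y - y')) - ip x' (y - y'))) := by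
      simp only [map_sub, LinearMap.sub_apply]; ring
    rw [e, mul_add]
    exact (abs_add_le _ _).trans (add_le_add le_rfl ((abs_add_le _ _).trans
      (add_le_add (abs_ip_S_sub_le _ _ _) (abs_ip_S_sub_le _ _ _))))
  · have e : ∀ n, |ip (S n x) (S n y) - ip x y| ≤
        nrm 0 (S n x - x) * nrm 0 y + nrm 0 x * nrm 0 (S n y - y) := fun n => by
      have : ip (S n x) (S n y) - ip x y = ip (S n x - x) (S n y) + ip x (S n y - y) := by
        simp only [map_sub, LinearMap.sub_apply]; ring
      rw [this]
      refine (abs_add_le _ _).trans (add_le_add ((abs_ip_le _ _).trans ?_) (abs_ip_le _ _))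
      exact mul_le_mul_of_nonneg_left (nrm_S_le n 0 y) (nrm_nonneg _ _)
    have hl := ((tendsto_nrm_S_sub 0 x).mul_const (nrm 0 y)).add
      ((tendsto_nrm_S_sub 0 y).const_mul (nrm 0 x))
    simp only [zero_mul, mul_zero, add_zero] at hl
    exact squeeze_zero (fun n => abs_nonneg _) e hl

/-- The commutator terms vanish in the limit. -/
theorem small_rem (h k : Nonlin) (μ lam : ℝ) {a : ℕ → HInf} {u B : Fin 3 → ℕ → HInf}
    (ha : CauchyNrm 3 a) (hu : ∀ j, CauchyNrm 3 (u j)) (hB : ∀ j, CauchyNrm 3 (B j))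
    (hDu : ∀ i j, CauchyNrm 3 fun m => D i (u j m))
    (hF : ∀ j, CauchyNrm 0 fun m => force h k μ lam (a m) (fun j => u j m) (fun j => B j m) j) :
    Small fun n m => rem h k μ lam n (a m) (fun j => u j m) (fun j => B j m) := by
  simp only [rem]
  have b2 : ∀ j, CauchyNrm 2 (B j) := fun j => (hB j).mono (by norm_num)
  have d2 : ∀ i j, CauchyNrm 2 fun m => D i (B j m) := fun i j => (hB j).deriv i
  refine ((Small.sum fun i => small_tc i (hu i) ha).add
    (Small.sum fun i => small_pc_three ha (hDu i i))).add (Small.sum fun j => ?_)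
  exact (((Small.sum fun i => (small_pc_two (b2 i) (d2 i j)).add (small_pc_two (b2 i) (d2 j i))).add
    (Small.sum fun i => (small_pc_three (hB i) (hDu i j)).add (small_pc_three (hB j) (hDu i i)))).add
    (Small.sum fun i => small_tc i (hu i) (hB j))).add
    (small_ip ((hu j).mono (by norm_num)) (hF j))

/-- What counts is the growth: uniform in n and linear in e, so that its product with a factor
linear in e is integrable in time. -/
theorem rem_le (h k : Nonlin) (μ lam M : ℝ) : ∃ K : ℝ, 0 < K ∧
    ∀ (n : ℕ) (a : HInf) (u B : Fin 3 → HInf) (d e : ℝ), Bounds a u B M M M (3 * M) d e →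
      rem h k μ lam n a u B ≤ K * (1 + e) := by
  obtain ⟨K₁, hK₁, h₁⟩ := nrm_tc_le 3 le_rfl
  obtain ⟨K₂, hK₂, h₂⟩ := nrm_three_pc_le
  obtain ⟨K₃, hK₃, h₃⟩ := nrm_pc_le
  obtain ⟨K₄, hK₄, h₄⟩ := nrm_two_force_le h k μ lam
  set L := |M| with hL
  refine ⟨12 * (K₁ * (L * L)) + 21 * (K₂ * L) + 18 * (K₃ * (L * L)) +
    6 * (L * (K₄ * (2 * L + 3 * L ^ 3 + 3 * L ^ 2))) + 1, by positivity, fun n a u B d e hb => ?_⟩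
  obtain ⟨M0, -, -, -, -, e0⟩ := hb.nonneg
  rw [hL, abs_of_nonneg M0]
  have t1 : ∀ i (f : HInf), nrm 3 f ≤ M → nrm 3 (tc n i (u i) f) ≤ K₁ * (M * M) := fun i f hf =>
    le_mul_mul_of_le (h₁ n i _ _) hK₁.le (hb.nu i) hf (nrm_nonneg _ _) M0
  have t2 : ∀ i j (f : HInf), nrm 3 f ≤ M → nrm 3 (pc n f (D i (u j))) ≤ K₂ * (M * e) :=
    fun i j f hf => le_mul_mul_of_le (h₂ n _ _) hK₂.le hf (hb.grad_u i j) (nrm_nonneg _ _) M0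
  have t3 : ∀ i j l, nrm 2 (pc n (B i) (D j (B l))) ≤ K₃ * (M * M) := fun i j l =>
    le_mul_mul_of_le (h₃ 2 le_rfl n _ _) hK₃.le ((nrm_succ_le _ _).trans (hb.nB i))
      ((nrm_D_le 2 j _).trans (hb.nB l)) (nrm_nonneg _ _) M0
  set X := M * e + M * e + 3 * M * M ^ 2 + M * (3 * M) with hX
  have t4 : ∀ j, |ip (S n (u j)) (S n (force h k μ lam a u B j)) -
      ip (u j) (force h k μ lam a u B j)| ≤ 2 * (M * (K₄ * X)) := fun j => by
    refine (abs_ip_S_sub_le _ _ _).trans ?_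
    have := h₄ a u B M M M (3 * M) e hb.range hb.na hb.nu hb.nB hb.grad_a hb.grad_u j
    have s := mul_le_mul ((nrm_mono (by norm_num) _).trans (hb.nu j))
      ((nrm_mono (by norm_num) _).trans this) (nrm_nonneg _ _) M0 (a := nrm 0 (u j))
      (c := nrm 0 (force h k μ lam a u B j))
    linarith
  have s1 : ∑ i, nrm 3 (tc n i (u i) a) ≤ ∑ i : Fin 3, K₁ * (M * M) :=
    Finset.sum_le_sum fun i _ => t1 i a hb.na
  have s2 : ∑ i, nrm 3 (pc n a (D i (u i))) ≤ ∑ i : Fin 3, K₂ * (M * e) :=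
    Finset.sum_le_sum fun i _ => t2 i i a hb.na
  have s3 : ∑ j, (∑ i, (nrm 2 (pc n (B i) (D i (B j))) + nrm 2 (pc n (B i) (D j (B i)))) +
      ∑ i, (nrm 3 (pc n (B i) (D i (u j))) + nrm 3 (pc n (B j) (D i (u i)))) +
      ∑ i, nrm 3 (tc n i (u i) (B j)) +
      |ip (S n (u j)) (S n (force h k μ lam a u B j)) - ip (u j) (force h k μ lam a u B j)|) ≤
      ∑ j : Fin 3, (∑ i : Fin 3, (K₃ * (M * M) + K₃ * (M * M)) +
        ∑ i : Fin 3, (K₂ * (M * e) + K₂ * (M * e)) + ∑ i : Fin 3, K₁ * (M * M) +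
        2 * (M * (K₄ * X))) := by
    refine Finset.sum_le_sum fun j _ => add_le_add (add_le_add (add_le_add ?_ ?_) ?_) (t4 j)
    · exact Finset.sum_le_sum fun i _ => add_le_add (t3 _ _ _) (t3 _ _ _)
    · exact Finset.sum_le_sum fun i _ => add_le_add (t2 _ _ _ (hb.nB _)) (t2 _ _ _ (hb.nB _))
    · exact Finset.sum_le_sum fun i _ => t1 _ _ (hb.nB j)
  refine (add_le_add (add_le_add s1 s2) s3).trans ?_
  simp only [Finset.sum_const, Finset.card_univ, Fintype.card_fin, nsmul_eq_mul, Nat.cast_ofNat]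
  have p1 : 0 ≤ K₁ * (M * M) * e := by positivity
  have p2 : 0 ≤ K₂ * M := by positivity
  have p3 : 0 ≤ K₃ * (M * M) * e := by positivity
  have p4 : 0 ≤ M * (K₄ * (2 * M)) := by positivity
  have p5 : 0 ≤ M * (K₄ * (3 * M ^ 3 + 3 * M ^ 2)) * e := by positivity
  rw [hX]
  linarith

theorem abs_diss_le {μ lam σ : ℝ} {u B : Fin 3 → HInf} {d e : ℝ} (hu : ∀ i j, nrm 3 (D i (u j)) ≤ e)
    (hB : ∀ j, nrm 3 (D 0 (B j)) ≤ d ∧ nrm 3 (D 1 (B j)) ≤ d) :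
    |diss μ lam σ u B| ≤ 9 * (|μ| + |lam + μ|) * e ^ 2 + 6 * |σ| * d ^ 2 := by
  have h1 : ∑ i, ∑ j, nrm 3 (D i (u j)) ^ 2 ≤ ∑ i : Fin 3, ∑ j : Fin 3, e ^ 2 :=
    Finset.sum_le_sum fun i _ => Finset.sum_le_sum fun j _ => pow_le_pow_left₀ (nrm_nonneg _ _) (hu i j) 2
  have h2 : ∑ j, (nrm 3 (D 0 (B j)) ^ 2 + nrm 3 (D 1 (B j)) ^ 2) ≤ ∑ j : Fin 3, (d ^ 2 + d ^ 2) :=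
    Finset.sum_le_sum fun j _ => add_le_add (pow_le_pow_left₀ (nrm_nonneg _ _) (hB j).1 2)
      (pow_le_pow_left₀ (nrm_nonneg _ _) (hB j).2 2)
  have h3 := (nrm_dv_sq_le 3 u).trans h1
  simp only [Finset.sum_const, Finset.card_univ, Fintype.card_fin, nsmul_eq_mul,
    Nat.cast_ofNat] at h1 h2 h3
  have g1 : |μ * ∑ i, ∑ j, nrm 3 (D i (u j)) ^ 2| ≤ |μ| * (3 * (3 * e ^ 2)) := by
    rw [abs_mul, abs_of_nonneg (a := ∑ i, ∑ j, nrm 3 (D i (u j)) ^ 2) (by positivity)]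
    gcongr
  have g2 : |(lam + μ) * nrm 3 (dv u) ^ 2| ≤ |lam + μ| * (3 * (3 * e ^ 2)) := by
    rw [abs_mul, abs_of_nonneg (a := nrm 3 (dv u) ^ 2) (by positivity)]
    gcongr
  have g3 : |σ * ∑ j, (nrm 3 (D 0 (B j)) ^ 2 + nrm 3 (D 1 (B j)) ^ 2)| ≤ |σ| * (3 * (d ^ 2 + d ^ 2)) := by
    rw [abs_mul, abs_of_nonneg (a := ∑ j, (nrm 3 (D 0 (B j)) ^ 2 + nrm 3 (D 1 (B j)) ^ 2))
      (by positivity)]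
    gcongr
  have := abs_add_le_of (abs_add_le_of g1 g2) g3
  rw [diss]
  linarith

/-- This provides the dominating function for the limit n → ∞ in time: with M fixed, the bound is
quadratic in the two quantities known to be square integrable. -/
theorem abs_rate_le (h k : Nonlin) (μ lam σ M : ℝ) : ∃ K : ℝ, 0 < K ∧
    ∀ (n : ℕ) (a : HInf) (u B : Fin 3 → HInf) (d e : ℝ), Bounds a u B M M M (3 * M) d e →
      |rate h k μ lam σ n a u B| ≤ K * (1 + e ^ 2 + d ^ 2) := by
  obtain ⟨K₁, hK₁, h₁⟩ := rate_add_diss_le h k μ lam σ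
  obtain ⟨K₂, hK₂, h₂⟩ := rem_le h k μ lam M
  set L := |M| with hL
  refine ⟨9 * (|μ| + |lam + μ|) + 6 * |σ| +
    10 * K₁ * (2 * (L * (3 * L) ^ 2) + L * (3 * L) + L + L + (3 * L) * L + 3 * L * L ^ 2 + L + L +
      3 * L * L ^ 2 + L * (3 * L)) + 10 * (1 + L) * K₂ + 1, by positivity, fun n a u B d e hb => ?_⟩
  obtain ⟨M0, -, -, -, d0, e0⟩ := hb.nonneg
  rw [hL, abs_of_nonneg M0]
  have hm := hb.mollify n
  have t1 := abs_diss_le (μ := μ) (lam := lam) (σ := σ) hm.grad_u hm.grad_B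
  have t2 := h₁ n a u B M M M (3 * M) d e hb
  have t3 := h₂ n a u B d e hb
  have t4 : (1 + M + M + 3 * e + M) * rem h k μ lam n a u B ≤
      (1 + M + M + 3 * e + M) * (K₂ * (1 + e)) := by gcongr
  have t5 := abs_sub_le_of t2 t1
  rw [add_sub_cancel_right] at t5
  set G := 1 + e ^ 2 + d ^ 2 with hG
  have g0 : 1 ≤ G := by nlinarith
  have g1 : e ≤ G := by nlinarith
  have g2 : e ^ 2 ≤ G := by nlinarith
  have g3 : d * e ≤ G := by nlinarith [sq_nonneg (d - e)]
  have g4 : d ^ 2 ≤ G := by nlinarith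
  have g5 : (1 + M + M + 3 * e + M) * (1 + e) ≤ 10 * (1 + M) * G := by
    have q1 : (1 + e) ^ 2 ≤ 2 * G := by nlinarith [sq_nonneg (e - 1)]
    have q2 : 1 + M + M + 3 * e + M ≤ 3 * (1 + M) * (1 + e) := by nlinarith [mul_nonneg M0 e0]
    calc _ ≤ 3 * (1 + M) * (1 + e) * (1 + e) := by gcongr
      _ = 3 * (1 + M) * (1 + e) ^ 2 := by ring
      _ ≤ 3 * (1 + M) * (2 * G) := by gcongr
      _ ≤ _ := by nlinarith [mul_nonneg M0 (zero_le_one.trans g0)]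
  have g6 := mul_le_mul_of_nonneg_left g5 hK₂.le
  have f1 : M * (3 * M) ^ 2 ≤ M * (3 * M) ^ 2 * G := le_mul_of_one_le_right (by positivity) g0
  have f2 : M * (3 * M) * e ≤ M * (3 * M) * G := by gcongr
  have f3 : M * (d * e) ≤ M * G := by gcongr
  have f4 : M * e ^ 2 ≤ M * G := by gcongr
  have f5 : 3 * M * M ^ 2 * e ≤ 3 * M * M ^ 2 * G := by gcongr
  have f6 : K₁ * (M * (3 * M) ^ 2 + M * (3 * M) * e + M * d * e + (M * e ^ 2 + e * (3 * M) * M +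
      3 * M * e * M ^ 2 + M * (3 * M) ^ 2) + e * (M * e + M * e + 3 * M * M ^ 2 + M * (3 * M))) ≤
      K₁ * ((2 * (M * (3 * M) ^ 2) + M * (3 * M) + M + M + (3 * M) * M + 3 * M * M ^ 2 + M + M +
      3 * M * M ^ 2 + M * (3 * M)) * G) := by
    gcongr; linarith
  have f7 : (|μ| + |lam + μ|) * e ^ 2 ≤ (|μ| + |lam + μ|) * G := by gcongr
  have f8 : |σ| * d ^ 2 ≤ |σ| * G := by gcongr
  have f9 : 0 ≤ K₁ * ((2 * (M * (3 * M) ^ 2) + M * (3 * M) + M + M + (3 * M) * M + 3 * M * M ^ 2 +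
    M + M + 3 * M * M ^ 2 + M * (3 * M)) * G) := by positivity
  linarith

end HInf


/-! ### L² classes, weak derivatives and Sobolev spaces. -/

open Classical in
/-- The class in `L²` of a square integrable function. -/
def cls (f : Space → ℝ) : L2 := if h : MemLp f 2 volume then h.toLp f else 0

theorem cls_eq {f : Space → ℝ} (h : MemLp f 2 volume) : cls f = h.toLp f := dif_pos h

theorem coeFn_cls {f : Space → ℝ} (h : MemLp f 2 volume) : cls f =ᵐ[volume] f := by
  rw [cls_eq h]; exact h.coeFn_toLp

theorem cls_congr {f g : Space → ℝ} (h : f =ᵐ[volume] g) : cls f = cls g := by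
  by_cases hf : MemLp f 2 volume
  · rw [cls_eq hf, cls_eq (hf.ae_eq h)]; exact MemLp.toLp_congr _ _ h
  · rw [cls, cls, dif_neg hf, dif_neg (mt (fun hg => hg.ae_eq h.symm) hf)]

theorem cls_add {f g : Space → ℝ} (hf : MemLp f 2 volume) (hg : MemLp g 2 volume) :
    cls (fun x => f x + g x) = cls f + cls g := by
  rw [cls_eq hf, cls_eq hg, cls_eq (f := fun x => f x + g x) (hf.add hg)]; rfl

theorem cls_const_mul {f : Space → ℝ} (c : ℝ) (hf : MemLp f 2 volume) :
    cls (fun x => c * f x) = c • cls f := by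
  rw [cls_eq hf, cls_eq (f := fun x => c * f x) (hf.const_mul c)]; rfl

theorem cls_sub {f g : Space → ℝ} (hf : MemLp f 2 volume) (hg : MemLp g 2 volume) :
    cls (fun x => f x - g x) = cls f - cls g := by
  rw [cls_eq hf, cls_eq hg, cls_eq (f := fun x => f x - g x) (hf.sub hg)]; rfl

theorem norm_cls {f : Space → ℝ} (hf : MemLp f 2 volume) : ‖cls f‖ = (eLpNorm f 2 volume).toReal := by
  rw [cls_eq hf, Lp.norm_toLp]

theorem inner_L2_eq (F G : L2) : inner ℝ F G = ∫ x, G x * F x := by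
  rw [MeasureTheory.L2.inner_def]; rfl

theorem norm_cls_sq {f : Space → ℝ} (hf : MemLp f 2 volume) : ‖cls f‖ ^ 2 = ∫ x, f x ^ 2 := by
  rw [← real_inner_self_eq_norm_sq, inner_L2_eq]
  refine integral_congr_ae ?_
  filter_upwards [coeFn_cls hf] with x hx
  rw [hx, sq]

theorem norm_cls_le_mul {f g : Space → ℝ} {c : ℝ} (hf : AEStronglyMeasurable f volume)
    (hg : MemLp g 2 volume) (h : ∀ᵐ x, |f x| ≤ c * |g x|) : ‖cls f‖ ≤ c * ‖cls g‖ := by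
  have hfm : MemLp f 2 volume := hg.of_le_mul hf h
  apply Lp.norm_le_mul_norm_of_ae_le_mul
  filter_upwards [coeFn_cls hfm, coeFn_cls hg, h] with x h1 h2 h3
  rw [h1, h2]; exact h3

/-! ### Weak derivatives -/

theorem weakDeriv_spec {i : Fin 3} {f : Space → ℝ} (h : ∃ g, IsWeakDeriv i f g) :
    IsWeakDeriv i f (weakDeriv i f) := by
  rw [weakDeriv, dif_pos h]; exact h.choose_spec

theorem IsWeakDeriv.ae_eq {i : Fin 3} {f g g' : Space → ℝ} (h : IsWeakDeriv i f g)
    (h' : IsWeakDeriv i f g') : g =ᵐ[volume] g' := by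
  refine ae_eq_of_integral_contDiff_smul_eq h.2.1 h'.2.1 fun φ hφ hc => ?_
  have h1 := h.2.2 φ hφ hc
  have h2 := h'.2.2 φ hφ hc
  simp only [smul_eq_mul, mul_comm (φ _)]
  linarith

theorem IsWeakDeriv.weakDeriv_eq {i : Fin 3} {f g : Space → ℝ} (h : IsWeakDeriv i f g) :
    weakDeriv i f =ᵐ[volume] g := (weakDeriv_spec ⟨g, h⟩).ae_eq h

theorem locallyIntegrable_congr {f g : Space → ℝ} (hf : LocallyIntegrable f volume)
    (h : f =ᵐ[volume] g) : LocallyIntegrable g volume := fun x => by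
  obtain ⟨s, hs, hi⟩ := hf x
  exact ⟨s, hs, hi.congr_fun_ae (ae_restrict_of_ae h)⟩

theorem IsWeakDeriv.congr {i : Fin 3} {f f' g g' : Space → ℝ} (h : IsWeakDeriv i f g)
    (hf : f =ᵐ[volume] f') (hg : g =ᵐ[volume] g') : IsWeakDeriv i f' g' := by
  refine ⟨locallyIntegrable_congr h.1 hf, locallyIntegrable_congr h.2.1 hg, fun φ hφ hc => ?_⟩
  have e1 : ∫ x, f' x * fderiv ℝ φ x (EuclideanSpace.single i (1 : ℝ)) =
      ∫ x, f x * fderiv ℝ φ x (EuclideanSpace.single i (1 : ℝ)) := integral_congr_ae (by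
    filter_upwards [hf] with x hx; rw [hx])
  have e2 : ∫ x, g' x * φ x = ∫ x, g x * φ x := integral_congr_ae (by
    filter_upwards [hg] with x hx; rw [hx])
  rw [e1, e2, h.2.2 φ hφ hc]

theorem integrable_mul_test {f φ : Space → ℝ} (hf : LocallyIntegrable f volume) (hφ : Continuous φ)
    (hc : HasCompactSupport φ) : Integrable (fun x => f x * φ x) volume := by
  have := hf.integrable_smul_right_of_hasCompactSupport hφ hc
  exact this

theorem continuous_test {φ : Space → ℝ} (hφ : ContDiff ℝ ∞ φ) (i : Fin 3) :
    Continuous fun x => fderiv ℝ φ x (EuclideanSpace.single i (1 : ℝ)) :=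
  (contDiff_pd hφ i).continuous

theorem hasCompactSupport_test {φ : Space → ℝ} (hφ : HasCompactSupport φ) (i : Fin 3) :
    HasCompactSupport fun x => fderiv ℝ φ x (EuclideanSpace.single i (1 : ℝ)) :=
  hasCompactSupport_pd hφ i

theorem IsWeakDeriv.add {i : Fin 3} {f f' g g' : Space → ℝ} (h : IsWeakDeriv i f g)
    (h' : IsWeakDeriv i f' g') : IsWeakDeriv i (fun x => f x + f' x) fun x => g x + g' x := by
  refine ⟨h.1.add h'.1, h.2.1.add h'.2.1, fun φ hφ hc => ?_⟩
  have c1 := continuous_test hφ i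
  have c2 := hasCompactSupport_test hc i
  simp only [add_mul]
  rw [integral_add (integrable_mul_test h.1 c1 c2) (integrable_mul_test h'.1 c1 c2),
    integral_add (integrable_mul_test h.2.1 hφ.continuous hc)
      (integrable_mul_test h'.2.1 hφ.continuous hc), h.2.2 φ hφ hc, h'.2.2 φ hφ hc]
  ring

theorem IsWeakDeriv.const_mul {i : Fin 3} {f g : Space → ℝ} (h : IsWeakDeriv i f g) (c : ℝ) :
    IsWeakDeriv i (fun x => c * f x) fun x => c * g x := by
  refine ⟨h.1.smul c, h.2.1.smul c, fun φ hφ hc => ?_⟩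
  simp only [mul_assoc, integral_const_mul]
  rw [h.2.2 φ hφ hc, mul_neg]

theorem IsWeakDeriv.const_add {i : Fin 3} {f g : Space → ℝ} (h : IsWeakDeriv i f g) (c : ℝ) :
    IsWeakDeriv i (fun x => c + f x) g := by
  have h0 : IsWeakDeriv i (fun _ => c) (fun _ => (0 : ℝ)) := by
    refine ⟨locallyIntegrable_const c, locallyIntegrable_const 0, fun φ hφ hc => ?_⟩
    have := integral_mul_fderiv_eq_neg_fderiv_mul_of_integrable (𝕜 := ℝ) (μ := volume)
      (f := fun _ : Space => c) (g := φ) (v := EuclideanSpace.single i (1 : ℝ)) (by simp)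
      ((continuous_const.mul (continuous_test hφ i)).integrable_of_hasCompactSupport
        (hasCompactSupport_test hc i).mul_left)
      ((continuous_const.mul hφ.continuous).integrable_of_hasCompactSupport hc.mul_left)
      (fun x _ => differentiableAt_const c) (fun x _ => hφ.differentiable (by simp) x)
    simpa using this
  simpa using h0.add h

/-! ### Sobolev spaces -/

theorem MemH.memLp {k : ℕ} {f : Space → ℝ} (h : MemH k f) : MemLp f 2 volume := by
  cases k with
  | zero => exact h
  | succ k => exact h.1

theorem MemH.isWeakDeriv {k : ℕ} {f : Space → ℝ} (h : MemH (k + 1) f) (i : Fin 3) :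
    IsWeakDeriv i f (weakDeriv i f) := weakDeriv_spec (h.2 i).1

theorem MemH.deriv {k : ℕ} {f : Space → ℝ} (h : MemH (k + 1) f) (i : Fin 3) :
    MemH k (weakDeriv i f) := (h.2 i).2

theorem MemH.congr {k : ℕ} {f g : Space → ℝ} (h : MemH k f) (hfg : f =ᵐ[volume] g) : MemH k g := by
  induction k generalizing f g with
  | zero => exact MemLp.ae_eq hfg h
  | succ k ih =>
    have hw : ∀ i, IsWeakDeriv i g (weakDeriv i f) := fun i =>
      (h.isWeakDeriv i).congr hfg (ae_eq_refl _)
    exact ⟨h.memLp.ae_eq hfg, fun i => ⟨⟨_, hw i⟩, ih (h.deriv i) (hw i).weakDeriv_eq.symm⟩⟩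

theorem MemH.add {k : ℕ} {f g : Space → ℝ} (hf : MemH k f) (hg : MemH k g) :
    MemH k fun x => f x + g x := by
  induction k generalizing f g with
  | zero => exact MemLp.add hf hg
  | succ k ih =>
    have hw := fun i => (hf.isWeakDeriv i).add (hg.isWeakDeriv i)
    exact ⟨hf.memLp.add hg.memLp, fun i => ⟨⟨_, hw i⟩,
      (ih (hf.deriv i) (hg.deriv i)).congr (hw i).weakDeriv_eq.symm⟩⟩

theorem MemH.const_mul {k : ℕ} {f : Space → ℝ} (hf : MemH k f) (c : ℝ) :
    MemH k fun x => c * f x := by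
  induction k generalizing f with
  | zero => exact MemLp.const_mul hf c
  | succ k ih =>
    have hw := fun i => (hf.isWeakDeriv i).const_mul c
    exact ⟨hf.memLp.const_mul c, fun i => ⟨⟨_, hw i⟩,
      (ih (hf.deriv i)).congr (hw i).weakDeriv_eq.symm⟩⟩

theorem MemH.sub {k : ℕ} {f g : Space → ℝ} (hf : MemH k f) (hg : MemH k g) :
    MemH k fun x => f x - g x := by
  have := hf.add (hg.const_mul (-1))
  simpa [sub_eq_add_neg] using this

theorem normSqH_nonneg (k : ℕ) (f : Space → ℝ) : 0 ≤ normSqH k f := by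
  induction k generalizing f with
  | zero => exact integral_nonneg fun _ => sq_nonneg _
  | succ k ih =>
    exact add_nonneg (integral_nonneg fun _ => sq_nonneg _) (Finset.sum_nonneg fun i _ => ih _)

namespace HInf

theorem toL_eq_cls (f : HInf) : toL f = cls f.1 := (cls_eq f.memLp).symm

theorem D_SL {i : Fin 3} {f g : Space → ℝ} (h : IsWeakDeriv i f g) (hf : MemLp f 2 volume)
    (hg : MemLp g 2 volume) (n : ℕ) : D i (SL n (cls f)) = SL n (cls g) := by
  rw [SL, D_moll]
  apply Subtype.ext
  change conv ((ker n).d i) (cls f) = conv (ker n) (cls g)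
  rw [conv_congr _ (coeFn_cls hf), conv_congr _ (coeFn_cls hg)]
  exact moll_d_eq h _

theorem D_SL_weakDeriv {k : ℕ} {f : Space → ℝ} (h : MemH (k + 1) f) (i : Fin 3) (n : ℕ) :
    D i (SL n (cls f)) = SL n (cls (weakDeriv i f)) :=
  D_SL (h.isWeakDeriv i) h.memLp (h.deriv i).memLp n

theorem nrm_SL_sq_le {k : ℕ} {f : Space → ℝ} (h : MemH k f) (n : ℕ) :
    nrm k (SL n (cls f)) ^ 2 ≤ normSqH k f := by
  have h0 : nrm 0 (SL n (cls f)) ^ 2 ≤ ∫ x, f x ^ 2 := by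
    rw [← norm_cls_sq h.memLp]
    exact pow_le_pow_left₀ (nrm_nonneg _ _) (nrm_zero_SL_le n _) 2
  induction k generalizing f with
  | zero => exact h0
  | succ k ih =>
    rw [nrm_succ_sq]
    refine add_le_add h0 (Finset.sum_le_sum fun i _ => ?_)
    rw [D_SL_weakDeriv h]
    refine ih (h.deriv i) ?_
    rw [← norm_cls_sq (h.deriv i).memLp]
    exact pow_le_pow_left₀ (nrm_nonneg _ _) (nrm_zero_SL_le n _) 2

theorem nrm_SL_le {k : ℕ} {f : Space → ℝ} (h : MemH k f) (n : ℕ) :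
    nrm k (SL n (cls f)) ≤ √(normSqH k f) :=
  Real.le_sqrt_of_sq_le (nrm_SL_sq_le h n)

theorem tendsto_nrm_SL_sq {k : ℕ} {f : Space → ℝ} (h : MemH k f) :
    Tendsto (fun n => nrm k (SL n (cls f)) ^ 2) atTop (𝓝 (normSqH k f)) := by
  have h0 : Tendsto (fun n => nrm 0 (SL n (cls f)) ^ 2) atTop (𝓝 (∫ x, f x ^ 2)) := by
    rw [← norm_cls_sq h.memLp]
    simp only [← norm_toL]
    exact ((tendsto_SL (cls f)).norm).pow 2
  induction k generalizing f with
  | zero => exact h0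
  | succ k ih =>
    simp only [nrm_succ_sq]
    refine h0.add (tendsto_finsetSum _ fun i _ => ?_)
    simp only [D_SL_weakDeriv h]
    refine ih (h.deriv i) ?_
    rw [← norm_cls_sq (h.deriv i).memLp]
    simp only [← norm_toL]
    exact ((tendsto_SL _).norm).pow 2

theorem cauchyNrm_zero_iff {x : ℕ → HInf} : CauchyNrm 0 x ↔ CauchySeq fun n => toL (x n) := by
  rw [Metric.cauchySeq_iff]
  simp only [dist_eq_norm, ← map_sub, norm_toL]
  refine ⟨fun h ε hε => ?_, fun h ε hε => ?_⟩
  · obtain ⟨N, hN⟩ := h (ε / 2) (by positivity)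
    exact ⟨N, fun m hm p hp => (hN m hm p hp).trans_lt (by linarith)⟩
  · obtain ⟨N, hN⟩ := h ε hε
    exact ⟨N, fun m hm p hp => (hN m hm p hp).le⟩

theorem cauchyNrm_succ {k : ℕ} {x : ℕ → HInf} (h0 : CauchyNrm 0 x)
    (h : ∀ i, CauchyNrm k fun n => D i (x n)) : CauchyNrm (k + 1) x := fun ε hε => by
  obtain ⟨N, hN⟩ := h0 (ε / 4) (by positivity)
  choose N' hN' using fun i => h i (ε / 4) (by positivity)
  refine ⟨max N (Finset.univ.sup N'), fun m hm p hp => (nrm_succ_le_add k _).trans ?_⟩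
  have h1 := hN m ((le_max_left _ _).trans hm) p ((le_max_left _ _).trans hp)
  have h2 : ∑ i : Fin 3, nrm k (D i (x m - x p)) ≤ ∑ i : Fin 3, ε / 4 :=
    Finset.sum_le_sum fun i _ => by
      have : N' i ≤ max N (Finset.univ.sup N') :=
        (Finset.le_sup (Finset.mem_univ i)).trans (le_max_right _ _)
      rw [map_sub]
      exact hN' i m (this.trans hm) p (this.trans hp)
  simp only [Finset.sum_const, Finset.card_univ, Fintype.card_fin, nsmul_eq_mul,
    Nat.cast_ofNat] at h2
  linarith

theorem cauchyNrm_SL {k : ℕ} {f : Space → ℝ} (h : MemH k f) :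
    CauchyNrm k fun n => SL n (cls f) := by
  have h0 : ∀ F : L2, CauchyNrm 0 fun n => SL n F := fun F =>
    cauchyNrm_zero_iff.2 (tendsto_SL F).cauchySeq
  induction k generalizing f with
  | zero => exact h0 _
  | succ k ih =>
    refine cauchyNrm_succ (h0 _) fun i => ?_
    simp only [D_SL_weakDeriv h]
    exact ih (h.deriv i)

/-- The squared norm is a square of a seminorm. -/
theorem sqrt_normSqH_le {k : ℕ} {f g : Space → ℝ} (hf : MemH k f) (hg : MemH k g) :
    √(normSqH k f) ≤ √(normSqH k g) + √(normSqH k fun x => f x - g x) := by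
  have h1 : Tendsto (fun n => nrm k (SL n (cls f))) atTop (𝓝 (√(normSqH k f))) := by
    have := (tendsto_nrm_SL_sq hf).sqrt
    simpa only [Real.sqrt_sq (nrm_nonneg _ _)] using this
  refine le_of_tendsto h1 (Eventually.of_forall fun n => ?_)
  have e : SL n (cls f) = SL n (cls g) + SL n (cls fun x => f x - g x) := by
    rw [cls_sub hf.memLp hg.memLp, map_sub, add_sub_cancel]
  rw [e]
  exact (nrm_add _ _ _).trans (add_le_add (nrm_SL_le hg n) (nrm_SL_le (hf.sub hg) n))

theorem inner_toL (f g : HInf) : inner ℝ (toL f) (toL g) = ip f g := by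
  rw [inner_L2_eq, ip_def]
  refine integral_congr_ae ?_
  filter_upwards [coeFn_toL f, coeFn_toL g] with x h1 h2
  rw [h1, h2, mul_comm]

theorem denseRange_toL : DenseRange toL := fun F =>
  mem_closure_of_tendsto (tendsto_SL F) (Eventually.of_forall fun _ => ⟨_, rfl⟩)

/-- The bound makes φ ↦ -⟨f, ∂ᵢφ⟩ continuous for the L² norm on a dense subspace, and Riesz
representation of its extension is the derivative. A bound along a subsequence is enough, which is
all that Fatou's lemma provides. -/
theorem exists_isWeakDeriv_of_frequently {f : Space → ℝ} (hf : MemLp f 2 volume) {i : Fin 3} {C : ℝ}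
    (h : ∃ᶠ n in atTop, nrm 0 (D i (SL n (cls f))) ≤ C) :
    ∃ g, IsWeakDeriv i f g ∧ MemLp g 2 volume := by
  let ℓ : HInf →ₗ[ℝ] ℝ := -((innerSL ℝ (cls f)).toLinearMap ∘ₗ toL ∘ₗ D i)
  have hℓ : ∀ φ, ‖ℓ φ‖ ≤ C * ‖toL φ‖ := fun φ => by
    have e : ℓ φ = -inner ℝ (cls f) (toL (D i φ)) := rfl
    rw [e, norm_neg]
    have ht := (Tendsto.inner (𝕜 := ℝ) (tendsto_SL (cls f)) (tendsto_const_nhds (x := toL (D i φ)))).norm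
    refine le_of_tendsto_of_frequently ht (h.mono fun n hn => ?_)
    have : ip (SL n (cls f)) (D i φ) = -ip (D i (SL n (cls f))) φ := by rw [ip_D, neg_neg]
    rw [inner_toL, this, norm_neg, norm_toL]
    exact (abs_ip_le _ _).trans (mul_le_mul_of_nonneg_right hn (nrm_nonneg _ _))
  let L : L2 →L[ℝ] ℝ := ℓ.extendOfNorm toL
  have hL : ∀ φ, L (toL φ) = ℓ φ := LinearMap.extendOfNorm_eq denseRange_toL ⟨C, hℓ⟩
  let G : L2 := (InnerProductSpace.toDual ℝ L2).symm L
  refine ⟨G, ⟨hf.locallyIntegrable (by norm_num), locallyIntegrable_L2 G, fun φ hφ hc => ?_⟩,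
    Lp.memLp G⟩
  let ψ : HInf := ⟨φ, mem_hInf_of_hasCompactSupport hφ hc⟩
  have h1 : inner ℝ G (toL ψ) = -inner ℝ (cls f) (toL (D i ψ)) := by
    rw [InnerProductSpace.toDual_symm_apply, hL]; rfl
  have h2 : inner ℝ G (toL ψ) = ∫ x, G x * φ x := by
    rw [inner_L2_eq]
    refine integral_congr_ae ?_
    filter_upwards [coeFn_toL ψ] with x hx
    rw [hx, mul_comm]
  have h3 : inner ℝ (cls f) (toL (D i ψ)) =
      ∫ x, f x * fderiv ℝ φ x (EuclideanSpace.single i (1 : ℝ)) := by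
    rw [inner_L2_eq]
    refine integral_congr_ae ?_
    filter_upwards [coeFn_toL (D i ψ), coeFn_cls hf] with x hx hy
    rw [hx, hy, mul_comm]; rfl
  rw [← h2, h1, h3, neg_neg]

/-- Regularity from bounds on mollifications. -/
theorem memH_of_frequently {k : ℕ} {f : Space → ℝ} (hf : MemLp f 2 volume) {C : ℝ}
    (h : ∃ᶠ n in atTop, nrm k (SL n (cls f)) ≤ C) : MemH k f := by
  induction k generalizing f with
  | zero => exact hf
  | succ k ih =>
    have hD : ∀ i, ∃ᶠ n in atTop, nrm k (D i (SL n (cls f))) ≤ C := fun i =>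
      h.mono fun n hn => (nrm_D_le k i _).trans hn
    refine ⟨hf, fun i => ?_⟩
    obtain ⟨g, hg, hg2⟩ := exists_isWeakDeriv_of_frequently hf
      ((hD i).mono fun n hn => (nrm_zero_le k _).trans hn)
    have h2 : MemLp (weakDeriv i f) 2 volume := hg2.ae_eq hg.weakDeriv_eq.symm
    refine ⟨⟨g, hg⟩, ih h2 ?_⟩
    simpa only [D_SL (weakDeriv_spec ⟨g, hg⟩) hf h2] using hD i

end HInf


/-! ### From smooth approximations to equations for Sobolev functions. -/

namespace HInf

/-- Convergence in `L²` of smooth functions. -/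
structure L2Lim (f : ℕ → HInf) (φ : Space → ℝ) : Prop where
  memLp : MemLp φ 2 volume
  tendsto : Tendsto (fun m => toL (f m)) atTop (𝓝 (cls φ))

/-- Bounded, essentially uniform convergence of continuous functions. -/
structure ULim (f : ℕ → Space → ℝ) (φ : Space → ℝ) : Prop where
  cont : ∀ m, Continuous (f m)
  meas : AEStronglyMeasurable φ volume
  bound : ∃ c, ∀ᶠ m in atTop, ∀ x, |f m x| ≤ c
  unif : ∀ ε > 0, ∀ᶠ m in atTop, ∀ᵐ x, |f m x - φ x| ≤ ε

theorem L2Lim.congr {f : ℕ → HInf} {φ ψ : Space → ℝ} (h : L2Lim f φ) (e : φ =ᵐ[volume] ψ) :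
    L2Lim f ψ := ⟨h.memLp.ae_eq e, cls_congr e ▸ h.tendsto⟩

theorem L2Lim.cauchy {f : ℕ → HInf} {φ : Space → ℝ} (h : L2Lim f φ) : CauchyNrm 0 f :=
  cauchyNrm_zero_iff.2 h.tendsto.cauchySeq

theorem L2Lim.add {f g : ℕ → HInf} {φ γ : Space → ℝ} (hf : L2Lim f φ) (hg : L2Lim g γ) :
    L2Lim (fun m => f m + g m) fun x => φ x + γ x :=
  ⟨hf.memLp.add hg.memLp, by
    rw [cls_add hf.memLp hg.memLp]
    simp only [map_add]
    exact hf.tendsto.add hg.tendsto⟩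

theorem L2Lim.sub {f g : ℕ → HInf} {φ γ : Space → ℝ} (hf : L2Lim f φ) (hg : L2Lim g γ) :
    L2Lim (fun m => f m - g m) fun x => φ x - γ x :=
  ⟨hf.memLp.sub hg.memLp, by
    rw [cls_sub hf.memLp hg.memLp]
    simp only [map_sub]
    exact hf.tendsto.sub hg.tendsto⟩

theorem L2Lim.smul {f : ℕ → HInf} {φ : Space → ℝ} (c : ℝ) (hf : L2Lim f φ) :
    L2Lim (fun m => c • f m) fun x => c * φ x :=
  ⟨hf.memLp.const_mul c, by
    rw [cls_const_mul c hf.memLp]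
    simp only [map_smul]
    exact hf.tendsto.const_smul c⟩

theorem L2Lim.neg {f : ℕ → HInf} {φ : Space → ℝ} (hf : L2Lim f φ) :
    L2Lim (fun m => -f m) fun x => -φ x := by
  have := hf.smul (-1)
  simpa only [neg_smul, one_smul, neg_mul, one_mul] using this

theorem L2Lim.sum {f : Fin 3 → ℕ → HInf} {φ : Fin 3 → Space → ℝ} (hf : ∀ i, L2Lim (f i) (φ i)) :
    L2Lim (fun m => ∑ i, f i m) fun x => ∑ i, φ i x := by
  have := ((hf 0).add (hf 1)).add (hf 2)
  simpa only [Fin.sum_univ_three] using this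

theorem ULim.exists_abs_le {f : ℕ → Space → ℝ} {φ : Space → ℝ} (h : ULim f φ) :
    ∃ c, 0 ≤ c ∧ (∀ᶠ m in atTop, ∀ x, |f m x| ≤ c) ∧ ∀ᵐ x, |φ x| ≤ c := by
  obtain ⟨c, hc⟩ := h.bound
  obtain ⟨m, h1, h2⟩ := (hc.and (h.unif 1 one_pos)).exists
  have c0 : 0 ≤ c := (abs_nonneg _).trans (h1 0)
  refine ⟨c + 1, by positivity, hc.mono fun m hm x => (hm x).trans (by linarith), ?_⟩
  filter_upwards [h2] with x hx
  have := abs_sub_le_of (h1 x) hx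
  rwa [sub_sub_cancel] at this

/-- In fₘgₘ - φγ = fₘ(gₘ - γ) + (fₘ - φ)γ the first term uses the uniform bound on fₘ and the second
its essentially uniform convergence. -/
theorem L2Lim.mul {f : ℕ → Space → ℝ} {g p : ℕ → HInf} {φ γ : Space → ℝ} (hf : ULim f φ)
    (hg : L2Lim g γ) (hp : ∀ m x, p m x = f m x * g m x) : L2Lim p fun x => φ x * γ x := by
  obtain ⟨c, c0, hc, hφ⟩ := hf.exists_abs_le
  have hm : MemLp (fun x => φ x * γ x) 2 volume :=
    hg.memLp.of_le_mul (c := c) (hf.meas.mul hg.memLp.1) (by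
      filter_upwards [hφ] with x hx
      rw [norm_mul]; gcongr; exact hx)
  refine ⟨hm, Metric.tendsto_atTop'.2 fun ε hε => ?_⟩
  set δ := ε / (2 * (c + ‖cls γ‖ + 1)) with hδ
  have δ0 : 0 < δ := by positivity
  have hg' := (tendsto_iff_norm_sub_tendsto_zero.1 hg.tendsto).eventually (gt_mem_nhds δ0)
  obtain ⟨N, hN⟩ := eventually_atTop.1 ((hc.and (hf.unif δ δ0)).and hg')
  refine ⟨N, fun m hm' => ?_⟩
  obtain ⟨⟨h1, h2⟩, h3⟩ := hN m hm'.le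
  have m1 : MemLp (fun x => g m x - γ x) 2 volume := (g m).memLp.sub hg.memLp
  have s1 : AEStronglyMeasurable (fun x => f m x * (g m x - γ x)) volume :=
    (hf.cont m).aestronglyMeasurable.mul m1.1
  have s2 : AEStronglyMeasurable (fun x => (f m x - φ x) * γ x) volume :=
    ((hf.cont m).aestronglyMeasurable.sub hf.meas).mul hg.memLp.1
  have b1 : ∀ᵐ x, |f m x * (g m x - γ x)| ≤ c * |g m x - γ x| := Eventually.of_forall fun x => by
    rw [abs_mul]; gcongr; exact h1 x
  have b2 : ∀ᵐ x, |(f m x - φ x) * γ x| ≤ δ * |γ x| := by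
    filter_upwards [h2] with x hx
    rw [abs_mul]; gcongr
  have n1 := norm_cls_le_mul s1 m1 b1
  have n2 := norm_cls_le_mul s2 hg.memLp b2
  have e : toL (p m) - cls (fun x => φ x * γ x) =
      cls (fun x => f m x * (g m x - γ x)) + cls fun x => (f m x - φ x) * γ x := by
    rw [← cls_add (m1.of_le_mul s1 b1) (hg.memLp.of_le_mul s2 b2), toL_eq_cls,
      ← cls_sub (p m).memLp hm]
    congr 1
    funext x
    have := hp m x
    change (p m) x - _ = _
    rw [this]; ring
  rw [cls_sub (g m).memLp hg.memLp, ← toL_eq_cls] at n1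
  rw [dist_eq_norm, e]
  have t := norm_add_le (cls fun x => f m x * (g m x - γ x)) (cls fun x => (f m x - φ x) * γ x)
  have q1 : c * ‖toL (g m) - cls γ‖ ≤ c * δ := by gcongr
  have q2 : δ * (2 * (c + ‖cls γ‖ + 1)) = ε := by rw [hδ]; field_simp
  nlinarith [norm_nonneg (cls γ)]

theorem ULim.comp {f : ℕ → Space → ℝ} {φ : Space → ℝ} (hf : ULim f φ) {G : ℝ → ℝ}
    (hG : Continuous G) : ULim (fun m x => G (f m x)) fun x => G (φ x) := by
  obtain ⟨c, c0, hc, hφ⟩ := hf.exists_abs_le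
  refine ⟨fun m => hG.comp (hf.cont m), hG.comp_aestronglyMeasurable hf.meas, ?_, fun ε hε => ?_⟩
  · obtain ⟨c', -, h⟩ := exists_abs_le_of_continuous hG c
    exact ⟨c', hc.mono fun m hm x => h _ (hm x)⟩
  · have hu := (isCompact_Icc (a := -c) (b := c)).uniformContinuousOn_of_continuous hG.continuousOn
    obtain ⟨δ, δ0, h⟩ := Metric.uniformContinuousOn_iff.1 hu ε hε
    filter_upwards [hc, hf.unif (δ / 2) (by positivity)] with m h1 h2
    filter_upwards [h2, hφ] with x h2 h3
    have := h (f m x) (abs_le.1 (h1 x)) (φ x) (abs_le.1 h3) (by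
      rw [Real.dist_eq]; linarith)
    rw [Real.dist_eq] at this
    exact this.le

/-- The Sobolev embedding makes the sequence uniformly Cauchy; an almost everywhere convergent
subsequence identifies the limit with φ. -/
theorem L2Lim.uLim {f : ℕ → HInf} {φ : Space → ℝ} (hφ : L2Lim f φ) (hf : CauchyNrm 2 f) :
    ULim (fun m x => f m x) φ := by
  obtain ⟨K, hK, h⟩ := sup_le
  refine ⟨fun m => (f m).continuous, hφ.memLp.1, ?_, fun ε hε => ?_⟩
  · obtain ⟨P, hP, hb⟩ := hf.exists_bound
    exact ⟨K * P, hb.mono fun m hm x => (h _ x).trans (by gcongr)⟩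
  · obtain ⟨N, hN⟩ := hf (ε / K) (by positivity)
    obtain ⟨ns, hns, ha⟩ := (tendstoInMeasure_of_tendsto_Lp hφ.tendsto).exists_seq_tendsto_ae
    filter_upwards [eventually_ge_atTop N] with m hm
    filter_upwards [ha, ae_all_iff.2 fun p => coeFn_toL (f p), coeFn_cls hφ.memLp] with x h1 h2 h3
    rw [h3] at h1
    simp only [h2] at h1
    refine le_of_tendsto ((tendsto_const_nhds.sub h1).abs) ?_
    filter_upwards [hns.tendsto_atTop.eventually_ge_atTop N] with p hp
    have e1 := h (f m - f (ns p)) x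
    rw [sub_apply] at e1
    refine e1.trans ?_
    have := hN m hm (ns p) hp
    calc K * nrm 2 (f m - f (ns p)) ≤ K * (ε / K) := by gcongr
      _ = ε := by field_simp

theorem L2Lim.tendsto_integral {f : ℕ → HInf} {φ ψ : Space → ℝ} (h : L2Lim f φ)
    (hψ : Continuous ψ) (hc : HasCompactSupport ψ) :
    Tendsto (fun m => ∫ x, f m x * ψ x) atTop (𝓝 (∫ x, φ x * ψ x)) := by
  have hm : MemLp ψ 2 volume := hψ.memLp_of_hasCompactSupport hc
  have e : ∀ (F : L2) (g : Space → ℝ), F =ᵐ[volume] g → inner ℝ (cls ψ) F = ∫ x, g x * ψ x :=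
    fun F g hg => by
    rw [inner_L2_eq]
    refine integral_congr_ae ?_
    filter_upwards [hg, coeFn_cls hm] with x h1 h2
    rw [h1, h2]
  have ht := Tendsto.inner (𝕜 := ℝ) (tendsto_const_nhds (x := cls ψ)) h.tendsto
  rw [e _ _ (coeFn_cls h.memLp)] at ht
  exact ht.congr fun m => e _ _ (coeFn_toL (f m))

theorem ULim.locallyIntegrable {f : ℕ → Space → ℝ} {φ : Space → ℝ} (h : ULim f φ) :
    LocallyIntegrable φ volume := by
  obtain ⟨c, -, -, hφ⟩ := h.exists_abs_le
  exact (memLp_top_of_bound h.meas c hφ).locallyIntegrable le_top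

theorem ULim.tendsto_integral {f : ℕ → Space → ℝ} {φ ψ : Space → ℝ} (h : ULim f φ)
    (hψ : Continuous ψ) (hc : HasCompactSupport ψ) :
    Tendsto (fun m => ∫ x, f m x * ψ x) atTop (𝓝 (∫ x, φ x * ψ x)) := by
  have hi : Integrable (fun x => |ψ x|) volume := (hψ.integrable_of_hasCompactSupport hc).abs
  rw [tendsto_iff_norm_sub_tendsto_zero, Metric.tendsto_atTop']
  intro ε hε
  set I := ∫ x, |ψ x| with hI
  have I0 : 0 ≤ I := integral_nonneg fun _ => abs_nonneg _
  obtain ⟨N, hN⟩ := eventually_atTop.1 (h.unif (ε / (I + 1)) (by positivity))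
  refine ⟨N, fun m hm => ?_⟩
  rw [dist_zero_right, norm_norm, ← integral_sub
    (integrable_mul_test (h.cont m).locallyIntegrable hψ hc)
    (integrable_mul_test h.locallyIntegrable hψ hc)]
  have : ‖∫ x, (f m x * ψ x - φ x * ψ x)‖ ≤ ∫ x, ε / (I + 1) * |ψ x| := by
    refine norm_integral_le_of_norm_le (hi.const_mul _) ?_
    filter_upwards [hN m hm.le] with x hx
    rw [← sub_mul, norm_mul, Real.norm_eq_abs, Real.norm_eq_abs]
    gcongr
  refine this.trans_lt ?_
  rw [integral_const_mul, ← hI, div_mul_eq_mul_div, div_lt_iff₀ (by positivity)]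
  nlinarith

theorem isWeakDeriv_of_tendsto {i : Fin 3} {f : ℕ → HInf} {φ γ : Space → ℝ}
    (hφ : LocallyIntegrable φ volume)
    (hf : ∀ ψ : Space → ℝ, Continuous ψ → HasCompactSupport ψ →
      Tendsto (fun m => ∫ x, f m x * ψ x) atTop (𝓝 (∫ x, φ x * ψ x)))
    (hg : L2Lim (fun m => D i (f m)) γ) : IsWeakDeriv i φ γ := by
  refine ⟨hφ, hg.memLp.locallyIntegrable (by norm_num), fun ψ hψ hc => ?_⟩
  refine tendsto_nhds_unique (hf _ (continuous_test hψ i) (hasCompactSupport_test hc i)) ?_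
  refine ((hg.tendsto_integral hψ.continuous hc).neg).congr fun m => ?_
  exact ((isWeakDeriv i (f m)).2.2 ψ hψ hc).symm

theorem L2Lim.isWeakDeriv {i : Fin 3} {f : ℕ → HInf} {φ γ : Space → ℝ} (hf : L2Lim f φ)
    (hg : L2Lim (fun m => D i (f m)) γ) : IsWeakDeriv i φ γ :=
  isWeakDeriv_of_tendsto (hf.memLp.locallyIntegrable (by norm_num))
    (fun _ h1 h2 => hf.tendsto_integral h1 h2) hg

/-- The regularisations of a square integrable function. -/
def approx (f : Space → ℝ) (m : ℕ) : HInf := SL m (cls f)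

theorem L2Lim.approx {f : Space → ℝ} (hf : MemLp f 2 volume) : L2Lim (approx f) f :=
  ⟨hf, tendsto_SL _⟩

theorem D_approx {k : ℕ} {f : Space → ℝ} (h : MemH (k + 1) f) (i : Fin 3) (m : ℕ) :
    D i (approx f m) = approx (weakDeriv i f) m := D_SL_weakDeriv h i m

theorem L2Lim.D_approx {k : ℕ} {f : Space → ℝ} (h : MemH (k + 1) f) (i : Fin 3) :
    L2Lim (fun m => D i (HInf.approx f m)) (weakDeriv i f) := by
  simp only [HInf.D_approx h]
  exact .approx (h.deriv i).memLp

theorem L2Lim.D_D_approx {k : ℕ} {f : Space → ℝ} (h : MemH (k + 2) f) (i j : Fin 3) :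
    L2Lim (fun m => D j (D i (HInf.approx f m))) (weakDeriv j (weakDeriv i f)) := by
  simp only [HInf.D_approx h]
  exact .D_approx (h.deriv i) j

theorem ULim.approx {f : Space → ℝ} (h : MemH 3 f) : ULim (fun m x => approx f m x) f :=
  (L2Lim.approx h.memLp).uLim ((cauchyNrm_SL h).mono (by norm_num))

/-- The regularisations of a vector field. -/
def approxv (u : Fin 3 → Space → ℝ) (m : ℕ) (j : Fin 3) : HInf := approx (u j) m

theorem L2Lim.mul_D_approx {f g : Space → ℝ} (hf : MemH 3 f) (hg : MemH 3 g) (i : Fin 3) :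
    L2Lim (fun m => HInf.approx f m * D i (HInf.approx g m)) fun x => f x * weakDeriv i g x :=
  .mul (ULim.approx hf) (.D_approx hg i) fun _ _ => rfl

variable {a : Space → ℝ} {u B : Fin 3 → Space → ℝ}

theorem tendsto_dv (hu : ∀ j, MemH 3 (u j)) :
    L2Lim (fun m => dv (approxv u m)) (divergence u) :=
  L2Lim.sum fun i => .D_approx (hu i) i

theorem tendsto_D_dv (hu : ∀ j, MemH 3 (u j)) (j : Fin 3) :
    L2Lim (fun m => D j (dv (approxv u m))) (weakDeriv j (divergence u)) := by
  have h : L2Lim (fun m => D j (dv (approxv u m)))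
      fun x => ∑ i, weakDeriv j (weakDeriv i (u i)) x := by
    simp only [dv, map_sum]
    exact L2Lim.sum fun i => .D_D_approx (hu i) i j
  exact h.congr (L2Lim.isWeakDeriv (tendsto_dv hu) h).weakDeriv_eq.symm

theorem tendsto_visc (μ lam : ℝ) (hu : ∀ j, MemH 3 (u j)) (j : Fin 3) :
    L2Lim (fun m => visc μ lam (approxv u m) j) fun x =>
      μ * laplacian (u j) x + (lam + μ) * weakDeriv j (divergence u) x :=
  ((L2Lim.sum fun i => .D_D_approx (hu j) i i).smul μ).add ((tendsto_D_dv hu j).smul (lam + μ))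

theorem tendsto_transport (hu : ∀ j, MemH 3 (u j)) {f : Space → ℝ} (hf : MemH 3 f) :
    L2Lim (fun m => transport (approxv u m) (approx f m)) (advect u f) :=
  L2Lim.sum fun i => .mul_D_approx (hu i) hf i

theorem tendsto_lor (hB : ∀ j, MemH 3 (B j)) (j : Fin 3) :
    L2Lim (fun m => lor (approxv B m) (approxv B m) j) (lorentz B j) := by
  have h : L2Lim (fun m => lor (approxv B m) (approxv B m) j)
      fun x => ∑ i, B i x * (weakDeriv i (B j) x - weakDeriv j (B i) x) :=
    L2Lim.sum fun i => .mul (ULim.approx (hB i)) ((L2Lim.D_approx (hB j) i).sub (.D_approx (hB i) j))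
      fun _ _ => rfl
  refine h.congr (Eventually.of_forall fun x => ?_)
  fin_cases j <;> simp [lorentz, crossProduct, curl, Fin.sum_univ_three] <;> ring

theorem tendsto_rhsA (ha : MemH 3 a) (hu : ∀ j, MemH 3 (u j)) :
    L2Lim (fun m => rhsA (approx a m) (approxv u m))
      fun x => -divergence (fun i y => (1 + a y) * u i y) x := by
  have h : L2Lim (fun m => rhsA (approx a m) (approxv u m))
      fun x => -divergence u x - advect u a x - a x * divergence u x :=
    ((tendsto_dv hu).neg.sub (tendsto_transport hu ha)).sub
      (.mul (ULim.approx ha) (tendsto_dv hu) fun _ _ => rfl)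
  refine h.congr ?_
  have hw : ∀ i, weakDeriv i (fun y => (1 + a y) * u i y) =ᵐ[volume]
      fun x => weakDeriv i (u i) x + (u i x * weakDeriv i a x + a x * weakDeriv i (u i) x) := fun i => by
    refine IsWeakDeriv.weakDeriv_eq ?_
    -- The function 1 + a is not square integrable, so the constant is split off before the product
    -- rule is derived by approximation.
    have e : (fun y => (1 + a y) * u i y) = fun y => u i y + a y * u i y := by funext y; ring
    rw [e]
    refine L2Lim.isWeakDeriv (f := fun m => approx (u i) m + approx a m * approx (u i) m)
      ((L2Lim.approx (hu i).memLp).add (.mul (ULim.approx ha) (.approx (hu i).memLp) fun _ _ => rfl)) ?_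
    have e2 : ∀ m, D i (approx (u i) m + approx a m * approx (u i) m) = D i (approx (u i) m) +
        (approx (u i) m * D i (approx a m) + approx a m * D i (approx (u i) m)) := fun m => by
      rw [map_add, D_mul, mul_comm (D i (approx a m))]
    simp only [e2]
    exact (L2Lim.D_approx (hu i) i).add ((L2Lim.mul_D_approx (hu i) ha i).add
      (.mul_D_approx ha (hu i) i))
  filter_upwards [ae_all_iff.2 hw] with x hx
  simp only [divergence, hx, advect, Finset.sum_add_distrib, ← Finset.mul_sum]
  ring

theorem tendsto_rhsB (σ : ℝ) (hu : ∀ j, MemH 3 (u j)) (hB : ∀ j, MemH 3 (B j)) (j : Fin 3) :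
    L2Lim (fun m => rhsB σ (approxv u m) (approxv B m) j)
      fun x => σ * hlaplacian (B j) x - advect u (B j) x +
        (advect B (u j) x - B j x * divergence u x) := by
  have h : L2Lim (fun m => stretch (approxv B m) (approxv u m) j)
      fun x => ∑ i, (B i x * weakDeriv i (u j) x - B j x * weakDeriv i (u i) x) :=
    L2Lim.sum fun i => (L2Lim.mul_D_approx (hB i) (hu j) i).sub (.mul_D_approx (hB j) (hu i) i)
  have h2 := ((((L2Lim.D_D_approx (hB j) 0 0).add (.D_D_approx (hB j) 1 1)).smul σ).sub
    (tendsto_transport hu (hB j))).add h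
  refine h2.congr (Eventually.of_forall fun x => ?_)
  simp only [Finset.sum_sub_distrib, ← Finset.mul_sum]
  rfl

theorem tendsto_force (h k : Nonlin) (μ lam : ℝ) (ha : MemH 3 a) (hu : ∀ j, MemH 3 (u j))
    (hB : ∀ j, MemH 3 (B j)) (j : Fin 3) :
    L2Lim (fun m => force h k μ lam (approx a m) (approxv u m) (approxv B m) j) fun x =>
      h.1 (a x) * ((μ * laplacian (u j) x + (lam + μ) * weakDeriv j (divergence u) x) +
        lorentz B j x) - k.1 (a x) * weakDeriv j a x - advect u (u j) x :=
  ((L2Lim.mul ((ULim.approx ha).comp h.2.1.continuous)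
    ((tendsto_visc μ lam hu j).add (tendsto_lor hB j)) fun _ _ => rfl).sub
    (.mul ((ULim.approx ha).comp k.2.1.continuous) (.D_approx ha j) fun _ _ => rfl)).sub
    (tendsto_transport hu (hu j))

theorem tendsto_rhsU (h k : Nonlin) (μ lam : ℝ) (ha : MemH 3 a) (hu : ∀ j, MemH 3 (u j))
    (hB : ∀ j, MemH 3 (B j)) (j : Fin 3) :
    L2Lim (fun m => rhsU h k μ lam (approx a m) (approxv u m) (approxv B m) j) fun x =>
      (μ * laplacian (u j) x + (lam + μ) * weakDeriv j (divergence u) x) - weakDeriv j a x +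
        lorentz B j x + (h.1 (a x) * ((μ * laplacian (u j) x +
        (lam + μ) * weakDeriv j (divergence u) x) + lorentz B j x) -
        k.1 (a x) * weakDeriv j a x - advect u (u j) x) :=
  (((tendsto_visc μ lam hu j).sub (.D_approx ha j)).add (tendsto_lor hB j)).add
    (tendsto_force h k μ lam ha hu hB j)

/-- The chain rule. -/
theorem isWeakDeriv_comp (G : Nonlin) (c : ℝ) (ha : MemH 3 a) (j : Fin 3) :
    IsWeakDeriv j (fun y => c + G.1 (a y)) fun x => deriv G.1 (a x) * weakDeriv j a x := by
  refine IsWeakDeriv.const_add ?_ c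
  have hu := (ULim.approx ha).comp G.2.1.continuous
  refine isWeakDeriv_of_tendsto (f := fun m => comp G (approx a m)) hu.locallyIntegrable
    (fun _ h1 h2 => hu.tendsto_integral h1 h2) ?_
  simp only [D_comp]
  exact .mul ((ULim.approx ha).comp (contDiff_deriv_infty G.2.1).continuous) (.D_approx ha j)
    fun _ _ => rfl

end HInf

/-- Smooth functions near `1` extended to the line. -/
theorem exists_nonlin {f : ℝ → ℝ} (hf : ContDiffOn ℝ ∞ f (Ioi 0)) (h1 : f 1 = 0) :
    ∃ G : Nonlin, ∀ r, |r| < 3 / 4 → G.1 r = f (1 + r) := by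
  -- The cutoff is 1 on a neighbourhood of [-1/2, 1/2], so that derivatives agree there too, and
  -- vanishes before 1 + r reaches 0.
  let b : ContDiffBump (0 : ℝ) := ⟨3 / 4, 7 / 8, by norm_num, by norm_num⟩
  have hs : ContDiff ℝ ∞ fun r => b r * f (1 + r) := by
    rw [contDiff_iff_contDiffAt]
    intro r
    by_cases hr : |r| < 1
    · have h2 : ContDiffAt ℝ ∞ f (1 + r) := hf.contDiffAt (Ioi_mem_nhds (by
        have := (abs_lt.1 hr).1; linarith))
      exact b.contDiffAt.mul (h2.comp r (contDiffAt_const.add contDiffAt_id))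
    · have : (fun r => b r * f (1 + r)) =ᶠ[𝓝 r] fun _ => 0 := by
        have hopen : {s : ℝ | 7 / 8 < |s|} ∈ 𝓝 r :=
          (isOpen_lt continuous_const continuous_abs).mem_nhds (by
              change 7 / 8 < |r|; linarith)
        filter_upwards [hopen] with s hs
        have : b s = 0 := b.zero_of_le_dist (by
          rw [dist_zero_right, Real.norm_eq_abs]; exact le_of_lt hs)
        rw [this, zero_mul]
      exact contDiffAt_const.congr_of_eventuallyEq this
  refine ⟨⟨_, hs, by simp [h1]⟩, fun r hr => ?_⟩
  have : b r = 1 := b.one_of_mem_closedBall (by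
    rw [mem_closedBall_zero_iff, Real.norm_eq_abs]; exact hr.le)
  change b r * f (1 + r) = _
  rw [this, one_mul]


/-! ### Real-variable tools for the time variable. -/

theorem sub_le_integral_of_ae {g g' φ : ℝ → ℝ} {a b : ℝ} (hab : a ≤ b)
    (hd : ∀ t ∈ Icc a b, HasDerivWithinAt g (g' t) (Icc a b) t) (hφ : IntegrableOn φ (Icc a b))
    (hle : ∀ᵐ t ∂(volume.restrict (Icc a b)), g' t ≤ φ t) : g b - g a ≤ ∫ t in a..b, φ t := by
  -- Replacing φ by the maximum makes the comparison hold at every time without changing the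
  -- integral; integrability of g' is not required.
  have he : (fun t => max (φ t) (g' t)) =ᵐ[volume.restrict (Icc a b)] φ := by
    filter_upwards [hle] with t ht
    exact max_eq_left ht
  have h := intervalIntegral.sub_le_integral_of_hasDeriv_right_of_le (φ := fun t => max (φ t) (g' t)) hab
    (fun t ht => (hd t ht).continuousWithinAt)
    (fun t ht => ((hd t (Ioo_subset_Icc_self ht)).hasDerivAt
      (Icc_mem_nhds ht.1 ht.2)).hasDerivWithinAt) (hφ.congr he.symm) fun t _ => le_max_right _ _
  refine h.trans (le_of_eq (intervalIntegral.integral_congr_ae ?_))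
  have he' := (ae_restrict_iff' measurableSet_Icc).1 he
  filter_upwards [he'] with t ht hm
  rw [uIoc_of_le hab] at hm
  exact ht (Ioc_subset_Icc_self hm)

theorem absolutelyContinuousOnInterval_of_dist_le {f g : ℝ → ℝ} {a b : ℝ}
    (hg : AbsolutelyContinuousOnInterval g a b)
    (h : ∀ x ∈ uIcc a b, ∀ y ∈ uIcc a b, dist (f x) (f y) ≤ dist (g x) (g y)) :
    AbsolutelyContinuousOnInterval f a b := by
  refine squeeze_zero' (Eventually.of_forall fun _ => Finset.sum_nonneg fun _ _ => dist_nonneg) ?_ hg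
  filter_upwards [mem_inf_of_right (mem_principal_self _)] with I hI
  exact Finset.sum_le_sum fun i hi => h _ (hI.1 i hi).1 _ (hI.1 i hi).2

/-- Limits of functions with one-sided control of the derivative. -/
theorem ae_deriv_le_of_tendsto {T : ℝ} (hT : 0 < T) {E G R : ℝ → ℝ} {F r : ℕ → ℝ → ℝ}
    (hd : ∀ n, ∀ t ∈ Icc 0 T, HasDerivWithinAt (F n) (r n t) (Icc 0 T) t)
    (hlim : ∀ t ∈ Icc 0 T, Tendsto (fun n => F n t) atTop (𝓝 (E t)))
    (hG : IntegrableOn G (Icc 0 T)) (hR : IntegrableOn R (Icc 0 T))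
    (hb : ∀ᵐ t ∂(volume.restrict (Icc 0 T)), ∀ n, |r n t| ≤ G t)
    (hle : ∀ᵐ t ∂(volume.restrict (Icc 0 T)), ∀ ε > 0, ∀ᶠ n in atTop, r n t ≤ R t + ε) :
    AbsolutelyContinuousOnInterval E 0 T ∧
      ∀ᵐ t ∂(volume.restrict (Icc 0 T)), DifferentiableAt ℝ E t ∧ deriv E t ≤ R t := by
  have hsub : ∀ {s t}, 0 ≤ s → t ≤ T → Icc s t ⊆ Icc 0 T := fun h1 h2 => Icc_subset_Icc h1 h2
  have hd' : ∀ n s t, 0 ≤ s → t ≤ T → ∀ x ∈ Icc s t,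
      HasDerivWithinAt (F n) (r n x) (Icc s t) x := fun n s t h1 h2 x hx =>
    (hd n x (hsub h1 h2 hx)).mono (hsub h1 h2)
  have hii : ∀ {f : ℝ → ℝ}, IntegrableOn f (Icc 0 T) → IntervalIntegrable f volume 0 T := fun hf =>
    (intervalIntegrable_iff_integrableOn_Icc_of_le hT.le).2 hf
  have hst : ∀ {f : ℝ → ℝ}, IntegrableOn f (Icc 0 T) → ∀ {s t}, s ∈ Icc 0 T → t ∈ Icc 0 T →
      ∫ x in s..t, f x = (∫ x in (0 : ℝ)..t, f x) - ∫ x in (0 : ℝ)..s, f x := fun {f} hf {s t} hs ht => by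
    have h1 : ∀ z ∈ Icc 0 T, IntervalIntegrable f volume 0 z := fun z hz =>
      (hii hf).mono_set (by
        rw [uIcc_of_le hz.1, uIcc_of_le hT.le]; exact Icc_subset_Icc le_rfl hz.2)
    rw [intervalIntegral.integral_interval_sub_left (h1 t ht) (h1 s hs)]
  -- The two-sided bound on increments passes to the limit and gives absolute continuity by
  -- comparison with the primitive of G.
  have hEG : ∀ s t, 0 ≤ s → s ≤ t → t ≤ T → |E t - E s| ≤ ∫ x in s..t, G x := fun s t h0 h1 h2 => by
    have hbr := ae_restrict_of_ae_restrict_of_subset (hsub h0 h2) hb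
    have hGr := hG.mono_set (hsub h0 h2)
    have hl : Tendsto (fun n => |F n t - F n s|) atTop (𝓝 |E t - E s|) :=
      ((hlim t ⟨h0.trans h1, h2⟩).sub (hlim s ⟨h0, h1.trans h2⟩)).abs
    refine le_of_tendsto hl (Eventually.of_forall fun n => abs_le'.2 ⟨?_, ?_⟩)
    · exact sub_le_integral_of_ae h1 (hd' n s t h0 h2) hGr (by
        filter_upwards [hbr] with x hx
        exact (le_abs_self _).trans (hx n))
    · have := sub_le_integral_of_ae h1 (g := fun x => -F n x) (g' := fun x => -r n x)
        (fun x hx => (hd' n s t h0 h2 x hx).neg) hGr (by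
        filter_upwards [hbr] with x hx
        exact (neg_le_abs _).trans (hx n))
      linarith
  have hGac := (hii hG).absolutelyContinuousOnInterval_intervalIntegral (c := 0) (by simp)
  have hAC : AbsolutelyContinuousOnInterval E 0 T := by
    refine absolutelyContinuousOnInterval_of_dist_le hGac fun x hx y hy => ?_
    rw [uIcc_of_le hT.le] at hx hy
    rw [Real.dist_eq, Real.dist_eq]
    rcases le_total x y with h | h
    · rw [abs_sub_comm, abs_sub_comm _ (∫ _ in _..y, _), ← hst hG hx hy]
      exact (hEG x y hx.1 h hy.2).trans (le_abs_self _)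
    · rw [← hst hG hy hx]
      exact (hEG y x hy.1 h hx.2).trans (le_abs_self _)
  refine ⟨hAC, ?_⟩
  have hmeas : ∀ n, AEStronglyMeasurable (r n) (volume.restrict (Icc 0 T)) := fun n => by
    refine ((stronglyMeasurable_deriv (F n)).aestronglyMeasurable).congr ?_
    rw [← restrict_Ioo_eq_restrict_Icc]
    filter_upwards [ae_restrict_mem measurableSet_Ioo] with x hx
    exact ((hd n x (Ioo_subset_Icc_self hx)).hasDerivAt (Icc_mem_nhds hx.1 hx.2)).deriv
  -- Only an upper bound on the limit of the derivatives is known, so dominated convergence is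
  -- applied to the positive part of the excess.
  set φ : ℕ → ℝ → ℝ := fun n x => max (r n x - R x) 0 with hφ
  have hφm : ∀ n, AEStronglyMeasurable (φ n) (volume.restrict (Icc 0 T)) := fun n =>
    ((hmeas n).sub hR.1).sup aestronglyMeasurable_const
  have hφb : ∀ n, ∀ᵐ x ∂(volume.restrict (Icc 0 T)), ‖φ n x‖ ≤ G x + |R x| := fun n => by
    filter_upwards [hb] with x hx
    rw [hφ, Real.norm_of_nonneg (le_max_right _ _)]
    have h1 := hx n
    refine max_le ?_ (add_nonneg ((abs_nonneg _).trans h1) (abs_nonneg _))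
    have := le_abs_self (r n x)
    have := neg_abs_le (R x)
    linarith
  have hφi : ∀ n, IntegrableOn (φ n) (Icc 0 T) := fun n => (hG.add hR.abs).mono' (hφm n) (hφb n)
  have hφ0 : ∀ᵐ x ∂(volume.restrict (Icc 0 T)), Tendsto (fun n => φ n x) atTop (𝓝 0) := by
    filter_upwards [hle] with x hx
    rw [Metric.tendsto_atTop']
    intro ε hε
    obtain ⟨N, hN⟩ := eventually_atTop.1 (hx (ε / 2) (by positivity))
    refine ⟨N, fun n hn => ?_⟩
    rw [dist_zero_right, hφ, Real.norm_of_nonneg (le_max_right _ _)]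
    exact max_lt (by have := hN n hn.le; linarith) hε
  have hER : ∀ s t, 0 ≤ s → s ≤ t → t ≤ T → E t - E s ≤ ∫ x in s..t, R x := fun s t h0 h1 h2 => by
    have hRr := hR.mono_set (hsub h0 h2)
    have hl : Tendsto (fun n => F n t - F n s) atTop (𝓝 (E t - E s)) :=
      (hlim t ⟨h0.trans h1, h2⟩).sub (hlim s ⟨h0, h1.trans h2⟩)
    have hDCT : Tendsto (fun n => ∫ x in Icc s t, (R x + φ n x)) atTop (𝓝 (∫ x in Icc s t, R x)) := by
      have := tendsto_integral_of_dominated_convergence (μ := volume.restrict (Icc s t))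
        (F := fun n x => R x + φ n x) (f := R) (fun x => |R x| + (G x + |R x|))
        (fun n => hRr.1.add ((hφm n).mono_measure (Measure.restrict_mono (hsub h0 h2) le_rfl)))
        (hRr.abs.add ((hG.mono_set (hsub h0 h2)).add hRr.abs)) (fun n => by
          filter_upwards [ae_restrict_of_ae_restrict_of_subset (hsub h0 h2) (hφb n)] with x hx
          exact (norm_add_le _ _).trans (add_le_add le_rfl hx)) (by
          filter_upwards [ae_restrict_of_ae_restrict_of_subset (hsub h0 h2) hφ0] with x hx
          simpa using hx.const_add (R x))
      exact this
    rw [intervalIntegral.integral_of_le h1, ← integral_Icc_eq_integral_Ioc]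
    refine le_of_tendsto_of_tendsto' hl hDCT fun n => ?_
    have := sub_le_integral_of_ae h1 (hd' n s t h0 h2) (hRr.add ((hφi n).mono_set (hsub h0 h2)))
      (Eventually.of_forall fun x => by
        have : r n x - R x ≤ φ n x := le_max_left _ _
        simp only [Pi.add_apply]; linarith)
    rwa [intervalIntegral.integral_of_le h1, ← integral_Icc_eq_integral_Ioc] at this
  rw [← restrict_Ioo_eq_restrict_Icc, ae_restrict_iff' measurableSet_Ioo]
  filter_upwards [hAC.ae_differentiableAt, (hii hR).ae_hasDerivAt_integral] with x hx1 hx2 hx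
  have hx' : x ∈ uIcc 0 T := by rw [uIcc_of_le hT.le]; exact Ioo_subset_Icc_self hx
  have hE := hx1 hx'
  refine ⟨hE, ?_⟩
  have hI := hx2 hx' 0 (by simp)
  -- The integrated inequality says that this difference is nondecreasing, so its derivative is
  -- nonnegative wherever it exists.
  have hmono : MonotoneOn (fun y => (∫ z in (0 : ℝ)..y, R z) - E y) (Icc 0 T) :=
    fun y hy z hz hyz => by
      have := hER y z hy.1 hyz hz.2
      rw [hst hR hy hz] at this
      simp only
      linarith
  have hder := (hI.fun_sub hE.hasDerivAt).hasDerivWithinAt (s := Icc 0 T)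
  have h0 := hmono.derivWithin_nonneg (x := x)
  rw [HasDerivWithinAt.derivWithin hder
    (uniqueDiffOn_Icc hT x (Ioo_subset_Icc_self hx))] at h0
  linarith

/-- Fatou's lemma for continuous functions on an interval. -/
theorem ae_frequently_le_of_integral_le {T : ℝ} {f : ℕ → ℝ → ℝ} {C : ℝ} (hT : 0 ≤ T)
    (hc : ∀ n, ContinuousOn (f n) (Icc 0 T)) (h0 : ∀ n t, 0 ≤ f n t)
    (hb : ∀ n, ∫ t in (0 : ℝ)..T, f n t ≤ C) :
    (∀ᵐ t ∂(volume.restrict (Icc 0 T)), ∃ c : ℝ, ∃ᶠ n in atTop, f n t ≤ c) ∧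
      ∀ g : ℝ → ℝ, (∀ᵐ t ∂(volume.restrict (Icc 0 T)), Tendsto (fun n => f n t) atTop (𝓝 (g t))) →
        IntegrableOn g (Icc 0 T) := by
  have hm : ∀ n, AEMeasurable (fun t => ENNReal.ofReal (f n t)) (volume.restrict (Icc 0 T)) := fun n =>
    ((hc n).aemeasurable measurableSet_Icc).ennreal_ofReal
  have hi : ∀ n, ∫⁻ t in Icc 0 T, ENNReal.ofReal (f n t) ≤ ENNReal.ofReal C := fun n => by
    rw [← ofReal_integral_eq_lintegral_ofReal ((hc n).integrableOn_Icc)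
      (Eventually.of_forall (h0 n))]
    refine ENNReal.ofReal_le_ofReal ?_
    rw [integral_Icc_eq_integral_Ioc, ← intervalIntegral.integral_of_le hT]
    exact hb n
  have hF : ∫⁻ t in Icc 0 T, liminf (fun n => ENNReal.ofReal (f n t)) atTop ≤ ENNReal.ofReal C :=
    (lintegral_liminf_le' hm).trans (liminf_le_of_frequently_le'
      (Frequently.of_forall fun n => hi n))
  refine ⟨?_, fun g hg => ?_⟩
  · have hlm : AEMeasurable (fun t => liminf (fun n => ENNReal.ofReal (f n t)) atTop)
        (volume.restrict (Icc 0 T)) := by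
      refine ⟨_, Measurable.liminf fun n => (hm n).measurable_mk, ?_⟩
      filter_upwards [ae_all_iff.2 fun n => (hm n).ae_eq_mk] with t ht
      simp only [ht]
    have hfin := ae_lt_top' hlm (hF.trans_lt ENNReal.ofReal_lt_top).ne
    filter_upwards [hfin] with t ht
    obtain ⟨c, hc1, hc2⟩ := exists_between ht
    refine ⟨c.toReal, (frequently_lt_of_liminf_lt (by isBoundedDefault) hc1).mono fun n hn => ?_⟩
    exact (ENNReal.ofReal_le_iff_le_toReal hc2.ne).1 hn.le
  · have hgm : AEStronglyMeasurable g (volume.restrict (Icc 0 T)) :=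
      aestronglyMeasurable_of_tendsto_ae atTop
        (fun n => (hc n).aestronglyMeasurable measurableSet_Icc) hg
    refine ⟨hgm, ?_⟩
    have hg0 : ∀ᵐ t ∂(volume.restrict (Icc 0 T)), 0 ≤ g t := by
      filter_upwards [hg] with t ht
      exact ge_of_tendsto' ht fun n => h0 n t
    rw [hasFiniteIntegral_iff_ofReal hg0]
    refine lt_of_le_of_lt (le_of_eq (lintegral_congr_ae ?_)) (hF.trans_lt ENNReal.ofReal_lt_top)
    filter_upwards [hg] with t ht
    exact ((ENNReal.tendsto_ofReal ht).liminf_eq).symm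

/-! ### Continuous bilinear functionals on L². -/

namespace HInf

/-- Continuous bilinear functionals of vectors of square integrable functions. -/
def Quad (Φ : (Fin 3 → L2) → (Fin 3 → L2) → ℝ) : Prop :=
  ∃ b : (Fin 3 → L2) →L[ℝ] (Fin 3 → L2) →L[ℝ] ℝ, ∀ X Y, Φ X Y = b X Y

variable {Φ Ψ : (Fin 3 → L2) → (Fin 3 → L2) → ℝ}

theorem Quad.add (h : Quad Φ) (h' : Quad Ψ) : Quad fun X Y => Φ X Y + Ψ X Y := by
  obtain ⟨b, hb⟩ := h
  obtain ⟨b', hb'⟩ := h'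
  exact ⟨b + b', fun X Y => by simp only [hb, hb']; rfl⟩

theorem Quad.const_mul (c : ℝ) (h : Quad Φ) : Quad fun X Y => c * Φ X Y := by
  obtain ⟨b, hb⟩ := h
  exact ⟨c • b, fun X Y => by simp only [hb]; rfl⟩

theorem Quad.sum {Φ : Fin 3 → (Fin 3 → L2) → (Fin 3 → L2) → ℝ} (h : ∀ i, Quad (Φ i)) :
    Quad fun X Y => ∑ i, Φ i X Y := by
  have := ((h 0).add (h 1)).add (h 2)
  simpa only [Fin.sum_univ_three] using this

/-- Bilinear forms on smooth functions give continuous bilinear functionals after mollification. -/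
theorem quad_of_le (β : HInf →ₗ[ℝ] HInf →ₗ[ℝ] ℝ) (m : ℕ)
    (h : ∀ f g, |β f g| ≤ nrm m f * nrm m g) (n : ℕ) (i j : Fin 3) :
    Quad fun X Y => β (SL n (X i)) (SL n (Y j)) := by
  obtain ⟨C, hC, hb⟩ := exists_nrm_moll_le m (ker n)
  let b : L2 →L[ℝ] L2 →L[ℝ] ℝ := LinearMap.mkContinuous₂ (β.compl₁₂ (SL n) (SL n)) (C * C)
    fun F G => (h _ _).trans ((mul_le_mul (hb F) (hb G) (nrm_nonneg _ _)
      (mul_nonneg hC (norm_nonneg _))).trans (le_of_eq (by ring)))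
  exact ⟨b.bilinearComp (ContinuousLinearMap.proj i) (ContinuousLinearMap.proj j), fun X Y => rfl⟩

theorem Quad.hasDerivWithinAt (h : Quad Φ) {X : ℝ → Fin 3 → L2} {X' : Fin 3 → L2} {s : Set ℝ} {t : ℝ}
    (hX : ∀ i, HasDerivWithinAt (fun t => X t i) (X' i) s t) :
    HasDerivWithinAt (fun t => Φ (X t) (X t)) (Φ (X t) X' + Φ X' (X t)) s t := by
  obtain ⟨b, hb⟩ := h
  have hX' : HasDerivWithinAt X X' s t := hasDerivWithinAt_pi.2 hX
  simp only [hb]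
  exact b.hasDerivWithinAt_of_bilinear hX' hX'

theorem Quad.tendsto (h : Quad Φ) {ι : Type*} {l : Filter ι} {X Y : ι → Fin 3 → L2} {X' Y' : Fin 3 → L2}
    (hX : ∀ i, Tendsto (fun m => X m i) l (𝓝 (X' i))) (hY : ∀ i, Tendsto (fun m => Y m i) l (𝓝 (Y' i))) :
    Tendsto (fun m => Φ (X m) (Y m)) l (𝓝 (Φ X' Y')) := by
  obtain ⟨b, hb⟩ := h
  simp only [hb]
  exact (b.continuous₂.tendsto (X', Y')).comp
    ((tendsto_pi_nhds.2 hX).prodMk_nhds (tendsto_pi_nhds.2 hY))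

end HInf

theorem HasTimeDeriv.hasDerivWithinAt {T : ℝ} {f f' : ℝ → Space → ℝ} (h : HasTimeDeriv T f f')
    (hf : ∀ t ∈ Icc 0 T, MemLp (f t) 2 volume) {t : ℝ} (ht : t ∈ Icc 0 T) :
    HasDerivWithinAt (fun s => cls (f s)) (cls (f' t)) (Icc 0 T) t := by
  obtain ⟨hm, hl⟩ := h t ht
  rw [hasDerivWithinAt_iff_tendsto_slope, tendsto_iff_norm_sub_tendsto_zero]
  have hl' := (ENNReal.tendsto_toReal ENNReal.zero_ne_top).comp hl
  refine hl'.congr' ?_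
  filter_upwards [self_mem_nhdsWithin] with s hs
  have m1 : MemLp (fun x => f s x - f t x) 2 volume := (hf s hs.1).sub (hf t ht)
  have m2 : MemLp (fun x => (s - t)⁻¹ * (f s x - f t x)) 2 volume := m1.const_mul _
  rw [slope_def_module, ← cls_sub (hf s hs.1) (hf t ht), ← cls_const_mul _ m1, ← cls_sub m2 hm]
  exact (norm_cls (m2.sub hm)).symm

theorem ContinuousInH.exists_bound {k : ℕ} {T : ℝ} {f : ℝ → Space → ℝ} (h : ContinuousInH k T f) :
    ∃ M, ∀ t ∈ Icc 0 T, √(normSqH k (f t)) ≤ M := by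
  -- Continuity gives a local bound by the triangle inequality, and compactness patches these bounds
  -- together.
  refine isCompact_Icc.induction_on (p := fun s => ∃ M, ∀ t ∈ s, √(normSqH k (f t)) ≤ M)
    ⟨0, fun t ht => ht.elim⟩ ?_ ?_ ?_ |>.imp fun M hM t ht => hM t ht
  · rintro s s' hs ⟨M, hM⟩
    exact ⟨M, fun t ht => hM t (hs ht)⟩
  · rintro s s' ⟨M, hM⟩ ⟨M', hM'⟩
    exact ⟨max M M', fun t ht => ht.elim (fun h => (hM t h).trans (le_max_left _ _))
      fun h => (hM' t h).trans (le_max_right _ _)⟩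
  · intro t ht
    obtain ⟨hm, hl⟩ := h t ht
    refine ⟨{s | s ∈ Icc 0 T ∧ normSqH k (fun x => f s x - f t x) ≤ 1},
      inter_mem self_mem_nhdsWithin (hl.eventually (ge_mem_nhds one_pos)),
      √(normSqH k (f t)) + 1, fun s hs => ?_⟩
    refine (HInf.sqrt_normSqH_le (h s hs.1).1 hm).trans (add_le_add le_rfl ?_)
    exact Real.sqrt_le_one.2 hs.2


/-! ### Solutions as differentiable curves in L². -/

open HInf

/-- Solutions of the system as curves in `L²`. -/
structure Flow (h k : Nonlin) (μ lam σ T M : ℝ) (a : ℝ → Space → ℝ) (u B : ℝ → Fin 3 → Space → ℝ) :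
    Prop where
  a3 : ∀ t ∈ Icc 0 T, MemH 3 (a t)
  u3 : ∀ t ∈ Icc 0 T, ∀ j, MemH 3 (u t j)
  B3 : ∀ t ∈ Icc 0 T, ∀ j, MemH 3 (B t j)
  range : ∀ t ∈ Icc 0 T, ∀ᵐ x, |a t x| ≤ 1 / 2
  div_B : ∀ t ∈ Icc 0 T, ∀ᵐ x, divergence (B t) x = 0
  bound_a : ∀ t ∈ Icc 0 T, √(normSqH 3 (a t)) ≤ M
  bound_u : ∀ t ∈ Icc 0 T, √(vnormSqH 3 (u t)) ≤ M
  bound_B : ∀ t ∈ Icc 0 T, √(vnormSqH 3 (B t)) ≤ M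
  deriv_a : ∃ A' : ℝ → L2, ∀ t ∈ Icc 0 T,
    HasDerivWithinAt (fun s => cls (a s)) (A' t) (Icc 0 T) t ∧
      Tendsto (fun m => toL (rhsA (approx (a t) m) (approxv (u t) m))) atTop (𝓝 (A' t))
  deriv_u : ∃ U' : ℝ → Fin 3 → L2, ∀ t ∈ Icc 0 T, ∀ j,
    HasDerivWithinAt (fun s => cls (u s j)) (U' t j) (Icc 0 T) t ∧
      Tendsto (fun m => toL (rhsU h k μ lam (approx (a t) m) (approxv (u t) m) (approxv (B t) m) j))
        atTop (𝓝 (U' t j))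
  deriv_B : ∃ B' : ℝ → Fin 3 → L2, ∀ t ∈ Icc 0 T, ∀ j,
    HasDerivWithinAt (fun s => cls (B s j)) (B' t j) (Icc 0 T) t ∧
      Tendsto (fun m => toL (rhsB σ (approxv (u t) m) (approxv (B t) m) j)) atTop (𝓝 (B' t j))

theorem normSqH_le_vnormSqH (k : ℕ) (u : Fin 3 → Space → ℝ) (j : Fin 3) :
    normSqH k (u j) ≤ vnormSqH k u :=
  Finset.single_le_sum (f := fun j => normSqH k (u j)) (fun _ _ => normSqH_nonneg k _)
    (Finset.mem_univ j)

theorem vnormSqH_nonneg (k : ℕ) (u : Fin 3 → Space → ℝ) : 0 ≤ vnormSqH k u :=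
  Finset.sum_nonneg fun _ _ => normSqH_nonneg _ _

theorem gradNormSqH_nonneg (k : ℕ) (u : Fin 3 → Space → ℝ) : 0 ≤ gradNormSqH k u :=
  Finset.sum_nonneg fun _ _ => Finset.sum_nonneg fun _ _ => normSqH_nonneg _ _

theorem hgradNormSqH_nonneg (k : ℕ) (u : Fin 3 → Space → ℝ) : 0 ≤ hgradNormSqH k u :=
  Finset.sum_nonneg fun _ _ => add_nonneg (normSqH_nonneg _ _) (normSqH_nonneg _ _)

theorem normSqH_weakDeriv_le_gradNormSqH (k : ℕ) (u : Fin 3 → Space → ℝ) (i j : Fin 3) :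
    normSqH k (weakDeriv i (u j)) ≤ gradNormSqH k u :=
  (Finset.single_le_sum (f := fun j => normSqH k (weakDeriv i (u j)))
    (fun _ _ => normSqH_nonneg k _) (Finset.mem_univ j)).trans
    (Finset.single_le_sum (f := fun i => ∑ j, normSqH k (weakDeriv i (u j)))
      (fun _ _ => Finset.sum_nonneg fun _ _ => normSqH_nonneg k _) (Finset.mem_univ i))

theorem normSqH_weakDeriv_le_hgradNormSqH (k : ℕ) (u : Fin 3 → Space → ℝ) (j : Fin 3) :
    normSqH k (weakDeriv 0 (u j)) ≤ hgradNormSqH k u ∧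
      normSqH k (weakDeriv 1 (u j)) ≤ hgradNormSqH k u := by
  have h : normSqH k (weakDeriv 0 (u j)) + normSqH k (weakDeriv 1 (u j)) ≤ hgradNormSqH k u :=
    Finset.single_le_sum
      (f := fun j => normSqH k (weakDeriv 0 (u j)) + normSqH k (weakDeriv 1 (u j)))
      (fun _ _ => add_nonneg (normSqH_nonneg k _) (normSqH_nonneg k _)) (Finset.mem_univ j)
  have h0 := normSqH_nonneg k (weakDeriv 0 (u j))
  have h1 := normSqH_nonneg k (weakDeriv 1 (u j))
  exact ⟨by linarith, by linarith⟩

theorem ContinuousInH.exists_bound_vnorm {k : ℕ} {T : ℝ} {f : ℝ → Fin 3 → Space → ℝ}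
    (h : ∀ j, ContinuousInH k T fun t => f t j) :
    ∃ M, ∀ t ∈ Icc 0 T, √(vnormSqH k (f t)) ≤ M := by
  choose M hM using fun j => (h j).exists_bound
  refine ⟨√(∑ j, M j ^ 2), fun t ht => Real.sqrt_le_sqrt (Finset.sum_le_sum fun j _ => ?_)⟩
  rw [← Real.sq_sqrt (normSqH_nonneg k (f t j))]
  exact pow_le_pow_left₀ (Real.sqrt_nonneg _) (hM j t ht) 2

/-- Solutions of the system are flows. -/
theorem exists_flow {P : ℝ → ℝ} (hP : ContDiffOn ℝ ∞ P (Ioi 0)) (hP1 : deriv P 1 = 1) :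
    ∃ h k : Nonlin, (∀ r, |r| ≤ 1 / 2 → -(1 / 2) ≤ h.1 r) ∧
      ∀ (μ lam σ T : ℝ) (a : ℝ → Space → ℝ) (u B : ℝ → Fin 3 → Space → ℝ),
        IsSolution μ lam σ P T a u B → (∀ t ∈ Icc 0 T, ∀ᵐ x, |a t x| ≤ 1 / 2) →
        ∃ M, Flow h k μ lam σ T M a u B := by
  have hPd : ContDiffOn ℝ ∞ (deriv P) (Ioi 0) :=
    ((contDiffOn_infty_iff_deriv_of_isOpen isOpen_Ioi).1 hP).2
  have hne : ∀ x ∈ Ioi (0 : ℝ), x ≠ 0 := fun x hx => ne_of_gt hx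
  -- As functions of a = ρ - 1, the three nonlinearities are 1/ρ - 1, P'(ρ)/ρ - 1 and P(ρ) - P(1).
  -- The second vanishes at a = 0 because P'(1) = 1.
  obtain ⟨h, hh⟩ := exists_nonlin (f := fun r => r⁻¹ - 1)
    ((contDiffOn_id.inv hne).sub contDiffOn_const) (by norm_num)
  obtain ⟨k, hk⟩ := exists_nonlin (f := fun r => deriv P r / r - 1)
    ((hPd.div contDiffOn_id hne).sub contDiffOn_const) (by norm_num [hP1])
  obtain ⟨p, hp⟩ := exists_nonlin (f := fun r => P r - P 1) (hP.sub contDiffOn_const) (by norm_num)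
  refine ⟨h, k, fun r hr => ?_, fun μ lam σ T a u B hs ha => ?_⟩
  · rw [hh r (by linarith)]
    obtain ⟨r1, r2⟩ := abs_le.1 hr
    have : (3 / 2 : ℝ)⁻¹ ≤ (1 + r)⁻¹ := inv_anti₀ (by linarith) (by linarith)
    norm_num at this
    linarith
  obtain ⟨Ma, hMa⟩ := hs.continuous_a.exists_bound
  obtain ⟨Mu, hMu⟩ := ContinuousInH.exists_bound_vnorm hs.continuous_u
  obtain ⟨MB, hMB⟩ := ContinuousInH.exists_bound_vnorm hs.continuous_B
  have a3 : ∀ t ∈ Icc 0 T, MemH 3 (a t) := fun t ht => (hs.continuous_a t ht).1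
  have u3 : ∀ t ∈ Icc 0 T, ∀ j, MemH 3 (u t j) := fun t ht j => (hs.continuous_u j t ht).1
  have B3 : ∀ t ∈ Icc 0 T, ∀ j, MemH 3 (B t j) := fun t ht j => (hs.continuous_B j t ht).1
  have key : ∀ {f : ℕ → HInf} {φ ψ : Space → ℝ}, L2Lim f φ → ψ =ᵐ[volume] φ →
      Tendsto (fun m => toL (f m)) atTop (𝓝 (cls ψ)) := fun hf e => (hf.congr e.symm).tendsto
  refine ⟨max Ma (max Mu MB), a3, u3, B3, ha, hs.div_free,
    fun t ht => (hMa t ht).trans (le_max_left _ _),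
    fun t ht => (hMu t ht).trans ((le_max_left _ _).trans (le_max_right _ _)),
    fun t ht => (hMB t ht).trans ((le_max_right _ _).trans (le_max_right _ _)), ?_, ?_, ?_⟩
  · obtain ⟨a', h1, h2⟩ := hs.mass
    refine ⟨fun t => cls (a' t), fun t ht => ⟨h1.hasDerivWithinAt (fun t ht => (a3 t ht).memLp) ht,
      key (tendsto_rhsA (a3 t ht) (u3 t ht)) ?_⟩⟩
    filter_upwards [h2 t ht] with x hx
    linarith
  · choose u' h1 h2 using hs.momentum
    refine ⟨fun t j => cls (u' j t), fun t ht j =>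
      ⟨(h1 j).hasDerivWithinAt (fun t ht => (u3 t ht j).memLp) ht,
        key (tendsto_rhsU h k μ lam (a3 t ht) (u3 t ht) (B3 t ht) j) ?_⟩⟩
    have hw : weakDeriv j (fun y => P (1 + a t y)) =ᵐ[volume]
        fun x => deriv p.1 (a t x) * weakDeriv j (a t) x := by
      refine ((isWeakDeriv_comp p (P 1) (a3 t ht) j).congr ?_ (ae_eq_refl _)).weakDeriv_eq
      filter_upwards [ha t ht] with x hx
      rw [hp _ (by linarith)]; ring
    filter_upwards [h2 j t ht, ha t ht, hw] with x hx hax hwx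
    have hd : deriv p.1 (a t x) = deriv P (1 + a t x) := by
      have e : p.1 =ᶠ[𝓝 (a t x)] fun r => P (1 + r) - P 1 := by
        have : {s : ℝ | |s| < 3 / 4} ∈ 𝓝 (a t x) :=
          (isOpen_lt continuous_abs continuous_const).mem_nhds (by
            change |a t x| < 3 / 4; linarith)
        filter_upwards [this] with r hr
        exact hp r hr
      rw [e.deriv_eq, deriv_sub_const, deriv_comp_const_add]
    have hpos : 1 + a t x ≠ 0 := by
      have := (abs_le.1 hax).1
      intro h0; linarith
    have e1 : (1 + a t x) * (1 + h.1 (a t x)) = 1 := by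
      rw [hh _ (by linarith)]; field_simp; ring
    have e2 : (1 + a t x) * (1 + k.1 (a t x)) = deriv P (1 + a t x) := by
      rw [hk _ (by linarith)]; field_simp; ring
    rw [hwx, hd] at hx
    -- The identity is checked after multiplication by ρ, where ρ(1 + h) = 1 and ρ(1 + k) = P'(ρ)
    -- recover the original momentum equation.
    apply mul_left_cancel₀ hpos
    linear_combination hx + (-(μ * laplacian (u t j) x +
      (lam + μ) * weakDeriv j (divergence (u t)) x) - lorentz (B t) j x) * e1 +
      weakDeriv j (a t) x * e2
  · choose B' h1 h2 using hs.induction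
    refine ⟨fun t j => cls (B' j t), fun t ht j =>
      ⟨(h1 j).hasDerivWithinAt (fun t ht => (B3 t ht j).memLp) ht,
        key (tendsto_rhsB σ (u3 t ht) (B3 t ht) j) ?_⟩⟩
    filter_upwards [h2 j t ht] with x hx
    linarith

namespace HInf

/-- The form `highForm` on square integrable functions. -/
def highL (μ lam : ℝ) (n : ℕ) (X Y : Fin 3 → L2) : ℝ :=
  ∑ i, ∑ k, (μ * ∑ l, ∑ j, pair 0 (D l (D i (D k (SL n (X j))))) (D l (D i (D k (SL n (Y j))))) +
    (lam + μ) * ∑ j, ∑ l, pair 0 (D j (D i (D k (SL n (X j))))) (D l (D i (D k (SL n (Y l))))))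

theorem highForm_eq_highL (μ lam : ℝ) (n : ℕ) (u v : Fin 3 → HInf) :
    highForm μ lam n u v = highL μ lam n (fun j => toL (u j)) fun j => toL (v j) := by
  have h : ∀ f g : Fin 3 → HInf, pair 0 (dv f) (dv g) = ∑ j, ∑ l, pair 0 (D j (f j)) (D l (g l)) :=
    fun f g => by
      rw [dv.eq_1 f, map_sum, LinearMap.sum_apply]
      simp only [dv, map_sum]
  rw [highForm_eq]
  simp only [h]
  rfl

theorem highL_comm (μ lam : ℝ) (n : ℕ) (X Y : Fin 3 → L2) : highL μ lam n X Y = highL μ lam n Y X := by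
  refine Finset.sum_congr rfl fun i _ => Finset.sum_congr rfl fun k _ => ?_
  congr 2
  · simp only [pair_comm 0 (D _ (D i (D k (SL n (X _)))))]
  · rw [Finset.sum_comm]
    simp only [pair_comm 0 (D _ (D i (D k (SL n (X _)))))]

theorem quad_highL (μ lam : ℝ) (n : ℕ) : Quad (highL μ lam n) := by
  have hD : ∀ i k l (f : HInf), nrm 0 (D l (D i (D k f))) ≤ nrm 3 f := fun i k l f =>
    (nrm_D_le 0 _ _).trans ((nrm_D_le 1 _ _).trans (nrm_D_le 2 _ _))
  have h : ∀ i k l l' j j', Quad fun X Y =>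
      pair 0 (D l (D i (D k (SL n (X j))))) (D l' (D i (D k (SL n (Y j'))))) := fun i k l l' j j' =>
    quad_of_le ((pair 0).compl₁₂ (D l ∘ₗ D i ∘ₗ D k) (D l' ∘ₗ D i ∘ₗ D k)) 3
      (fun f g => (abs_pair_le _ _ _).trans
        (mul_le_mul (hD _ _ _ _) (hD _ _ _ _) (nrm_nonneg _ _) (nrm_nonneg _ _))) n j j'
  exact Quad.sum fun i => Quad.sum fun k => ((Quad.sum fun l => Quad.sum fun j =>
    h i k l l j j).const_mul μ).add ((Quad.sum fun j => Quad.sum fun l =>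
      h i k j l j l).const_mul (lam + μ))

/-- The inner product of mollifications in `H³`. -/
def pairL (n : ℕ) (X Y : Fin 3 → L2) : ℝ := ∑ j, pair 3 (SL n (X j)) (SL n (Y j))

theorem quad_pair (n k : ℕ) (j : Fin 3) : Quad fun X Y => pair k (SL n (X j)) (SL n (Y j)) :=
  quad_of_le (pair k) k (abs_pair_le k) n j j

theorem quad_pairL (n : ℕ) : Quad (pairL n) := Quad.sum fun j => quad_pair n 3 j

theorem pairL_comm (n : ℕ) (X Y : Fin 3 → L2) : pairL n X Y = pairL n Y X :=
  Finset.sum_congr rfl fun _ _ => pair_comm _ _ _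

theorem quad_pair_D (n k : ℕ) (i j : Fin 3) :
    Quad fun X Y => pair k (D i (SL n (X j))) (D i (SL n (Y j))) :=
  quad_of_le ((pair k).compl₁₂ (D i) (D i)) (k + 1) (fun _ _ => (abs_pair_le _ _ _).trans
    (mul_le_mul (nrm_D_le _ _ _) (nrm_D_le _ _ _) (nrm_nonneg _ _) (nrm_nonneg _ _))) n j j

/-- The gradient form of mollifications in `H³`. -/
def gradL (n : ℕ) (X Y : Fin 3 → L2) : ℝ :=
  ∑ i, ∑ j, pair 3 (D i (SL n (X j))) (D i (SL n (Y j)))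

theorem quad_gradL (n : ℕ) : Quad (gradL n) := Quad.sum fun i => Quad.sum fun j => quad_pair_D n 3 i j

/-- The horizontal gradient form of mollifications in `H³`. -/
def hgradL (n : ℕ) (X Y : Fin 3 → L2) : ℝ :=
  ∑ j, (pair 3 (D 0 (SL n (X j))) (D 0 (SL n (Y j))) + pair 3 (D 1 (SL n (X j))) (D 1 (SL n (Y j))))

theorem quad_hgradL (n : ℕ) : Quad (hgradL n) :=
  Quad.sum fun j => (quad_pair_D n 3 0 j).add (quad_pair_D n 3 1 j)

theorem gradL_self_nonneg (n : ℕ) (X : Fin 3 → L2) : 0 ≤ gradL n X X :=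
  Finset.sum_nonneg fun _ _ => Finset.sum_nonneg fun _ _ => pair_self_nonneg _ _

theorem hgradL_self_nonneg (n : ℕ) (X : Fin 3 → L2) : 0 ≤ hgradL n X X :=
  Finset.sum_nonneg fun _ _ => add_nonneg (pair_self_nonneg _ _) (pair_self_nonneg _ _)

theorem nrm_approxv_le {k : ℕ} {u : Fin 3 → Space → ℝ} (hu : ∀ j, MemH k (u j)) (m : ℕ) (j : Fin 3) :
    nrm k (approxv u m j) ≤ √(vnormSqH k u) :=
  (nrm_SL_le (hu j) m).trans (Real.sqrt_le_sqrt (normSqH_le_vnormSqH k u j))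

theorem abs_approx_le {a : Space → ℝ} {c : ℝ} (ha : MemLp a 2 volume) (h : ∀ᵐ x, |a x| ≤ c) (m : ℕ)
    (x : Space) : |approx a m x| ≤ c := by
  have := abs_mol_le (ker m) (cls a) (c := c) (by
    filter_upwards [h, coeFn_cls ha] with x h1 h2
    rwa [h2]) x
  rwa [size_ker, mul_one] at this

theorem tendsto_gradL {u : Fin 3 → Space → ℝ} (hu : ∀ j, MemH 3 (u j))
    (h : ∀ i j, MemH 3 (weakDeriv i (u j))) :
    Tendsto (fun n => gradL n (fun j => cls (u j)) fun j => cls (u j)) atTop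
      (𝓝 (gradNormSqH 3 u)) := by
  refine tendsto_finsetSum _ fun i _ => tendsto_finsetSum _ fun j _ => ?_
  simp only [D_SL_weakDeriv (hu j), ← nrm_sq]
  exact tendsto_nrm_SL_sq (h i j)

theorem tendsto_hgradL {u : Fin 3 → Space → ℝ} (hu : ∀ j, MemH 3 (u j))
    (h : ∀ j, MemH 3 (weakDeriv 0 (u j)) ∧ MemH 3 (weakDeriv 1 (u j))) :
    Tendsto (fun n => hgradL n (fun j => cls (u j)) fun j => cls (u j)) atTop
      (𝓝 (hgradNormSqH 3 u)) := by
  refine tendsto_finsetSum _ fun j _ => ?_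
  simp only [D_SL_weakDeriv (hu j), ← nrm_sq]
  exact (tendsto_nrm_SL_sq (h j).1).add (tendsto_nrm_SL_sq (h j).2)

theorem memH_weakDeriv_of_frequently {f : Space → ℝ} (hf : MemH 3 f) {i : Fin 3} {c : ℝ}
    (h : ∃ᶠ n in atTop, nrm 3 (D i (SL n (cls f))) ^ 2 ≤ c) : MemH 3 (weakDeriv i f) := by
  refine memH_of_frequently (hf.deriv i).memLp (C := √c) (h.mono fun n hn => ?_)
  rw [← D_SL_weakDeriv hf]
  exact Real.le_sqrt_of_sq_le hn

end HInf

/-! ### Gain of regularity: ∇u and ∇_h B in L²(0,T; H³). -/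

namespace Flow

variable {h k : Nonlin} {μ lam σ T M : ℝ} {a : ℝ → Space → ℝ} {u B : ℝ → Fin 3 → Space → ℝ}

theorem continuousOn_quad_u (hF : Flow h k μ lam σ T M a u B) {Φ : (Fin 3 → L2) → (Fin 3 → L2) → ℝ}
    (hΦ : Quad Φ) : ContinuousOn (fun t => Φ (fun j => cls (u t j)) fun j => cls (u t j)) (Icc 0 T) := by
  obtain ⟨U', hU'⟩ := hF.deriv_u
  exact fun t ht => (hΦ.hasDerivWithinAt (X := fun t j => cls (u t j))
    fun j => (hU' t ht j).1).continuousWithinAt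

theorem continuousOn_quad_B (hF : Flow h k μ lam σ T M a u B) {Φ : (Fin 3 → L2) → (Fin 3 → L2) → ℝ}
    (hΦ : Quad Φ) : ContinuousOn (fun t => Φ (fun j => cls (B t j)) fun j => cls (B t j)) (Icc 0 T) := by
  obtain ⟨U', hU'⟩ := hF.deriv_B
  exact fun t ht => (hΦ.hasDerivWithinAt (X := fun t j => cls (B t j))
    fun j => (hU' t ht j).1).continuousWithinAt

theorem nonneg (hF : Flow h k μ lam σ T M a u B) (hT : 0 < T) : 0 ≤ M :=
  (Real.sqrt_nonneg _).trans (hF.bound_a 0 (left_mem_Icc.2 hT.le))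

/-- The form `highL` is nonnegative, bounded by the H³ norm, and its time derivative is at most 2K -
2c `gradL`; integrating over [0, T] bounds the last term. All constants depend on M but not on n. -/
theorem integral_gradL_le (hF : Flow h k μ lam σ T M a u B) (hT : 0 < T) (hμ : 0 < μ)
    (hν : 0 < lam + 2 * μ) (hh : ∀ r, |r| ≤ 1 / 2 → -(1 / 2) ≤ h.1 r) :
    ∃ C, ∀ n, ∫ t in (0 : ℝ)..T, gradL n (fun j => cls (u t j)) (fun j => cls (u t j)) ≤ C := by
  obtain ⟨K, hK, hb⟩ := highForm_rhsU_le h k hh hμ hν M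
  obtain ⟨U', hU'⟩ := hF.deriv_u
  set c := min μ (lam + 2 * μ) ^ 2 / 4 with hc
  have c0 : 0 < c := by have := lt_min hμ hν; positivity
  set X : ℝ → Fin 3 → L2 := fun t j => cls (u t j) with hX
  set L := 81 * (|μ| + |lam + μ|) * M ^ 2 with hL
  refine ⟨(L + T * (2 * K)) / (2 * c), fun n => ?_⟩
  have hlim : ∀ t ∈ Icc 0 T, ∀ j, Tendsto (fun m => toL (approxv (u t) m j)) atTop (𝓝 (X t j)) :=
    fun t _ j => tendsto_SL _
  have hub : ∀ t ∈ Icc 0 T, ∀ m j, nrm 3 (approxv (u t) m j) ≤ M := fun t ht m j =>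
    (nrm_approxv_le (hF.u3 t ht) m j).trans (hF.bound_u t ht)
  have hQ : ∀ t ∈ Icc 0 T, 0 ≤ highL μ lam n (X t) (X t) ∧ highL μ lam n (X t) (X t) ≤ L := fun t ht => by
    have hl := (quad_highL μ lam n).tendsto (hlim t ht) (hlim t ht)
    refine ⟨ge_of_tendsto' hl fun m => ?_, le_of_tendsto' hl fun m => ?_⟩
    · exact (highForm_self_nonneg hμ hν n _).trans_eq (highForm_eq_highL _ _ _ _ _)
    · exact (highForm_eq_highL _ _ _ _ _).symm.trans_le (highForm_self_le n (hub t ht m))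
  have hd : ∀ t ∈ Icc 0 T, HasDerivWithinAt (fun t => highL μ lam n (X t) (X t))
      (2 * highL μ lam n (X t) (U' t)) (Icc 0 T) t := fun t ht => by
    have := (quad_highL μ lam n).hasDerivWithinAt (X := X) fun j => (hU' t ht j).1
    rwa [highL_comm μ lam n (U' t), ← two_mul] at this
  have hle : ∀ t ∈ Icc 0 T, 2 * highL μ lam n (X t) (U' t) ≤ 2 * K - 2 * c * gradL n (X t) (X t) :=
    fun t ht => by
    -- The smoothing estimate is available for the smooth approximations; at fixed n both sides are
    -- continuous on L², so m → ∞ transfers it to the solution.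
    have l1 := (quad_highL μ lam n).tendsto (hlim t ht) fun j => (hU' t ht j).2
    have l2 := (((quad_gradL n).tendsto (hlim t ht) (hlim t ht)).const_mul c).const_sub K
    have := le_of_tendsto_of_tendsto' l1 l2 fun m => by
      have hq := hb n (approx (a t) m) (approxv (u t) m) (approxv (B t) m)
        (abs_approx_le (hF.a3 t ht).memLp (hF.range t ht) m)
        ((nrm_SL_le (hF.a3 t ht) m).trans (hF.bound_a t ht)) (hub t ht m)
        (fun j => (nrm_approxv_le (hF.B3 t ht) m j).trans (hF.bound_B t ht))
      rw [highForm_eq_highL] at hq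
      simp only [nrm_sq] at hq
      exact hq
    linarith
  have hci := (hF.continuousOn_quad_u (quad_gradL n)).integrableOn_Icc (μ := volume)
  have hii : IntervalIntegrable (fun t => gradL n (X t) (X t)) volume 0 T :=
    (intervalIntegrable_iff_integrableOn_Icc_of_le hT.le).2 hci
  have hfin := sub_le_integral_of_ae hT.le hd
    (φ := fun t => 2 * K - 2 * c * gradL n (X t) (X t))
    ((integrableOn_const (by simp)).sub (hci.const_mul _))
    ((ae_restrict_iff' measurableSet_Icc).2 (Eventually.of_forall hle))
  rw [intervalIntegral.integral_sub intervalIntegrable_const (hii.const_mul _),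
    intervalIntegral.integral_const_mul (2 * c), intervalIntegral.integral_const, smul_eq_mul, sub_zero] at hfin
  have q1 := (hQ 0 (left_mem_Icc.2 hT.le)).2
  have q2 := (hQ T (right_mem_Icc.2 hT.le)).1
  rw [le_div_iff₀ (by positivity)]
  change (∫ t in (0 : ℝ)..T, gradL n (X t) (X t)) * (2 * c) ≤ _
  linarith

/-- Fatou's lemma bounds the mollified gradients along a subsequence at almost every time, which
gives membership in H³. Then the whole sequence converges, and the integrable limit is identified.
-/
theorem grad_u (hF : Flow h k μ lam σ T M a u B) (hT : 0 < T) (hμ : 0 < μ)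
    (hν : 0 < lam + 2 * μ) (hh : ∀ r, |r| ≤ 1 / 2 → -(1 / 2) ≤ h.1 r) :
    (∀ᵐ t ∂(volume.restrict (Icc 0 T)), ∀ i j, MemH 3 (weakDeriv i (u t j))) ∧
      IntegrableOn (fun t => gradNormSqH 3 (u t)) (Icc 0 T) volume := by
  obtain ⟨C, hC⟩ := hF.integral_gradL_le hT hμ hν hh
  obtain ⟨h1, h2⟩ := ae_frequently_le_of_integral_le hT.le
    (fun n => hF.continuousOn_quad_u (quad_gradL n)) (fun n t => gradL_self_nonneg n _) hC
  have h3 : ∀ᵐ t ∂(volume.restrict (Icc 0 T)), ∀ i j, MemH 3 (weakDeriv i (u t j)) := by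
    filter_upwards [h1, ae_restrict_mem measurableSet_Icc] with t ht hm i j
    obtain ⟨c, hc⟩ := ht
    refine memH_weakDeriv_of_frequently (hF.u3 t hm j) (hc.mono fun n hn => le_trans ?_ hn)
    rw [nrm_sq]
    exact (Finset.single_le_sum
      (f := fun j => pair 3 (D i (SL n (cls (u t j)))) (D i (SL n (cls (u t j)))))
      (fun j _ => pair_self_nonneg 3 _) (Finset.mem_univ j)).trans
      (Finset.single_le_sum
        (f := fun i => ∑ j, pair 3 (D i (SL n (cls (u t j)))) (D i (SL n (cls (u t j)))))
        (fun i _ => Finset.sum_nonneg fun j _ => pair_self_nonneg 3 _) (Finset.mem_univ i))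
  refine ⟨h3, h2 _ ?_⟩
  filter_upwards [h3, ae_restrict_mem measurableSet_Icc] with t ht hm
  exact tendsto_gradL (hF.u3 t hm) ht

/-- The H³ energy of B_n alone is integrated in time. The forcing is bounded through the norm of ∇u,
whose integrability has to be known beforehand. -/
theorem integral_hgradL_le (hF : Flow h k μ lam σ T M a u B) (hT : 0 < T) (hσ : 0 < σ)
    (hu : ∀ᵐ t ∂(volume.restrict (Icc 0 T)), ∀ i j, MemH 3 (weakDeriv i (u t j)))
    (hi : IntegrableOn (fun t => gradNormSqH 3 (u t)) (Icc 0 T) volume) :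
    ∃ C, ∀ n, ∫ t in (0 : ℝ)..T, hgradL n (fun j => cls (B t j)) (fun j => cls (B t j)) ≤ C := by
  obtain ⟨K, hK, hb⟩ := abs_rateB_add_le σ
  obtain ⟨B', hB'⟩ := hF.deriv_B
  have M0 := hF.nonneg hT
  set X : ℝ → Fin 3 → L2 := fun t j => cls (B t j) with hX
  set g : ℝ → ℝ := fun t => 2 * (K * (M ^ 2 * (M + 1 + gradNormSqH 3 (u t)))) with hg
  have hgi : IntegrableOn g (Icc 0 T) volume :=
    ((((integrableOn_const (by simp)).add hi).const_mul _).const_mul _).const_mul _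
  refine ⟨(3 * M ^ 2 + ∫ t in (0 : ℝ)..T, g t) / (2 * σ), fun n => ?_⟩
  have hlim : ∀ t ∈ Icc 0 T, ∀ j, Tendsto (fun m => toL (approxv (B t) m j)) atTop (𝓝 (X t j)) :=
    fun t _ j => tendsto_SL _
  have hd : ∀ t ∈ Icc 0 T, HasDerivWithinAt (fun t => pairL n (X t) (X t))
      (2 * pairL n (X t) (B' t)) (Icc 0 T) t := fun t ht => by
    have := (quad_pairL n).hasDerivWithinAt (X := X) fun j => (hB' t ht j).1
    rwa [pairL_comm n (B' t), ← two_mul] at this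
  have hle : ∀ᵐ t ∂(volume.restrict (Icc 0 T)),
      2 * pairL n (X t) (B' t) ≤ g t - 2 * σ * hgradL n (X t) (X t) := by
    filter_upwards [hu, ae_restrict_mem measurableSet_Icc] with t hut ht
    have l1 := (quad_pairL n).tendsto (hlim t ht) fun j => (hB' t ht j).2
    have l2 := ((quad_hgradL n).tendsto (hlim t ht) (hlim t ht)).const_mul σ
    have := le_of_tendsto' (l1.add l2) (b := K * (M ^ 2 * (M + √(gradNormSqH 3 (u t))))) fun m => by
      have hq := hb n (approxv (u t) m) (approxv (B t) m) M M (√(gradNormSqH 3 (u t)))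
        (fun j => (nrm_approxv_le (hF.u3 t ht) m j).trans (hF.bound_u t ht))
        (fun j => (nrm_approxv_le (hF.B3 t ht) m j).trans (hF.bound_B t ht))
        (fun i j => by
          rw [approxv, D_approx (hF.u3 t ht j)]
          exact (nrm_SL_le (hut i j) m).trans
            (Real.sqrt_le_sqrt (normSqH_weakDeriv_le_gradNormSqH 3 _ i j)))
      have hq' := (le_abs_self _).trans hq
      simp only [nrm_sq] at hq'
      exact hq'
    have hs : √(gradNormSqH 3 (u t)) ≤ 1 + gradNormSqH 3 (u t) := by
      have h0 := gradNormSqH_nonneg 3 (u t)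
      rw [Real.sqrt_le_iff]
      exact ⟨by linarith, by nlinarith⟩
    have h4 : K * (M ^ 2 * (M + √(gradNormSqH 3 (u t)))) ≤
        K * (M ^ 2 * (M + 1 + gradNormSqH 3 (u t))) := by
      have : 0 ≤ M ^ 2 := sq_nonneg _
      gcongr ?_ * (?_ * ?_)
      linarith
    simp only [hg]
    linarith
  have hci := (hF.continuousOn_quad_B (quad_hgradL n)).integrableOn_Icc (μ := volume)
  have hii : IntervalIntegrable (fun t => hgradL n (X t) (X t)) volume 0 T :=
    (intervalIntegrable_iff_integrableOn_Icc_of_le hT.le).2 hci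
  have hfin := sub_le_integral_of_ae hT.le hd (hgi.sub (hci.const_mul (2 * σ))) hle
  simp only [Pi.sub_apply] at hfin
  rw [intervalIntegral.integral_sub ((intervalIntegrable_iff_integrableOn_Icc_of_le hT.le).2 hgi)
    (hii.const_mul _), intervalIntegral.integral_const_mul (2 * σ)] at hfin
  have q2 : 0 ≤ pairL n (X T) (X T) := Finset.sum_nonneg fun _ _ => pair_self_nonneg _ _
  have q1 : pairL n (X 0) (X 0) ≤ 3 * M ^ 2 := by
    have h0 := left_mem_Icc.2 hT.le
    have : pairL n (X 0) (X 0) ≤ ∑ j : Fin 3, M ^ 2 := Finset.sum_le_sum fun j _ => by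
      rw [← nrm_sq]
      exact pow_le_pow_left₀ (nrm_nonneg _ _)
        ((nrm_approxv_le (hF.B3 0 h0) n j).trans (hF.bound_B 0 h0)) 2
    simpa using this
  rw [le_div_iff₀ (by positivity)]
  change (∫ t in (0 : ℝ)..T, hgradL n (X t) (X t)) * (2 * σ) ≤ _
  linarith

theorem hgrad_B (hF : Flow h k μ lam σ T M a u B) (hT : 0 < T) (hσ : 0 < σ)
    (hu : ∀ᵐ t ∂(volume.restrict (Icc 0 T)), ∀ i j, MemH 3 (weakDeriv i (u t j)))
    (hi : IntegrableOn (fun t => gradNormSqH 3 (u t)) (Icc 0 T) volume) :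
    (∀ᵐ t ∂(volume.restrict (Icc 0 T)), ∀ j,
      MemH 3 (weakDeriv 0 (B t j)) ∧ MemH 3 (weakDeriv 1 (B t j))) ∧
      IntegrableOn (fun t => hgradNormSqH 3 (B t)) (Icc 0 T) volume := by
  obtain ⟨C, hC⟩ := hF.integral_hgradL_le hT hσ hu hi
  obtain ⟨h1, h2⟩ := ae_frequently_le_of_integral_le hT.le
    (fun n => hF.continuousOn_quad_B (quad_hgradL n)) (fun n t => hgradL_self_nonneg n _) hC
  have h3 : ∀ᵐ t ∂(volume.restrict (Icc 0 T)), ∀ j,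
      MemH 3 (weakDeriv 0 (B t j)) ∧ MemH 3 (weakDeriv 1 (B t j)) := by
    filter_upwards [h1, ae_restrict_mem measurableSet_Icc] with t ht hm j
    obtain ⟨c, hc⟩ := ht
    have key : ∀ n, nrm 3 (D 0 (SL n (cls (B t j)))) ^ 2 + nrm 3 (D 1 (SL n (cls (B t j)))) ^ 2 ≤
        hgradL n (fun j => cls (B t j)) fun j => cls (B t j) := fun n => by
      rw [nrm_sq, nrm_sq]
      exact Finset.single_le_sum
        (f := fun j => pair 3 (D 0 (SL n (cls (B t j)))) (D 0 (SL n (cls (B t j)))) +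
          pair 3 (D 1 (SL n (cls (B t j)))) (D 1 (SL n (cls (B t j)))))
        (fun j _ => add_nonneg (pair_self_nonneg 3 _) (pair_self_nonneg 3 _)) (Finset.mem_univ j)
    constructor
    · exact memH_weakDeriv_of_frequently (hF.B3 t hm j) (hc.mono fun n hn =>
        (le_add_of_nonneg_right (sq_nonneg _)).trans ((key n).trans hn))
    · exact memH_weakDeriv_of_frequently (hF.B3 t hm j) (hc.mono fun n hn =>
        (le_add_of_nonneg_left (sq_nonneg _)).trans ((key n).trans hn))
  refine ⟨h3, h2 _ ?_⟩
  filter_upwards [h3, ae_restrict_mem measurableSet_Icc] with t ht hm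
  exact tendsto_hgradL (hF.B3 t hm) ht

end Flow


/-! ### The mollified inequality in the limit. -/

open HInf

namespace HInf

theorem cls_divergence {u : Fin 3 → Space → ℝ} (hu : ∀ i, MemLp (weakDeriv i (u i)) 2 volume) :
    cls (divergence u) = ∑ i, cls (weakDeriv i (u i)) := by
  have e : divergence u = fun x => weakDeriv 0 (u 0) x + weakDeriv 1 (u 1) x + weakDeriv 2 (u 2) x := by
    funext x; simp [divergence, Fin.sum_univ_three]
  rw [e, cls_add (f := fun x => weakDeriv 0 (u 0) x + weakDeriv 1 (u 1) x) ((hu 0).add (hu 1)) (hu 2),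
    cls_add (hu 0) (hu 1), Fin.sum_univ_three]

theorem dv_SL {u : Fin 3 → Space → ℝ} (hu : ∀ j, MemH 3 (u j)) (n : ℕ) :
    dv (fun j => SL n (cls (u j))) = SL n (cls (divergence u)) := by
  rw [cls_divergence fun i => ((hu i).deriv i).memLp, map_sum]
  exact Finset.sum_congr rfl fun i _ => D_SL_weakDeriv (hu i) i n

theorem memH_divergence {k : ℕ} {u : Fin 3 → Space → ℝ} (h : ∀ i, MemH k (weakDeriv i (u i))) :
    MemH k (divergence u) := by
  have e : divergence u = fun x => weakDeriv 0 (u 0) x + weakDeriv 1 (u 1) x + weakDeriv 2 (u 2) x := by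
    funext x; simp [divergence, Fin.sum_univ_three]
  rw [e]
  exact ((h 0).add (h 1)).add (h 2)

/-- The divergence form of mollifications in `H³`. -/
def divL (n : ℕ) (X Y : Fin 3 → L2) : ℝ :=
  ∑ j, ∑ l, pair 3 (D j (SL n (X j))) (D l (SL n (Y l)))

theorem quad_divL (n : ℕ) : Quad (divL n) := Quad.sum fun j => Quad.sum fun l => by
  have h : ∀ f g, |pair 3 (D j f) (D l g)| ≤ nrm 4 f * nrm 4 g := fun f g =>
    (abs_pair_le 3 _ _).trans
      (mul_le_mul (nrm_D_le 3 _ _) (nrm_D_le 3 _ _) (nrm_nonneg _ _) (nrm_nonneg _ _))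
  exact quad_of_le ((pair 3).compl₁₂ (D j) (D l)) 4 h n j l

theorem divL_self (n : ℕ) (X : Fin 3 → L2) :
    divL n X X = nrm 3 (dv fun j => SL n (X j)) ^ 2 := by
  rw [nrm_sq, dv]
  simp only [map_sum, LinearMap.sum_apply]
  rw [divL, Finset.sum_comm]

theorem tendsto_divL {u : Fin 3 → Space → ℝ} (hu : ∀ j, MemH 3 (u j))
    (h : ∀ i j, MemH 3 (weakDeriv i (u j))) :
    Tendsto (fun n => divL n (fun j => cls (u j)) fun j => cls (u j)) atTop
      (𝓝 (normSqH 3 (divergence u))) := by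
  simp only [divL_self, dv_SL hu]
  exact tendsto_nrm_SL_sq (memH_divergence fun i => h i i)

theorem normSqH_divergence_le {u : Fin 3 → Space → ℝ} (hu : ∀ j, MemH 3 (u j))
    (h : ∀ i j, MemH 3 (weakDeriv i (u j))) : normSqH 3 (divergence u) ≤ gradNormSqH 3 u := by
  refine le_of_tendsto_of_tendsto' (tendsto_divL hu h) (tendsto_gradL hu h) fun n => ?_
  rw [divL_self]
  refine (nrm_dv_sq_le 3 _).trans (le_of_eq ?_)
  simp only [nrm_sq]
  rfl

/-- The dissipation functional on square integrable functions. -/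
def dissL (μ lam σ : ℝ) (n : ℕ) (X Y : Fin 3 → L2) : ℝ :=
  μ * gradL n X X + (lam + μ) * divL n X X + σ * hgradL n Y Y

theorem tendsto_diss (μ lam σ : ℝ) (n : ℕ) (u B : Fin 3 → Space → ℝ) :
    Tendsto (fun m => diss μ lam σ (Sv n (approxv u m)) (Sv n (approxv B m))) atTop
      (𝓝 (dissL μ lam σ n (fun j => cls (u j)) fun j => cls (B j))) := by
  have hl : ∀ (v : Fin 3 → Space → ℝ) j,
      Tendsto (fun m => toL (approxv v m j)) atTop (𝓝 (cls (v j))) := fun v j => tendsto_SL _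
  have h := ((((quad_gradL n).tendsto (hl u) (hl u)).const_mul μ).add
    (((quad_divL n).tendsto (hl u) (hl u)).const_mul (lam + μ))).add
    (((quad_hgradL n).tendsto (hl B) (hl B)).const_mul σ)
  refine h.congr fun m => ?_
  simp only [diss, divL_self, nrm_sq]
  rfl

theorem tendsto_dissL (μ lam σ : ℝ) {u B : Fin 3 → Space → ℝ} (hu : ∀ j, MemH 3 (u j))
    (hB : ∀ j, MemH 3 (B j)) (hDu : ∀ i j, MemH 3 (weakDeriv i (u j)))
    (hDB : ∀ j, MemH 3 (weakDeriv 0 (B j)) ∧ MemH 3 (weakDeriv 1 (B j))) :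
    Tendsto (fun n => dissL μ lam σ n (fun j => cls (u j)) fun j => cls (B j)) atTop
      (𝓝 (dissipation μ lam σ u B)) :=
  (((tendsto_gradL hu hDu).const_mul μ).add ((tendsto_divL hu hDu).const_mul (lam + μ))).add
    ((tendsto_hgradL hB hDB).const_mul σ)

/-- Coercivity without a sign on λ + μ: the divergence term is dominated by the full gradient with
constant 1. -/
theorem dissipation_ge {μ lam σ : ℝ} {u B : Fin 3 → Space → ℝ}
    (hu : ∀ j, MemH 3 (u j)) (hDu : ∀ i j, MemH 3 (weakDeriv i (u j))) :
    min (min μ (lam + 2 * μ)) σ * (gradNormSqH 3 u + hgradNormSqH 3 B) ≤ dissipation μ lam σ u B := by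
  have h1 := visc_form_lower (μ := μ) (lam := lam) (normSqH_divergence_le hu hDu) (normSqH_nonneg _ _)
  have h2 := mul_le_mul_of_nonneg_right (min_le_left (min μ (lam + 2 * μ)) σ) (gradNormSqH_nonneg 3 u)
  have h3 := mul_le_mul_of_nonneg_right (min_le_right (min μ (lam + 2 * μ)) σ) (hgradNormSqH_nonneg 3 B)
  rw [dissipation]
  linarith

/-- The √3 is Cauchy–Schwarz between the sum of three norms used in the estimates and the sum of
squares in the theorem. -/
theorem gn_approx_le {a : Space → ℝ} (ha : MemH 3 a) (m : ℕ) :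
    gn 2 (approx a m) ≤ √3 * √(∑ i, normSqH 2 (weakDeriv i a)) := by
  rw [← Real.sqrt_mul (by norm_num)]
  apply Real.le_sqrt_of_sq_le
  have h : gn 2 (approx a m) ≤ ∑ i, √(normSqH 2 (weakDeriv i a)) :=
    Finset.sum_le_sum fun i _ => by
      rw [D_approx ha]; exact nrm_SL_le (ha.deriv i) m
  refine (pow_le_pow_left₀ (gn_nonneg _ _) h 2).trans ?_
  have hs := fun i => Real.sq_sqrt (normSqH_nonneg 2 (weakDeriv i a))
  rw [Fin.sum_univ_three, Fin.sum_univ_three, ← hs 0, ← hs 1, ← hs 2]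
  simp only [Real.sqrt_sq (Real.sqrt_nonneg _)]
  nlinarith [sq_nonneg (√(normSqH 2 (weakDeriv 0 a)) - √(normSqH 2 (weakDeriv 1 a))),
    sq_nonneg (√(normSqH 2 (weakDeriv 1 a)) - √(normSqH 2 (weakDeriv 2 a))),
    sq_nonneg (√(normSqH 2 (weakDeriv 0 a)) - √(normSqH 2 (weakDeriv 2 a)))]

theorem Bounds.coarse {a : HInf} {u B : Fin 3 → HInf} {α U b A d e M : ℝ}
    (h : Bounds a u B α U b A d e) (hα : α ≤ M) (hU : U ≤ M) (hb : b ≤ M) :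
    Bounds a u B M M M (3 * M) d e where
  range := h.range
  na := h.na.trans hα
  nu j := (h.nu j).trans hU
  nB j := (h.nB j).trans hb
  grad_a := (gn_le 2 a).trans (by have := h.na.trans hα; gcongr)
  grad_B := h.grad_B
  grad_u := h.grad_u
  div_B := h.div_B

end HInf

/-- States of the system with finite dissipation. -/
structure Regular (a : Space → ℝ) (u B : Fin 3 → Space → ℝ) : Prop where
  a3 : MemH 3 a
  u3 : ∀ j, MemH 3 (u j)
  B3 : ∀ j, MemH 3 (B j)
  range : ∀ᵐ x, |a x| ≤ 1 / 2
  div_B : ∀ᵐ x, divergence B x = 0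
  grad_u : ∀ i j, MemH 3 (weakDeriv i (u j))
  grad_B : ∀ j, MemH 3 (weakDeriv 0 (B j)) ∧ MemH 3 (weakDeriv 1 (B j))

namespace Regular

variable {a : Space → ℝ} {u B : Fin 3 → Space → ℝ}

theorem bounds (hs : Regular a u B) (m : ℕ) : Bounds (approx a m) (approxv u m) (approxv B m)
    (√(normSqH 3 a)) (√(vnormSqH 3 u)) (√(vnormSqH 3 B)) (√3 * √(∑ i, normSqH 2 (weakDeriv i a)))
    (√(hgradNormSqH 3 B)) (√(gradNormSqH 3 u)) where
  range := abs_approx_le hs.a3.memLp hs.range m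
  na := nrm_SL_le hs.a3 m
  nu := nrm_approxv_le hs.u3 m
  nB := nrm_approxv_le hs.B3 m
  grad_a := gn_approx_le hs.a3 m
  grad_B j := by
    rw [approxv, D_approx (hs.B3 j), D_approx (hs.B3 j)]
    exact ⟨(nrm_SL_le (hs.grad_B j).1 m).trans
      (Real.sqrt_le_sqrt (normSqH_weakDeriv_le_hgradNormSqH 3 B j).1),
      (nrm_SL_le (hs.grad_B j).2 m).trans
      (Real.sqrt_le_sqrt (normSqH_weakDeriv_le_hgradNormSqH 3 B j).2)⟩
  grad_u i j := by
    rw [approxv, D_approx (hs.u3 j)]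
    exact (nrm_SL_le (hs.grad_u i j) m).trans
      (Real.sqrt_le_sqrt (normSqH_weakDeriv_le_gradNormSqH 3 u i j))
  div_B := by
    have e : cls (divergence B) = 0 := by
      rw [cls_congr hs.div_B]
      exact (cls_eq MemLp.zero').trans (MemLp.toLp_zero _)
    have := dv_SL hs.B3 m
    rw [e, map_zero] at this
    exact this

theorem small_rem (hs : Regular a u B) (h k : Nonlin) (μ lam : ℝ) :
    Small fun n m => rem h k μ lam n (approx a m) (approxv u m) (approxv B m) := by
  refine HInf.small_rem h k μ lam (a := approx a) (u := fun j => approx (u j))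
    (B := fun j => approx (B j)) (cauchyNrm_SL hs.a3) (fun j => cauchyNrm_SL (hs.u3 j))
    (fun j => cauchyNrm_SL (hs.B3 j)) (fun i j => ?_)
    fun j => (tendsto_force h k μ lam hs.a3 hs.u3 hs.B3 j).cauchy
  simp only [D_approx (hs.u3 j)]
  exact cauchyNrm_SL (hs.grad_u i j)

end Regular

/-- The mollified energy inequality in the limit. -/
theorem exists_rate_le (h k : Nonlin) {μ lam σ θ : ℝ} (hμ : 0 < μ) (hν : 0 < lam + 2 * μ) (hσ : 0 < σ)
    (hθ : θ < 1) : ∃ C : ℝ, 0 < C ∧ ∀ (a : Space → ℝ) (u B : Fin 3 → Space → ℝ) (r : ℕ → ℝ),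
      Regular a u B → (∀ n, Tendsto (fun m =>
        rate h k μ lam σ n (approx a m) (approxv u m) (approxv B m)) atTop (𝓝 (r n))) →
      ∀ ε > 0, ∀ᶠ n in atTop, r n ≤
        C * (√(vnormSqH 3 u) + (normSqH 3 a + vnormSqH 3 u) + vnormSqH 3 B ^ 2) *
          (∑ i, normSqH 2 (weakDeriv i a)) +
        C * (normSqH 3 a * vnormSqH 3 B + energy a u B) * gradNormSqH 3 u -
        θ * dissipation μ lam σ u B + ε := by
  obtain ⟨K, hK, hb⟩ := rate_add_diss_le h k μ lam σ
  set c₀ := min (min μ (lam + 2 * μ)) σ with hc₀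
  have c0 : 0 < c₀ := lt_min (lt_min hμ hν) hσ
  -- Chosen so that K · 8η(e² + d²) = (1 - θ) c₀ (e² + d²), which coercivity bounds by the fraction
  -- 1 - θ of the dissipation.
  set η := (1 - θ) * c₀ / (8 * K) with hη
  have θ1 : 0 < 1 - θ := by linarith
  have η0 : 0 < η := by positivity
  -- The factor 3 comes from A² = 3s.
  refine ⟨3 * (K * (2 / η + 2)), by positivity, fun a u B r hs hr ε hε => ?_⟩
  set α := √(normSqH 3 a) with hα
  set U := √(vnormSqH 3 u) with hU
  set b := √(vnormSqH 3 B) with hb'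
  set s := ∑ i, normSqH 2 (weakDeriv i a) with hs'
  set A := √3 * √s with hA
  set d := √(hgradNormSqH 3 B) with hd
  set e := √(gradNormSqH 3 u) with he
  have s0 : 0 ≤ s := Finset.sum_nonneg fun _ _ => normSqH_nonneg _ _
  have α2 : normSqH 3 a = α ^ 2 := (Real.sq_sqrt (normSqH_nonneg _ _)).symm
  have U2 : vnormSqH 3 u = U ^ 2 := (Real.sq_sqrt (vnormSqH_nonneg _ _)).symm
  have b2 : vnormSqH 3 B = b ^ 2 := (Real.sq_sqrt (vnormSqH_nonneg _ _)).symm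
  have d2 : hgradNormSqH 3 B = d ^ 2 := (Real.sq_sqrt (hgradNormSqH_nonneg _ _)).symm
  have e2 : gradNormSqH 3 u = e ^ 2 := (Real.sq_sqrt (gradNormSqH_nonneg _ _)).symm
  have A2 : A ^ 2 = 3 * s := by
    rw [hA, mul_pow, Real.sq_sqrt (by norm_num), Real.sq_sqrt s0]
  have U0 : 0 ≤ U := Real.sqrt_nonneg _
  have hdiss := dissipation_ge (σ := σ) (B := B) (μ := μ) (lam := lam) hs.u3 hs.grad_u
  rw [← hc₀, d2, e2] at hdiss
  set Q := 1 + α + U + 3 * e + b with hQ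
  have Q0 : 0 < Q := by positivity
  have hy := mul_le_mul_of_nonneg_left (young_estimate (η := η) η0 (α := α) (b := b) (A := A)
    (d := d) (e := e) U0) hK.le
  have hlim := (tendsto_dissL μ lam σ hs.u3 hs.B3 hs.grad_u hs.grad_B).eventually
    (lt_mem_nhds (show dissipation μ lam σ u B - ε / 2 < _ by linarith))
  -- One half of ε is for the commutators, multiplied by Q, the other for replacing the dissipation
  -- by its mollified version.
  filter_upwards [hs.small_rem h k μ lam (ε / (2 * Q)) (by positivity), hlim] with n hn1 hn2
  have hle : r n + dissL μ lam σ n (fun j => cls (u j)) (fun j => cls (B j)) ≤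
      K * (U * A ^ 2 + α * A * e + b * d * e + (U * e ^ 2 + e * A * U + A * e * b ^ 2 + U * A ^ 2) +
        e * (U * e + α * e + A * b ^ 2 + α * A)) + ε / 2 := by
    refine le_of_tendsto ((hr n).add (tendsto_diss μ lam σ n u B)) ?_
    filter_upwards [hn1] with m hm
    refine (le_abs_self _).trans ((hb n _ _ _ _ _ _ _ _ _ (hs.bounds m)).trans
      (add_le_add le_rfl ?_))
    calc Q * rem h k μ lam n (approx a m) (approxv u m) (approxv B m) ≤ Q * (ε / (2 * Q)) := by gcongr
      _ = ε / 2 := by field_simp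
  have hKη : K * (8 * η * (e ^ 2 + d ^ 2)) = (1 - θ) * (c₀ * (e ^ 2 + d ^ 2)) := by
    rw [hη]; field_simp
  have hdθ := mul_le_mul_of_nonneg_left hdiss θ1.le
  rw [mul_add K (8 * η * (e ^ 2 + d ^ 2)), hKη, A2] at hy
  rw [energy, α2, U2, b2, e2]
  have p1 : 0 ≤ K * (2 / η + 2) := by positivity
  have p2 : 0 ≤ K * (2 / η + 2) * ((α ^ 2 + U ^ 2 + b ^ 2) * e ^ 2) := by positivity
  have p3 : 0 ≤ K * (2 / η + 2) * (α ^ 2 * b ^ 2 * e ^ 2) := by positivity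
  rw [A2] at hle
  linarith

/-- The product rule uses only the time derivatives in L². Those derivatives are L² limits of the
right-hand sides of smooth approximations, and pairing after mollification at fixed n is continuous
on L². -/
theorem Flow.exists_rate {h k : Nonlin} {μ lam σ T M : ℝ} {a : ℝ → Space → ℝ}
    {u B : ℝ → Fin 3 → Space → ℝ} (hF : Flow h k μ lam σ T M a u B) :
    ∃ r : ℕ → ℝ → ℝ, ∀ n, ∀ t ∈ Icc 0 T,
      HasDerivWithinAt (fun t => pair 3 (SL n (cls (a t))) (SL n (cls (a t))) +
        pairL n (fun j => cls (u t j)) (fun j => cls (u t j)) +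
        pairL n (fun j => cls (B t j)) fun j => cls (B t j)) (2 * r n t) (Icc 0 T) t ∧
      Tendsto (fun m => rate h k μ lam σ n (approx (a t) m) (approxv (u t) m) (approxv (B t) m))
        atTop (𝓝 (r n t)) := by
  obtain ⟨A', hA⟩ := hF.deriv_a
  obtain ⟨U', hU⟩ := hF.deriv_u
  obtain ⟨B', hB⟩ := hF.deriv_B
  refine ⟨fun n t => pair 3 (SL n (cls (a t))) (SL n (A' t)) + pairL n (fun j => cls (u t j)) (U' t) +
    pairL n (fun j => cls (B t j)) (B' t), fun n t ht => ⟨?_, ?_⟩⟩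
  · have h1 := (quad_pair n 3 0).hasDerivWithinAt (X := fun t _ => cls (a t)) (X' := fun _ => A' t)
      fun _ => (hA t ht).1
    have h2 := (quad_pairL n).hasDerivWithinAt (X := fun t j => cls (u t j)) fun j => (hU t ht j).1
    have h3 := (quad_pairL n).hasDerivWithinAt (X := fun t j => cls (B t j)) fun j => (hB t ht j).1
    refine ((h1.add h2).add h3).congr_deriv ?_
    rw [pairL_comm n (U' t), pairL_comm n (B' t), HInf.pair_comm 3 (SL n (A' t))]
    ring
  · have h1 := (quad_pair n 3 0).tendsto (X := fun m _ => toL (approx (a t) m))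
      (X' := fun _ => cls (a t)) (fun _ => tendsto_SL _) (Y := fun m _ =>
        toL (rhsA (approx (a t) m) (approxv (u t) m))) (Y' := fun _ => A' t) fun _ => (hA t ht).2
    have h2 := (quad_pairL n).tendsto (X := fun m j => toL (approxv (u t) m j))
      (fun j => tendsto_SL (cls (u t j))) fun j => (hU t ht j).2
    have h3 := (quad_pairL n).tendsto (X := fun m j => toL (approxv (B t) m j))
      (fun j => tendsto_SL (cls (B t j))) fun j => (hB t ht j).2
    exact (h1.add h2).add h3

theorem Flow.continuousOn_quad_a {h k : Nonlin} {μ lam σ T M : ℝ} {a : ℝ → Space → ℝ}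
    {u B : ℝ → Fin 3 → Space → ℝ} (hF : Flow h k μ lam σ T M a u B)
    {Φ : (Fin 3 → L2) → (Fin 3 → L2) → ℝ} (hΦ : Quad Φ) :
    ContinuousOn (fun t => Φ (fun _ => cls (a t)) fun _ => cls (a t)) (Icc 0 T) := by
  obtain ⟨A', hA⟩ := hF.deriv_a
  exact fun t ht => (hΦ.hasDerivWithinAt (X := fun t _ => cls (a t)) (X' := fun _ => A' t)
    fun _ => (hA t ht).1).continuousWithinAt

theorem aestronglyMeasurable_of_tendsto_continuousOn {T : ℝ} {f : ℕ → ℝ → ℝ} {g : ℝ → ℝ}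
    (hf : ∀ n, ContinuousOn (f n) (Icc 0 T))
    (h : ∀ᵐ t ∂(volume.restrict (Icc 0 T)), Tendsto (fun n => f n t) atTop (𝓝 (g t))) :
    AEStronglyMeasurable g (volume.restrict (Icc 0 T)) :=
  aestronglyMeasurable_of_tendsto_ae atTop (fun n => (hf n).aestronglyMeasurable measurableSet_Icc) h

theorem tendsto_pairL {u : Fin 3 → Space → ℝ} (hu : ∀ j, MemH 3 (u j)) :
    Tendsto (fun n => pairL n (fun j => cls (u j)) fun j => cls (u j)) atTop (𝓝 (vnormSqH 3 u)) :=
  tendsto_finsetSum _ fun j _ => by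
    simp only [← nrm_sq]; exact tendsto_nrm_SL_sq (hu j)


/-! ### The differential inequality for flows. -/

open HInf

/-- The right-hand side of the energy inequality. -/
def growth (C : ℝ) (a : Space → ℝ) (u B : Fin 3 → Space → ℝ) : ℝ :=
  C * (√(vnormSqH 3 u) + (normSqH 3 a + vnormSqH 3 u) + vnormSqH 3 B ^ 2) *
    (∑ i, normSqH 2 (weakDeriv i a)) +
  C * (normSqH 3 a * vnormSqH 3 B + energy a u B) * gradNormSqH 3 u

theorem sum_normSqH_weakDeriv_le (k : ℕ) (f : Space → ℝ) :
    ∑ i, normSqH k (weakDeriv i f) ≤ normSqH (k + 1) f :=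
  le_add_of_nonneg_left (integral_nonneg fun _ => sq_nonneg _)

namespace Flow

variable {h k : Nonlin} {μ lam σ T M : ℝ} {a : ℝ → Space → ℝ} {u B : ℝ → Fin 3 → Space → ℝ}

theorem ae_regular (hF : Flow h k μ lam σ T M a u B)
    (hu : ∀ᵐ t ∂(volume.restrict (Icc 0 T)), ∀ i j, MemH 3 (weakDeriv i (u t j)))
    (hB : ∀ᵐ t ∂(volume.restrict (Icc 0 T)), ∀ j,
      MemH 3 (weakDeriv 0 (B t j)) ∧ MemH 3 (weakDeriv 1 (B t j))) :
    ∀ᵐ t ∂(volume.restrict (Icc 0 T)), Regular (a t) (u t) (B t) := by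
  filter_upwards [hu, hB, ae_restrict_mem measurableSet_Icc] with t h1 h2 ht
  exact ⟨hF.a3 t ht, hF.u3 t ht, hF.B3 t ht, hF.range t ht, hF.div_B t ht, h1, h2⟩

/-- Measurability in time comes from writing each norm as a limit of continuous functions of t;
domination uses the uniform bound M and the integrability of the squared gradient of u. -/
theorem integrableOn_growth (hF : Flow h k μ lam σ T M a u B) {C : ℝ} (hC : 0 < C)
    (hi : IntegrableOn (fun t => gradNormSqH 3 (u t)) (Icc 0 T) volume) :
    IntegrableOn (fun t => growth C (a t) (u t) (B t)) (Icc 0 T) volume := by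
  have ma : AEStronglyMeasurable (fun t => normSqH 3 (a t)) (volume.restrict (Icc 0 T)) := by
    refine aestronglyMeasurable_of_tendsto_continuousOn
      (fun n => hF.continuousOn_quad_a (quad_pair n 3 0)) ?_
    filter_upwards [ae_restrict_mem measurableSet_Icc] with t ht
    simp only [← nrm_sq]
    exact tendsto_nrm_SL_sq (hF.a3 t ht)
  have mu : AEStronglyMeasurable (fun t => vnormSqH 3 (u t)) (volume.restrict (Icc 0 T)) := by
    refine aestronglyMeasurable_of_tendsto_continuousOn
      (fun n => hF.continuousOn_quad_u (quad_pairL n)) ?_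
    filter_upwards [ae_restrict_mem measurableSet_Icc] with t ht
    exact tendsto_pairL (hF.u3 t ht)
  have mB : AEStronglyMeasurable (fun t => vnormSqH 3 (B t)) (volume.restrict (Icc 0 T)) := by
    refine aestronglyMeasurable_of_tendsto_continuousOn
      (fun n => hF.continuousOn_quad_B (quad_pairL n)) ?_
    filter_upwards [ae_restrict_mem measurableSet_Icc] with t ht
    exact tendsto_pairL (hF.B3 t ht)
  have ms : AEStronglyMeasurable (fun t => ∑ i, normSqH 2 (weakDeriv i (a t)))
      (volume.restrict (Icc 0 T)) := by
    refine aestronglyMeasurable_of_tendsto_continuousOn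
      (fun n => hF.continuousOn_quad_a (Quad.sum fun i => quad_pair_D n 2 i 0)) ?_
    filter_upwards [ae_restrict_mem measurableSet_Icc] with t ht
    refine tendsto_finsetSum _ fun i _ => ?_
    simp only [D_SL_weakDeriv (hF.a3 t ht), ← nrm_sq]
    exact tendsto_nrm_SL_sq ((hF.a3 t ht).deriv i)
  have hm : AEStronglyMeasurable (fun t => growth C (a t) (u t) (B t))
      (volume.restrict (Icc 0 T)) :=
    ((((Real.continuous_sqrt.comp_aestronglyMeasurable mu).add (ma.add mu)).add
      (mB.pow 2)).const_mul C |>.mul ms).add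
      ((((ma.mul mB).add ((ma.add mu).add mB)).const_mul C).mul hi.aestronglyMeasurable)
  refine Integrable.mono' (g := fun t => C * (M + (M ^ 2 + M ^ 2) + (M ^ 2) ^ 2) * M ^ 2 +
    C * (M ^ 2 * M ^ 2 + (M ^ 2 + M ^ 2 + M ^ 2)) * gradNormSqH 3 (u t))
    ((integrable_const _).add (Integrable.const_mul hi _)) hm ?_
  filter_upwards [ae_restrict_mem measurableSet_Icc] with t ht
  have ba := (Real.sqrt_le_left ((Real.sqrt_nonneg _).trans (hF.bound_a t ht))).1 (hF.bound_a t ht)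
  have bu := (Real.sqrt_le_left ((Real.sqrt_nonneg _).trans (hF.bound_u t ht))).1 (hF.bound_u t ht)
  have bB := (Real.sqrt_le_left ((Real.sqrt_nonneg _).trans (hF.bound_B t ht))).1 (hF.bound_B t ht)
  have bs := (sum_normSqH_weakDeriv_le 2 (a t)).trans ba
  have b0 := hF.bound_u t ht
  have a0 := normSqH_nonneg 3 (a t)
  have u0 := vnormSqH_nonneg 3 (u t)
  have B0 := vnormSqH_nonneg 3 (B t)
  have g0 := gradNormSqH_nonneg 3 (u t)
  have s0 : 0 ≤ ∑ i, normSqH 2 (weakDeriv i (a t)) :=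
    Finset.sum_nonneg fun _ _ => normSqH_nonneg _ _
  have M0 : 0 ≤ M := (Real.sqrt_nonneg _).trans b0
  rw [Real.norm_eq_abs, growth, energy, abs_of_nonneg (by positivity)]
  gcongr

theorem integrableOn_dissipation (hF : Flow h k μ lam σ T M a u B)
    (hu : ∀ᵐ t ∂(volume.restrict (Icc 0 T)), ∀ i j, MemH 3 (weakDeriv i (u t j)))
    (hi : IntegrableOn (fun t => gradNormSqH 3 (u t)) (Icc 0 T) volume)
    (hBi : IntegrableOn (fun t => hgradNormSqH 3 (B t)) (Icc 0 T) volume) :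
    IntegrableOn (fun t => dissipation μ lam σ (u t) (B t)) (Icc 0 T) volume := by
  have hd : IntegrableOn (fun t => normSqH 3 (divergence (u t))) (Icc 0 T) volume := by
    refine Integrable.mono' hi (aestronglyMeasurable_of_tendsto_continuousOn
      (fun n => hF.continuousOn_quad_u (quad_divL n)) ?_) ?_
    · filter_upwards [hu, ae_restrict_mem measurableSet_Icc] with t h1 ht
      exact tendsto_divL (hF.u3 t ht) h1
    · filter_upwards [hu, ae_restrict_mem measurableSet_Icc] with t h1 ht
      rw [Real.norm_eq_abs, abs_of_nonneg (normSqH_nonneg _ _)]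
      exact normSqH_divergence_le (hF.u3 t ht) h1
  exact ((hi.const_mul μ).add (hd.const_mul (lam + μ))).add (hBi.const_mul σ)

theorem energy_inequality (hF : Flow h k μ lam σ T M a u B) (hT : 0 < T) {θ C : ℝ} (hC : 0 < C)
    (hu : ∀ᵐ t ∂(volume.restrict (Icc 0 T)), ∀ i j, MemH 3 (weakDeriv i (u t j)))
    (hi : IntegrableOn (fun t => gradNormSqH 3 (u t)) (Icc 0 T) volume)
    (hB : ∀ᵐ t ∂(volume.restrict (Icc 0 T)), ∀ j,
      MemH 3 (weakDeriv 0 (B t j)) ∧ MemH 3 (weakDeriv 1 (B t j)))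
    (hBi : IntegrableOn (fun t => hgradNormSqH 3 (B t)) (Icc 0 T) volume)
    (hle : ∀ (a : Space → ℝ) (u B : Fin 3 → Space → ℝ) (r : ℕ → ℝ),
      Regular a u B → (∀ n, Tendsto (fun m =>
        rate h k μ lam σ n (approx a m) (approxv u m) (approxv B m)) atTop (𝓝 (r n))) →
      ∀ ε > 0, ∀ᶠ n in atTop, r n ≤ growth C a u B - θ * dissipation μ lam σ u B + ε) :
    AbsolutelyContinuousOnInterval (fun t => energy (a t) (u t) (B t)) 0 T ∧
      ∀ᵐ t ∂(volume.restrict (Icc 0 T)),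
        DifferentiableAt ℝ (fun s => energy (a s) (u s) (B s)) t ∧
        deriv (fun s => energy (a s) (u s) (B s)) t ≤
          2 * (growth C (a t) (u t) (B t) - θ * dissipation μ lam σ (u t) (B t)) := by
  obtain ⟨r, hr⟩ := hF.exists_rate
  obtain ⟨K, -, hK⟩ := abs_rate_le h k μ lam σ M
  have hreg := hF.ae_regular hu hB
  refine ae_deriv_le_of_tendsto hT (r := fun n t => 2 * r n t)
    (G := fun t => 2 * (K * (1 + gradNormSqH 3 (u t) + hgradNormSqH 3 (B t))))
    (fun n t ht => (hr n t ht).1) (fun t ht => ?_)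
    (((((integrableOn_const (by simp)).add hi).add hBi).const_mul K).const_mul 2)
    (((hF.integrableOn_growth hC hi).sub
      ((hF.integrableOn_dissipation hu hi hBi).const_mul θ)).const_mul 2) ?_ ?_
  · simp only [← nrm_sq]
    exact ((tendsto_nrm_SL_sq (hF.a3 t ht)).add (tendsto_pairL (hF.u3 t ht))).add
      (tendsto_pairL (hF.B3 t ht))
  · filter_upwards [hreg, ae_restrict_mem measurableSet_Icc] with t hs ht n
    rw [abs_mul, abs_two]
    refine mul_le_mul_of_nonneg_left (le_of_tendsto' (hr n t ht).2.abs fun m => ?_) zero_le_two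
    have := hK n _ _ _ _ _ ((hs.bounds m).coarse (hF.bound_a t ht) (hF.bound_u t ht)
      (hF.bound_B t ht))
    rwa [Real.sq_sqrt (gradNormSqH_nonneg _ _), Real.sq_sqrt (hgradNormSqH_nonneg _ _)] at this
  · filter_upwards [hreg, ae_restrict_mem measurableSet_Icc] with t hs ht ε hε
    filter_upwards [hle _ _ _ _ hs (fun n => (hr n t ht).2) (ε / 2) (by positivity)] with n hn
    linarith

end Flow

end

end MHD

theorem proposition2p2 (μ lam σ : ℝ) (hμ : 0 < μ) (hν : 0 < lam + 2 * μ) (hσ : 0 < σ)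
    (P : ℝ → ℝ) (hP : ContDiffOn ℝ ∞ P (Ioi 0)) (hP' : ∀ r, 0 < r → 0 < deriv P r)
    (hP1 : deriv P 1 = 1) (θ : ℝ) (hθ0 : 0 < θ) (hθ1 : θ < 1) :
    ∃ C : ℝ, 0 < C ∧
      ∀ (T : ℝ) (a : ℝ → MHD.Space → ℝ) (u B : ℝ → Fin 3 → MHD.Space → ℝ), 0 < T →
        MHD.IsSolution μ lam σ P T a u B →
        (∀ t ∈ Icc 0 T, ∀ᵐ x, |a t x| ≤ 1 / 2) →
        AbsolutelyContinuousOnInterval (fun t => MHD.energy (a t) (u t) (B t)) 0 T ∧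
        IntegrableOn (fun t => MHD.gradNormSqH 3 (u t)) (Icc 0 T) volume ∧
        IntegrableOn (fun t => MHD.hgradNormSqH 3 (B t)) (Icc 0 T) volume ∧
        ∀ᵐ t ∂(volume.restrict (Icc 0 T)),
          (∀ i j, MHD.MemH 3 (MHD.weakDeriv i (u t j))) ∧
          (∀ j, MHD.MemH 3 (MHD.weakDeriv 0 (B t j)) ∧ MHD.MemH 3 (MHD.weakDeriv 1 (B t j))) ∧
          DifferentiableAt ℝ (fun s => MHD.energy (a s) (u s) (B s)) t ∧
          1 / 2 * deriv (fun s => MHD.energy (a s) (u s) (B s)) t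
              + θ * MHD.dissipation μ lam σ (u t) (B t)
            ≤ C * (√(MHD.vnormSqH 3 (u t))
                    + (MHD.normSqH 3 (a t) + MHD.vnormSqH 3 (u t))
                    + MHD.vnormSqH 3 (B t) ^ 2)
                  * (∑ i : Fin 3, MHD.normSqH 2 (MHD.weakDeriv i (a t)))
              + C * (MHD.normSqH 3 (a t) * MHD.vnormSqH 3 (B t)
                    + MHD.energy (a t) (u t) (B t))
                  * MHD.gradNormSqH 3 (u t) := by
  -- The nonlinearities depend on P alone, so C is fixed before the solution. The bound M of a
  -- particular solution enters only the qualitative statements: integrability and absolute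
  -- continuity.
  obtain ⟨h, k, hh, hfl⟩ := MHD.exists_flow hP hP1
  obtain ⟨C, hC, hle⟩ := MHD.exists_rate_le h k hμ hν hσ hθ1
  refine ⟨C, hC, fun T a u B hT hsol ha => ?_⟩
  obtain ⟨M, hF⟩ := hfl μ lam σ T a u B hsol ha
  obtain ⟨hu, hi⟩ := hF.grad_u hT hμ hν hh
  obtain ⟨hB, hBi⟩ := hF.hgrad_B hT hσ hu hi
  obtain ⟨hac, hd⟩ := hF.energy_inequality hT (θ := θ) hC hu hi hB hBi hle
  refine ⟨hac, hi, hBi, ?_⟩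
  filter_upwards [hu, hB, hd] with t h1 h2 h3
  refine ⟨h1, h2, h3.1, ?_⟩
  have := h3.2
  rw [MHD.growth] at this
  linarith
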